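/- **Setting.** Near a Morse–Bott torus in a contact three-manifold use coordinates $(z,x,y)\in \mathbb{R}/\tau\mathbb{Z}\times\mathbb{R}/\mathbb{Z}\times(-\rho,\rho)$ in which the contact form is $\lambda_{MB}=h\,(dz-y\,dx)$ with $h>0$ smooth and $h=1$, $dh=0$ on the torus $\{y=0\}$; the torus is foliated by the closed Reeb orbits $t\mapsto(t,x,0)$ of period $\tau$ and is Morse–Bott, i.e. the fixed vectors of the linearized Reeb flow over one period are tangent to the torus. Let $j$ be a smooth complex structure on $\xi=\ker(dz-y\,dx)$ with $d\lambda_{MB}(\cdot,j\cdot)>0$ and $j\partial_x=\partial_y$ on the torus. Let $f:\mathbb{R}/\mathbb{Z}\to\mathbb{R}$ be a smooth Morse function with exactly two critical points, its minimum at $0$ and its maximum at $1/2$. For $\delta>0$ put $\lambda_\delta=e^{\delta f(x)}\lambda_{MB}$, let $R_\delta$ be its Reeb field, and let $J_\delta$ be the $\mathbb{R}$-invariant almost complex structure on the symplectization, with coordinates $(a,z,x,y)$, such that $J_\delta\partial_a=R_\delta$ and $J_\delta|_\xi=j$. The data $(\tau,\rho,h,j,f)$ are called the local geometry. For a map $u=(a,z,x,y)$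 on $[s_0,s_1]\times\mathbb{R}/\tau\mathbb{Z}$ let $Y=(a-s,\,z-t,\,x,\,y)$, let $PY(s)$ be the $L^2(S^1)$-orthogonal projection of $Y(s,\cdot)$ to the constant combinations of $\partial_a,\partial_z,\partial_x$ (the kernel of the asymptotic operator of the torus), and $QY=Y-PY$. A lift of a gradient trajectory is a map $v(s,t)=(a_v(s),\,t+c,\,x_v(s),\,0)$ with $c$ constant, $a_v'=e^{\delta f(x_v)}$ and $x_v'=\delta f'(x_v)$. For a field $\varphi(s,t)$ let $\|\varphi\|_{C^n}(s)$ be the supremum over $t$ of the sum of the norms of all partial derivatives of $\varphi$ of order at most $n$ at $(s,t)$. **Theorem.** There is $\lambda>0$ depending only on the local geometry such that for every integer $k\ge1$ and every real $p>4k$ there are $\varepsilon>0$ and $\delta_0>0$, depending only on the local geometry, $k$ and $p$, with the following property. Let $0<\delta\le\delta_0$, let $s_0<s_1$, and let $u=(a,z,x,y):[s_0,s_1]\times\mathbb{R}/\tau\mathbb{Z}\to\mathbb{R}\times\mathbb{R}/\tau\mathbb{Z}\times\mathbb{R}/\mathbb{Z}\times(-\rho,\rho)$ be smooth and $J_\delta$-holomorphic,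 $\partial_su+J_\delta(u)\partial_tu=0$, such that all partial derivatives of order $0,\dots,k$ of $z-t$ and $y$, and all those of order $1,\dots,k$ of $x$, are bounded by $\varepsilon$ in absolute value. Put $$B(s)=\max\left(\|QY(s_0,\cdot)\|_{L^2(S^1)}^{2/p},\ \|QY(s_1,\cdot)\|_{L^2(S^1)}^{2/p}\right)\,\frac{\cosh\left(\lambda\left(s-\frac{s_0+s_1}{2}\right)\right)}{\cosh\left(\lambda\,\frac{s_1-s_0}{2}\right)}.$$ 1. For all $s\in[s_0,s_1]$, $\|QY\|_{C^{k-1}}(s)\le B(s)$. 2. If for some $\eta>0$ the coordinate $x$ of $u$ stays at distance at least $\eta$ from all critical points of $f$ with at most one exception, then there is a lift $v$ of a gradient trajectory such that, with $Y_v=v-(s,t,0,0)$, for all $s\in[s_0,s_1]$, $\|PY-Y_v\|_{C^{k-1}}(s)\le B(s)$. -/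

import Mathlib

open scoped ContDiff

noncomputable section

namespace MorseBottCylinder

/-- Coordinates `(z, x, y)` (indices `0, 1, 2`) on the universal cover `ℝ × ℝ × (-ρ, ρ)` of a
neighbourhood `S¹ × S¹ × (-ρ, ρ)` of a Morse–Bott torus in a contact three-manifold. -/
abbrev E3 := EuclideanSpace ℝ (Fin 3)

/-- Coordinates `(a, z, x, y)` (indices `0, 1, 2, 3`) on the universal cover of the
symplectization of that neighbourhood. -/
abbrev E4 := EuclideanSpace ℝ (Fin 4)

/-- The coordinate vectors `∂_z, ∂_x, ∂_y`. -/
def ez : E3 := EuclideanSpace.single 0 1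
def ex : E3 := EuclideanSpace.single 1 1
def ey : E3 := EuclideanSpace.single 2 1

/-! ### Contact forms `F (dz - y dx)`, their differentials and Reeb fields -/

/-- The one-form `F · (dz - y dx)`. -/
def contactForm (F : E3 → ℝ) (q : E3) : E3 →L[ℝ] ℝ :=
  F q • (EuclideanSpace.proj (0 : Fin 3) - q 2 • EuclideanSpace.proj (1 : Fin 3))

/-- The differential two-form `d(F · (dz - y dx))`, evaluated on two vectors. -/
def dContactForm (F : E3 → ℝ) (q v w : E3) : ℝ :=
  extDeriv (fun r => ContinuousAlternatingMap.ofSubsingletonLIE (𝕜 := ℝ) (E := E3) (F := ℝ) (0 : Fin 1)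
    (contactForm F r)) q ![v, w]

/-- The Reeb vector field of `F · (dz - y dx)`, written with `H = 1 / F`:
`R = (H - y H_y) ∂_z - H_y ∂_x + (H_x + y H_z) ∂_y`.
Its two defining equations are `contactForm_reeb` and `dContactForm_reeb`. -/
def reeb (F : E3 → ℝ) (q : E3) : E3 :=
  let dH : E3 →L[ℝ] ℝ := fderiv ℝ (fun r => (F r)⁻¹) q
  !₂[(F q)⁻¹ - q 2 * dH ey, -dH ey, dH ex + q 2 * dH ez]

theorem contactForm_apply (F : E3 → ℝ) (q v : E3) :
    contactForm F q v = F q * (v 0 - q 2 * v 1) := by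
  simp [contactForm]

theorem vec_eq (v : E3) : v = v 0 • ez + v 1 • ex + v 2 • ey := by
  ext i; fin_cases i <;> simp [ez, ex, ey]

theorem dContactForm_apply (F : E3 → ℝ) (q v w : E3) (hF : DifferentiableAt ℝ F q) :
    dContactForm F q v w = fderiv ℝ F q v * (w 0 - q 2 * w 1) - fderiv ℝ F q w * (v 0 - q 2 * v 1)
      + F q * (v 1 * w 2 - v 2 * w 1) := by
  have hp : ∀ (i : Fin 3), DifferentiableAt ℝ (fun r : E3 => r i) q := fun i => by fun_prop
  have h0 : DifferentiableAt ℝ (contactForm F) q := by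
    unfold contactForm
    fun_prop
  have h1 : DifferentiableAt ℝ (fun r => ContinuousAlternatingMap.ofSubsingletonLIE (𝕜 := ℝ) (E := E3) (F := ℝ)
      (0 : Fin 1) (contactForm F r)) q :=
    (ContinuousAlternatingMap.ofSubsingletonLIE (𝕜 := ℝ) (E := E3) (F := ℝ) (0 : Fin 1)).differentiable.differentiableAt.comp
      q h0
  have h2 : ∀ w' v' : E3, fderiv ℝ (fun r => contactForm F r w') q v'
      = fderiv ℝ F q v' * (w' 0 - q 2 * w' 1) - F q * (v' 2 * w' 1) := by
    intro w' v'
    simp only [contactForm_apply]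
    have hy : HasFDerivAt (fun r : E3 => r 2) (EuclideanSpace.proj (2 : Fin 3) : E3 →L[ℝ] ℝ) q :=
      (EuclideanSpace.proj (2 : Fin 3) : E3 →L[ℝ] ℝ).hasFDerivAt
    have := hF.hasFDerivAt.mul ((hy.mul_const (w' 1)).const_sub (w' 0))
    rw [show (fun r : E3 => F r * (w' 0 - r 2 * w' 1))
      = (F * fun r : E3 => w' 0 - r 2 * w' 1) from rfl, this.fderiv]
    simp
    ring
  unfold dContactForm
  rw [extDeriv_apply h1]
  have h3 : ∀ (g : Fin 1 → E3) (r : E3),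
      (ContinuousAlternatingMap.ofSubsingletonLIE (𝕜 := ℝ) (E := E3) (F := ℝ) (0 : Fin 1) (contactForm F r)) g
        = contactForm F r (g 0) := fun g r => rfl
  simp only [h3, h2, Fin.removeNth]
  simp
  ring

theorem contactForm_reeb (F : E3 → ℝ) (q : E3) (hF : F q ≠ 0) :
    contactForm F q (reeb F q) = 1 := by
  simp [contactForm_apply, reeb, hF]

theorem dContactForm_reeb (F : E3 → ℝ) (q w : E3) (hd : DifferentiableAt ℝ F q) (hF : F q ≠ 0) :
    dContactForm F q (reeb F q) w = 0 := by
  have hH : ∀ v, fderiv ℝ (fun r => (F r)⁻¹) q v = -((F q) ^ 2)⁻¹ * fderiv ℝ F q v := by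
    intro v
    have h := (hasDerivAt_inv hF).comp_hasFDerivAt q hd.hasFDerivAt
    rw [show (fun r => (F r)⁻¹) = (fun y : ℝ => y⁻¹) ∘ F from rfl, h.fderiv]
    simp
  rw [dContactForm_apply F q _ w hd]
  have h1 : ∀ v : E3, fderiv ℝ F q v
      = v 0 * fderiv ℝ F q ez + v 1 * fderiv ℝ F q ex + v 2 * fderiv ℝ F q ey := by
    intro v
    conv_lhs => rw [vec_eq v]
    simp
  rw [h1 w, h1 (reeb F q)]
  simp only [reeb, hH]
  simp
  field_simp
  ring

/-! ### The neighbourhood of a Morse–Bott torus -/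

/-- The data fixed in a neighbourhood of a Morse–Bott torus ("the local geometry"): coordinates
`(z, x, y) ∈ ℝ/τℤ × ℝ/ℤ × (-ρ, ρ)` in which the contact form is `λ = h · (dz - y dx)` with `h = 1`
and `dh = 0` on the torus `{y = 0}`, the restriction `j` of the almost complex structure to the
contact distribution `ξ = ker (dz - y dx)`, and the Morse function `f` of `x` along which `λ` is
perturbed. Functions of `z ∈ ℝ/τℤ` and `x ∈ ℝ/ℤ` are written as periodic functions. -/
structure MorseBottNbhd where
  /-- The common period of the Reeb orbits `t ↦ (t, x, 0)` that foliate the torus. -/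
  τ : ℝ
  /-- The width of the neighbourhood, on which the cutoff of the perturbation equals one. -/
  ρ : ℝ
  h : E3 → ℝ
  j : E3 → E3 →L[ℝ] E3
  f : ℝ → ℝ
  τ_pos : 0 < τ
  ρ_pos : 0 < ρ
  h_smooth : ContDiffOn ℝ ∞ h {q | |q 2| < ρ}
  h_pos : ∀ q, |q 2| < ρ → 0 < h q
  h_periodic : ∀ q, |q 2| < ρ → h (q + τ • ez) = h q ∧ h (q + ex) = h q
  h_torus : ∀ q : E3, q 2 = 0 → h q = 1 ∧ fderiv ℝ h q = 0
  /-- The Morse–Bott condition: the fixed vectors of the linearized Reeb flow over one period are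
  tangent to the torus. -/
  morseBott : ∀ (x : ℝ) (ζ : ℝ → E3),
    (∀ t, HasDerivAt ζ (fderiv ℝ (reeb h) !₂[t, x, 0] (ζ t)) t) → ζ τ = ζ 0 → ζ 0 2 = 0
  j_smooth : ContDiffOn ℝ ∞ j {q | |q 2| < ρ}
  j_periodic : ∀ q, |q 2| < ρ → j (q + τ • ez) = j q ∧ j (q + ex) = j q
  /-- `j` maps `ξ` to itself, squares to `-1` there, and `dλ(·, j ·)` is positive on `ξ`. -/
  j_compatible : ∀ q v, |q 2| < ρ → contactForm h q v = 0 →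
    contactForm h q (j q v) = 0 ∧ j q (j q v) = -v ∧ (v ≠ 0 → 0 < dContactForm h q v (j q v))
  j_torus : ∀ q : E3, q 2 = 0 → j q ex = ey
  f_smooth : ContDiff ℝ ∞ f
  f_periodic : Function.Periodic f 1
  /-- `f` is Morse on `ℝ/ℤ` with exactly two critical points, its minimum `0` and maximum `1/2`. -/
  f_critical : ∀ x, deriv f x = 0 ↔ ∃ n : ℤ, x = n / 2
  f_morse : ∀ x, deriv f x = 0 → deriv (deriv f) x ≠ 0
  f_min_max : ∀ x, f 0 ≤ f x ∧ f x ≤ f (1 / 2)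

namespace MorseBottNbhd

variable (G : MorseBottNbhd)

/-- The factor `e^{δ f} h` of the perturbed contact form `λ_δ = e^{δ f} λ`. -/
def pert (δ : ℝ) (q : E3) : ℝ := Real.exp (δ * G.f (q 1)) * G.h q

/-- The `ℝ`-invariant almost complex structure `J_δ` on the symplectization, at a point over `q`,
applied to a tangent vector `V = V_a ∂_a + V'`. It is the one with `J_δ ∂_a = R_δ`,
`J_δ R_δ = -∂_a`, and `J_δ = j` on `ξ`:
`J_δ V = -λ_δ(V') ∂_a + V_a R_δ + j (V' - λ_δ(V') R_δ)`. -/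
def acs (δ : ℝ) (q : E3) (V : E4) : E4 :=
  let R : E3 := reeb (G.pert δ) q
  let V' : E3 := !₂[V 1, V 2, V 3]
  let l : ℝ := contactForm (G.pert δ) q V'
  let W : E3 := V 0 • R + G.j q (V' - l • R)
  !₂[-l, W 0, W 1, W 2]

end MorseBottNbhd

/-! ### Partial derivatives and `C^n` size -/

section Deriv

variable {E : Type} [NormedAddCommGroup E] [NormedSpace ℝ E]

/-- `∂_s`. -/
def dS (φ : ℝ → ℝ → E) (s t : ℝ) : E := deriv (fun r => φ r t) s

/-- `∂_t`. -/
def dT (φ : ℝ → ℝ → E) (s t : ℝ) : E := deriv (fun r => φ s r) t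

/-- `∂_s^i ∂_t^j`. -/
def pd (i j : ℕ) (φ : ℝ → ℝ → E) : ℝ → ℝ → E := dS^[i] (dT^[j] φ)

/-- The sum of the norms of all partial derivatives of order at most `n` at the point `(s, t)`. -/
def cSize (n : ℕ) (φ : ℝ → ℝ → E) (s t : ℝ) : ℝ :=
  ∑ m ∈ Finset.range (n + 1), ∑ ij ∈ Finset.HasAntidiagonal.antidiagonal m, ‖pd ij.1 ij.2 φ s t‖

end Deriv

/-! ### Holomorphic cylinders near the torus -/

/-- `u` is (a lift to the universal cover of) a smooth `J_δ`-holomorphic cylinder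
`[s₀, s₁] × ℝ/τℤ → ℝ × ℝ/τℤ × ℝ/ℤ × (-ρ, ρ)`. A map that is smooth up to the boundary of the strip
`[s₀, s₁] × ℝ` is given as the restriction of a smooth map on the plane; nothing is required of it
outside the strip. -/
structure IsHolomorphicCylinder (G : MorseBottNbhd) (δ s₀ s₁ : ℝ) (u : ℝ → ℝ → E4) : Prop where
  smooth : ContDiff ℝ ∞ (fun q : ℝ × ℝ => u q.1 q.2)
  deck : ∃ m n : ℤ, ∀ s ∈ Set.Icc s₀ s₁, ∀ t,
    u s (t + G.τ) = u s t + !₂[0, (n : ℝ) * G.τ, (m : ℝ), 0]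
  mem_nbhd : ∀ s ∈ Set.Icc s₀ s₁, ∀ t, |u s t 3| < G.ρ
  holomorphic : ∀ s ∈ Set.Icc s₀ s₁, ∀ t,
    dS u s t + G.acs δ !₂[u s t 1, u s t 2, u s t 3] (dT u s t) = 0

/-- On `[s₀, s₁] × S¹` all partial derivatives of order `≤ k` of `z - t` and `y`, and all those of
order `1, …, k` of `x`, are at most `ε` in absolute value. -/
def IsCloseToTorus (k : ℕ) (ε s₀ s₁ : ℝ) (u : ℝ → ℝ → E4) : Prop :=
  ∀ s ∈ Set.Icc s₀ s₁, ∀ t, ∀ i j : ℕ, i + j ≤ k →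
    |pd i j (fun s t => u s t 1 - t) s t| ≤ ε ∧
    |pd i j (fun s t => u s t 3) s t| ≤ ε ∧
    (1 ≤ i + j → |pd i j (fun s t => u s t 2) s t| ≤ ε)

/-- On `[s₀, s₁] × S¹` the `x`-coordinate has distance at least `η` from every critical point of `f`
on `ℝ/ℤ`, with the exception of at most one critical point (the class of `c`). -/
def AwayFromAllButOne (G : MorseBottNbhd) (η s₀ s₁ : ℝ) (u : ℝ → ℝ → E4) : Prop :=
  ∃ c : ℝ, ∀ c' : ℝ, deriv G.f c' = 0 → (∀ n : ℤ, c' ≠ c + n) →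
    ∀ s ∈ Set.Icc s₀ s₁, ∀ t, η ≤ |u s t 2 - c'|

/-- `Y = (a - s, z - t, x, y)`. -/
def displacement (u : ℝ → ℝ → E4) (s t : ℝ) : E4 := u s t - !₂[s, t, 0, 0]

/-- Over each circle `{s} × S¹`, the `L²`-orthogonal projection of `Y` to the kernel of the
asymptotic operator of the torus, which consists of the constant combinations of
`∂_a, ∂_z, ∂_x`. -/
def projP (τ : ℝ) (Y : ℝ → ℝ → E4) (s _t : ℝ) : E4 :=
  !₂[τ⁻¹ * ∫ r in (0 : ℝ)..τ, Y s r 0, τ⁻¹ * ∫ r in (0 : ℝ)..τ, Y s r 1,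
    τ⁻¹ * ∫ r in (0 : ℝ)..τ, Y s r 2, 0]

/-- The complementary projection `Q = 1 - P`. -/
def projQ (τ : ℝ) (Y : ℝ → ℝ → E4) (s t : ℝ) : E4 := Y s t - projP τ Y s t

/-- The `L²`-norm of `Y` over `{s} × ℝ/τℤ`. -/
def sliceNorm (τ : ℝ) (Y : ℝ → ℝ → E4) (s : ℝ) : ℝ :=
  Real.sqrt (∫ t in (0 : ℝ)..τ, ‖Y s t‖ ^ 2)

/-- `max(‖QY(s₀)‖^{2/p}, ‖QY(s₁)‖^{2/p}) · cosh(lam (s - (s₀+s₁)/2)) / cosh(lam (s₁ - s₀)/2)`. -/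
def coshBound (τ p lam s₀ s₁ : ℝ) (Y : ℝ → ℝ → E4) (s : ℝ) : ℝ :=
  max (sliceNorm τ (projQ τ Y) s₀ ^ (2 / p)) (sliceNorm τ (projQ τ Y) s₁ ^ (2 / p)) *
    (Real.cosh (lam * (s - (s₀ + s₁) / 2)) / Real.cosh (lam * (s₁ - s₀) / 2))

/-- `v(s,t) = (a(s), t + c, x(s), 0)` with `a' = e^{δ f(x)}` and `x' = δ f'(x)`: the lift of a
gradient trajectory of `δ f` to the symplectization. -/
def IsGradientLift (G : MorseBottNbhd) (δ : ℝ) (v : ℝ → ℝ → E4) : Prop :=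
  ∃ (a x : ℝ → ℝ) (c : ℝ),
    (∀ s, HasDerivAt a (Real.exp (δ * G.f (x s))) s) ∧
    (∀ s, HasDerivAt x (δ * deriv G.f (x s)) s) ∧
    v = fun s t => !₂[a s, t + c, x s, 0]

end MorseBottCylinder

end

/-! Near the torus the displacement satisfies `Y_s = -J₀ Y_t + M (Y_t + ∂_z)`, where `M` is the
deviation of `J_δ` from the constant structure `J₀`. This deviation vanishes on the torus at `δ =
0`, so `M = O(δ + ε)`. Expanding the drift `M ∂_z` to first order about the Reeb orbit below each
circle (`drift_eq_add`) and projecting (`IsNearCylinder.linSys`) splits the equation. The component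
`W = QY` solves `W_s = A W + Q(M W_t + c W)`, where `A = -J₀ ∂_t + κ π_y`, `κ` is the rotation
coefficient of the linearized Reeb flow, and `M`, `c`, `κ_s` are small. The component `PY` solves
the ordinary differential equation `(PY)_s = drift0(x) + E` with `E = P((c - M_t) W)`; its
unperturbed form is exactly the equation of lifted gradient trajectories.

Decay of `W`. The Morse–Bott condition says that the integral of `κ` over a closed orbit is nonzero,
which makes `A` invertible on the complement of its kernel (`spectral_gap`). Since `A` is symmetric,
`g = ∑ ‖∂_s^l W‖²` satisfies `g'' ≥ μ² g`, where `μ` depends only on the gap and not on the number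
of derivatives. The maximum principle then bounds `g` by its boundary values times a `cosh` profile
(`LinSys.exists_decay`).

The boundary values are to be controlled by `‖W‖` alone. The equation exchanges `s`-derivatives for
`t`-derivatives up to terms that can be absorbed (`LinSys.exists_l2c_le`), and log-convexity of the
norms `‖∂_t^l W‖` against a bounded derivative of order `k` gives `‖∂_t^l W‖² ≤ ‖W‖^(2/k)` for `l <
k`. Passing from `L²` to pointwise bounds costs a square root, because the derivatives of order `k`
are bounded but not shown to decay. Hence the fourth power of the `C^{k-1}` size is at most a small
constant times `N^(2/k) cosh(μ ·)/cosh(μ ·)`, with `N` the larger end norm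
(`LinSys.exists_decay_cSize`). As `N ≤ 1`, the condition `p > 4k` is what allows `N^(1/(2k)) ≤
N^(2/p)`, and the constant is absorbed by the smallness of `δ + ε`.

Shadowing. The forcing `E` is an average over circles, so it inherits the `L²` decay with no further
loss (`exists_drag_decay`). Let `V` be the displacement of the gradient lift that agrees with `PY`
at the midpoint of the cylinder, where the forcing bound is smallest. The unperturbed field has
Lipschitz constant `O(δ)`, well below the decay rate, so a Grönwall comparison from the midpoint
outwards keeps the `cosh` profile (`exists_norm_sub_shadow_le`). Differentiating the equation
repeatedly gives the higher derivatives (`exists_cSize_sub_shadow_le`). -/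

noncomputable section

namespace MorseBottCylinder

/-! ### Smooth maps on the plane -/

section Plane

variable {E F H : Type} [NormedAddCommGroup E] [NormedSpace ℝ E] [NormedAddCommGroup F]
  [NormedSpace ℝ F] [NormedAddCommGroup H] [NormedSpace ℝ H]

/-- Smoothness of a map on the plane in curried form. -/
def Smooth2 (φ : ℝ → ℝ → E) : Prop := ContDiff ℝ ∞ (fun q : ℝ × ℝ => φ q.1 q.2)

theorem Smooth2.hasFDerivAt {φ : ℝ → ℝ → E} (h : Smooth2 φ) (q : ℝ × ℝ) :
    HasFDerivAt (fun q : ℝ × ℝ => φ q.1 q.2) (fderiv ℝ (fun q : ℝ × ℝ => φ q.1 q.2) q) q :=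
  (h.differentiable (by simp) q).hasFDerivAt

theorem Smooth2.hasDerivAt_fst' {φ : ℝ → ℝ → E} (h : Smooth2 φ) (s t : ℝ) :
    HasDerivAt (fun r => φ r t) (fderiv ℝ (fun q : ℝ × ℝ => φ q.1 q.2) (s, t) (1, 0)) s := by
  have h1 := h.hasFDerivAt (s, t)
  have h2 : HasDerivAt (fun r : ℝ => (r, t)) ((1 : ℝ), (0 : ℝ)) s :=
    (hasDerivAt_id s).prodMk (hasDerivAt_const s t)
  exact h1.comp_hasDerivAt s h2

theorem Smooth2.hasDerivAt_snd' {φ : ℝ → ℝ → E} (h : Smooth2 φ) (s t : ℝ) :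
    HasDerivAt (fun r => φ s r) (fderiv ℝ (fun q : ℝ × ℝ => φ q.1 q.2) (s, t) (0, 1)) t := by
  have h1 := h.hasFDerivAt (s, t)
  have h2 : HasDerivAt (fun r : ℝ => (s, r)) ((0 : ℝ), (1 : ℝ)) t :=
    (hasDerivAt_const t s).prodMk (hasDerivAt_id t)
  exact h1.comp_hasDerivAt t h2

theorem Smooth2.dS_eq {φ : ℝ → ℝ → E} (h : Smooth2 φ) (s t : ℝ) :
    dS φ s t = fderiv ℝ (fun q : ℝ × ℝ => φ q.1 q.2) (s, t) (1, 0) :=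
  (h.hasDerivAt_fst' s t).deriv

theorem Smooth2.dT_eq {φ : ℝ → ℝ → E} (h : Smooth2 φ) (s t : ℝ) :
    dT φ s t = fderiv ℝ (fun q : ℝ × ℝ => φ q.1 q.2) (s, t) (0, 1) :=
  (h.hasDerivAt_snd' s t).deriv

theorem Smooth2.hasDerivAt_fst {φ : ℝ → ℝ → E} (h : Smooth2 φ) (s t : ℝ) :
    HasDerivAt (fun r => φ r t) (dS φ s t) s := by
  rw [h.dS_eq]; exact h.hasDerivAt_fst' s t

theorem Smooth2.hasDerivAt_snd {φ : ℝ → ℝ → E} (h : Smooth2 φ) (s t : ℝ) :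
    HasDerivAt (fun r => φ s r) (dT φ s t) t := by
  rw [h.dT_eq]; exact h.hasDerivAt_snd' s t

theorem Smooth2.dS {φ : ℝ → ℝ → E} (h : Smooth2 φ) : Smooth2 (dS φ) := by
  have h1 : ContDiff ℝ ∞ (fderiv ℝ (fun q : ℝ × ℝ => φ q.1 q.2)) :=
    h.fderiv_right (by simp)
  have h2 := h1.clm_apply (contDiff_const (c := ((1 : ℝ), (0 : ℝ))))
  have e : (fun q : ℝ × ℝ => MorseBottCylinder.dS φ q.1 q.2)
      = fun q => fderiv ℝ (fun q : ℝ × ℝ => φ q.1 q.2) q (1, 0) := by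
    funext q; exact h.dS_eq _ _
  unfold Smooth2
  rw [e]
  exact h2

theorem Smooth2.dT {φ : ℝ → ℝ → E} (h : Smooth2 φ) : Smooth2 (dT φ) := by
  have h1 : ContDiff ℝ ∞ (fderiv ℝ (fun q : ℝ × ℝ => φ q.1 q.2)) :=
    h.fderiv_right (by simp)
  have h2 := h1.clm_apply (contDiff_const (c := ((0 : ℝ), (1 : ℝ))))
  have e : (fun q : ℝ × ℝ => MorseBottCylinder.dT φ q.1 q.2)
      = fun q => fderiv ℝ (fun q : ℝ × ℝ => φ q.1 q.2) q (0, 1) := by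
    funext q; exact h.dT_eq _ _
  unfold Smooth2
  rw [e]
  exact h2

theorem Smooth2.comm {φ : ℝ → ℝ → E} (h : Smooth2 φ) :
    MorseBottCylinder.dS (MorseBottCylinder.dT φ) = MorseBottCylinder.dT (MorseBottCylinder.dS φ) := by
  have h1 : ContDiff ℝ ∞ (fderiv ℝ (fun q : ℝ × ℝ => φ q.1 q.2)) := h.fderiv_right (by simp)
  funext s t
  have hsym : IsSymmSndFDerivAt ℝ (fun q : ℝ × ℝ => φ q.1 q.2) (s, t) :=
    ContDiffAt.isSymmSndFDerivAt (ContDiff.contDiffAt h) (by simp; exact WithTop.coe_le_coe.2 (le_top : (2 : ℕ∞) ≤ ⊤))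
  have key : ∀ v w : ℝ × ℝ, fderiv ℝ (fun q => fderiv ℝ (fun q : ℝ × ℝ => φ q.1 q.2) q v) (s, t) w
      = fderiv ℝ (fderiv ℝ (fun q : ℝ × ℝ => φ q.1 q.2)) (s, t) w v := by
    intro v w
    have hd := (h1.differentiable (by simp) (s, t)).hasFDerivAt
    have := (hd.clm_apply (hasFDerivAt_const v (s, t))).fderiv
    rw [this]; simp
  rw [h.dT.dS_eq, h.dS.dT_eq]
  have e1 : (fun q : ℝ × ℝ => MorseBottCylinder.dT φ q.1 q.2)
      = fun q => fderiv ℝ (fun q : ℝ × ℝ => φ q.1 q.2) q (0, 1) := by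
    funext q; exact h.dT_eq _ _
  have e2 : (fun q : ℝ × ℝ => MorseBottCylinder.dS φ q.1 q.2)
      = fun q => fderiv ℝ (fun q : ℝ × ℝ => φ q.1 q.2) q (1, 0) := by
    funext q; exact h.dS_eq _ _
  rw [e1, e2, key, key]
  exact hsym _ _

theorem Smooth2.iterate_dS {φ : ℝ → ℝ → E} (h : Smooth2 φ) (i : ℕ) :
    Smooth2 (MorseBottCylinder.dS^[i] φ) := by
  induction i with
  | zero => exact h
  | succ i ih => rw [Function.iterate_succ_apply']; exact ih.dS

theorem Smooth2.iterate_dT {φ : ℝ → ℝ → E} (h : Smooth2 φ) (i : ℕ) :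
    Smooth2 (MorseBottCylinder.dT^[i] φ) := by
  induction i with
  | zero => exact h
  | succ i ih => rw [Function.iterate_succ_apply']; exact ih.dT

theorem Smooth2.pd {φ : ℝ → ℝ → E} (h : Smooth2 φ) (i j : ℕ) :
    Smooth2 (MorseBottCylinder.pd i j φ) := (h.iterate_dT j).iterate_dS i

theorem pd_zero_zero (φ : ℝ → ℝ → E) : pd 0 0 φ = φ := rfl

theorem dS_pd (i j : ℕ) (φ : ℝ → ℝ → E) : dS (pd i j φ) = pd (i + 1) j φ := by
  unfold pd; rw [Function.iterate_succ_apply']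

theorem pd_dT (i j : ℕ) (φ : ℝ → ℝ → E) : pd i j (dT φ) = pd i (j + 1) φ := by
  unfold pd; rw [Function.iterate_succ_apply]

theorem Smooth2.dT_pd {φ : ℝ → ℝ → E} (h : Smooth2 φ) (i j : ℕ) :
    MorseBottCylinder.dT (MorseBottCylinder.pd i j φ) = MorseBottCylinder.pd i (j + 1) φ := by
  induction i with
  | zero =>
    change MorseBottCylinder.dT (MorseBottCylinder.dT^[j] φ) = MorseBottCylinder.dT^[j+1] φ
    rw [Function.iterate_succ_apply']
  | succ i ih => rw [← dS_pd, ← (h.pd i j).comm, ih, dS_pd]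

theorem Smooth2.pd_dS {φ : ℝ → ℝ → E} (h : Smooth2 φ) (i j : ℕ) :
    MorseBottCylinder.pd i j (MorseBottCylinder.dS φ) = MorseBottCylinder.pd (i + 1) j φ := by
  induction i with
  | zero =>
    induction j with
    | zero => rfl
    | succ j ih =>
      rw [← h.dS.dT_pd, ih, h.dT_pd]
  | succ i ih => rw [← dS_pd, ih, dS_pd]

theorem Smooth2.add {φ ψ : ℝ → ℝ → E} (h : Smooth2 φ) (h' : Smooth2 ψ) :
    Smooth2 (fun s t => φ s t + ψ s t) := ContDiff.add h h'

theorem Smooth2.sub {φ ψ : ℝ → ℝ → E} (h : Smooth2 φ) (h' : Smooth2 ψ) :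
    Smooth2 (fun s t => φ s t - ψ s t) := ContDiff.sub h h'

theorem Smooth2.clm {φ : ℝ → ℝ → E} (h : Smooth2 φ) (L : E →L[ℝ] F) :
    Smooth2 (fun s t => L (φ s t)) := L.contDiff.comp h

theorem Smooth2.bilin {φ : ℝ → ℝ → E} {ψ : ℝ → ℝ → F} (h : Smooth2 φ) (h' : Smooth2 ψ)
    (B : E →L[ℝ] F →L[ℝ] H) : Smooth2 (fun s t => B (φ s t) (ψ s t)) :=
  (B.contDiff.comp h).clm_apply h'

theorem Smooth2.const (c : E) : Smooth2 (fun _ _ => c) := contDiff_const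

theorem Smooth2.comp {Φ : E → F} {φ : ℝ → ℝ → E} (hΦ : ContDiff ℝ ∞ Φ) (h : Smooth2 φ) :
    Smooth2 (fun s t => Φ (φ s t)) := ContDiff.comp hΦ h

theorem Smooth2.sum {ι : Type} (S : Finset ι) {φ : ι → ℝ → ℝ → E} (h : ∀ i ∈ S, Smooth2 (φ i)) :
    Smooth2 (fun s t => ∑ i ∈ S, φ i s t) := ContDiff.sum h

theorem dS_const (c : E) : dS (fun _ _ => c) = fun _ _ => 0 := by
  funext s t; simp [dS]

theorem dT_of_const (g : ℝ → E) : dT (fun s _ => g s) = fun _ _ => 0 := by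
  funext s t; simp [dT]

theorem Smooth2.dS_add {φ ψ : ℝ → ℝ → E} (h : Smooth2 φ) (h' : Smooth2 ψ) :
    MorseBottCylinder.dS (fun s t => φ s t + ψ s t)
      = fun s t => MorseBottCylinder.dS φ s t + MorseBottCylinder.dS ψ s t := by
  funext s t; exact ((h.hasDerivAt_fst s t).add (h'.hasDerivAt_fst s t)).deriv

theorem Smooth2.dT_add {φ ψ : ℝ → ℝ → E} (h : Smooth2 φ) (h' : Smooth2 ψ) :
    MorseBottCylinder.dT (fun s t => φ s t + ψ s t)
      = fun s t => MorseBottCylinder.dT φ s t + MorseBottCylinder.dT ψ s t := by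
  funext s t; exact ((h.hasDerivAt_snd s t).add (h'.hasDerivAt_snd s t)).deriv

theorem Smooth2.dS_sub {φ ψ : ℝ → ℝ → E} (h : Smooth2 φ) (h' : Smooth2 ψ) :
    MorseBottCylinder.dS (fun s t => φ s t - ψ s t)
      = fun s t => MorseBottCylinder.dS φ s t - MorseBottCylinder.dS ψ s t := by
  funext s t; exact ((h.hasDerivAt_fst s t).sub (h'.hasDerivAt_fst s t)).deriv

theorem Smooth2.dT_sub {φ ψ : ℝ → ℝ → E} (h : Smooth2 φ) (h' : Smooth2 ψ) :
    MorseBottCylinder.dT (fun s t => φ s t - ψ s t)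
      = fun s t => MorseBottCylinder.dT φ s t - MorseBottCylinder.dT ψ s t := by
  funext s t; exact ((h.hasDerivAt_snd s t).sub (h'.hasDerivAt_snd s t)).deriv

theorem Smooth2.dS_clm {φ : ℝ → ℝ → E} (h : Smooth2 φ) (L : E →L[ℝ] F) :
    MorseBottCylinder.dS (fun s t => L (φ s t)) = fun s t => L (MorseBottCylinder.dS φ s t) := by
  funext s t; exact (L.hasFDerivAt.comp_hasDerivAt s (h.hasDerivAt_fst s t)).deriv

theorem Smooth2.dT_clm {φ : ℝ → ℝ → E} (h : Smooth2 φ) (L : E →L[ℝ] F) :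
    MorseBottCylinder.dT (fun s t => L (φ s t)) = fun s t => L (MorseBottCylinder.dT φ s t) := by
  funext s t; exact (L.hasFDerivAt.comp_hasDerivAt t (h.hasDerivAt_snd s t)).deriv

theorem Smooth2.pd_clm {φ : ℝ → ℝ → E} (h : Smooth2 φ) (L : E →L[ℝ] F) (i j : ℕ) :
    MorseBottCylinder.pd i j (fun s t => L (φ s t))
      = fun s t => L (MorseBottCylinder.pd i j φ s t) := by
  induction i with
  | zero =>
    induction j with
    | zero => rfl
    | succ j ih => rw [← (h.clm L).dT_pd, ih, (h.pd 0 j).dT_clm, h.dT_pd]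
  | succ i ih => rw [← dS_pd, ih, (h.pd i j).dS_clm, dS_pd]

theorem Smooth2.pd_add {φ ψ : ℝ → ℝ → E} (h : Smooth2 φ) (h' : Smooth2 ψ) (i j : ℕ) :
    MorseBottCylinder.pd i j (fun s t => φ s t + ψ s t)
      = fun s t => MorseBottCylinder.pd i j φ s t + MorseBottCylinder.pd i j ψ s t := by
  induction i with
  | zero =>
    induction j with
    | zero => rfl
    | succ j ih => rw [← (h.add h').dT_pd, ih, (h.pd 0 j).dT_add (h'.pd 0 j), h.dT_pd, h'.dT_pd]
  | succ i ih => rw [← dS_pd, ih, (h.pd i j).dS_add (h'.pd i j), dS_pd, dS_pd]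

theorem Smooth2.pd_sub {φ ψ : ℝ → ℝ → E} (h : Smooth2 φ) (h' : Smooth2 ψ) (i j : ℕ) :
    MorseBottCylinder.pd i j (fun s t => φ s t - ψ s t)
      = fun s t => MorseBottCylinder.pd i j φ s t - MorseBottCylinder.pd i j ψ s t := by
  induction i with
  | zero =>
    induction j with
    | zero => rfl
    | succ j ih => rw [← (h.sub h').dT_pd, ih, (h.pd 0 j).dT_sub (h'.pd 0 j), h.dT_pd, h'.dT_pd]
  | succ i ih => rw [← dS_pd, ih, (h.pd i j).dS_sub (h'.pd i j), dS_pd, dS_pd]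

theorem Smooth2.dS_bilin {φ : ℝ → ℝ → E} {ψ : ℝ → ℝ → F} (h : Smooth2 φ) (h' : Smooth2 ψ)
    (B : E →L[ℝ] F →L[ℝ] H) :
    MorseBottCylinder.dS (fun s t => B (φ s t) (ψ s t)) = fun s t =>
      B (MorseBottCylinder.dS φ s t) (ψ s t) + B (φ s t) (MorseBottCylinder.dS ψ s t) := by
  funext s t
  exact ((B.hasFDerivAt.comp_hasDerivAt s (h.hasDerivAt_fst s t)).clm_apply
    (h'.hasDerivAt_fst s t)).deriv

theorem Smooth2.dT_bilin {φ : ℝ → ℝ → E} {ψ : ℝ → ℝ → F} (h : Smooth2 φ) (h' : Smooth2 ψ)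
    (B : E →L[ℝ] F →L[ℝ] H) :
    MorseBottCylinder.dT (fun s t => B (φ s t) (ψ s t)) = fun s t =>
      B (MorseBottCylinder.dT φ s t) (ψ s t) + B (φ s t) (MorseBottCylinder.dT ψ s t) := by
  funext s t
  exact ((B.hasFDerivAt.comp_hasDerivAt t (h.hasDerivAt_snd s t)).clm_apply
    (h'.hasDerivAt_snd s t)).deriv

theorem Smooth2.continuous {φ : ℝ → ℝ → E} (h : Smooth2 φ) :
    Continuous (fun q : ℝ × ℝ => φ q.1 q.2) := ContDiff.continuous h

theorem Smooth2.continuous_snd {φ : ℝ → ℝ → E} (h : Smooth2 φ) (s : ℝ) : Continuous (φ s) :=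
  h.continuous.comp (Continuous.prodMk_right s)

/-- Smooth maps that agree on a closed strip have the same derivatives there. -/
theorem dS_congr_strip {φ ψ : ℝ → ℝ → E} (h : Smooth2 φ) (h' : Smooth2 ψ) {a b : ℝ} (hab : a < b)
    (e : ∀ s ∈ Set.Icc a b, ∀ t, φ s t = ψ s t) :
    ∀ s ∈ Set.Icc a b, ∀ t, dS φ s t = dS ψ s t := by
  intro s hs t
  -- At the two ends only the one-sided derivative is determined by the strip; for maps smooth on
  -- the plane it equals the full derivative.
  have hu := uniqueDiffOn_Icc hab s hs
  have h1 := ((h.hasDerivAt_fst s t).hasDerivWithinAt (s := Set.Icc a b)).derivWithin hu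
  have h2 := ((h'.hasDerivAt_fst s t).hasDerivWithinAt (s := Set.Icc a b)).derivWithin hu
  rw [← h1, ← h2]
  exact derivWithin_congr (fun r hr => e r hr t) (e s hs t)

theorem dT_congr_strip {φ ψ : ℝ → ℝ → E} {S : Set ℝ}
    (e : ∀ s ∈ S, ∀ t, φ s t = ψ s t) : ∀ s ∈ S, ∀ t, dT φ s t = dT ψ s t := by
  intro s hs t
  unfold dT
  rw [show (fun r => φ s r) = fun r => ψ s r from funext (e s hs)]

theorem pd_congr_strip {φ ψ : ℝ → ℝ → E} (h : Smooth2 φ) (h' : Smooth2 ψ) {a b : ℝ} (hab : a < b)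
    (e : ∀ s ∈ Set.Icc a b, ∀ t, φ s t = ψ s t) (i j : ℕ) :
    ∀ s ∈ Set.Icc a b, ∀ t, pd i j φ s t = pd i j ψ s t := by
  induction i with
  | zero =>
    induction j with
    | zero => exact e
    | succ j ih => rw [← h.dT_pd, ← h'.dT_pd]; exact dT_congr_strip ih
  | succ i ih => rw [← dS_pd, ← dS_pd]; exact dS_congr_strip (h.pd i j) (h'.pd i j) hab ih

/-- Periodicity in `t` over a set of values of `s`. -/
def PeriodicOn (τ : ℝ) (S : Set ℝ) (φ : ℝ → ℝ → E) : Prop := ∀ s ∈ S, ∀ t, φ s (t + τ) = φ s t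

theorem Smooth2.shift {φ : ℝ → ℝ → E} (h : Smooth2 φ) (τ : ℝ) : Smooth2 (fun s t => φ s (t + τ)) :=
  ContDiff.comp h (contDiff_fst.prodMk (contDiff_snd.add contDiff_const))

theorem pd_shift (i j : ℕ) (φ : ℝ → ℝ → E) (τ : ℝ) :
    pd i j (fun s t => φ s (t + τ)) = fun s t => pd i j φ s (t + τ) := by
  induction i with
  | zero =>
    induction j generalizing φ with
    | zero => rfl
    | succ j ih =>
      rw [← pd_dT, ← pd_dT, ← ih]
      congr 1; funext s t
      exact deriv_comp_add_const (f := fun r => φ s r) _ _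
  | succ i ih => rw [← dS_pd, ih, ← dS_pd]; rfl

theorem PeriodicOn.pd {φ : ℝ → ℝ → E} (h : Smooth2 φ) {τ a b : ℝ} (hab : a < b)
    (hp : PeriodicOn τ (Set.Icc a b) φ) (i j : ℕ) :
    PeriodicOn τ (Set.Icc a b) (MorseBottCylinder.pd i j φ) := by
  intro s hs t
  have := pd_congr_strip (h.shift τ) h hab hp i j s hs t
  rwa [pd_shift] at this

end Plane

/-! ### Integrals depending on a parameter -/

section Param

variable {V F : Type} [NormedAddCommGroup V] [NormedSpace ℝ V]
  [NormedAddCommGroup F] [NormedSpace ℝ F]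

theorem hasFDerivAt_parametric_integral [ProperSpace V] {Φ : V → ℝ → F}
    (h : ContDiff ℝ 1 (fun p : V × ℝ => Φ p.1 p.2)) (a b : ℝ) (x : V) :
    HasFDerivAt (fun x => ∫ t in a..b, Φ x t) (∫ t in a..b, fderiv ℝ (fun x => Φ x t) x) x := by
  have hd : ContDiff ℝ 0 (fun p : V × ℝ => fderiv ℝ (fun x => Φ x p.2) p.1) := by
    refine ContDiff.fderiv (n := 0) (m := 1) (f := fun (p : V × ℝ) x => Φ x p.2) (g := fun p => p.1) ?_
      contDiff_fst (by simp)
    exact h.comp (contDiff_snd.prodMk (contDiff_snd.comp contDiff_fst))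
  have hc := hd.continuous
  have hK : IsCompact (Metric.closedBall x 1 ×ˢ Set.uIcc a b) :=
    (isCompact_closedBall x 1).prod isCompact_uIcc
  obtain ⟨C, hC⟩ := hK.exists_bound_of_continuousOn hc.continuousOn
  have hcont : ∀ y, Continuous (Φ y) := fun y => h.continuous.comp (Continuous.prodMk_right y)
  refine intervalIntegral.hasFDerivAt_integral_of_dominated_of_fderiv_le (bound := fun _ => C)
    (F' := fun x t => fderiv ℝ (fun x => Φ x t) x)
    (Metric.closedBall_mem_nhds x one_pos) ?_ ((hcont x).intervalIntegrable _ _) ?_ ?_ (by simp) ?_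
  · exact Filter.Eventually.of_forall fun y => (hcont y).aestronglyMeasurable
  · exact (hc.comp (Continuous.prodMk_right x)).aestronglyMeasurable
  · refine Filter.Eventually.of_forall fun t ht y hy => hC (y, t) ⟨hy, Set.uIoc_subset_uIcc ht⟩
  · refine Filter.Eventually.of_forall fun t _ y _ => ?_
    have h2 : ContDiff ℝ 1 (fun x => Φ x t) := h.comp (contDiff_id.prodMk contDiff_const)
    exact (h2.differentiable (by simp) y).hasFDerivAt

/-- The codomain is quantified inside the induction because the derivative in the parameter is an
integral with values in a different space. -/
theorem contDiff_parametric_integral_nat [ProperSpace V] (n : ℕ) : ∀ {F : Type} [NormedAddCommGroup F]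
    [NormedSpace ℝ F] {Φ : V → ℝ → F}, ContDiff ℝ ∞ (fun p : V × ℝ => Φ p.1 p.2) → ∀ a b : ℝ,
    ContDiff ℝ n (fun x => ∫ t in a..b, Φ x t) := by
  induction n with
  | zero =>
    intro F _ _ Φ h a b
    have h1 : ContDiff ℝ 1 (fun p : V × ℝ => Φ p.1 p.2) := h.of_le (by simp)
    have : Differentiable ℝ (fun x => ∫ t in a..b, Φ x t) := fun x =>
      (hasFDerivAt_parametric_integral h1 a b x).differentiableAt
    exact contDiff_zero.2 this.continuous
  | succ n ih =>
    intro F _ _ Φ h a b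
    have h1 : ContDiff ℝ 1 (fun p : V × ℝ => Φ p.1 p.2) := h.of_le (by simp)
    have hd := hasFDerivAt_parametric_integral h1 a b
    have : ((n + 1 : ℕ) : WithTop ℕ∞) = (n : WithTop ℕ∞) + 1 := by simp
    rw [this, contDiff_succ_iff_fderiv]
    refine ⟨fun x => (hd x).differentiableAt, by simp, ?_⟩
    rw [show fderiv ℝ (fun x => ∫ t in a..b, Φ x t)
      = fun x => ∫ t in a..b, fderiv ℝ (fun x => Φ x t) x from funext fun x => (hd x).fderiv]
    refine ih ?_ a b
    refine ContDiff.fderiv (m := ∞) (f := fun (p : V × ℝ) x => Φ x p.2) (g := fun p => p.1) ?_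
      contDiff_fst (by simp)
    exact h.comp (contDiff_snd.prodMk (contDiff_snd.comp contDiff_fst))

theorem contDiff_parametric_integral [ProperSpace V] {Φ : V → ℝ → F}
    (h : ContDiff ℝ ∞ (fun p : V × ℝ => Φ p.1 p.2)) (a b : ℝ) :
    ContDiff ℝ ∞ (fun x => ∫ t in a..b, Φ x t) :=
  contDiff_infty.2 fun n => contDiff_parametric_integral_nat n h a b

/-- The Hadamard quotient `∫₀¹ DΦ(p + θ w) dθ`. -/
def hadamard (Φ : V → F) (p : V × V) : V →L[ℝ] F := ∫ θ in (0 : ℝ)..1, fderiv ℝ Φ (p.1 + θ • p.2)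

theorem hadamard_contDiff [ProperSpace V] {Φ : V → F} (h : ContDiff ℝ ∞ Φ) : ContDiff ℝ ∞ (hadamard Φ) := by
  refine contDiff_parametric_integral (Φ := fun (p : V × V) θ => fderiv ℝ Φ (p.1 + θ • p.2)) ?_ 0 1
  have h1 : ContDiff ℝ ∞ (fderiv ℝ Φ) := h.fderiv_right (by simp)
  refine h1.comp ?_
  fun_prop

/-- This exact factorization replaces Taylor estimates below: a remainder becomes a smooth
coefficient applied to the increment, so its derivatives are controlled by product and composition
bounds. -/
theorem hadamard_apply [CompleteSpace F] {Φ : V → F} (h : ContDiff ℝ ∞ Φ) (p w : V) :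
    hadamard Φ (p, w) w = Φ (p + w) - Φ p := by
  have h1 : ContDiff ℝ ∞ (fderiv ℝ Φ) := h.fderiv_right (by simp)
  have hcont : Continuous (fun θ : ℝ => fderiv ℝ Φ (p + θ • w)) := h1.continuous.comp (by fun_prop)
  unfold hadamard
  rw [ContinuousLinearMap.intervalIntegral_apply (hcont.intervalIntegrable _ _)]
  have hd : ∀ θ ∈ Set.uIcc (0 : ℝ) 1,
      HasDerivAt (fun θ : ℝ => Φ (p + θ • w)) (fderiv ℝ Φ (p + θ • w) w) θ := by
    intro θ _
    have e1 : HasDerivAt (fun θ : ℝ => p + θ • w) w θ := by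
      simpa using ((hasDerivAt_id θ).smul_const w).const_add p
    exact ((h.differentiable (by simp) _).hasFDerivAt).comp_hasDerivAt θ e1
  rw [intervalIntegral.integral_eq_sub_of_hasDerivAt hd
    ((hcont.clm_apply continuous_const).intervalIntegrable _ _)]
  simp

theorem hadamard_zero [CompleteSpace F] (Φ : V → F) (p : V) : hadamard Φ (p, 0) = fderiv ℝ Φ p := by
  simp [hadamard]

end Param

/-! ### The `C^n` size -/

section CSize

variable {E F H : Type} [NormedAddCommGroup E] [NormedSpace ℝ E] [NormedAddCommGroup F]
  [NormedSpace ℝ F] [NormedAddCommGroup H] [NormedSpace ℝ H]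

theorem cSize_nonneg (n : ℕ) (φ : ℝ → ℝ → E) (s t : ℝ) : 0 ≤ cSize n φ s t :=
  Finset.sum_nonneg fun _ _ => Finset.sum_nonneg fun _ _ => norm_nonneg _

theorem cSize_zero (φ : ℝ → ℝ → E) (s t : ℝ) : cSize 0 φ s t = ‖φ s t‖ := by
  simp [cSize, pd]

theorem cSize_succ (n : ℕ) (φ : ℝ → ℝ → E) (s t : ℝ) : cSize (n + 1) φ s t = cSize n φ s t +
    ∑ ij ∈ Finset.HasAntidiagonal.antidiagonal (n + 1), ‖pd ij.1 ij.2 φ s t‖ :=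
  Finset.sum_range_succ _ _

theorem cSize_mono {n m : ℕ} (h : n ≤ m) (φ : ℝ → ℝ → E) (s t : ℝ) :
    cSize n φ s t ≤ cSize m φ s t :=
  Finset.sum_le_sum_of_subset_of_nonneg (Finset.range_mono (by omega))
    fun _ _ _ => Finset.sum_nonneg fun _ _ => norm_nonneg _

theorem norm_pd_le_cSize {i j n : ℕ} (h : i + j ≤ n) (φ : ℝ → ℝ → E) (s t : ℝ) :
    ‖pd i j φ s t‖ ≤ cSize n φ s t := by
  refine le_trans ?_ (Finset.single_le_sum (f := fun m =>
    ∑ ij ∈ Finset.HasAntidiagonal.antidiagonal m, ‖pd ij.1 ij.2 φ s t‖)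
    (fun _ _ => Finset.sum_nonneg fun _ _ => norm_nonneg _) (Finset.mem_range.2 (Nat.lt_succ_of_le h)))
  exact Finset.single_le_sum (f := fun ij : ℕ × ℕ => ‖pd ij.1 ij.2 φ s t‖)
    (fun _ _ => norm_nonneg _) (Finset.HasAntidiagonal.mem_antidiagonal.2 (rfl : (i, j).1 + (i, j).2 = i + j))

theorem norm_le_cSize (n : ℕ) (φ : ℝ → ℝ → E) (s t : ℝ) : ‖φ s t‖ ≤ cSize n φ s t :=
  norm_pd_le_cSize (i := 0) (j := 0) (by omega) φ s t

theorem cSize_le {n : ℕ} {φ : ℝ → ℝ → E} {s t K : ℝ} (hK : 0 ≤ K)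
    (h : ∀ i j : ℕ, i + j ≤ n → ‖pd i j φ s t‖ ≤ K) : cSize n φ s t ≤ ((n : ℝ) + 1) ^ 2 * K := by
  have h1 : ∀ m ∈ Finset.range (n + 1),
      ∑ ij ∈ Finset.HasAntidiagonal.antidiagonal m, ‖pd ij.1 ij.2 φ s t‖ ≤ ((n : ℝ) + 1) * K := by
    intro m hm
    have hm' : m ≤ n := Nat.lt_succ_iff.1 (Finset.mem_range.1 hm)
    refine (Finset.sum_le_card_nsmul _ _ K fun ij hij => h _ _ ?_).trans ?_
    · rw [Finset.HasAntidiagonal.mem_antidiagonal.1 hij]; exact hm'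
    · rw [Finset.Nat.card_antidiagonal, nsmul_eq_mul]
      gcongr
      exact_mod_cast Nat.succ_le_succ hm'
  refine (Finset.sum_le_card_nsmul _ _ _ h1).trans ?_
  rw [Finset.card_range, nsmul_eq_mul]
  push_cast
  exact le_of_eq (by ring)

theorem cSize_dS_le {φ : ℝ → ℝ → E} (h : Smooth2 φ) (n : ℕ) (s t : ℝ) :
    cSize n (dS φ) s t ≤ cSize (n + 1) φ s t := by
  have e : cSize (n + 1) φ s t = (∑ m ∈ Finset.range (n + 1),
      ∑ ij ∈ Finset.HasAntidiagonal.antidiagonal (m + 1), ‖pd ij.1 ij.2 φ s t‖)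
      + ∑ ij ∈ Finset.HasAntidiagonal.antidiagonal 0, ‖pd ij.1 ij.2 φ s t‖ := by
    unfold cSize; rw [Finset.sum_range_succ']
  rw [e]
  refine le_trans ?_ (le_add_of_nonneg_right (Finset.sum_nonneg fun _ _ => norm_nonneg _))
  refine Finset.sum_le_sum fun m _ => ?_
  rw [Finset.Nat.sum_antidiagonal_succ (f := fun ij : ℕ × ℕ => ‖pd ij.1 ij.2 φ s t‖)]
  simp only [h.pd_dS]
  exact le_add_of_nonneg_left (norm_nonneg _)

theorem cSize_dT_le (φ : ℝ → ℝ → E) (n : ℕ) (s t : ℝ) :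
    cSize n (dT φ) s t ≤ cSize (n + 1) φ s t := by
  have e : cSize (n + 1) φ s t = (∑ m ∈ Finset.range (n + 1),
      ∑ ij ∈ Finset.HasAntidiagonal.antidiagonal (m + 1), ‖pd ij.1 ij.2 φ s t‖)
      + ∑ ij ∈ Finset.HasAntidiagonal.antidiagonal 0, ‖pd ij.1 ij.2 φ s t‖ := by
    unfold cSize; rw [Finset.sum_range_succ']
  rw [e]
  refine le_trans ?_ (le_add_of_nonneg_right (Finset.sum_nonneg fun _ _ => norm_nonneg _))
  refine Finset.sum_le_sum fun m _ => ?_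
  rw [Finset.Nat.sum_antidiagonal_succ' (f := fun ij : ℕ × ℕ => ‖pd ij.1 ij.2 φ s t‖)]
  simp only [pd_dT]
  exact le_add_of_nonneg_left (norm_nonneg _)

theorem cSize_succ_le {φ : ℝ → ℝ → E} (h : Smooth2 φ) (n : ℕ) (s t : ℝ) :
    cSize (n + 1) φ s t ≤ ‖φ s t‖ + cSize n (dS φ) s t + cSize n (dT φ) s t := by
  have e : cSize (n + 1) φ s t = (∑ m ∈ Finset.range (n + 1),
      ∑ ij ∈ Finset.HasAntidiagonal.antidiagonal (m + 1), ‖pd ij.1 ij.2 φ s t‖) + ‖φ s t‖ := by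
    unfold cSize; rw [Finset.sum_range_succ']; simp [pd]
  rw [e]
  have : (∑ m ∈ Finset.range (n + 1),
      ∑ ij ∈ Finset.HasAntidiagonal.antidiagonal (m + 1), ‖pd ij.1 ij.2 φ s t‖)
      ≤ cSize n (dS φ) s t + cSize n (dT φ) s t := by
    unfold cSize
    rw [← Finset.sum_add_distrib]
    refine Finset.sum_le_sum fun m _ => ?_
    rw [Finset.Nat.sum_antidiagonal_succ (f := fun ij : ℕ × ℕ => ‖pd ij.1 ij.2 φ s t‖)]
    simp only [h.pd_dS, pd_dT]
    rw [add_comm]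
    refine add_le_add le_rfl ?_
    exact Finset.single_le_sum (f := fun ij : ℕ × ℕ => ‖pd ij.1 (ij.2 + 1) φ s t‖)
      (fun _ _ => norm_nonneg _) (a := (0, m)) (Finset.HasAntidiagonal.mem_antidiagonal.2 (zero_add m))
  linarith

theorem cSize_congr_strip {φ ψ : ℝ → ℝ → E} (h : Smooth2 φ) (h' : Smooth2 ψ) {a b : ℝ} (hab : a < b)
    (e : ∀ s ∈ Set.Icc a b, ∀ t, φ s t = ψ s t) (n : ℕ) :
    ∀ s ∈ Set.Icc a b, ∀ t, cSize n φ s t = cSize n ψ s t := by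
  intro s hs t
  unfold cSize
  simp only [pd_congr_strip h h' hab e _ _ s hs t]

theorem cSize_add_le {φ ψ : ℝ → ℝ → E} (h : Smooth2 φ) (h' : Smooth2 ψ) (n : ℕ) (s t : ℝ) :
    cSize n (fun s t => φ s t + ψ s t) s t ≤ cSize n φ s t + cSize n ψ s t := by
  unfold cSize
  rw [← Finset.sum_add_distrib]
  refine Finset.sum_le_sum fun m _ => ?_
  rw [← Finset.sum_add_distrib]
  refine Finset.sum_le_sum fun ij _ => ?_
  rw [h.pd_add h']
  exact norm_add_le _ _

theorem cSize_sub_le {φ ψ : ℝ → ℝ → E} (h : Smooth2 φ) (h' : Smooth2 ψ) (n : ℕ) (s t : ℝ) :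
    cSize n (fun s t => φ s t - ψ s t) s t ≤ cSize n φ s t + cSize n ψ s t := by
  unfold cSize
  rw [← Finset.sum_add_distrib]
  refine Finset.sum_le_sum fun m _ => ?_
  rw [← Finset.sum_add_distrib]
  refine Finset.sum_le_sum fun ij _ => ?_
  rw [h.pd_sub h']
  exact norm_sub_le _ _

theorem cSize_clm_le {φ : ℝ → ℝ → E} (h : Smooth2 φ) (L : E →L[ℝ] F) (n : ℕ) (s t : ℝ) :
    cSize n (fun s t => L (φ s t)) s t ≤ ‖L‖ * cSize n φ s t := by
  unfold cSize
  rw [Finset.mul_sum]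
  refine Finset.sum_le_sum fun m _ => ?_
  rw [Finset.mul_sum]
  refine Finset.sum_le_sum fun ij _ => ?_
  rw [h.pd_clm]
  exact L.le_opNorm _

theorem cSize_zero_fun (n : ℕ) (s t : ℝ) : cSize n (fun _ _ => (0 : E)) s t = 0 := by
  have h := cSize_clm_le (φ := fun _ _ => (0 : E)) (Smooth2.const 0) (0 : E →L[ℝ] E) n s t
  simp only [zero_apply, norm_zero, zero_mul] at h
  exact le_antisymm h (cSize_nonneg _ _ _ _)

theorem cSize_succ_le_of_const (g : ℝ → E) (hg : ContDiff ℝ ∞ g) (n : ℕ) (s t : ℝ) :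
    cSize (n + 1) (fun s _ => g s) s t ≤ ‖g s‖ + cSize n (fun s _ => deriv g s) s t := by
  have h : Smooth2 (fun s (_ : ℝ) => g s) := hg.comp contDiff_fst
  refine (cSize_succ_le h n s t).trans ?_
  rw [dT_of_const, cSize_zero_fun, add_zero]
  exact le_rfl

theorem cSize_const (c : E) (n : ℕ) (s t : ℝ) : cSize n (fun _ _ => c) s t = ‖c‖ := by
  refine le_antisymm ?_ (norm_le_cSize n (fun _ _ => c) s t)
  cases n with
  | zero => rw [cSize_zero]
  | succ n =>
    refine (cSize_succ_le_of_const (fun _ => c) contDiff_const n s t).trans ?_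
    simp [cSize_zero_fun]

/-- The constant comes from the recursion: one term of order zero and, for each of `∂_s` and `∂_t`,
the two terms of the Leibniz rule. -/
theorem cSize_bilin_le (n : ℕ) (B : E →L[ℝ] F →L[ℝ] H) {φ : ℝ → ℝ → E} {ψ : ℝ → ℝ → F}
    (h : Smooth2 φ) (h' : Smooth2 ψ) (s t : ℝ) :
    cSize n (fun s t => B (φ s t) (ψ s t)) s t ≤ ‖B‖ * 5 ^ n * cSize n φ s t * cSize n ψ s t := by
  induction n generalizing φ ψ with
  | zero =>
    simp only [cSize_zero, pow_zero, mul_one]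
    exact B.le_opNorm₂ _ _
  | succ n ih =>
    refine (cSize_succ_le (h.bilin h' B) n s t).trans ?_
    rw [h.dS_bilin h' B, h.dT_bilin h' B]
    have a1 := cSize_add_le (h.dS.bilin h' B) (h.bilin h'.dS B) n s t
    have a2 := cSize_add_le (h.dT.bilin h' B) (h.bilin h'.dT B) n s t
    have b1 := ih h.dS h'
    have b2 := ih h h'.dS
    have b3 := ih h.dT h'
    have b4 := ih h h'.dT
    have n1 := cSize_dS_le h n s t
    have n2 := cSize_dT_le φ n s t
    have n3 := cSize_dS_le h' n s t
    have n4 := cSize_dT_le ψ n s t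
    have n5 := cSize_mono (Nat.le_succ n) φ s t
    have n6 := cSize_mono (Nat.le_succ n) ψ s t
    have n7 := norm_le_cSize (n + 1) φ s t
    have n8 := norm_le_cSize (n + 1) ψ s t
    have p1 := cSize_nonneg (n + 1) φ s t
    have p2 := cSize_nonneg (n + 1) ψ s t
    have q1 := cSize_nonneg n ψ s t
    have q3 := cSize_nonneg n (dS ψ) s t
    have q4 := cSize_nonneg n (dT ψ) s t
    set X := cSize (n + 1) φ s t
    set Y := cSize (n + 1) ψ s t
    have hB := norm_nonneg B
    have c0 : ‖B (φ s t) (ψ s t)‖ ≤ ‖B‖ * 5 ^ n * X * Y := by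
      refine (B.le_opNorm₂ _ _).trans ?_
      have : (1 : ℝ) ≤ 5 ^ n := one_le_pow₀ (by norm_num)
      have : ‖B‖ ≤ ‖B‖ * 5 ^ n := le_mul_of_one_le_right hB this
      gcongr
    have cc : ∀ x y : ℝ, 0 ≤ y → x ≤ X → y ≤ Y → ‖B‖ * 5 ^ n * x * y ≤ ‖B‖ * 5 ^ n * X * Y := by
      intro x y hy hx' hy'
      gcongr
    have d1 := cc _ _ q1 n1 n6
    have d2 := cc _ _ q3 n5 n3
    have d3 := cc _ _ q1 n2 n6
    have d4 := cc _ _ q4 n5 n4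
    have : ‖B‖ * 5 ^ (n + 1) * X * Y = 5 * (‖B‖ * 5 ^ n * X * Y) := by ring
    rw [this]
    linarith

theorem cSize_apply_le (n : ℕ) {c : ℝ → ℝ → E →L[ℝ] F} {φ : ℝ → ℝ → E}
    (h : Smooth2 c) (h' : Smooth2 φ) (s t : ℝ) :
    cSize n (fun s t => c s t (φ s t)) s t ≤ 5 ^ n * cSize n c s t * cSize n φ s t := by
  refine (cSize_bilin_le n (ContinuousLinearMap.id ℝ (E →L[ℝ] F)) h h' s t).trans ?_
  have h1 : ‖ContinuousLinearMap.id ℝ (E →L[ℝ] F)‖ ≤ 1 := ContinuousLinearMap.norm_id_le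
  have p1 := cSize_nonneg n c s t
  have p2 := cSize_nonneg n φ s t
  calc _ ≤ 1 * 5 ^ n * cSize n c s t * cSize n φ s t := by gcongr
    _ = _ := by ring

theorem Smooth2.apply {c : ℝ → ℝ → E →L[ℝ] F} {φ : ℝ → ℝ → E}
    (h : Smooth2 c) (h' : Smooth2 φ) : Smooth2 (fun s t => c s t (φ s t)) :=
  ContDiff.clm_apply h h'

theorem Smooth2.dT_apply {c : ℝ → ℝ → E →L[ℝ] F} {φ : ℝ → ℝ → E}
    (h : Smooth2 c) (h' : Smooth2 φ) : MorseBottCylinder.dT (fun s t => c s t (φ s t))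
      = fun s t => MorseBottCylinder.dT c s t (φ s t) + c s t (MorseBottCylinder.dT φ s t) :=
  h.dT_bilin h' (ContinuousLinearMap.id ℝ (E →L[ℝ] F))

end CSize

/-! ### Composition with maps whose derivatives are bounded -/

section Comp

variable {E F : Type} [NormedAddCommGroup E] [NormedSpace ℝ E] [NormedAddCommGroup F]
  [NormedSpace ℝ F]

/-- Every iterated derivative of `Φ` is bounded on `Ω`. -/
def BddDerivs (Ω : Set E) (Φ : E → F) : Prop :=
  ∀ n : ℕ, ∃ C : ℝ, ∀ x ∈ Ω, ‖iteratedFDeriv ℝ n Φ x‖ ≤ C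

theorem BddDerivs.fderiv {Ω : Set E} {Φ : E → F} (h : BddDerivs Ω Φ) :
    BddDerivs Ω (fderiv ℝ Φ) := by
  intro n
  obtain ⟨C, hC⟩ := h (n + 1)
  exact ⟨C, fun x hx => by rw [norm_iteratedFDeriv_fderiv]; exact hC x hx⟩

theorem BddDerivs.exists_bound {Ω : Set E} {Φ : E → F} (h : BddDerivs Ω Φ) :
    ∃ C : ℝ, 0 ≤ C ∧ ∀ x ∈ Ω, ‖Φ x‖ ≤ C := by
  obtain ⟨C, hC⟩ := h 0
  refine ⟨max C 0, le_max_right _ _, fun x hx => ?_⟩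
  have := hC x hx
  rw [norm_iteratedFDeriv_zero] at this
  exact this.trans (le_max_left _ _)

/-- Translations that preserve `Φ` also preserve its iterated derivatives, so a bound on the compact
set reaches every translate of it. -/
theorem BddDerivs.of_compact {Φ : E → F} (hΦ : ContDiff ℝ ∞ Φ) {K Ω : Set E} (hK : IsCompact K)
    (h : ∀ v ∈ Ω, ∃ w ∈ K, ∀ x, Φ (x + (v - w)) = Φ x) : BddDerivs Ω Φ := by
  intro n
  have hc : Continuous (iteratedFDeriv ℝ n Φ) :=
    hΦ.continuous_iteratedFDeriv (WithTop.coe_le_coe.2 le_top)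
  obtain ⟨C, hC⟩ := hK.exists_bound_of_continuousOn hc.continuousOn
  refine ⟨C, fun v hv => ?_⟩
  obtain ⟨w, hw, hp⟩ := h v hv
  have e := iteratedFDeriv_comp_add_right (𝕜 := ℝ) (f := Φ) n (v - w) w
  rw [show (fun z => Φ (z + (v - w))) = Φ from funext hp, add_sub_cancel] at e
  rw [← e]
  exact hC w hw

theorem Smooth2.dS_comp {Φ : E → F} {θ : ℝ → ℝ → E} (hΦ : ContDiff ℝ ∞ Φ) (h : Smooth2 θ) :
    MorseBottCylinder.dS (fun s t => Φ (θ s t))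
      = fun s t => fderiv ℝ Φ (θ s t) (MorseBottCylinder.dS θ s t) := by
  funext s t
  exact ((hΦ.differentiable (by simp) _).hasFDerivAt.comp_hasDerivAt s (h.hasDerivAt_fst s t)).deriv

theorem Smooth2.dT_comp {Φ : E → F} {θ : ℝ → ℝ → E} (hΦ : ContDiff ℝ ∞ Φ) (h : Smooth2 θ) :
    MorseBottCylinder.dT (fun s t => Φ (θ s t))
      = fun s t => fderiv ℝ Φ (θ s t) (MorseBottCylinder.dT θ s t) := by
  funext s t
  exact ((hΦ.differentiable (by simp) _).hasFDerivAt.comp_hasDerivAt t (h.hasDerivAt_snd s t)).deriv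

/-- Only derivatives of `θ` of positive order are assumed bounded: the inner map runs along the
universal cover and is itself unbounded, and its values enter only through membership in `Ω`. -/
theorem cSize_comp_le (n : ℕ) : ∀ {F : Type} [NormedAddCommGroup F] [NormedSpace ℝ F] {Ω : Set E}
    {Φ : E → F}, ContDiff ℝ ∞ Φ → BddDerivs Ω Φ → ∀ D : ℝ, 0 ≤ D → ∃ C : ℝ, 0 ≤ C ∧
    ∀ θ : ℝ → ℝ → E, Smooth2 θ → ∀ s t, θ s t ∈ Ω →
      (∀ i j : ℕ, 1 ≤ i + j → i + j ≤ n → ‖pd i j θ s t‖ ≤ D) →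
      cSize n (fun s t => Φ (θ s t)) s t ≤ C := by
  induction n with
  | zero =>
    intro F _ _ Ω Φ hΦ hB D _
    obtain ⟨C, hC, hb⟩ := hB.exists_bound
    exact ⟨C, hC, fun θ _ s t hθ _ => by rw [cSize_zero]; exact hb _ hθ⟩
  | succ n ih =>
    intro F _ _ Ω Φ hΦ hB D hD
    obtain ⟨C0, hC0, hb⟩ := hB.exists_bound
    have hΦ' : ContDiff ℝ ∞ (fderiv ℝ Φ) := hΦ.fderiv_right (by simp)
    obtain ⟨C, hC, hc⟩ := ih hΦ' hB.fderiv D hD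
    refine ⟨C0 + 5 ^ n * C * (((n : ℝ) + 1) ^ 2 * D) + 5 ^ n * C * (((n : ℝ) + 1) ^ 2 * D),
      by positivity, fun θ hθ s t hΩ hd => ?_⟩
    have hcc := hc θ hθ s t hΩ (fun i j h1 h2 => hd i j h1 (by omega))
    have hsm : Smooth2 (fun s t => _root_.fderiv ℝ Φ (θ s t)) := Smooth2.comp hΦ' hθ
    refine (cSize_succ_le (Smooth2.comp hΦ hθ) n s t).trans ?_
    rw [Smooth2.dS_comp hΦ hθ, Smooth2.dT_comp hΦ hθ]
    have a1 := cSize_apply_le n hsm hθ.dS s t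
    have a2 := cSize_apply_le n hsm hθ.dT s t
    have b1 : cSize n (dS θ) s t ≤ ((n : ℝ) + 1) ^ 2 * D := cSize_le hD fun i j hij => by
      rw [hθ.pd_dS]; exact hd _ _ (by omega) (by omega)
    have b2 : cSize n (dT θ) s t ≤ ((n : ℝ) + 1) ^ 2 * D := cSize_le hD fun i j hij => by
      rw [pd_dT]; exact hd _ _ (by omega) (by omega)
    have p := cSize_nonneg n (fun s t => _root_.fderiv ℝ Φ (θ s t)) s t
    have p1 := cSize_nonneg n (dS θ) s t
    have p2 := cSize_nonneg n (dT θ) s t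
    refine add_le_add (add_le_add (hb _ hΩ) (a1.trans ?_)) (a2.trans ?_)
    · gcongr
    · gcongr

/-- The bound is linear in `∂_s θ`, so a slowly moving argument gives a small derivative. This is
how `∂_s κ` becomes small while `κ` is merely bounded. -/
theorem cSize_dS_comp_le (n : ℕ) {Ω : Set E} {Φ : E → F} (hΦ : ContDiff ℝ ∞ Φ)
    (hB : BddDerivs Ω Φ) (D : ℝ) (hD : 0 ≤ D) : ∃ C : ℝ, 0 ≤ C ∧
    ∀ θ : ℝ → ℝ → E, Smooth2 θ → ∀ s t, θ s t ∈ Ω →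
      (∀ i j : ℕ, 1 ≤ i + j → i + j ≤ n → ‖pd i j θ s t‖ ≤ D) →
      cSize n (dS (fun s t => Φ (θ s t))) s t ≤ C * cSize n (dS θ) s t := by
  have hΦ' : ContDiff ℝ ∞ (fderiv ℝ Φ) := hΦ.fderiv_right (by simp)
  obtain ⟨C, hC, hc⟩ := cSize_comp_le n hΦ' hB.fderiv D hD
  refine ⟨5 ^ n * C, by positivity, fun θ hθ s t hΩ hd => ?_⟩
  have hsm : Smooth2 (fun s t => _root_.fderiv ℝ Φ (θ s t)) := Smooth2.comp hΦ' hθ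
  rw [Smooth2.dS_comp hΦ hθ]
  refine (cSize_apply_le n hsm hθ.dS s t).trans ?_
  have p1 := cSize_nonneg n (dS θ) s t
  have := hc θ hθ s t hΩ hd
  gcongr

end Comp

/-! ### Integral inequalities on a circle -/

section Circle

theorem sq_integral_mul_le {τ : ℝ} (hτ : 0 ≤ τ) {f g : ℝ → ℝ} (hf : Continuous f)
    (hg : Continuous g) : (∫ t in (0 : ℝ)..τ, f t * g t) ^ 2
      ≤ (∫ t in (0 : ℝ)..τ, f t ^ 2) * ∫ t in (0 : ℝ)..τ, g t ^ 2 := by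
  set A := ∫ t in (0 : ℝ)..τ, f t ^ 2
  set B := ∫ t in (0 : ℝ)..τ, f t * g t
  set C := ∫ t in (0 : ℝ)..τ, g t ^ 2
  have key : ∀ x : ℝ, 0 ≤ C * (x * x) + 2 * B * x + A := by
    intro x
    have e : (∫ t in (0 : ℝ)..τ, (f t + x * g t) ^ 2) = C * (x * x) + 2 * B * x + A := by
      have : ∀ t, (f t + x * g t) ^ 2 = f t ^ 2 + (2 * x) * (f t * g t) + (x * x) * g t ^ 2 :=
        fun t => by ring
      simp only [this]
      rw [intervalIntegral.integral_add, intervalIntegral.integral_add,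
        intervalIntegral.integral_const_mul, intervalIntegral.integral_const_mul]
      · ring
      all_goals exact Continuous.intervalIntegrable (by fun_prop) _ _
    rw [← e]
    exact intervalIntegral.integral_nonneg hτ fun t _ => sq_nonneg _
  have := discrim_le_zero key
  unfold discrim at this
  nlinarith

theorem sq_integral_le {τ : ℝ} (hτ : 0 ≤ τ) {f : ℝ → ℝ} (hf : Continuous f) :
    (∫ t in (0 : ℝ)..τ, f t) ^ 2 ≤ τ * ∫ t in (0 : ℝ)..τ, f t ^ 2 := by
  have := sq_integral_mul_le hτ (continuous_const (y := (1 : ℝ))) hf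
  simpa using this

variable {E : Type} [NormedAddCommGroup E]

section
variable [NormedSpace ℝ E]

theorem norm_integral_sq_le {τ : ℝ} (hτ : 0 ≤ τ) {f : ℝ → E} (hf : Continuous f) :
    ‖∫ t in (0 : ℝ)..τ, f t‖ ^ 2 ≤ τ * ∫ t in (0 : ℝ)..τ, ‖f t‖ ^ 2 := by
  have h1 := intervalIntegral.norm_integral_le_integral_norm (f := f) (μ := MeasureTheory.volume) hτ
  refine le_trans ?_ (sq_integral_le hτ hf.norm)
  gcongr

theorem norm_sub_le_integral {τ : ℝ} (hτ : 0 ≤ τ) [CompleteSpace E] {f f' : ℝ → E}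
    (hf : ∀ t, HasDerivAt f (f' t) t)
    (hc : Continuous f') {a b : ℝ} (ha : a ∈ Set.Icc 0 τ) (hb : b ∈ Set.Icc 0 τ) :
    ‖f a - f b‖ ≤ ∫ t in (0 : ℝ)..τ, ‖f' t‖ := by
  have e : f a - f b = ∫ t in b..a, f' t :=
    (intervalIntegral.integral_eq_sub_of_hasDerivAt (fun t _ => hf t) (hc.intervalIntegrable _ _)).symm
  rw [e]
  refine intervalIntegral.norm_integral_le_integral_norm_uIoc.trans ?_
  rw [intervalIntegral.integral_of_le hτ]
  refine MeasureTheory.setIntegral_mono_set ?_ ?_ ?_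
  · exact (hc.norm.intervalIntegrable 0 τ).1
  · exact Filter.Eventually.of_forall fun t => norm_nonneg _
  · refine Filter.Eventually.of_forall fun t ht => ?_
    have ht' : min b a < t ∧ t ≤ max b a := ht
    exact ⟨lt_of_le_of_lt (le_min hb.1 ha.1) ht'.1, ht'.2.trans (max_le hb.2 ha.2)⟩

/-- A Poincaré inequality with pointwise left side: the deviation from the mean is the average of
the differences `f a - f t`, each bounded by the total variation. -/
theorem norm_sub_mean_sq_le {τ : ℝ} (hτ : 0 < τ) [CompleteSpace E] {f f' : ℝ → E}
    (hf : ∀ t, HasDerivAt f (f' t) t)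
    (hc : Continuous f') {a : ℝ} (ha : a ∈ Set.Icc 0 τ) :
    ‖f a - τ⁻¹ • ∫ t in (0 : ℝ)..τ, f t‖ ^ 2 ≤ τ * ∫ t in (0 : ℝ)..τ, ‖f' t‖ ^ 2 := by
  have hfc : Continuous f := continuous_iff_continuousAt.2 fun t => (hf t).continuousAt
  have e : f a - τ⁻¹ • ∫ t in (0 : ℝ)..τ, f t = τ⁻¹ • ∫ t in (0 : ℝ)..τ, (f a - f t) := by
    rw [intervalIntegral.integral_sub (by simp) (hfc.intervalIntegrable _ _),
      intervalIntegral.integral_const, smul_sub, sub_zero, smul_smul, inv_mul_cancel₀ hτ.ne', one_smul]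
  have h1 : ‖∫ t in (0 : ℝ)..τ, (f a - f t)‖ ≤ (∫ t in (0 : ℝ)..τ, ‖f' t‖) * |τ - 0| := by
    refine intervalIntegral.norm_integral_le_of_norm_le_const fun t ht => ?_
    rw [Set.uIoc_of_le hτ.le] at ht
    exact norm_sub_le_integral hτ.le hf hc ha ⟨ht.1.le, ht.2⟩
  have h2 : ‖f a - τ⁻¹ • ∫ t in (0 : ℝ)..τ, f t‖ ≤ ∫ t in (0 : ℝ)..τ, ‖f' t‖ := by
    rw [e, norm_smul, Real.norm_of_nonneg (inv_nonneg.2 hτ.le)]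
    rw [sub_zero, abs_of_pos hτ] at h1
    rw [inv_mul_le_iff₀ hτ]
    linarith
  refine le_trans ?_ (sq_integral_le hτ.le hc.norm)
  gcongr

end

variable [InnerProductSpace ℝ E]

theorem integral_inner_deriv {τ : ℝ} {f f' g g' : ℝ → E}
    (hf : ∀ t, HasDerivAt f (f' t) t) (hg : ∀ t, HasDerivAt g (g' t) t)
    (hf' : Continuous f') (hg' : Continuous g') (h0 : f τ = f 0) (h0' : g τ = g 0) :
    ∫ t in (0 : ℝ)..τ, inner ℝ (f' t) (g t) = - ∫ t in (0 : ℝ)..τ, inner ℝ (f t) (g' t) := by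
  have hfc : Continuous f := continuous_iff_continuousAt.2 fun t => (hf t).continuousAt
  have hgc : Continuous g := continuous_iff_continuousAt.2 fun t => (hg t).continuousAt
  have h1 : ∀ t ∈ Set.uIcc (0 : ℝ) τ, HasDerivAt (fun t => inner ℝ (f t) (g t))
      (inner ℝ (f t) (g' t) + inner ℝ (f' t) (g t)) t := fun t _ => (hf t).inner ℝ (hg t)
  have i1 : IntervalIntegrable (fun t => inner ℝ (f t) (g' t)) MeasureTheory.volume 0 τ :=
    (hfc.inner hg').intervalIntegrable _ _
  have i2 : IntervalIntegrable (fun t => inner ℝ (f' t) (g t)) MeasureTheory.volume 0 τ :=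
    (hf'.inner hgc).intervalIntegrable _ _
  have h2 := intervalIntegral.integral_eq_sub_of_hasDerivAt h1 (i1.add i2)
  rw [intervalIntegral.integral_add i1 i2, h0, h0', sub_self] at h2
  linarith

/-- Cauchy–Schwarz for the `L²` product on the circle. -/
theorem sq_integral_inner_le {τ : ℝ} (hτ : 0 ≤ τ) {f g : ℝ → E} (hf : Continuous f)
    (hg : Continuous g) : (∫ t in (0 : ℝ)..τ, inner ℝ (f t) (g t)) ^ 2
      ≤ (∫ t in (0 : ℝ)..τ, ‖f t‖ ^ 2) * ∫ t in (0 : ℝ)..τ, ‖g t‖ ^ 2 := by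
  refine le_trans ?_ (sq_integral_mul_le hτ hf.norm hg.norm)
  have h1 : |∫ t in (0 : ℝ)..τ, inner ℝ (f t) (g t)| ≤ ∫ t in (0 : ℝ)..τ, ‖f t‖ * ‖g t‖ := by
    refine (intervalIntegral.abs_integral_le_integral_abs hτ).trans ?_
    refine intervalIntegral.integral_mono_on hτ ((hf.inner hg).abs.intervalIntegrable _ _)
      ((hf.norm.mul hg.norm).intervalIntegrable _ _) fun t _ => abs_real_inner_le_norm _ _
  rw [← sq_abs]
  gcongr

/-- `‖f'‖⁴ ≤ ‖f‖² ‖f''‖²` in `L²` of the circle. -/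
theorem sq_integral_deriv_le {τ : ℝ} (hτ : 0 ≤ τ) {f f' f'' : ℝ → E}
    (hf : ∀ t, HasDerivAt f (f' t) t) (hf' : ∀ t, HasDerivAt f' (f'' t) t) (hc : Continuous f'')
    (h0 : f τ = f 0) (h0' : f' τ = f' 0) :
    (∫ t in (0 : ℝ)..τ, ‖f' t‖ ^ 2) ^ 2
      ≤ (∫ t in (0 : ℝ)..τ, ‖f t‖ ^ 2) * ∫ t in (0 : ℝ)..τ, ‖f'' t‖ ^ 2 := by
  have hfc : Continuous f := continuous_iff_continuousAt.2 fun t => (hf t).continuousAt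
  have hfc' : Continuous f' := continuous_iff_continuousAt.2 fun t => (hf' t).continuousAt
  have h1 := integral_inner_deriv hf hf' hfc' hc h0 h0'
  simp only [real_inner_self_eq_norm_sq] at h1
  rw [h1, neg_sq]
  exact sq_integral_inner_le hτ hfc hc

/-- Integrating `(‖f‖²)' = 2⟨f, f'⟩` from a point where `‖f‖²` is at most its mean. The derivative
enters only in a product with `f`, so decay of `f` in `L²` and mere boundedness of `f'` already give
pointwise decay. -/
theorem norm_sq_le_integral {τ : ℝ} (hτ : 0 < τ) {f f' : ℝ → E}
    (hf : ∀ t, HasDerivAt f (f' t) t) (hc : Continuous f') {a : ℝ} (ha : a ∈ Set.Icc 0 τ) :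
    ‖f a‖ ^ 2 ≤ τ⁻¹ * (∫ t in (0 : ℝ)..τ, ‖f t‖ ^ 2) + 2 * ∫ t in (0 : ℝ)..τ, ‖f t‖ * ‖f' t‖ := by
  have hfc : Continuous f := continuous_iff_continuousAt.2 fun t => (hf t).continuousAt
  have hd : ∀ t, HasDerivAt (fun t => ‖f t‖ ^ 2) (2 * inner ℝ (f t) (f' t)) t :=
    fun t => (hf t).norm_sq
  have hcd : Continuous fun t => 2 * inner ℝ (f t) (f' t) := continuous_const.mul (hfc.inner hc)
  set D := 2 * ∫ t in (0 : ℝ)..τ, ‖f t‖ * ‖f' t‖ with hD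
  have h1 : ∀ b ∈ Set.Icc 0 τ, ‖f a‖ ^ 2 - D ≤ ‖f b‖ ^ 2 := by
    intro b hb
    have h2 := norm_sub_le_integral hτ.le hd hcd ha hb
    have h3 : ∫ t in (0 : ℝ)..τ, ‖2 * inner ℝ (f t) (f' t)‖ ≤ D := by
      rw [hD, ← intervalIntegral.integral_const_mul]
      refine intervalIntegral.integral_mono_on hτ.le (hcd.norm.intervalIntegrable _ _)
        ((continuous_const.mul (hfc.norm.mul hc.norm)).intervalIntegrable _ _) fun t _ => ?_
      rw [norm_mul, Real.norm_eq_abs, Real.norm_eq_abs, abs_two]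
      have := abs_real_inner_le_norm (f t) (f' t)
      linarith
    have := (le_abs_self _).trans (h2.trans h3)
    linarith
  have h4 : ∫ _ in (0 : ℝ)..τ, (‖f a‖ ^ 2 - D) ≤ ∫ t in (0 : ℝ)..τ, ‖f t‖ ^ 2 :=
    intervalIntegral.integral_mono_on hτ.le (by simp)
      ((hfc.norm.pow 2).intervalIntegrable _ _) h1
  rw [intervalIntegral.integral_const, smul_eq_mul, sub_zero] at h4
  have : ‖f a‖ ^ 2 - D ≤ τ⁻¹ * ∫ t in (0 : ℝ)..τ, ‖f t‖ ^ 2 := by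
    rw [← div_eq_inv_mul, le_div_iff₀ hτ]; linarith
  linarith

end Circle

/-! ### The standard complex structure and the asymptotic operator -/

/-- The standard complex structure `∂_a ↦ ∂_z ↦ -∂_a`, `∂_x ↦ ∂_y ↦ -∂_x`. -/
def J0 : E4 →L[ℝ] E4 := LinearMap.toContinuousLinearMap
  { toFun := fun v => !₂[-v 1, v 0, -v 3, v 2]
    map_add' := fun v w => by ext i; fin_cases i <;> simp <;> ring
    map_smul' := fun c v => by ext i; fin_cases i <;> simp }

theorem J0_apply (v : E4) : J0 v = !₂[-v 1, v 0, -v 3, v 2] := rfl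

/-- The projection to the `y`-direction. -/
def piY : E4 →L[ℝ] E4 := LinearMap.toContinuousLinearMap
  { toFun := fun v => !₂[0, 0, 0, v 3]
    map_add' := fun v w => by ext i; fin_cases i <;> simp
    map_smul' := fun c v => by ext i; fin_cases i <;> simp }

theorem piY_apply (v : E4) : piY v = !₂[0, 0, 0, v 3] := rfl

/-- The projection to the `a`, `z`, `x`-directions. -/
def piP : E4 →L[ℝ] E4 := LinearMap.toContinuousLinearMap
  { toFun := fun v => !₂[v 0, v 1, v 2, 0]
    map_add' := fun v w => by ext i; fin_cases i <;> simp
    map_smul' := fun c v => by ext i; fin_cases i <;> simp }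

theorem piP_apply (v : E4) : piP v = !₂[v 0, v 1, v 2, 0] := rfl

theorem E4_inner (v w : E4) : inner ℝ v w = v 0 * w 0 + v 1 * w 1 + v 2 * w 2 + v 3 * w 3 := by
  rw [PiLp.inner_apply, Fin.sum_univ_four]; simp [mul_comm]

theorem E4_norm_sq (v : E4) : ‖v‖ ^ 2 = v 0 ^ 2 + v 1 ^ 2 + v 2 ^ 2 + v 3 ^ 2 := by
  rw [← real_inner_self_eq_norm_sq, E4_inner]; ring

theorem norm_J0 (v : E4) : ‖J0 v‖ = ‖v‖ := by
  have : ‖J0 v‖ ^ 2 = ‖v‖ ^ 2 := by rw [E4_norm_sq, E4_norm_sq]; simp [J0_apply]; ring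
  exact (pow_left_inj₀ (norm_nonneg _) (norm_nonneg _) two_ne_zero).1 this

theorem inner_J0 (v w : E4) : inner ℝ (J0 v) w = - inner ℝ v (J0 w) := by
  rw [E4_inner, E4_inner]; simp [J0_apply]; ring

theorem inner_piY (v w : E4) : inner ℝ (piY v) w = inner ℝ v (piY w) := by
  rw [E4_inner, E4_inner]; simp [piY_apply]

theorem inner_piP (v w : E4) : inner ℝ (piP v) w = inner ℝ v (piP w) := by
  rw [E4_inner, E4_inner]; simp [piP_apply]

theorem piP_piP (v : E4) : piP (piP v) = piP v := by
  ext i; fin_cases i <;> simp [piP_apply]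

theorem norm_piP_le (v : E4) : ‖piP v‖ ≤ ‖v‖ := by
  have : ‖piP v‖ ^ 2 ≤ ‖v‖ ^ 2 := by
    rw [E4_norm_sq, E4_norm_sq]; simp [piP_apply]; exact sq_nonneg _
  exact (pow_le_pow_iff_left₀ (norm_nonneg _) (norm_nonneg _) two_ne_zero).1 this

theorem norm_piY_le (v : E4) : ‖piY v‖ ≤ ‖v‖ := by
  have : ‖piY v‖ ^ 2 ≤ ‖v‖ ^ 2 := by
    rw [E4_norm_sq, E4_norm_sq]; simp [piY_apply]; positivity
  exact (pow_le_pow_iff_left₀ (norm_nonneg _) (norm_nonneg _) two_ne_zero).1 this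

theorem abs_coord_le (v : E4) (i : Fin 4) : |v i| ≤ ‖v‖ := by
  simpa using PiLp.norm_apply_le v i

theorem hasDerivAt_coord {f : ℝ → E4} {f' : E4} {t : ℝ} (h : HasDerivAt f f' t) (i : Fin 4) :
    HasDerivAt (fun t => f t i) (f' i) t :=
  (EuclideanSpace.proj (𝕜 := ℝ) i : E4 →L[ℝ] ℝ).hasFDerivAt.comp_hasDerivAt t h

theorem integral_coord {f : ℝ → E4} (hf : Continuous f) (a b : ℝ) (i : Fin 4) :
    (∫ t in a..b, f t) i = ∫ t in a..b, f t i :=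
  ((EuclideanSpace.proj (𝕜 := ℝ) i : E4 →L[ℝ] ℝ).intervalIntegral_comp_comm
    (hf.intervalIntegrable a b)).symm

theorem integral_le_const_mul {τ c : ℝ} (hτ : 0 ≤ τ) {f : ℝ → ℝ} (hf : Continuous f)
    (h : ∀ t ∈ Set.Icc 0 τ, f t ≤ c) : ∫ t in (0 : ℝ)..τ, f t ≤ τ * c := by
  have h2 := intervalIntegral.integral_mono_on (μ := MeasureTheory.volume) hτ
    (hf.intervalIntegrable _ _) (g := fun _ => c) (by simp) h
  rwa [intervalIntegral.integral_const, smul_eq_mul, sub_zero] at h2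

set_option maxHeartbeats 1000000 in
/-- The spectral gap of the asymptotic operator `A = -J₀ ∂_t + κ π_y` on the complement of its
kernel. -/
theorem spectral_gap {τ Kb m : ℝ} (hτ : 0 < τ) (hm : 0 < m) : ∃ C : ℝ, 0 < C ∧
    ∀ (κ : ℝ → ℝ) (f f' : ℝ → E4), Continuous κ → (∀ t, |κ t| ≤ Kb) →
      m ≤ |∫ t in (0 : ℝ)..τ, κ t| → (∀ t, HasDerivAt f (f' t) t) → Continuous f' → f τ = f 0 →
      piP (∫ t in (0 : ℝ)..τ, f t) = 0 →
      (∫ t in (0 : ℝ)..τ, ‖f t‖ ^ 2) + (∫ t in (0 : ℝ)..τ, ‖f' t‖ ^ 2)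
        ≤ C * ∫ t in (0 : ℝ)..τ, ‖-J0 (f' t) + κ t • piY (f t)‖ ^ 2 := by
  -- The constant in the pointwise bound of the `y`-component: twice the bound of the squared mean
  -- of `y` plus twice that of the squared oscillation.
  set A : ℝ := (4 * τ + 4 * Kb ^ 2 * τ ^ 3) / m ^ 2 + 2 * τ with hA
  have hA0 : 0 < A := by positivity
  refine ⟨1 + τ ^ 2 + τ * A + (1 + τ ^ 2) * (2 * Kb ^ 2 * τ * A + 2), by positivity, ?_⟩
  intro κ f f' hκ hKb hmκ hf hf' h0 hP
  have hfc : Continuous f := continuous_iff_continuousAt.2 fun t => (hf t).continuousAt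
  have hci : ∀ i : Fin 4, Continuous fun t => f t i := fun i => by fun_prop
  have hci' : ∀ i : Fin 4, Continuous fun t => f' t i := fun i => by fun_prop
  have hKb2 : ∀ t, κ t ^ 2 ≤ Kb ^ 2 := fun t => by
    rw [← sq_abs]; exact pow_le_pow_left₀ (abs_nonneg _) (hKb t) 2
  have hmean : ∀ i : Fin 4, i ≠ 3 → ∫ t in (0 : ℝ)..τ, f t i = 0 := by
    intro i hi
    rw [← integral_coord hfc]
    have := congrArg (fun v : E4 => v i) hP
    fin_cases i
    · simpa [piP_apply] using this
    · simpa [piP_apply] using this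
    · simpa [piP_apply] using this
    · exact absurd rfl hi
  have poin : ∀ i : Fin 4, i ≠ 3 → ∫ t in (0 : ℝ)..τ, (f t i) ^ 2
      ≤ τ ^ 2 * ∫ t in (0 : ℝ)..τ, (f' t i) ^ 2 := by
    intro i hi
    have h1 : ∀ a ∈ Set.Icc 0 τ, (f a i) ^ 2 ≤ τ * ∫ t in (0 : ℝ)..τ, (f' t i) ^ 2 := by
      intro a ha
      have := norm_sub_mean_sq_le hτ (fun t => hasDerivAt_coord (hf t) i) (hci' i) ha
      rw [hmean i hi] at this
      simpa using this
    have h2 := integral_le_const_mul (f := fun t => f t i ^ 2) hτ.le ((hci i).pow 2) h1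
    linarith
  -- the equation in components
  set g : ℝ → E4 := fun t => -J0 (f' t) + κ t • piY (f t) with hg
  have g0 : ∀ t, g t 0 = f' t 1 := fun t => by simp [hg, J0_apply, piY_apply]
  have g1 : ∀ t, g t 1 = -f' t 0 := fun t => by simp [hg, J0_apply, piY_apply]
  have g2 : ∀ t, g t 2 = f' t 3 := fun t => by simp [hg, J0_apply, piY_apply]
  have g3 : ∀ t, g t 3 = -f' t 2 + κ t * f t 3 := fun t => by simp [hg, J0_apply, piY_apply]
  have hgc : Continuous g := ((J0.continuous.comp hf').neg).add (hκ.smul (piY.continuous.comp hfc))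
  have hgi : ∀ i : Fin 4, Continuous fun t => g t i := fun i => by fun_prop
  have split : ∀ w : ℝ → E4, Continuous w → ∫ t in (0 : ℝ)..τ, ‖w t‖ ^ 2
      = (∫ t in (0 : ℝ)..τ, (w t 0) ^ 2) + (∫ t in (0 : ℝ)..τ, (w t 1) ^ 2)
        + (∫ t in (0 : ℝ)..τ, (w t 2) ^ 2) + ∫ t in (0 : ℝ)..τ, (w t 3) ^ 2 := by
    intro w hw
    simp only [E4_norm_sq]
    rw [intervalIntegral.integral_add, intervalIntegral.integral_add, intervalIntegral.integral_add]
    all_goals exact Continuous.intervalIntegrable (by fun_prop) _ _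
  rw [split f hfc, split f' hf', split g hgc]
  have G0 : ∫ t in (0 : ℝ)..τ, (g t 0) ^ 2 = ∫ t in (0 : ℝ)..τ, (f' t 1) ^ 2 := by simp only [g0]
  have G1 : ∫ t in (0 : ℝ)..τ, (g t 1) ^ 2 = ∫ t in (0 : ℝ)..τ, (f' t 0) ^ 2 := by
    simp only [g1, neg_sq]
  have G2 : ∫ t in (0 : ℝ)..τ, (g t 2) ^ 2 = ∫ t in (0 : ℝ)..τ, (f' t 3) ^ 2 := by simp only [g2]
  set p := ∫ t in (0 : ℝ)..τ, (f' t 3) ^ 2 with hp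
  set q := ∫ t in (0 : ℝ)..τ, (g t 3) ^ 2 with hq
  have p0 : 0 ≤ p := intervalIntegral.integral_nonneg hτ.le fun t _ => sq_nonneg _
  have q0 : 0 ≤ q := intervalIntegral.integral_nonneg hτ.le fun t _ => sq_nonneg _
  set yb : ℝ := τ⁻¹ * ∫ t in (0 : ℝ)..τ, f t 3 with hyb
  have ytil : ∀ a ∈ Set.Icc 0 τ, (f a 3 - yb) ^ 2 ≤ τ * p := by
    intro a ha
    have := norm_sub_mean_sq_le hτ (fun t => hasDerivAt_coord (hf t) 3) (hci' 3) ha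
    simpa using this
  have intx : ∫ t in (0 : ℝ)..τ, f' t 2 = 0 := by
    rw [intervalIntegral.integral_eq_sub_of_hasDerivAt (fun t _ => hasDerivAt_coord (hf t) 2)
      ((hci' 2).intervalIntegrable _ _), h0, sub_self]
  -- The only place where a kernel could hide is the mean of `y`. Averaging the last component
  -- removes `x'` by periodicity and leaves this mean times the total rotation, which is bounded
  -- away from zero; the oscillation of `y` is controlled by `y' = g₂`.
  have eq3 : yb * (∫ t in (0 : ℝ)..τ, κ t)
      = (∫ t in (0 : ℝ)..τ, g t 3) - ∫ t in (0 : ℝ)..τ, κ t * (f t 3 - yb) := by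
    simp only [g3, mul_sub]
    rw [intervalIntegral.integral_add, intervalIntegral.integral_sub, intervalIntegral.integral_neg,
      intx, intervalIntegral.integral_mul_const]
    · ring
    all_goals exact Continuous.intervalIntegrable (by fun_prop) _ _
  have b1 : (∫ t in (0 : ℝ)..τ, g t 3) ^ 2 ≤ τ * q := sq_integral_le hτ.le (hgi 3)
  have b2 : (∫ t in (0 : ℝ)..τ, κ t * (f t 3 - yb)) ^ 2 ≤ Kb ^ 2 * τ ^ 3 * p := by
    refine (sq_integral_le hτ.le (by fun_prop)).trans ?_
    have h2 : ∫ t in (0 : ℝ)..τ, (κ t * (f t 3 - yb)) ^ 2 ≤ τ * (Kb ^ 2 * (τ * p)) := by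
      refine integral_le_const_mul hτ.le (by fun_prop) fun t ht => ?_
      rw [mul_pow]
      have e1 : κ t ^ 2 ≤ Kb ^ 2 := hKb2 t
      have e2 := ytil t ht
      gcongr
    calc _ ≤ τ * (τ * (Kb ^ 2 * (τ * p))) := by gcongr
      _ = _ := by ring
  have b3 : m ^ 2 * yb ^ 2 ≤ 2 * τ * q + 2 * Kb ^ 2 * τ ^ 3 * p := by
    have e1 : m ^ 2 ≤ (∫ t in (0 : ℝ)..τ, κ t) ^ 2 := by
      rw [← sq_abs (∫ t in (0 : ℝ)..τ, κ t)]; exact pow_le_pow_left₀ hm.le hmκ 2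
    have e2 : m ^ 2 * yb ^ 2 ≤ (yb * (∫ t in (0 : ℝ)..τ, κ t)) ^ 2 := by
      exact (mul_le_mul_of_nonneg_right e1 (sq_nonneg yb)).trans_eq (by ring)
    rw [eq3] at e2
    have e3 := sq_nonneg ((∫ t in (0 : ℝ)..τ, g t 3) + ∫ t in (0 : ℝ)..τ, κ t * (f t 3 - yb))
    nlinarith
  have b4 : yb ^ 2 ≤ (2 * τ + 2 * Kb ^ 2 * τ ^ 3) / m ^ 2 * (p + q) := by
    have : yb ^ 2 ≤ (2 * τ * q + 2 * Kb ^ 2 * τ ^ 3 * p) / m ^ 2 := by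
      rw [le_div_iff₀ (by positivity)]; linarith
    refine this.trans ?_
    rw [div_mul_eq_mul_div]
    gcongr
    have : 0 ≤ 2 * τ * p + 2 * Kb ^ 2 * τ ^ 3 * q := by positivity
    nlinarith
  have ysup : ∀ a ∈ Set.Icc 0 τ, (f a 3) ^ 2 ≤ A * (p + q) := by
    intro a ha
    have e1 := ytil a ha
    have e2 : (f a 3) ^ 2 ≤ 2 * yb ^ 2 + 2 * (f a 3 - yb) ^ 2 := by
      nlinarith [sq_nonneg (f a 3 - 2 * yb)]
    have e3 : A * (p + q) = 2 * ((2 * τ + 2 * Kb ^ 2 * τ ^ 3) / m ^ 2 * (p + q)) + 2 * (τ * p)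
        + 2 * (τ * q) := by rw [hA]; ring
    have e4 : 0 ≤ τ * q := by positivity
    rw [e3]; linarith
  have iy : ∫ t in (0 : ℝ)..τ, (f t 3) ^ 2 ≤ τ * A * (p + q) := by
    have h2 := integral_le_const_mul (f := fun t => f t 3 ^ 2) hτ.le ((hci 3).pow 2) ysup
    linarith
  -- With `y` controlled, the last component of the equation is solved for `x'`.
  have ix : ∫ t in (0 : ℝ)..τ, (f' t 2) ^ 2 ≤ (2 * Kb ^ 2 * τ * A + 2) * (p + q) := by
    have h2 : ∫ t in (0 : ℝ)..τ, (f' t 2) ^ 2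
        ≤ ∫ t in (0 : ℝ)..τ, (2 * Kb ^ 2 * (f t 3) ^ 2 + 2 * (g t 3) ^ 2) := by
      refine intervalIntegral.integral_mono_on hτ.le (Continuous.intervalIntegrable (by fun_prop) _ _)
        (Continuous.intervalIntegrable (by fun_prop) _ _) fun t _ => ?_
      have e1 : κ t ^ 2 ≤ Kb ^ 2 := hKb2 t
      have e2 : κ t ^ 2 * (f t 3) ^ 2 ≤ Kb ^ 2 * (f t 3) ^ 2 := by gcongr
      rw [show f' t 2 = κ t * f t 3 - g t 3 by rw [g3]; ring]
      nlinarith [sq_nonneg (κ t * f t 3 + g t 3)]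
    rw [intervalIntegral.integral_add, intervalIntegral.integral_const_mul,
      intervalIntegral.integral_const_mul] at h2
    · have e3 : 2 * Kb ^ 2 * (∫ t in (0 : ℝ)..τ, (f t 3) ^ 2) ≤ 2 * Kb ^ 2 * (τ * A * (p + q)) := by
        gcongr
      have : (2 * Kb ^ 2 * τ * A + 2) * (p + q) = 2 * Kb ^ 2 * (τ * A * (p + q)) + 2 * q + 2 * p := by
        ring
      rw [this]; linarith
    all_goals exact Continuous.intervalIntegrable (by fun_prop) _ _
  have P0 := poin 0 (by decide)
  have P1 := poin 1 (by decide)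
  have P2 := poin 2 (by decide)
  rw [G0, G1, G2]
  set a' := ∫ t in (0 : ℝ)..τ, (f' t 0) ^ 2
  set z' := ∫ t in (0 : ℝ)..τ, (f' t 1) ^ 2
  set x' := ∫ t in (0 : ℝ)..τ, (f' t 2) ^ 2
  have a0 : 0 ≤ a' := intervalIntegral.integral_nonneg hτ.le fun t _ => sq_nonneg _
  have z0 : 0 ≤ z' := intervalIntegral.integral_nonneg hτ.le fun t _ => sq_nonneg _
  set X := 2 * Kb ^ 2 * τ * A + 2
  have X0 : 0 ≤ X := by positivity
  have e1 : (1 + τ ^ 2) * x' ≤ (1 + τ ^ 2) * (X * (p + q)) := by gcongr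
  have e2 : 0 ≤ τ * A * (a' + z') := by positivity
  have e3 : 0 ≤ (1 + τ ^ 2) * X * (a' + z') := by positivity
  have e4 : 0 ≤ τ ^ 2 * (p + q) := by positivity
  have e5 : (1 + τ ^ 2 + τ * A + (1 + τ ^ 2) * X) * (z' + a' + p + q)
      = (1 + τ ^ 2) * (z' + a') + p + τ * A * (p + q) + (1 + τ ^ 2) * (X * (p + q))
        + (τ * A * (a' + z') + (1 + τ ^ 2) * X * (a' + z') + τ ^ 2 * (p + q) + q) := by ring
  rw [e5]
  linarith

/-! ### The projections `P` and `Q` -/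

section Proj

theorem Smooth2.hasDerivAt_integral {E : Type} [NormedAddCommGroup E] [NormedSpace ℝ E]
    [CompleteSpace E] {φ : ℝ → ℝ → E} (h : Smooth2 φ) (a b s : ℝ) :
    HasDerivAt (fun s => ∫ t in a..b, φ s t) (∫ t in a..b, MorseBottCylinder.dS φ s t) s := by
  have h1 : ContDiff ℝ 1 (fun p : ℝ × ℝ => φ p.1 p.2) := ContDiff.of_le h (by simp)
  have h2 := (hasFDerivAt_parametric_integral h1 a b s).hasDerivAt
  have h3 : Continuous fun t => fderiv ℝ (fun x => φ x t) s := by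
    have e : (fun t => fderiv ℝ (fun x => φ x t) s)
        = fun t => ContinuousLinearMap.toSpanSingleton ℝ (MorseBottCylinder.dS φ s t) := by
      funext t
      exact ((h.hasDerivAt_fst s t).hasFDerivAt).fderiv
    rw [e]
    exact (ContinuousLinearMap.toSpanSingletonCLE (𝕜 := ℝ) (E := E)).continuous.comp
      (h.dS.continuous_snd s)
  rw [ContinuousLinearMap.intervalIntegral_apply (h3.intervalIntegrable _ _)] at h2
  convert h2 using 1
  refine intervalIntegral.integral_congr fun t _ => ?_
  exact ((congrArg (fun L : ℝ →L[ℝ] E => L 1) ((h.hasDerivAt_fst s t).hasFDerivAt).fderiv).trans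
    (by simp)).symm

theorem Smooth2.integral {E : Type} [NormedAddCommGroup E] [NormedSpace ℝ E]
    {φ : ℝ → ℝ → E} (h : Smooth2 φ) (a b : ℝ) :
    ContDiff ℝ ∞ (fun s => ∫ t in a..b, φ s t) := contDiff_parametric_integral h a b

variable {τ : ℝ} {φ ψ : ℝ → ℝ → E4}

theorem projP_eq (h : Smooth2 φ) (s t : ℝ) :
    projP τ φ s t = piP (τ⁻¹ • ∫ r in (0 : ℝ)..τ, φ s r) := by
  ext i
  have := integral_coord (h.continuous_snd s) 0 τ
  fin_cases i <;> simp [projP, piP_apply, this]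

theorem Smooth2.projP (h : Smooth2 φ) : Smooth2 (projP τ φ) := by
  have e : MorseBottCylinder.projP τ φ = fun s _ => piP (τ⁻¹ • ∫ r in (0 : ℝ)..τ, φ s r) := by
    funext s t; exact projP_eq h s t
  rw [e]
  exact piP.contDiff.comp (((h.integral 0 τ).const_smul _).comp contDiff_fst)

theorem dS_projP (h : Smooth2 φ) : dS (projP τ φ) = projP τ (dS φ) := by
  have e : MorseBottCylinder.projP τ φ = fun s _ => piP (τ⁻¹ • ∫ r in (0 : ℝ)..τ, φ s r) := by
    funext s t; exact projP_eq h s t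
  funext s t
  rw [projP_eq h.dS, e]
  exact (piP.hasFDerivAt.comp_hasDerivAt s ((h.hasDerivAt_integral 0 τ s).const_smul τ⁻¹)).deriv

theorem dT_projP : dT (projP τ φ) = fun _ _ => 0 := by
  funext s t
  exact deriv_const _ _

theorem pd_projP (h : Smooth2 φ) (i : ℕ) : pd i 0 (projP τ φ) = projP τ (pd i 0 φ) := by
  induction i with
  | zero => rfl
  | succ i ih => rw [← dS_pd, ih, dS_projP (h.pd i 0), dS_pd]

theorem pd_projP_succ (i j : ℕ) : pd i (j + 1) (projP τ φ) = fun _ _ => 0 := by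
  rw [← pd_dT, dT_projP]
  funext s t
  have := norm_pd_le_cSize (le_refl (i + j)) (fun _ _ => (0 : E4)) s t
  rw [cSize_zero_fun] at this
  exact norm_le_zero_iff.1 this

theorem Smooth2.projQ (h : Smooth2 φ) : Smooth2 (projQ τ φ) := Smooth2.sub h h.projP

theorem dS_projQ (h : Smooth2 φ) : dS (projQ τ φ) = projQ τ (dS φ) := by
  unfold projQ
  rw [h.dS_sub h.projP, dS_projP h]

theorem dT_projQ (h : Smooth2 φ) : dT (projQ τ φ) = dT φ := by
  unfold projQ
  rw [h.dT_sub h.projP, dT_projP]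
  funext s t; simp

theorem pd_projQ (h : Smooth2 φ) (i : ℕ) : pd i 0 (projQ τ φ) = projQ τ (pd i 0 φ) := by
  unfold projQ
  rw [h.pd_sub h.projP, pd_projP h]

theorem pd_projQ_succ (h : Smooth2 φ) (i j : ℕ) : pd i (j + 1) (projQ τ φ) = pd i (j + 1) φ := by
  unfold projQ
  rw [h.pd_sub h.projP, pd_projP_succ]
  funext s t; simp

theorem integral_projP (hτ : 0 < τ) (h : Smooth2 φ) (s : ℝ) :
    ∫ t in (0 : ℝ)..τ, projP τ φ s t = piP (∫ t in (0 : ℝ)..τ, φ s t) := by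
  simp only [projP_eq h]
  rw [intervalIntegral.integral_const, sub_zero, map_smul, smul_smul, mul_inv_cancel₀ hτ.ne',
    one_smul]

theorem piP_integral_projQ (hτ : 0 < τ) (h : Smooth2 φ) (s : ℝ) :
    piP (∫ t in (0 : ℝ)..τ, projQ τ φ s t) = 0 := by
  unfold projQ
  rw [intervalIntegral.integral_sub ((h.continuous_snd s).intervalIntegrable _ _)
    (((h.projP).continuous_snd s).intervalIntegrable _ _), integral_projP hτ h, map_sub, piP_piP,
    sub_self]

/-- `P` is self-adjoint, so pairing with a field that it annihilates removes the nonlocal operator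
`Q` from the energy identities. -/
theorem integral_inner_projQ (h : Smooth2 φ) (hψ : Smooth2 ψ) {s : ℝ}
    (h0 : piP (∫ t in (0 : ℝ)..τ, ψ s t) = 0) :
    ∫ t in (0 : ℝ)..τ, inner ℝ (projQ τ φ s t) (ψ s t)
      = ∫ t in (0 : ℝ)..τ, inner ℝ (φ s t) (ψ s t) := by
  have e : ∀ t, inner ℝ (projQ τ φ s t) (ψ s t) = inner ℝ (φ s t) (ψ s t)
      - inner ℝ (τ⁻¹ • ∫ r in (0 : ℝ)..τ, φ s r) (piP (ψ s t)) := by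
    intro t
    unfold projQ
    rw [projP_eq h, inner_sub_left, inner_piP]
  simp only [e]
  have c1 := h.continuous_snd s
  have c2 := hψ.continuous_snd s
  rw [intervalIntegral.integral_sub ((c1.inner c2).intervalIntegrable _ _)
    ((continuous_const.inner (piP.continuous.comp c2)).intervalIntegrable _ _)]
  have e2 : ∫ t in (0 : ℝ)..τ, inner ℝ (τ⁻¹ • ∫ r in (0 : ℝ)..τ, φ s r) (piP (ψ s t))
      = inner ℝ (τ⁻¹ • ∫ r in (0 : ℝ)..τ, φ s r) (piP (∫ t in (0 : ℝ)..τ, ψ s t)) := by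
    rw [← piP.intervalIntegral_comp_comm (c2.intervalIntegrable _ _)]
    exact (innerSL ℝ (τ⁻¹ • ∫ r in (0 : ℝ)..τ, φ s r)).intervalIntegral_comp_comm
      ((piP.continuous.comp c2).intervalIntegrable _ _)
  rw [e2, h0, inner_zero_right, sub_zero]

theorem norm_projP_sq_le (hτ : 0 < τ) (h : Smooth2 φ) (s t : ℝ) :
    ‖projP τ φ s t‖ ^ 2 ≤ τ⁻¹ * ∫ t in (0 : ℝ)..τ, ‖φ s t‖ ^ 2 := by
  rw [projP_eq h]
  have h1 := norm_piP_le (τ⁻¹ • ∫ r in (0 : ℝ)..τ, φ s r)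
  have h2 := norm_integral_sq_le hτ.le (h.continuous_snd s)
  calc _ ≤ ‖τ⁻¹ • ∫ r in (0 : ℝ)..τ, φ s r‖ ^ 2 := by gcongr
    _ = τ⁻¹ ^ 2 * ‖∫ r in (0 : ℝ)..τ, φ s r‖ ^ 2 := by
        rw [norm_smul, mul_pow, Real.norm_of_nonneg (inv_nonneg.2 hτ.le)]
    _ ≤ τ⁻¹ ^ 2 * (τ * ∫ t in (0 : ℝ)..τ, ‖φ s t‖ ^ 2) := by gcongr
    _ = _ := by field_simp

end Proj

/-! ### `L²`-norms over circles -/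

section L2

variable {E : Type} [NormedAddCommGroup E]

/-- The square of the `L²`-norm over `{s} × [0, τ]`. -/
def l2sq (τ : ℝ) (φ : ℝ → ℝ → E) (s : ℝ) : ℝ := ∫ t in (0 : ℝ)..τ, ‖φ s t‖ ^ 2

theorem l2sq_nonneg {τ : ℝ} (hτ : 0 ≤ τ) (φ : ℝ → ℝ → E) (s : ℝ) : 0 ≤ l2sq τ φ s :=
  intervalIntegral.integral_nonneg hτ fun _ _ => sq_nonneg _

variable [NormedSpace ℝ E]

theorem l2sq_le_sq {τ : ℝ} (hτ : 0 ≤ τ) {φ : ℝ → ℝ → E} (h : Smooth2 φ) {s C : ℝ}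
    (hb : ∀ t, ‖φ s t‖ ≤ C) : l2sq τ φ s ≤ τ * C ^ 2 :=
  integral_le_const_mul hτ ((h.continuous_snd s).norm.pow 2) fun t _ => by
    have := norm_nonneg (φ s t)
    exact pow_le_pow_left₀ this (hb t) 2

theorem l2sq_add_le {τ : ℝ} (hτ : 0 ≤ τ) {φ ψ χ : ℝ → ℝ → E} (h : Smooth2 φ) (h' : Smooth2 ψ)
    (hχ : Smooth2 χ) {s : ℝ} (hs : ∀ t, ‖χ s t‖ ≤ ‖φ s t‖ + ‖ψ s t‖) :
    l2sq τ χ s ≤ 2 * l2sq τ φ s + 2 * l2sq τ ψ s := by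
  have c1 := (h.continuous_snd s).norm
  have c2 := (h'.continuous_snd s).norm
  have c3 := (hχ.continuous_snd s).norm
  unfold l2sq
  rw [← intervalIntegral.integral_const_mul, ← intervalIntegral.integral_const_mul,
    ← intervalIntegral.integral_add]
  · refine intervalIntegral.integral_mono_on hτ (Continuous.intervalIntegrable (by fun_prop) _ _)
      (Continuous.intervalIntegrable (by fun_prop) _ _) fun t _ => ?_
    have := hs t
    have h0 := norm_nonneg (χ s t)
    calc ‖χ s t‖ ^ 2 ≤ (‖φ s t‖ + ‖ψ s t‖) ^ 2 := by gcongr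
      _ ≤ _ := by nlinarith [sq_nonneg (‖φ s t‖ - ‖ψ s t‖)]
  all_goals exact Continuous.intervalIntegrable (by fun_prop) _ _

theorem l2sq_projQ_le {τ : ℝ} (hτ : 0 < τ) {φ : ℝ → ℝ → E4} (h : Smooth2 φ) (s : ℝ) :
    l2sq τ (projQ τ φ) s ≤ 4 * l2sq τ φ s := by
  have h1 := l2sq_add_le (ψ := projP τ φ) (χ := projQ τ φ) hτ.le h h.projP h.projQ (s := s)
    (fun t => by unfold projQ; exact norm_sub_le _ _)
  have h2 : l2sq τ (projP τ φ) s ≤ l2sq τ φ s := by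
    have := integral_le_const_mul (f := fun t => ‖projP τ φ s t‖ ^ 2) hτ.le
      ((h.projP.continuous_snd s).norm.pow 2) (fun t _ => norm_projP_sq_le hτ h s t)
    rwa [← mul_assoc, mul_inv_cancel₀ hτ.ne', one_mul] at this
  linarith

end L2

/-- Young's inequality in the form needed for perturbation terms: a coefficient of size `η` applied
to a field of energy at most `D` contributes at most `η D`. -/
theorem abs_integral_inner_le {τ η D : ℝ} (hτ : 0 ≤ τ) (hη : 0 ≤ η) {a b b' : ℝ → E4}
    (ha : Continuous a) (hb : Continuous b) (hb' : Continuous b') (h : ∀ t, ‖b t‖ ≤ η * ‖b' t‖)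
    (hA : ∫ t in (0 : ℝ)..τ, ‖a t‖ ^ 2 ≤ D) (hB : ∫ t in (0 : ℝ)..τ, ‖b' t‖ ^ 2 ≤ D) :
    |∫ t in (0 : ℝ)..τ, inner ℝ (a t) (b t)| ≤ η * D := by
  refine (intervalIntegral.abs_integral_le_integral_abs hτ).trans ?_
  have h1 : ∫ t in (0 : ℝ)..τ, |inner ℝ (a t) (b t)|
      ≤ ∫ t in (0 : ℝ)..τ, (η / 2 * ‖a t‖ ^ 2 + η / 2 * ‖b' t‖ ^ 2) := by
    refine intervalIntegral.integral_mono_on hτ (Continuous.intervalIntegrable (by fun_prop) _ _)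
      (Continuous.intervalIntegrable (by fun_prop) _ _) fun t _ => ?_
    refine (abs_real_inner_le_norm _ _).trans ?_
    have h2 : ‖a t‖ * ‖b t‖ ≤ ‖a t‖ * (η * ‖b' t‖) :=
      mul_le_mul_of_nonneg_left (h t) (norm_nonneg _)
    have h3 : 0 ≤ η * (‖a t‖ - ‖b' t‖) ^ 2 := mul_nonneg hη (sq_nonneg _)
    nlinarith
  refine h1.trans ?_
  rw [intervalIntegral.integral_add, intervalIntegral.integral_const_mul,
    intervalIntegral.integral_const_mul]
  · have := mul_le_mul_of_nonneg_left hA (div_nonneg hη zero_le_two)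
    have := mul_le_mul_of_nonneg_left hB (div_nonneg hη zero_le_two)
    linarith
  all_goals exact Continuous.intervalIntegrable (by fun_prop) _ _

/-! ### Energy identities for the linear Cauchy–Riemann system -/

section Energy

theorem Smooth2.smul {E : Type} [NormedAddCommGroup E] [NormedSpace ℝ E] {κ : ℝ → ℝ → ℝ}
    {φ : ℝ → ℝ → E} (h : Smooth2 κ) (h' : Smooth2 φ) : Smooth2 (fun s t => κ s t • φ s t) :=
  ContDiff.smul h h'

theorem Smooth2.dS_smul {E : Type} [NormedAddCommGroup E] [NormedSpace ℝ E] {κ : ℝ → ℝ → ℝ}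
    {φ : ℝ → ℝ → E} (h : Smooth2 κ) (h' : Smooth2 φ) :
    MorseBottCylinder.dS (fun s t => κ s t • φ s t) = fun s t =>
      MorseBottCylinder.dS κ s t • φ s t + κ s t • MorseBottCylinder.dS φ s t := by
  funext s t
  exact (((h.hasDerivAt_fst s t).smul (h'.hasDerivAt_fst s t)).deriv).trans (add_comm _ _)

variable {τ a b : ℝ} {κ : ℝ → ℝ → ℝ} {W f : ℝ → ℝ → E4}

theorem dS_equation (hab : a < b) (hκ : Smooth2 κ) (hW : Smooth2 W) (hf : Smooth2 f)
    (eq : ∀ s ∈ Set.Icc a b, ∀ t,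
      dS W s t = -J0 (dT W s t) + κ s t • piY (W s t) + projQ τ f s t) :
    ∀ s ∈ Set.Icc a b, ∀ t, dS (dS W) s t = -J0 (dT (dS W) s t)
      + (dS κ s t • piY (W s t) + κ s t • piY (dS W s t)) + projQ τ (dS f) s t := by
  intro s hs t
  have h1 : Smooth2 (fun s t => (-J0) (dT W s t)) := hW.dT.clm (-J0)
  have h2 : Smooth2 (fun s t => κ s t • piY (W s t)) := hκ.smul (hW.clm piY)
  have h3 := dS_congr_strip hW.dS ((h1.add h2).add (hf.projQ (τ := τ))) hab eq s hs t
  rw [h3, (h1.add h2).dS_add hf.projQ, h1.dS_add h2, hW.dT.dS_clm, hκ.dS_smul (hW.clm piY),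
    hW.dS_clm, dS_projQ hf, hW.comm]
  rfl

/-- Symmetry of `A` moves it from `W_s` to `W`, and `A W = W_s - Q f` by the equation. The good term
`‖W_s‖²` appears, and all others carry `f`, `f_s` or `κ_s`. In particular no smallness of `κ` itself
is required. -/
theorem integral_inner_dS_dS (hab : a < b) (hκ : Smooth2 κ) (hW : Smooth2 W) (hf : Smooth2 f)
    (hper : PeriodicOn τ (Set.Icc a b) W)
    (hmean : ∀ s ∈ Set.Icc a b, piP (∫ t in (0 : ℝ)..τ, W s t) = 0)
    (hmean' : ∀ s ∈ Set.Icc a b, piP (∫ t in (0 : ℝ)..τ, dS W s t) = 0)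
    (eq : ∀ s ∈ Set.Icc a b, ∀ t,
      dS W s t = -J0 (dT W s t) + κ s t • piY (W s t) + projQ τ f s t) :
    ∀ s ∈ Set.Icc a b, ∫ t in (0 : ℝ)..τ, inner ℝ (dS (dS W) s t) (W s t)
      = (∫ t in (0 : ℝ)..τ, ‖dS W s t‖ ^ 2) - (∫ t in (0 : ℝ)..τ, inner ℝ (f s t) (dS W s t))
        + (∫ t in (0 : ℝ)..τ, inner ℝ (W s t) (dS κ s t • piY (W s t)))
        + ∫ t in (0 : ℝ)..τ, inner ℝ (W s t) (dS f s t) := by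
  intro s hs
  have cW := hW.continuous_snd s
  have cWs := hW.dS.continuous_snd s
  have cWt := hW.dT.continuous_snd s
  have cWst := hW.dS.dT.continuous_snd s
  have cκ := hκ.continuous_snd s
  have cκs := hκ.dS.continuous_snd s
  have cf := hf.continuous_snd s
  have cfs := hf.dS.continuous_snd s
  have cQf := (hf.projQ (τ := τ)).continuous_snd s
  have cQfs := (hf.dS.projQ (τ := τ)).continuous_snd s
  -- Both `J₀` and `∂_t` are skew on the circle, so their product is symmetric.
  have ibp : ∫ t in (0 : ℝ)..τ, inner ℝ (dT (dS W) s t) (J0 (W s t))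
      = - ∫ t in (0 : ℝ)..τ, inner ℝ (dS W s t) (J0 (dT W s t)) := by
    refine integral_inner_deriv (fun t => hW.dS.hasDerivAt_snd s t)
      (fun t => J0.hasFDerivAt.comp_hasDerivAt t (hW.hasDerivAt_snd s t)) cWst
      (J0.continuous.comp cWt) ?_ ?_
    · have := hper.pd hW hab 1 0 s hs 0
      rwa [zero_add] at this
    · have := hper s hs 0
      rw [zero_add] at this
      rw [this]
  have e1 : ∀ t, inner ℝ (dS (dS W) s t) (W s t) = inner ℝ (dT (dS W) s t) (J0 (W s t))
      + inner ℝ (W s t) (dS κ s t • piY (W s t)) + inner ℝ (dS W s t) (κ s t • piY (W s t))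
      + inner ℝ (projQ τ (dS f) s t) (W s t) := by
    intro t
    rw [dS_equation hab hκ hW hf eq s hs t, inner_add_left, inner_add_left, inner_add_left,
      inner_neg_left, inner_J0, neg_neg, real_inner_comm (W s t), inner_smul_left (piY (dS W s t)),
      inner_piY (dS W s t), inner_smul_right (dS W s t)]
    simp
    ring
  have e2 : ∀ t, inner ℝ (dS W s t) (κ s t • piY (W s t)) = ‖dS W s t‖ ^ 2
      + inner ℝ (dS W s t) (J0 (dT W s t)) - inner ℝ (projQ τ f s t) (dS W s t) := by
    intro t
    have : κ s t • piY (W s t) = dS W s t + J0 (dT W s t) - projQ τ f s t := by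
      rw [eq s hs t]; abel
    rw [this, inner_sub_right, inner_add_right, real_inner_self_eq_norm_sq,
      real_inner_comm (dS W s t) (projQ τ f s t)]
  simp only [e1, e2]
  have q1 := integral_inner_projQ hf hW.dS (τ := τ) (hmean' s hs)
  have q2 := integral_inner_projQ hf.dS hW (τ := τ) (hmean s hs)
  rw [intervalIntegral.integral_add, intervalIntegral.integral_add, intervalIntegral.integral_add,
    intervalIntegral.integral_sub, intervalIntegral.integral_add, ibp, q1, q2]
  · have : ∫ t in (0 : ℝ)..τ, inner ℝ (W s t) (dS f s t)
        = ∫ t in (0 : ℝ)..τ, inner ℝ (dS f s t) (W s t) := by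
      simp only [real_inner_comm]
    rw [this]
    ring
  all_goals exact Continuous.intervalIntegrable (by fun_prop) _ _

theorem l2sq_hasDerivAt (hW : Smooth2 W) (s : ℝ) :
    HasDerivAt (l2sq τ W) (2 * ∫ t in (0 : ℝ)..τ, inner ℝ (dS W s t) (W s t)) s := by
  have h1 : Smooth2 (fun s t => ‖W s t‖ ^ 2) := ContDiff.norm_sq ℝ hW
  have h2 := h1.hasDerivAt_integral 0 τ s
  rw [← intervalIntegral.integral_const_mul]
  refine h2.congr_deriv ?_
  refine intervalIntegral.integral_congr fun t _ => ?_
  have := ((hW.hasDerivAt_fst s t).norm_sq).deriv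
  rw [real_inner_comm] at this
  exact this

theorem integral_inner_dS_hasDerivAt (hW : Smooth2 W) (s : ℝ) :
    HasDerivAt (fun s => 2 * ∫ t in (0 : ℝ)..τ, inner ℝ (dS W s t) (W s t))
      (2 * ((∫ t in (0 : ℝ)..τ, inner ℝ (dS (dS W) s t) (W s t)) + l2sq τ (dS W) s)) s := by
  have h1 : Smooth2 (fun s t => inner ℝ (dS W s t) (W s t)) := ContDiff.inner ℝ hW.dS hW
  have h2 := (h1.hasDerivAt_integral 0 τ s).const_mul 2
  refine h2.congr_deriv ?_
  congr 1
  unfold l2sq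
  rw [← intervalIntegral.integral_add]
  · refine intervalIntegral.integral_congr fun t _ => ?_
    have := ((hW.dS.hasDerivAt_fst s t).inner ℝ (hW.hasDerivAt_fst s t)).deriv
    refine Eq.trans this ?_
    rw [real_inner_self_eq_norm_sq, add_comm]
  · exact ((hW.dS.dS.continuous_snd s).inner (hW.continuous_snd s)).intervalIntegrable _ _
  · exact ((hW.dS.continuous_snd s).norm.pow 2).intervalIntegrable _ _

end Energy

/-! ### A maximum principle -/

/-- Were the second derivative positive, the point would also be a local minimum, the function
locally constant and its second derivative zero. -/
theorem deriv2_nonpos_of_isLocalMax {φ φ' : ℝ → ℝ} {φ'' x : ℝ} (h : ∀ s, HasDerivAt φ (φ' s) s)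
    (h' : HasDerivAt φ' φ'' x) (hx : IsLocalMax φ x) : φ'' ≤ 0 := by
  by_contra hpos
  rw [not_le] at hpos
  have e : deriv φ = φ' := funext fun s => (h s).deriv
  have h0 : deriv φ x = 0 := hx.deriv_eq_zero
  have hmin : IsLocalMin φ x := isLocalMin_of_deriv_deriv_pos (by rw [e, h'.deriv]; exact hpos) h0
    (h x).continuousAt
  have hc : φ =ᶠ[nhds x] fun _ => φ x := by
    filter_upwards [hx, hmin] with y h1 h2
    exact le_antisymm h1 h2
  have h1 : deriv φ =ᶠ[nhds x] deriv (fun _ => φ x) := hc.deriv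
  have h2 : φ' =ᶠ[nhds x] fun _ => 0 := by
    rw [e] at h1; simpa using h1
  have h3 := h2.deriv_eq
  rw [h'.deriv, deriv_const] at h3
  exact hpos.ne' h3

/-- The `cosh` profile solves the equality case with boundary value one. The difference cannot have
a positive interior maximum, since its second derivative there would be at least `ν²` times a
positive number. -/
theorem le_cosh_of_deriv2_ge {g g' g'' : ℝ → ℝ} {a b ν M : ℝ} (hν : 0 < ν) (hab : a < b)
    (h : ∀ s, HasDerivAt g (g' s) s) (h' : ∀ s, HasDerivAt g' (g'' s) s)
    (hg : ∀ s ∈ Set.Icc a b, ν ^ 2 * g s ≤ g'' s)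
    (ha : g a ≤ M) (hb : g b ≤ M) :
    ∀ s ∈ Set.Icc a b, g s ≤ M *
      (Real.cosh (ν * (s - (a + b) / 2)) / Real.cosh (ν * (b - a) / 2)) := by
  set q := Real.cosh (ν * (b - a) / 2) with hq
  have hq0 : 0 < q := Real.cosh_pos _
  set φ : ℝ → ℝ := fun s => g s - M * (Real.cosh (ν * (s - (a + b) / 2)) / q) with hφ
  set φ' : ℝ → ℝ := fun s => g' s - M * (ν * Real.sinh (ν * (s - (a + b) / 2)) / q) with hφ'
  have d0 : ∀ s, HasDerivAt (fun s => ν * (s - (a + b) / 2)) ν s := fun s => by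
    simpa using ((hasDerivAt_id s).sub_const ((a + b) / 2)).const_mul ν
  have d1 : ∀ s, HasDerivAt φ (φ' s) s := fun s => by
    refine (h s).sub ((((d0 s).cosh).div_const q).const_mul M |>.congr_deriv ?_)
    ring
  have d2 : ∀ s, HasDerivAt φ' (g'' s - M * (ν ^ 2 * Real.cosh (ν * (s - (a + b) / 2)) / q)) s :=
    fun s => by
    refine (h' s).sub (((((d0 s).sinh).const_mul ν).div_const q).const_mul M |>.congr_deriv ?_)
    ring
  have hend : φ a ≤ 0 ∧ φ b ≤ 0 := by
    have e1 : Real.cosh (ν * (a - (a + b) / 2)) = q := by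
      rw [hq, ← Real.cosh_neg]; congr 1; ring
    have e2 : Real.cosh (ν * (b - (a + b) / 2)) = q := by
      rw [hq]; congr 1; ring
    simp only [hφ, e1, e2, div_self hq0.ne', mul_one]
    exact ⟨by linarith, by linarith⟩
  have hcont : ContinuousOn φ (Set.Icc a b) := fun s _ => (d1 s).continuousAt.continuousWithinAt
  obtain ⟨x, hx, hmax⟩ := isCompact_Icc.exists_isMaxOn (Set.nonempty_Icc.2 hab.le) hcont
  have hx0 : φ x ≤ 0 := by
    by_contra hpos
    rw [not_le] at hpos
    have hxa : a < x := lt_of_le_of_ne hx.1 (by rintro rfl; linarith [hend.1])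
    have hxb : x < b := lt_of_le_of_ne hx.2 (by rintro rfl; linarith [hend.2])
    have hloc : IsLocalMax φ x := hmax.isLocalMax (Icc_mem_nhds hxa hxb)
    have h1 := deriv2_nonpos_of_isLocalMax d1 (d2 x) hloc
    have h2 := hg x hx
    have h3 : 0 < ν ^ 2 * φ x := by positivity
    have h4 : ν ^ 2 * φ x = ν ^ 2 * g x - M * (ν ^ 2 * Real.cosh (ν * (x - (a + b) / 2)) / q) := by
      simp only [hφ]; ring
    linarith
  intro s hs
  have := hmax hs
  have h5 : φ s ≤ 0 := le_trans this hx0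
  simp only [hφ] at h5
  linarith

/-! ### The linear system and its derivatives in `s` -/

theorem projP_add {τ : ℝ} {φ ψ : ℝ → ℝ → E4} (h : Smooth2 φ) (h' : Smooth2 ψ) (s t : ℝ) :
    projP τ (fun s t => φ s t + ψ s t) s t = projP τ φ s t + projP τ ψ s t := by
  rw [projP_eq (h.add h'), projP_eq h, projP_eq h',
    intervalIntegral.integral_add ((h.continuous_snd s).intervalIntegrable _ _)
      ((h'.continuous_snd s).intervalIntegrable _ _), smul_add, map_add]

theorem projQ_add {τ : ℝ} {φ ψ : ℝ → ℝ → E4} (h : Smooth2 φ) (h' : Smooth2 ψ) (s t : ℝ) :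
    projQ τ (fun s t => φ s t + ψ s t) s t = projQ τ φ s t + projQ τ ψ s t := by
  unfold projQ
  rw [projP_add h h', add_sub_add_comm]

/-- A field in the `y`-direction has no component in the range of `P`. Hence the term with `κ_s`
produced by differentiating the equation can be moved inside `Q`. -/
theorem projQ_smul_piY {τ : ℝ} (κ : ℝ → ℝ → ℝ) (φ : ℝ → ℝ → E4) (s t : ℝ) :
    projQ τ (fun s t => κ s t • piY (φ s t)) s t = κ s t • piY (φ s t) := by
  have : projP τ (fun s t => κ s t • piY (φ s t)) s t = 0 := by
    ext i; fin_cases i <;> simp [projP, piY_apply]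
  unfold projQ
  rw [this, sub_zero]

/-- The coefficient of the `l`-th `s`-derivative in the `n`-th `s`-derivative of `c · W`, where the
derivatives of an additional term `K · W` are absorbed in the lower coefficients. -/
def leibnizCoef (c K : ℝ → ℝ → E4 →L[ℝ] E4) : ℕ → ℕ → ℝ → ℝ → E4 →L[ℝ] E4
  | 0, l => if l = 0 then c else fun _ _ => 0
  | n + 1, l => fun s t => dS (leibnizCoef c K n l) s t
      + (if l = 0 then 0 else leibnizCoef c K n (l - 1) s t) + (if l = n then dS K s t else 0)

section Coef

variable {c K : ℝ → ℝ → E4 →L[ℝ] E4}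

theorem leibnizCoef_of_lt {n l : ℕ} (h : n < l) : leibnizCoef c K n l = fun _ _ => 0 := by
  induction n generalizing l with
  | zero => simp [leibnizCoef, show l ≠ 0 by omega]
  | succ n ih =>
    funext s t
    simp [leibnizCoef, ih (show n < l by omega), ih (show n < l - 1 by omega), dS_const,
      show l ≠ 0 by omega, show l ≠ n by omega]

theorem Smooth2.leibnizCoef (hc : Smooth2 c) (hK : Smooth2 K) (n l : ℕ) :
    Smooth2 (leibnizCoef c K n l) := by
  induction n generalizing l with
  | zero =>
    unfold MorseBottCylinder.leibnizCoef
    split_ifs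
    · exact hc
    · exact Smooth2.const 0
  | succ n ih =>
    refine ((ih l).dS.add (ψ := fun s t => if l = 0 then 0 else
      MorseBottCylinder.leibnizCoef c K n (l - 1) s t) ?_).add (ψ := fun s t => if l = n then
        MorseBottCylinder.dS K s t else 0) ?_
    · split_ifs
      · exact Smooth2.const 0
      · exact ih (l - 1)
    · split_ifs
      · exact hK.dS
      · exact Smooth2.const 0

/-- Each differentiation adds up three coefficients and uses one of the `k` available derivatives,
whence the factor `3 ^ n` and the order `k - n`. -/
theorem cSize_leibnizCoef_le (hc : Smooth2 c) (hK : Smooth2 K) {k : ℕ} {η s t : ℝ}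
    (h1 : cSize k c s t ≤ η) (h2 : cSize (k - 1) (dS K) s t ≤ η) (n l : ℕ) (hn : n ≤ k) :
    cSize (k - n) (leibnizCoef c K n l) s t ≤ 3 ^ n * η := by
  have hη : 0 ≤ η := (cSize_nonneg _ _ _ _).trans h1
  induction n generalizing l with
  | zero =>
    unfold MorseBottCylinder.leibnizCoef
    split_ifs
    · simpa using h1
    · rw [cSize_zero_fun]; positivity
  | succ n ih =>
    have e : k - n = (k - (n + 1)) + 1 := by omega
    have b1 : cSize (k - (n + 1)) (dS (leibnizCoef c K n l)) s t ≤ 3 ^ n * η := by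
      refine (cSize_dS_le (hc.leibnizCoef hK n l) _ s t).trans ?_
      rw [← e]; exact ih l (by omega)
    have s2 : Smooth2 (fun s t => if l = 0 then 0 else leibnizCoef c K n (l - 1) s t) := by
      split_ifs
      · exact Smooth2.const 0
      · exact hc.leibnizCoef hK n (l - 1)
    have s3 : Smooth2 (fun s t => if l = n then dS K s t else 0) := by
      split_ifs
      · exact hK.dS
      · exact Smooth2.const 0
    have b2 : cSize (k - (n + 1)) (fun s t => if l = 0 then 0 else leibnizCoef c K n (l - 1) s t) s t
        ≤ 3 ^ n * η := by
      split_ifs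
      · rw [cSize_zero_fun]; positivity
      · exact (cSize_mono (by omega) _ _ _).trans (ih (l - 1) (by omega))
    have b3 : cSize (k - (n + 1)) (fun s t => if l = n then dS K s t else 0) s t ≤ 3 ^ n * η := by
      split_ifs
      · refine (cSize_mono (by omega) _ _ _).trans (h2.trans ?_)
        exact le_mul_of_one_le_left hη (one_le_pow₀ (by norm_num))
      · rw [cSize_zero_fun]; positivity
    refine (cSize_add_le ((hc.leibnizCoef hK n l).dS.add s2) s3 _ s t).trans ?_
    have := cSize_add_le (hc.leibnizCoef hK n l).dS s2 (k - (n + 1)) s t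
    rw [pow_succ]
    linarith

theorem PeriodicOn.leibnizCoef {τ a b : ℝ} (hab : a < b) (hc : Smooth2 c) (hK : Smooth2 K)
    (pc : PeriodicOn τ (Set.Icc a b) c) (pK : PeriodicOn τ (Set.Icc a b) K) (n l : ℕ) :
    PeriodicOn τ (Set.Icc a b) (leibnizCoef c K n l) := by
  induction n generalizing l with
  | zero =>
    intro s hs t
    unfold MorseBottCylinder.leibnizCoef
    split_ifs
    · exact pc s hs t
    · rfl
  | succ n ih =>
    intro s hs t
    have h1 := (ih l).pd (hc.leibnizCoef hK n l) hab 1 0 s hs t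
    have h2 := pK.pd hK hab 1 0 s hs t
    change dS (MorseBottCylinder.leibnizCoef c K n l) s (t + τ)
      = dS (MorseBottCylinder.leibnizCoef c K n l) s t at h1
    change dS K s (t + τ) = dS K s t at h2
    simp only [MorseBottCylinder.leibnizCoef, h1, h2, ih (l - 1) s hs t]

end Coef

/-- A solution `W` of `W_s = -J₀ W_t + κ π_y W + Q(M W_t + c W)` on a cylinder, with values in the
complement of the kernel of the asymptotic operator. -/
structure LinSys (τ a b : ℝ) (κ : ℝ → ℝ → ℝ) (M c : ℝ → ℝ → E4 →L[ℝ] E4) (W : ℝ → ℝ → E4) :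
    Prop where
  τ_pos : 0 < τ
  lt : a < b
  smooth_κ : Smooth2 κ
  smooth_M : Smooth2 M
  smooth_c : Smooth2 c
  smooth_W : Smooth2 W
  periodic_M : PeriodicOn τ (Set.Icc a b) M
  periodic_W : PeriodicOn τ (Set.Icc a b) W
  mean : ∀ s ∈ Set.Icc a b, piP (∫ t in (0 : ℝ)..τ, W s t) = 0
  eqn : ∀ s ∈ Set.Icc a b, ∀ t, dS W s t = -J0 (dT W s t) + κ s t • piY (W s t)
    + projQ τ (fun s t => M s t (dT W s t) + c s t (W s t)) s t

namespace LinSys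

variable {τ a b : ℝ} {κ : ℝ → ℝ → ℝ} {M c : ℝ → ℝ → E4 →L[ℝ] E4} {W : ℝ → ℝ → E4}

/-- The coefficients of the zeroth-order term `κ π_y`. -/
def kop (κ : ℝ → ℝ → ℝ) : ℝ → ℝ → E4 →L[ℝ] E4 := fun s t => κ s t • piY

theorem smooth_kop (h : Smooth2 κ) : Smooth2 (kop κ) := h.smul (Smooth2.const piY)

theorem dS_kop (h : Smooth2 κ) : dS (kop κ) = fun s t => dS κ s t • piY := by
  unfold kop
  rw [h.dS_smul (Smooth2.const piY), dS_const]
  simp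

/-- The lower-order terms in the equation of `∂_s^n W`. -/
def rhs (N : ℕ) (κ : ℝ → ℝ → ℝ) (M c : ℝ → ℝ → E4 →L[ℝ] E4) (W : ℝ → ℝ → E4) (n : ℕ)
    (s t : ℝ) : E4 :=
  ∑ l ∈ Finset.range N, (leibnizCoef M (fun _ _ => 0) n l s t (pd l 1 W s t)
    + leibnizCoef c (kop κ) n l s t (pd l 0 W s t))

variable (h : LinSys τ a b κ M c W)
include h

theorem smooth_m (n l : ℕ) : Smooth2 (leibnizCoef M (fun _ _ => 0) n l) :=
  h.smooth_M.leibnizCoef (Smooth2.const 0) n l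

theorem smooth_l (n l : ℕ) : Smooth2 (leibnizCoef c (kop κ) n l) :=
  h.smooth_c.leibnizCoef (smooth_kop h.smooth_κ) n l

theorem smooth_rhs (N n : ℕ) : Smooth2 (rhs N κ M c W n) :=
  Smooth2.sum _ fun l _ => ((h.smooth_m n l).apply (h.smooth_W.pd l 1)).add
    ((h.smooth_l n l).apply (h.smooth_W.pd l 0))

theorem dS_rhs (N n : ℕ) (s t : ℝ) : dS (rhs N κ M c W n) s t = ∑ l ∈ Finset.range N,
    (dS (leibnizCoef M (fun _ _ => 0) n l) s t (pd l 1 W s t)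
      + leibnizCoef M (fun _ _ => 0) n l s t (pd (l + 1) 1 W s t)
      + (dS (leibnizCoef c (kop κ) n l) s t (pd l 0 W s t)
      + leibnizCoef c (kop κ) n l s t (pd (l + 1) 0 W s t))) := by
  have hd : ∀ l ∈ Finset.range N, HasDerivAt (fun s => leibnizCoef M (fun _ _ => 0) n l s t (pd l 1 W s t)
    + leibnizCoef c (kop κ) n l s t (pd l 0 W s t))
    (dS (leibnizCoef M (fun _ _ => 0) n l) s t (pd l 1 W s t)
      + leibnizCoef M (fun _ _ => 0) n l s t (pd (l + 1) 1 W s t)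
      + (dS (leibnizCoef c (kop κ) n l) s t (pd l 0 W s t)
      + leibnizCoef c (kop κ) n l s t (pd (l + 1) 0 W s t))) s := by
    intro l _
    have h1 := ((h.smooth_m n l).hasDerivAt_fst s t).clm_apply ((h.smooth_W.pd l 1).hasDerivAt_fst s t)
    have h2 := ((h.smooth_l n l).hasDerivAt_fst s t).clm_apply ((h.smooth_W.pd l 0).hasDerivAt_fst s t)
    rw [dS_pd] at h1 h2
    exact h1.add h2
  exact (HasDerivAt.fun_sum hd).deriv

/-- Differentiating the main term `κ π_y ∂_s^n W` leaves the commutator `κ_s π_y ∂_s^n W`. The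
second argument of `leibnizCoef` absorbs it, so that all derived equations have the same shape. The
strict bound on `n + 1` keeps every nonzero coefficient within the sum. -/
theorem rhs_succ {N n : ℕ} (hn : n + 1 < N) (s t : ℝ) :
    rhs N κ M c W (n + 1) s t = dS (rhs N κ M c W n) s t + dS κ s t • piY (pd n 0 W s t) := by
  rw [h.dS_rhs]
  unfold rhs
  obtain ⟨N, rfl⟩ : ∃ N', N = N' + 1 := ⟨N - 1, by omega⟩
  -- Reindexing by one loses no boundary term: the shifted sum starts with a zero and the top
  -- coefficient of the old sum vanishes.
  have shift : ∀ (A : ℕ → ℕ → ℝ → ℝ → E4 →L[ℝ] E4) (V : ℕ → E4), A n N = (fun _ _ => 0) →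
      ∑ l ∈ Finset.range (N + 1), (if l = 0 then (0 : E4 →L[ℝ] E4) else A n (l - 1) s t) (V l)
        = ∑ l ∈ Finset.range (N + 1), A n l s t (V (l + 1)) := by
    intro A V hA
    rw [Finset.sum_range_succ', Finset.sum_range_succ, hA]
    simp
  have s1 := shift (leibnizCoef M (fun _ _ => 0)) (fun l => pd l 1 W s t)
    (leibnizCoef_of_lt (by omega))
  have s2 := shift (leibnizCoef c (kop κ)) (fun l => pd l 0 W s t) (leibnizCoef_of_lt (by omega))
  have s3 : ∑ l ∈ Finset.range (N + 1), (if l = n then dS (kop κ) s t else 0) (pd l 0 W s t)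
      = dS κ s t • piY (pd n 0 W s t) := by
    rw [Finset.sum_eq_single n]
    · simp [dS_kop h.smooth_κ]
    · intro l _ hl; simp [hl]
    · intro hl; exact absurd (Finset.mem_range.2 (by omega)) hl
  simp only [Finset.sum_add_distrib] at *
  rw [← s1, ← s2, ← s3]
  simp only [leibnizCoef, dS_const, ite_self, add_zero, add_apply,
    Finset.sum_add_distrib]
  abel

theorem eqn_pd {N : ℕ} (n : ℕ) (hn : n < N) : ∀ s ∈ Set.Icc a b, ∀ t,
    dS (pd n 0 W) s t = -J0 (dT (pd n 0 W) s t) + κ s t • piY (pd n 0 W s t)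
      + projQ τ (rhs N κ M c W n) s t := by
  induction n with
  | zero =>
    intro s hs t
    rw [pd_zero_zero, h.eqn s hs t]
    congr 2
    funext s t
    unfold rhs
    rw [Finset.sum_eq_single 0]
    · simp [leibnizCoef, pd]
    · intro l _ hl
      simp [leibnizCoef, hl]
    · intro hl; exact absurd (Finset.mem_range.2 hn) hl
  | succ n ih =>
    intro s hs t
    have h1 := dS_equation h.lt h.smooth_κ (h.smooth_W.pd n 0) (h.smooth_rhs N n) (ih (by omega)) s hs t
    rw [dS_pd] at h1
    rw [h1]
    have h2 : Smooth2 (fun s t => dS κ s t • piY (pd n 0 W s t)) :=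
      h.smooth_κ.dS.smul ((h.smooth_W.pd n 0).clm piY)
    have h3 : rhs N κ M c W (n + 1) = fun s t => dS (rhs N κ M c W n) s t
        + dS κ s t • piY (pd n 0 W s t) := by
      funext s t; exact h.rhs_succ hn s t
    rw [h3, projQ_add (h.smooth_rhs N n).dS h2, projQ_smul_piY]
    abel

/-- A pure `s`-derivative commutes with the mean over the circle; a derivative containing `∂_t` has
zero mean by periodicity. -/
theorem mean_pd (i j : ℕ) : ∀ s ∈ Set.Icc a b, piP (∫ t in (0 : ℝ)..τ, pd i j W s t) = 0 := by
  intro s hs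
  cases j with
  | zero =>
    have e : ∀ s ∈ Set.Icc a b, ∀ t, projP τ W s t = (fun _ _ => (0 : E4)) s t := by
      intro s hs t
      rw [projP_eq h.smooth_W, map_smul, h.mean s hs, smul_zero]
    have := pd_congr_strip h.smooth_W.projP (Smooth2.const 0) h.lt e i 0 s hs 0
    rw [pd_projP h.smooth_W, projP_eq (h.smooth_W.pd i 0)] at this
    have h0 : pd i 0 (fun _ _ => (0 : E4)) s 0 = 0 := by
      have := norm_pd_le_cSize (le_refl (i + 0)) (fun _ _ => (0 : E4)) s 0
      rw [cSize_zero_fun] at this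
      exact norm_le_zero_iff.1 this
    rw [h0, map_smul] at this
    exact (smul_eq_zero.1 this).resolve_left (inv_ne_zero h.τ_pos.ne')
  | succ j =>
    rw [← h.smooth_W.dT_pd]
    have hp := h.periodic_W.pd h.smooth_W h.lt i j s hs 0
    rw [zero_add] at hp
    rw [intervalIntegral.integral_eq_sub_of_hasDerivAt
      (fun t _ => (h.smooth_W.pd i j).hasDerivAt_snd s t)
      (((h.smooth_W.pd i j).dT.continuous_snd s).intervalIntegrable _ _), hp, sub_self, map_zero]

end LinSys

/-! ### Exponential decay of solutions of the linear system -/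

namespace LinSys

variable {τ a b : ℝ} {κ : ℝ → ℝ → ℝ} {M c : ℝ → ℝ → E4 →L[ℝ] E4} {W : ℝ → ℝ → E4}

/-- The total energy `∑ ‖∂_s^l W‖² + ‖∂_t ∂_s^l W‖² + ‖∂_s^{l+1} W‖²` on a circle. -/
def energy (τ : ℝ) (N : ℕ) (W : ℝ → ℝ → E4) (s : ℝ) : ℝ :=
  ∑ l ∈ Finset.range N, (l2sq τ (pd l 0 W) s + l2sq τ (pd l 1 W) s + l2sq τ (pd (l + 1) 0 W) s)

/-- The coefficients of the derived equations and `∂_s κ` are bounded by `η`. -/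
structure SmallCoef (a b : ℝ) (κ : ℝ → ℝ → ℝ) (M c : ℝ → ℝ → E4 →L[ℝ] E4) (N : ℕ) (η : ℝ) :
    Prop where
  m : ∀ n l, n < N → l < N → ∀ s ∈ Set.Icc a b, ∀ t,
    cSize 1 (leibnizCoef M (fun _ _ => 0) n l) s t ≤ η
  c : ∀ n l, n < N → l < N → ∀ s ∈ Set.Icc a b, ∀ t,
    cSize 1 (leibnizCoef c (kop κ) n l) s t ≤ η
  κ : ∀ s ∈ Set.Icc a b, ∀ t, |dS κ s t| ≤ η

theorem energy_term_le (hτ : 0 ≤ τ) {N l : ℕ} (hl : l < N) (W : ℝ → ℝ → E4) (s : ℝ) :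
    l2sq τ (pd l 0 W) s + l2sq τ (pd l 1 W) s + l2sq τ (pd (l + 1) 0 W) s ≤ energy τ N W s := by
  have hnn := fun i j => l2sq_nonneg hτ (pd i j W) s
  exact Finset.single_le_sum (f := fun l => l2sq τ (pd l 0 W) s + l2sq τ (pd l 1 W) s
    + l2sq τ (pd (l + 1) 0 W) s)
    (fun i _ => add_nonneg (add_nonneg (hnn _ _) (hnn _ _)) (hnn _ _)) (Finset.mem_range.2 hl)

theorem abs_sum_le_card {N : ℕ} {F : ℕ → ℝ} {C : ℝ} (h : ∀ l ∈ Finset.range N, |F l| ≤ C) :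
    |∑ l ∈ Finset.range N, F l| ≤ N * C := by
  refine (Finset.abs_sum_le_sum_abs _ _).trans ((Finset.sum_le_card_nsmul _ _ _ h).trans ?_)
  rw [Finset.card_range, nsmul_eq_mul]

theorem apply_m_le {N : ℕ} {η : ℝ} (hc : SmallCoef a b κ M c N η) {n l : ℕ} (hn : n < N) (hl : l < N) {s : ℝ} (hs : s ∈ Set.Icc a b) (t : ℝ)
    (v : E4) : ‖leibnizCoef M (fun _ _ => 0) n l s t v‖ ≤ η * ‖v‖ ∧
      ‖dS (leibnizCoef M (fun _ _ => 0) n l) s t v‖ ≤ η * ‖v‖ ∧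
      ‖dT (leibnizCoef M (fun _ _ => 0) n l) s t v‖ ≤ η * ‖v‖ := by
  have h0 := hc.m n l hn hl s hs t
  refine ⟨?_, ?_, ?_⟩
  · exact (ContinuousLinearMap.le_opNorm _ _).trans (mul_le_mul_of_nonneg_right
      ((norm_le_cSize _ _ _ _).trans h0) (norm_nonneg _))
  · exact (ContinuousLinearMap.le_opNorm _ _).trans (mul_le_mul_of_nonneg_right
      ((norm_pd_le_cSize (i := 1) (j := 0) le_rfl _ _ _).trans h0) (norm_nonneg _))
  · exact (ContinuousLinearMap.le_opNorm _ _).trans (mul_le_mul_of_nonneg_right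
      ((norm_pd_le_cSize (i := 0) (j := 1) le_rfl _ _ _).trans h0) (norm_nonneg _))

theorem apply_c_le {N : ℕ} {η : ℝ} (hc : SmallCoef a b κ M c N η) {n l : ℕ} (hn : n < N) (hl : l < N) {s : ℝ} (hs : s ∈ Set.Icc a b) (t : ℝ)
    (v : E4) : ‖leibnizCoef c (kop κ) n l s t v‖ ≤ η * ‖v‖ ∧
      ‖dS (leibnizCoef c (kop κ) n l) s t v‖ ≤ η * ‖v‖ := by
  have h0 := hc.c n l hn hl s hs t
  refine ⟨?_, ?_⟩
  · exact (ContinuousLinearMap.le_opNorm _ _).trans (mul_le_mul_of_nonneg_right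
      ((norm_le_cSize _ _ _ _).trans h0) (norm_nonneg _))
  · exact (ContinuousLinearMap.le_opNorm _ _).trans (mul_le_mul_of_nonneg_right
      ((norm_pd_le_cSize (i := 1) (j := 0) le_rfl _ _ _).trans h0) (norm_nonneg _))

variable (h : LinSys τ a b κ M c W)
include h

section
variable {N : ℕ} {η : ℝ} (hc : SmallCoef a b κ M c N η)
include hc

theorem abs_integral_rhs_le (hη : 0 ≤ η) {n : ℕ} (hn : n < N) {s : ℝ} (hs : s ∈ Set.Icc a b) :
    |∫ t in (0 : ℝ)..τ, inner ℝ (rhs N κ M c W n s t) (pd (n + 1) 0 W s t)|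
      ≤ N * (2 * (η * energy τ N W s)) := by
  have cW : ∀ i j, Continuous (pd i j W s) := fun i j => (h.smooth_W.pd i j).continuous_snd s
  have cm : ∀ l, Continuous fun t => leibnizCoef M (fun _ _ => 0) n l s t (pd l 1 W s t) :=
    fun l => ((h.smooth_m n l).continuous_snd s).clm_apply (cW l 1)
  have cc : ∀ l, Continuous fun t => leibnizCoef c (kop κ) n l s t (pd l 0 W s t) :=
    fun l => ((h.smooth_l n l).continuous_snd s).clm_apply (cW l 0)
  have e : ∀ t, inner ℝ (rhs N κ M c W n s t) (pd (n + 1) 0 W s t) = ∑ l ∈ Finset.range N,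
      (inner ℝ (pd (n + 1) 0 W s t) (leibnizCoef M (fun _ _ => 0) n l s t (pd l 1 W s t))
      + inner ℝ (pd (n + 1) 0 W s t) (leibnizCoef c (kop κ) n l s t (pd l 0 W s t))) := by
    intro t
    rw [real_inner_comm, rhs, inner_sum]
    simp only [inner_add_right]
  have hτ := h.τ_pos.le
  have hnn := fun i j => l2sq_nonneg hτ (pd i j W) s
  have hD := fun l (hl : l < N) => energy_term_le hτ hl W s
  simp only [e]
  rw [intervalIntegral.integral_finsetSum]
  · refine abs_sum_le_card fun l hl => ?_
    have hl := Finset.mem_range.1 hl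
    rw [intervalIntegral.integral_add]
    · have b1 := abs_integral_inner_le hτ hη (cW (n + 1) 0) (cm l) (cW l 1)
        (fun t => (apply_m_le hc hn hl hs t _).1) (D := energy τ N W s)
        (by have := hD n hn; have := hnn n 0; have := hnn n 1; unfold l2sq at *; linarith)
        (by have := hD l hl; have := hnn l 0; have := hnn (l + 1) 0; unfold l2sq at *; linarith)
      have b2 := abs_integral_inner_le hτ hη (cW (n + 1) 0) (cc l) (cW l 0)
        (fun t => (apply_c_le hc hn hl hs t _).1) (D := energy τ N W s)
        (by have := hD n hn; have := hnn n 0; have := hnn n 1; unfold l2sq at *; linarith)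
        (by have := hD l hl; have := hnn l 1; have := hnn (l + 1) 0; unfold l2sq at *; linarith)
      refine (abs_add_le _ _).trans ?_
      linarith
    · exact ((cW _ _).inner (cm l)).intervalIntegrable _ _
    · exact ((cW _ _).inner (cc l)).intervalIntegrable _ _
  · intro l _
    exact (((cW _ _).inner (cm l)).add ((cW _ _).inner (cc l))).intervalIntegrable _ _

/-- The energy does not contain the mixed derivative `∂_t ∂_s^{l+1} W`. An integration by parts in
`t` moves `∂_t` to the coefficient and to the other factor, which accounts for five terms instead of
four. -/
theorem abs_integral_dS_rhs_le (hη : 0 ≤ η) {n : ℕ} (hn : n < N) {s : ℝ} (hs : s ∈ Set.Icc a b) :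
    |∫ t in (0 : ℝ)..τ, inner ℝ (pd n 0 W s t) (dS (rhs N κ M c W n) s t)|
      ≤ N * (5 * (η * energy τ N W s)) := by
  have cW : ∀ i j, Continuous (pd i j W s) := fun i j => (h.smooth_W.pd i j).continuous_snd s
  have c1 : ∀ l, Continuous fun t => dS (leibnizCoef M (fun _ _ => 0) n l) s t (pd l 1 W s t) :=
    fun l => ((h.smooth_m n l).dS.continuous_snd s).clm_apply (cW l 1)
  have c2 : ∀ l, Continuous fun t => leibnizCoef M (fun _ _ => 0) n l s t (pd (l + 1) 1 W s t) :=
    fun l => ((h.smooth_m n l).continuous_snd s).clm_apply (cW _ 1)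
  have c2' : ∀ l, Continuous fun t => leibnizCoef M (fun _ _ => 0) n l s t (pd (l + 1) 0 W s t) :=
    fun l => ((h.smooth_m n l).continuous_snd s).clm_apply (cW _ 0)
  have c2'' : ∀ l, Continuous fun t =>
      dT (leibnizCoef M (fun _ _ => 0) n l) s t (pd (l + 1) 0 W s t) :=
    fun l => ((h.smooth_m n l).dT.continuous_snd s).clm_apply (cW _ 0)
  have c3 : ∀ l, Continuous fun t => dS (leibnizCoef c (kop κ) n l) s t (pd l 0 W s t) :=
    fun l => ((h.smooth_l n l).dS.continuous_snd s).clm_apply (cW l 0)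
  have c4 : ∀ l, Continuous fun t => leibnizCoef c (kop κ) n l s t (pd (l + 1) 0 W s t) :=
    fun l => ((h.smooth_l n l).continuous_snd s).clm_apply (cW _ 0)
  have e : ∀ t, inner ℝ (pd n 0 W s t) (dS (rhs N κ M c W n) s t) = ∑ l ∈ Finset.range N,
      (inner ℝ (pd n 0 W s t) (dS (leibnizCoef M (fun _ _ => 0) n l) s t (pd l 1 W s t))
      + inner ℝ (pd n 0 W s t) (leibnizCoef M (fun _ _ => 0) n l s t (pd (l + 1) 1 W s t))
      + (inner ℝ (pd n 0 W s t) (dS (leibnizCoef c (kop κ) n l) s t (pd l 0 W s t))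
      + inner ℝ (pd n 0 W s t) (leibnizCoef c (kop κ) n l s t (pd (l + 1) 0 W s t)))) := by
    intro t
    rw [h.dS_rhs, inner_sum]
    simp only [inner_add_right]
  have hτ := h.τ_pos.le
  have hnn := fun i j => l2sq_nonneg hτ (pd i j W) s
  have hD := fun l (hl : l < N) => energy_term_le hτ hl W s
  have e00 : ∀ l, l < N → ∫ t in (0 : ℝ)..τ, ‖pd l 0 W s t‖ ^ 2 ≤ energy τ N W s := fun l hl => by
    have := hD l hl; have := hnn l 1; have := hnn (l + 1) 0; unfold l2sq at *; linarith
  have e01 : ∀ l, l < N → ∫ t in (0 : ℝ)..τ, ‖pd l 1 W s t‖ ^ 2 ≤ energy τ N W s := fun l hl => by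
    have := hD l hl; have := hnn l 0; have := hnn (l + 1) 0; unfold l2sq at *; linarith
  have e10 : ∀ l, l < N → ∫ t in (0 : ℝ)..τ, ‖pd (l + 1) 0 W s t‖ ^ 2 ≤ energy τ N W s :=
    fun l hl => by
    have := hD l hl; have := hnn l 0; have := hnn l 1; unfold l2sq at *; linarith
  have ibp : ∀ l, ∫ t in (0 : ℝ)..τ,
      inner ℝ (pd n 0 W s t) (leibnizCoef M (fun _ _ => 0) n l s t (pd (l + 1) 1 W s t))
      = - (∫ t in (0 : ℝ)..τ,
        inner ℝ (pd n 1 W s t) (leibnizCoef M (fun _ _ => 0) n l s t (pd (l + 1) 0 W s t)))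
      - ∫ t in (0 : ℝ)..τ,
        inner ℝ (pd n 0 W s t) (dT (leibnizCoef M (fun _ _ => 0) n l) s t (pd (l + 1) 0 W s t)) := by
    intro l
    have hd1 : ∀ t, HasDerivAt (fun t => leibnizCoef M (fun _ _ => 0) n l s t (pd (l + 1) 0 W s t))
        (dT (leibnizCoef M (fun _ _ => 0) n l) s t (pd (l + 1) 0 W s t)
          + leibnizCoef M (fun _ _ => 0) n l s t (pd (l + 1) 1 W s t)) t := by
      intro t
      have := ((h.smooth_m n l).hasDerivAt_snd s t).clm_apply
        ((h.smooth_W.pd (l + 1) 0).hasDerivAt_snd s t)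
      rwa [h.smooth_W.dT_pd] at this
    have hd2 : ∀ t, HasDerivAt (fun t => pd n 0 W s t) (pd n 1 W s t) t := by
      intro t
      have := (h.smooth_W.pd n 0).hasDerivAt_snd s t
      rwa [h.smooth_W.dT_pd] at this
    have p1 := h.periodic_W.pd h.smooth_W h.lt n 0 s hs 0
    have p2 := h.periodic_W.pd h.smooth_W h.lt (l + 1) 0 s hs 0
    have p3 := PeriodicOn.leibnizCoef h.lt h.smooth_M (Smooth2.const 0) h.periodic_M
      (fun _ _ _ => rfl) n l s hs 0
    rw [zero_add] at p1 p2 p3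
    have := integral_inner_deriv hd2 hd1 (cW n 1) ((c2'' l).add (c2 l)) p1 (by simp only [p2, p3])
    rw [this]
    simp only [inner_add_right]
    rw [intervalIntegral.integral_add (((cW _ _).inner (c2'' l)).intervalIntegrable _ _)
      (((cW _ _).inner (c2 l)).intervalIntegrable _ _)]
    ring
  simp only [e]
  rw [intervalIntegral.integral_finsetSum]
  · refine abs_sum_le_card fun l hl => ?_
    have hl := Finset.mem_range.1 hl
    rw [intervalIntegral.integral_add, intervalIntegral.integral_add, intervalIntegral.integral_add,
      ibp l]
    · have b1 := abs_integral_inner_le hτ hη (cW n 0) (c1 l) (cW l 1)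
        (fun t => (apply_m_le hc hn hl hs t _).2.1) (e00 n hn) (e01 l hl)
      have b2 := abs_integral_inner_le hτ hη (cW n 1) (c2' l) (cW (l + 1) 0)
        (fun t => (apply_m_le hc hn hl hs t _).1) (e01 n hn) (e10 l hl)
      have b3 := abs_integral_inner_le hτ hη (cW n 0) (c2'' l) (cW (l + 1) 0)
        (fun t => (apply_m_le hc hn hl hs t _).2.2) (e00 n hn) (e10 l hl)
      have b4 := abs_integral_inner_le hτ hη (cW n 0) (c3 l) (cW l 0)
        (fun t => (apply_c_le hc hn hl hs t _).2) (e00 n hn) (e00 l hl)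
      have b5 := abs_integral_inner_le hτ hη (cW n 0) (c4 l) (cW (l + 1) 0)
        (fun t => (apply_c_le hc hn hl hs t _).1) (e00 n hn) (e10 l hl)
      rw [abs_le] at b1 b2 b3 b4 b5 ⊢
      constructor <;> linarith [b1.1, b1.2, b2.1, b2.2, b3.1, b3.2, b4.1, b4.2, b5.1, b5.2]
    · exact ((cW _ _).inner (c3 l)).intervalIntegrable _ _
    · exact ((cW _ _).inner (c4 l)).intervalIntegrable _ _
    · exact ((cW _ _).inner (c1 l)).intervalIntegrable _ _
    · exact ((cW _ _).inner (c2 l)).intervalIntegrable _ _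
    · exact (((cW _ _).inner (c1 l)).add ((cW _ _).inner (c2 l))).intervalIntegrable _ _
    · exact (((cW _ _).inner (c3 l)).add ((cW _ _).inner (c4 l))).intervalIntegrable _ _
  · intro l _
    exact ((((cW _ _).inner (c1 l)).add ((cW _ _).inner (c2 l))).add
      (((cW _ _).inner (c3 l)).add ((cW _ _).inner (c4 l)))).intervalIntegrable _ _

theorem l2sq_rhs_le {n : ℕ} (hn : n < N) {s : ℝ} (hs : s ∈ Set.Icc a b) :
    l2sq τ (rhs N κ M c W n) s ≤ 2 * N * η ^ 2 * energy τ N W s := by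
  have hτ := h.τ_pos.le
  have cW : ∀ i j, Continuous (pd i j W s) := fun i j => (h.smooth_W.pd i j).continuous_snd s
  have pt : ∀ t, ‖rhs N κ M c W n s t‖ ^ 2 ≤ ∑ l ∈ Finset.range N,
      (2 * N * η ^ 2) * (‖pd l 1 W s t‖ ^ 2 + ‖pd l 0 W s t‖ ^ 2) := by
    intro t
    have h1 : ‖rhs N κ M c W n s t‖ ≤ ∑ l ∈ Finset.range N,
        (η * (‖pd l 1 W s t‖ + ‖pd l 0 W s t‖)) := by
      refine (norm_sum_le _ _).trans (Finset.sum_le_sum fun l hl => ?_)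
      have hl := Finset.mem_range.1 hl
      refine (norm_add_le _ _).trans ?_
      have := (apply_m_le hc hn hl hs t (pd l 1 W s t)).1
      have := (apply_c_le hc hn hl hs t (pd l 0 W s t)).1
      linarith
    have h2 := pow_le_pow_left₀ (norm_nonneg _) h1 2
    refine h2.trans ((sq_sum_le_card_mul_sum_sq).trans ?_)
    rw [Finset.card_range, Finset.mul_sum]
    refine Finset.sum_le_sum fun l _ => ?_
    have h3 : 0 ≤ (N : ℝ) * η ^ 2 * (‖pd l 1 W s t‖ - ‖pd l 0 W s t‖) ^ 2 := by positivity
    nlinarith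
  have h1 : l2sq τ (rhs N κ M c W n) s ≤ ∫ t in (0 : ℝ)..τ, ∑ l ∈ Finset.range N,
      (2 * N * η ^ 2) * (‖pd l 1 W s t‖ ^ 2 + ‖pd l 0 W s t‖ ^ 2) := by
    refine intervalIntegral.integral_mono_on hτ
      ((((h.smooth_rhs N n).continuous_snd s).norm.pow 2).intervalIntegrable _ _) ?_ fun t _ => pt t
    exact Continuous.intervalIntegrable (continuous_finsetSum _ fun l _ => by
      have := cW l 1; have := cW l 0; fun_prop) _ _
  refine h1.trans ?_
  rw [intervalIntegral.integral_finsetSum, energy, Finset.mul_sum]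
  · refine Finset.sum_le_sum fun l _ => ?_
    have := cW l 1
    have := cW l 0
    rw [intervalIntegral.integral_const_mul, intervalIntegral.integral_add]
    · have h3 := l2sq_nonneg hτ (pd (l + 1) 0 W) s
      have h4 : 0 ≤ 2 * N * η ^ 2 := by positivity
      refine mul_le_mul_of_nonneg_left ?_ h4
      unfold l2sq at *
      linarith
    all_goals exact Continuous.intervalIntegrable (by fun_prop) _ _
  · intro l _
    have := cW l 1
    have := cW l 0
    exact Continuous.intervalIntegrable (by fun_prop) _ _

end

end LinSys

theorem abs_integral_smul_piY_le {τ η D : ℝ} (hτ : 0 ≤ τ) (hη : 0 ≤ η) {k : ℝ → ℝ} {w : ℝ → E4}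
    (hk : Continuous k) (hw : Continuous w) (hb : ∀ t, |k t| ≤ η)
    (hD : ∫ t in (0 : ℝ)..τ, ‖w t‖ ^ 2 ≤ D) :
    |∫ t in (0 : ℝ)..τ, inner ℝ (w t) (k t • piY (w t))| ≤ η * D := by
  refine abs_integral_inner_le hτ hη hw (hk.smul (piY.continuous.comp hw)) hw (fun t => ?_) hD hD
  rw [norm_smul]
  exact mul_le_mul (hb t) (norm_piY_le _) (norm_nonneg _) hη

set_option maxHeartbeats 400000 in
/-- Convexity: the `L²`-norms of the `s`-derivatives of a solution decay exponentially, at a rate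
that depends only on the asymptotic operator. -/
theorem LinSys.exists_decay {τ Kb m : ℝ} (hτ : 0 < τ) (hm : 0 < m) : ∃ μ : ℝ, 0 < μ ∧
    ∀ N : ℕ, ∃ η : ℝ, 0 < η ∧ ∀ (a b : ℝ) (κ : ℝ → ℝ → ℝ) (M c : ℝ → ℝ → E4 →L[ℝ] E4)
      (W : ℝ → ℝ → E4), LinSys τ a b κ M c W → SmallCoef a b κ M c N η →
      (∀ s ∈ Set.Icc a b, ∀ t, |κ s t| ≤ Kb) →
      (∀ s ∈ Set.Icc a b, m ≤ |∫ t in (0 : ℝ)..τ, κ s t|) →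
      ∀ B : ℝ, ∑ l ∈ Finset.range N, l2sq τ (pd l 0 W) a ≤ B →
        ∑ l ∈ Finset.range N, l2sq τ (pd l 0 W) b ≤ B → ∀ s ∈ Set.Icc a b,
        ∑ l ∈ Finset.range N, l2sq τ (pd l 0 W) s ≤ B *
          (Real.cosh (μ * (s - (a + b) / 2)) / Real.cosh (μ * (b - a) / 2)) := by
  obtain ⟨Cg, hCg, gap⟩ := spectral_gap (Kb := Kb) hτ hm
  -- The ellipticity constant, hence the rate `√(2 / C1)`, is fixed before `N`: only the smallness
  -- threshold may depend on the number of derivatives.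
  set C1 : ℝ := 2 * (1 + 2 * Cg) with hC1
  have hC1p : 0 < C1 := by positivity
  refine ⟨Real.sqrt (2 / C1), Real.sqrt_pos.2 (by positivity), fun N => ?_⟩
  -- The first condition absorbs the lower-order terms of the elliptic estimate; the second absorbs
  -- the errors of the convexity estimate, `7N + 1` of them per derivative (`2N` from `f`, `5N` from
  -- `f_s`, one from `κ_s`).
  obtain ⟨η, hη, hη1, hη2⟩ : ∃ η : ℝ, 0 < η ∧ 16 * Cg * N ^ 2 * η ^ 2 ≤ 1 / 2 ∧
      N * (7 * N + 1) * η * C1 ≤ 1 := by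
    set Z : ℝ := 1 + 32 * Cg * N ^ 2 + N * (7 * N + 1) * C1 with hZ
    have hZ1 : 1 ≤ Z := by
      have : 0 ≤ 32 * Cg * (N : ℝ) ^ 2 := by positivity
      have : 0 ≤ (N : ℝ) * (7 * N + 1) * C1 := by positivity
      linarith
    have hZ0 : 0 < Z := by linarith
    refine ⟨1 / Z, by positivity, ?_, ?_⟩
    · have h1 : (1 / Z) ^ 2 ≤ 1 / Z := by
        rw [sq]; exact mul_le_of_le_one_left (by positivity) (by rw [div_le_one hZ0]; exact hZ1)
      have h2 : 32 * Cg * (N : ℝ) ^ 2 * (1 / Z) ≤ 1 := by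
        rw [mul_one_div, div_le_one hZ0]
        have : 0 ≤ (N : ℝ) * (7 * N + 1) * C1 := by positivity
        linarith
      have h3 : 16 * Cg * (N : ℝ) ^ 2 * (1 / Z) ^ 2 ≤ 16 * Cg * (N : ℝ) ^ 2 * (1 / Z) := by gcongr
      linarith
    · have : (N : ℝ) * (7 * N + 1) * (1 / Z) * C1 = (N * (7 * N + 1) * C1) / Z := by ring
      rw [this, div_le_one hZ0]
      have : 0 ≤ 32 * Cg * (N : ℝ) ^ 2 := by positivity
      linarith
  refine ⟨η, hη, ?_⟩
  intro a b κ M c W h hc hκb hκm B hBa hBb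
  set g : ℝ → ℝ := fun s => ∑ l ∈ Finset.range N, l2sq τ (pd l 0 W) s with hg
  set g' : ℝ → ℝ := fun s => ∑ l ∈ Finset.range N,
    2 * ∫ t in (0 : ℝ)..τ, inner ℝ (dS (pd l 0 W) s t) (pd l 0 W s t) with hg'
  set g'' : ℝ → ℝ := fun s => ∑ l ∈ Finset.range N,
    2 * ((∫ t in (0 : ℝ)..τ, inner ℝ (dS (dS (pd l 0 W)) s t) (pd l 0 W s t))
      + l2sq τ (dS (pd l 0 W)) s) with hg''
  have d1 : ∀ s, HasDerivAt g (g' s) s := fun s =>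
    HasDerivAt.fun_sum fun l _ => l2sq_hasDerivAt (h.smooth_W.pd l 0) s
  have d2 : ∀ s, HasDerivAt g' (g'' s) s := fun s =>
    HasDerivAt.fun_sum fun l _ => integral_inner_dS_hasDerivAt (h.smooth_W.pd l 0) s
  refine le_cosh_of_deriv2_ge (Real.sqrt_pos.2 (by positivity)) h.lt d1 d2 ?_ hBa hBb
  intro s hs
  rw [Real.sq_sqrt (by positivity)]
  set D := energy τ N W s with hD
  set S : ℝ := ∑ l ∈ Finset.range N, l2sq τ (pd (l + 1) 0 W) s with hS
  have hnn := fun i j => l2sq_nonneg hτ.le (pd i j W) s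
  have hDl := fun l (hl : l < N) => energy_term_le hτ.le hl W s
  have hD0 : 0 ≤ D := Finset.sum_nonneg fun l _ => by
    have := hnn l 0; have := hnn l 1; have := hnn (l + 1) 0; linarith
  -- ellipticity
  have ell : ∀ l ∈ Finset.range N, l2sq τ (pd l 0 W) s + l2sq τ (pd l 1 W) s
      + l2sq τ (pd (l + 1) 0 W) s ≤ (1 + 2 * Cg) * l2sq τ (pd (l + 1) 0 W) s
        + 16 * Cg * N * η ^ 2 * D := by
    intro l hl
    have hl := Finset.mem_range.1 hl
    have heq := h.eqn_pd l hl s hs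
    simp only [dS_pd, h.smooth_W.dT_pd] at heq
    have hp := h.periodic_W.pd h.smooth_W h.lt l 0 s hs 0
    rw [zero_add] at hp
    have hg1 := gap (κ s) (pd l 0 W s) (pd l 1 W s) (h.smooth_κ.continuous_snd s) (hκb s hs)
      (hκm s hs) (fun t => by
        have := (h.smooth_W.pd l 0).hasDerivAt_snd s t
        rwa [h.smooth_W.dT_pd] at this) ((h.smooth_W.pd l 1).continuous_snd s) hp
      (h.mean_pd l 0 s hs)
    have e1 : ∀ t, -J0 (pd l 1 W s t) + κ s t • piY (pd l 0 W s t)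
        = pd (l + 1) 0 W s t - projQ τ (LinSys.rhs N κ M c W l) s t := by
      intro t; rw [heq t]; abel
    simp only [e1] at hg1
    have hsub := l2sq_add_le hτ.le (h.smooth_W.pd (l + 1) 0) ((h.smooth_rhs N l).projQ (τ := τ))
      ((h.smooth_W.pd (l + 1) 0).sub ((h.smooth_rhs N l).projQ (τ := τ))) (s := s) (τ := τ)
      (fun t => norm_sub_le _ _)
    have hq := l2sq_projQ_le hτ (h.smooth_rhs N l) s
    have hr := h.l2sq_rhs_le hc hl hs
    unfold l2sq at hsub hq hr ⊢
    have h5 : Cg * (∫ t in (0 : ℝ)..τ, ‖pd (l + 1) 0 W s t - projQ τ (LinSys.rhs N κ M c W l) s t‖ ^ 2)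
        ≤ Cg * (2 * (∫ t in (0 : ℝ)..τ, ‖pd (l + 1) 0 W s t‖ ^ 2) + 16 * N * η ^ 2 * D) := by
      refine mul_le_mul_of_nonneg_left ?_ hCg.le
      linarith
    linarith
  -- The errors sum to at most half of the total energy, so the `s`-derivatives alone control it.
  have ellS : D ≤ C1 * S := by
    have h1 : D ≤ ∑ l ∈ Finset.range N, ((1 + 2 * Cg) * l2sq τ (pd (l + 1) 0 W) s
        + 16 * Cg * N * η ^ 2 * D) := Finset.sum_le_sum ell
    rw [Finset.sum_add_distrib, ← Finset.mul_sum, Finset.sum_const, Finset.card_range, nsmul_eq_mul]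
      at h1
    have h2 : (N : ℝ) * (16 * Cg * N * η ^ 2 * D) ≤ 1 / 2 * D := by
      calc _ = (16 * Cg * N ^ 2 * η ^ 2) * D := by ring
        _ ≤ _ := by gcongr
    have h3 : C1 * S = 2 * ((1 + 2 * Cg) * S) := by rw [hC1]; ring
    rw [h3]
    linarith
  -- the second derivative
  have low : ∀ l ∈ Finset.range N, 4 * l2sq τ (pd (l + 1) 0 W) s
      - 2 * (7 * N + 1) * (η * D) ≤ 2 * ((∫ t in (0 : ℝ)..τ, inner ℝ (dS (dS (pd l 0 W)) s t)
        (pd l 0 W s t)) + l2sq τ (dS (pd l 0 W)) s) := by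
    intro l hl
    have hl := Finset.mem_range.1 hl
    have hid := integral_inner_dS_dS h.lt h.smooth_κ (h.smooth_W.pd l 0) (h.smooth_rhs N l)
      (h.periodic_W.pd h.smooth_W h.lt l 0) (h.mean_pd l 0)
      (by rw [dS_pd]; exact h.mean_pd (l + 1) 0) (h.eqn_pd l hl) s hs
    rw [hid]
    simp only [dS_pd]
    have b1 := h.abs_integral_rhs_le hc hη.le hl hs
    have b2 := h.abs_integral_dS_rhs_le hc hη.le hl hs
    have b3 := abs_integral_smul_piY_le (D := D) hτ.le hη.le (h.smooth_κ.dS.continuous_snd s)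
      ((h.smooth_W.pd l 0).continuous_snd s) (hc.κ s hs)
      (by have := hDl l hl; have := hnn l 1; have := hnn (l + 1) 0; unfold l2sq at *; linarith)
    rw [← hD] at b1 b2
    rw [abs_le] at b1 b2 b3
    unfold l2sq
    linarith [b1.1, b1.2, b2.1, b2.2, b3.1, b3.2]
  have hlow : 4 * S - N * (2 * (7 * N + 1) * (η * D)) ≤ g'' s := by
    have h1 := Finset.sum_le_sum low
    rw [Finset.sum_sub_distrib, ← Finset.mul_sum, Finset.sum_const, Finset.card_range, nsmul_eq_mul]
      at h1
    exact h1
  have hgD : g s ≤ D := Finset.sum_le_sum fun l _ => by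
    have := hnn l 1; have := hnn (l + 1) 0; linarith
  have hS0 : 0 ≤ S := Finset.sum_nonneg fun l _ => hnn _ _
  -- Half of `4 S` pays for the errors; the remaining `2 S` is at least `2 / C1` times the energy,
  -- and so at least `2 / C1` times `g`.
  have h6 : N * (2 * (7 * N + 1) * (η * D)) ≤ 2 * S := by
    calc (N : ℝ) * (2 * (7 * N + 1) * (η * D)) ≤ N * (2 * (7 * N + 1) * (η * (C1 * S))) := by gcongr
      _ = 2 * ((N * (7 * N + 1) * η * C1) * S) := by ring
      _ ≤ 2 * (1 * S) := by gcongr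
      _ = 2 * S := by ring
  have h7 : 2 / C1 * g s ≤ 2 * S := by
    rw [div_mul_eq_mul_div, div_le_iff₀ hC1p]
    linarith
  linarith

/-! ### Comparison of derivatives in `s` and in `t` -/

/-- The squared `L²`-norm over `{s} × [0, τ]` of the pointwise `C^n` size. -/
def l2c (τ : ℝ) (n : ℕ) (φ : ℝ → ℝ → E4) (s : ℝ) : ℝ := ∫ t in (0 : ℝ)..τ, cSize n φ s t ^ 2

theorem cSize_continuous {E : Type} [NormedAddCommGroup E] [NormedSpace ℝ E] {φ : ℝ → ℝ → E}
    (h : Smooth2 φ) (n : ℕ) (s : ℝ) : Continuous (cSize n φ s) :=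
  continuous_finsetSum _ fun _ _ => continuous_finsetSum _ fun ij _ =>
    ((h.pd ij.1 ij.2).continuous_snd s).norm

theorem l2c_nonneg {τ : ℝ} (hτ : 0 ≤ τ) (n : ℕ) (φ : ℝ → ℝ → E4) (s : ℝ) : 0 ≤ l2c τ n φ s :=
  intervalIntegral.integral_nonneg hτ fun _ _ => sq_nonneg _

theorem l2sq_le_l2c {E : Type} [NormedAddCommGroup E] [NormedSpace ℝ E] {τ C s : ℝ} (hτ : 0 ≤ τ)
    {φ : ℝ → ℝ → E} {ψ : ℝ → ℝ → E4} {n : ℕ} (h : Smooth2 φ) (h' : Smooth2 ψ)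
    (hb : ∀ t, ‖φ s t‖ ≤ C * cSize n ψ s t) : l2sq τ φ s ≤ C ^ 2 * l2c τ n ψ s := by
  unfold l2sq l2c
  rw [← intervalIntegral.integral_const_mul]
  have c1 := cSize_continuous h' n s
  have c2 := h.continuous_snd s
  refine intervalIntegral.integral_mono_on hτ (Continuous.intervalIntegrable (by fun_prop) _ _)
    (Continuous.intervalIntegrable (by fun_prop) _ _) fun t _ => ?_
  rw [← mul_pow]
  exact pow_le_pow_left₀ (norm_nonneg _) (hb t) 2

theorem l2c_zero (τ : ℝ) (φ : ℝ → ℝ → E4) (s : ℝ) : l2c τ 0 φ s = l2sq τ φ s := by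
  unfold l2c l2sq; simp only [cSize_zero]

theorem l2c_succ_le {τ : ℝ} (hτ : 0 ≤ τ) {φ : ℝ → ℝ → E4} (h : Smooth2 φ) (n : ℕ) (s C : ℝ)
    (hC : ∀ i j, i + j = n + 1 → l2sq τ (pd i j φ) s ≤ C) :
    l2c τ (n + 1) φ s ≤ 2 * l2c τ n φ s + 2 * ((n : ℝ) + 2) ^ 2 * C := by
  have c1 := cSize_continuous h n s
  have c2 := cSize_continuous h (n + 1) s
  have c3 := fun i j => (h.pd i j).continuous_snd s
  have hpt : ∀ t, cSize (n + 1) φ s t ^ 2 ≤ 2 * cSize n φ s t ^ 2 + 2 * ((n : ℝ) + 2) *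
      ∑ ij ∈ Finset.HasAntidiagonal.antidiagonal (n + 1), ‖pd ij.1 ij.2 φ s t‖ ^ 2 := by
    intro t
    rw [cSize_succ]
    set A := cSize n φ s t
    set B := ∑ ij ∈ Finset.HasAntidiagonal.antidiagonal (n + 1), ‖pd ij.1 ij.2 φ s t‖
    have h1 : B ^ 2 ≤ ((n : ℝ) + 2) *
        ∑ ij ∈ Finset.HasAntidiagonal.antidiagonal (n + 1), ‖pd ij.1 ij.2 φ s t‖ ^ 2 := by
      have := sq_sum_le_card_mul_sum_sq (α := ℝ) (s := Finset.HasAntidiagonal.antidiagonal (n + 1))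
        (f := fun ij : ℕ × ℕ => ‖pd ij.1 ij.2 φ s t‖)
      rw [Finset.Nat.card_antidiagonal] at this
      push_cast at this
      rwa [add_assoc, one_add_one_eq_two] at this
    nlinarith [sq_nonneg (A - B)]
  have h2 : l2c τ (n + 1) φ s ≤ ∫ t in (0 : ℝ)..τ, (2 * cSize n φ s t ^ 2 + 2 * ((n : ℝ) + 2) *
      ∑ ij ∈ Finset.HasAntidiagonal.antidiagonal (n + 1), ‖pd ij.1 ij.2 φ s t‖ ^ 2) := by
    refine intervalIntegral.integral_mono_on hτ (Continuous.intervalIntegrable (by fun_prop) _ _)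
      (Continuous.intervalIntegrable ?_ _ _) fun t _ => hpt t
    exact (by fun_prop : Continuous fun t => 2 * cSize n φ s t ^ 2).add
      (continuous_const.mul (continuous_finsetSum _ fun ij _ => (c3 _ _).norm.pow 2))
  refine h2.trans ?_
  rw [intervalIntegral.integral_add, intervalIntegral.integral_const_mul,
    intervalIntegral.integral_const_mul, intervalIntegral.integral_finsetSum]
  · have h3 : ∑ ij ∈ Finset.HasAntidiagonal.antidiagonal (n + 1),
        ∫ t in (0 : ℝ)..τ, ‖pd ij.1 ij.2 φ s t‖ ^ 2 ≤ ((n : ℝ) + 2) * C := by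
      refine (Finset.sum_le_card_nsmul _ _ C fun ij hij =>
        hC _ _ (Finset.HasAntidiagonal.mem_antidiagonal.1 hij)).trans ?_
      rw [Finset.Nat.card_antidiagonal, nsmul_eq_mul]
      push_cast
      rw [add_assoc, one_add_one_eq_two]
    have h4 : 2 * ((n : ℝ) + 2) * ∑ ij ∈ Finset.HasAntidiagonal.antidiagonal (n + 1),
        ∫ t in (0 : ℝ)..τ, ‖pd ij.1 ij.2 φ s t‖ ^ 2 ≤ 2 * ((n : ℝ) + 2) * (((n : ℝ) + 2) * C) := by
      gcongr
    unfold l2c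
    linarith
  · intro ij _
    exact ((c3 _ _).norm.pow 2).intervalIntegrable _ _
  · exact Continuous.intervalIntegrable (by fun_prop) _ _
  · exact (continuous_const.mul (continuous_finsetSum _ fun ij _ =>
      (c3 _ _).norm.pow 2)).intervalIntegrable _ _

/-- Used along a row of derivatives of fixed total order, where each step exchanges one `∂_s` with
one `∂_t`. -/
theorem chain_le {A : ℕ → ℝ} {E : ℝ} {n : ℕ} (hE : 0 ≤ E) (h0 : 0 ≤ A 0)
    (h : ∀ i < n, A (i + 1) ≤ 2 * A i + 2 * E) : ∀ i ≤ n, A i ≤ 2 ^ n * (A 0 + 2 * E) := by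
  have key : ∀ i ≤ n, A i + 2 * E ≤ 2 ^ i * (A 0 + 2 * E) := by
    intro i hi
    induction i with
    | zero => simp
    | succ i ih =>
      have h1 := ih (by omega)
      have h2 := h i (by omega)
      rw [pow_succ]
      linarith
  intro i hi
  have h1 := key i hi
  have h2 : (2 : ℝ) ^ i * (A 0 + 2 * E) ≤ 2 ^ n * (A 0 + 2 * E) := by
    have : (2 : ℝ) ^ i ≤ 2 ^ n := pow_le_pow_right₀ (by norm_num) hi
    gcongr
  linarith

namespace LinSys

variable {τ a b : ℝ} {κ : ℝ → ℝ → ℝ} {M c : ℝ → ℝ → E4 →L[ℝ] E4} {W : ℝ → ℝ → E4}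

theorem cSize_kop_le (h : Smooth2 κ) (n : ℕ) (s t : ℝ) : cSize n (kop κ) s t ≤ cSize n κ s t := by
  have e : kop κ = fun s t => ContinuousLinearMap.toSpanSingleton ℝ piY (κ s t) := by
    funext s t; simp [kop]
  rw [e]
  refine (cSize_clm_le h _ n s t).trans ?_
  have h1 : ‖ContinuousLinearMap.toSpanSingleton ℝ piY‖ ≤ 1 := by
    rw [ContinuousLinearMap.norm_toSpanSingleton]
    exact ContinuousLinearMap.opNorm_le_bound _ zero_le_one fun v => by
      rw [one_mul]; exact norm_piY_le v
  exact mul_le_of_le_one_left (cSize_nonneg _ _ _ _) h1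

/-- By the equation `∂_s + J₀ ∂_t` acts on `W` as an operator of order zero plus a small operator of
order one. The order-zero part costs only the lower norm, while the top norm has a coefficient of
order `η²`. -/
theorem l2sq_commutation_le (h : LinSys τ a b κ M c W) {n : ℕ} {η CK s : ℝ}
    (hs : s ∈ Set.Icc a b)
    (hM : ∀ t, cSize n M s t ≤ η) (hc : ∀ t, cSize n c s t ≤ η) (hκ : ∀ t, cSize n κ s t ≤ CK)
    {i j : ℕ} (hij : i + j = n) :
    l2sq τ (fun s t => pd (i + 1) j W s t + J0 (pd i (j + 1) W s t)) s
      ≤ 2 * (5 ^ n * CK) ^ 2 * l2c τ n W s + 8 * (5 ^ n * (2 * η)) ^ 2 * l2c τ (n + 1) W s := by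
  have hτ := h.τ_pos.le
  have hη : 0 ≤ η := (cSize_nonneg _ _ _ _).trans (hM 0)
  have hCK : 0 ≤ CK := (cSize_nonneg _ _ _ _).trans (hκ 0)
  set f : ℝ → ℝ → E4 := fun s t => M s t (dT W s t) + c s t (W s t) with hf
  have sM := h.smooth_M.apply h.smooth_W.dT
  have sc := h.smooth_c.apply h.smooth_W
  have sf : Smooth2 f := sM.add sc
  have sk : Smooth2 (fun s t => kop κ s t (W s t)) := (smooth_kop h.smooth_κ).apply h.smooth_W
  have e : ∀ s ∈ Set.Icc a b, ∀ t, dS W s t + J0 (dT W s t)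
      = kop κ s t (W s t) + projQ τ f s t := by
    intro s hs t
    rw [h.eqn s hs t]
    simp only [kop, smul_apply]
    abel
  have e2 := pd_congr_strip (h.smooth_W.dS.add (h.smooth_W.dT.clm J0)) (sk.add (sf.projQ (τ := τ)))
    h.lt e i j s hs
  rw [h.smooth_W.dS.pd_add (h.smooth_W.dT.clm J0), h.smooth_W.dT.pd_clm, sk.pd_add sf.projQ,
    h.smooth_W.pd_dS, pd_dT] at e2
  have sL : Smooth2 (fun s t => pd (i + 1) j W s t + J0 (pd i (j + 1) W s t)) :=
    (h.smooth_W.pd _ _).add ((h.smooth_W.pd _ _).clm J0)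
  have b1 := l2sq_add_le hτ (sk.pd i j) ((sf.projQ (τ := τ)).pd i j) sL (s := s)
    (fun t => (congrArg norm (e2 t)).trans_le (norm_add_le _ _))
  have b2 : l2sq τ (pd i j (fun s t => kop κ s t (W s t))) s ≤ (5 ^ n * CK) ^ 2 * l2c τ n W s := by
    refine l2sq_le_l2c hτ (sk.pd i j) h.smooth_W fun t => ?_
    refine (norm_pd_le_cSize hij.le _ _ _).trans ((cSize_apply_le n (smooth_kop h.smooth_κ)
      h.smooth_W s t).trans ?_)
    have := (cSize_kop_le h.smooth_κ n s t).trans (hκ t)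
    have := cSize_nonneg n W s t
    gcongr
  have b3 : l2sq τ (pd i j (projQ τ f)) s ≤ 4 * l2sq τ (pd i j f) s := by
    cases j with
    | zero => rw [pd_projQ sf]; exact l2sq_projQ_le h.τ_pos (sf.pd i 0) s
    | succ j =>
      rw [pd_projQ_succ sf]
      have := l2sq_nonneg hτ (pd i (j + 1) f) s
      linarith
  have b4 : l2sq τ (pd i j f) s ≤ (5 ^ n * (2 * η)) ^ 2 * l2c τ (n + 1) W s := by
    refine l2sq_le_l2c hτ (sf.pd i j) h.smooth_W fun t => ?_
    refine (norm_pd_le_cSize hij.le _ _ _).trans ((cSize_add_le sM sc n s t).trans ?_)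
    have a1 := cSize_apply_le n h.smooth_M h.smooth_W.dT s t
    have a2 := cSize_apply_le n h.smooth_c h.smooth_W s t
    have a3 := cSize_dT_le W n s t
    have a4 := cSize_mono (Nat.le_succ n) W s t
    have p1 := cSize_nonneg n (dT W) s t
    have p2 := cSize_nonneg n W s t
    have a5 : (5 : ℝ) ^ n * cSize n M s t * cSize n (dT W) s t ≤ 5 ^ n * η * cSize (n + 1) W s t := by
      have := hM t
      gcongr
    have a6 : (5 : ℝ) ^ n * cSize n c s t * cSize n W s t ≤ 5 ^ n * η * cSize (n + 1) W s t := by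
      have := hc t
      gcongr
    linarith
  linarith

/-- Derivatives of a solution are controlled in `L²` of each circle by pure derivatives in `t`, and
by pure derivatives in `s`. -/
theorem exists_l2c_le (n : ℕ) (CK : ℝ) : ∃ η C : ℝ, 0 < η ∧ 0 ≤ C ∧
    ∀ {τ a b : ℝ} {κ : ℝ → ℝ → ℝ} {M c : ℝ → ℝ → E4 →L[ℝ] E4} {W : ℝ → ℝ → E4},
      LinSys τ a b κ M c W → ∀ s ∈ Set.Icc a b, (∀ t, cSize n M s t ≤ η) →
      (∀ t, cSize n c s t ≤ η) → (∀ t, cSize n κ s t ≤ CK) →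
      l2c τ n W s ≤ C * ∑ l ∈ Finset.range (n + 1), l2sq τ (pd 0 l W) s ∧
      l2c τ n W s ≤ C * ∑ l ∈ Finset.range (n + 1), l2sq τ (pd l 0 W) s := by
  induction n with
  | zero =>
    refine ⟨1, 1, one_pos, zero_le_one, fun h s _ _ _ _ => ?_⟩
    simp [l2c_zero, pd_zero_zero]
  | succ n ih =>
    obtain ⟨η0, C0, hη0, hC0, ih⟩ := ih
    set A : ℝ := 2 * ((n : ℝ) + 2) ^ 2 * 2 ^ (n + 1) with hA
    have hA0 : 0 < A := by positivity
    set c1 : ℝ := 2 * (5 ^ n * CK) ^ 2 with hc1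
    set Z : ℝ := 2 * A * (8 * (5 ^ n * 2) ^ 2) with hZ
    have hZ0 : 0 < Z := by positivity
    -- `Z η²` is the coefficient with which the top-order norm reappears on the right; this choice
    -- makes it at most one half.
    refine ⟨min η0 (min 1 (1 / (2 * Z))), 2 * (2 + 2 * A * c1) * C0 + 2 * A, by positivity,
      by positivity, ?_⟩
    intro τ a b κ M c W h s hs hM hc hκ
    set η := min η0 (min 1 (1 / (2 * Z))) with hη
    have hη0' : 0 < η := by positivity
    have hηη : η ^ 2 ≤ 1 / (2 * Z) := by
      have h1 : η ≤ 1 := (min_le_right _ _).trans (min_le_left _ _)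
      have h2 : η ≤ 1 / (2 * Z) := (min_le_right _ _).trans (min_le_right _ _)
      nlinarith
    have mM : ∀ t, cSize n M s t ≤ η := fun t => (cSize_mono (Nat.le_succ n) _ _ _).trans (hM t)
    have mc : ∀ t, cSize n c s t ≤ η := fun t => (cSize_mono (Nat.le_succ n) _ _ _).trans (hc t)
    have mκ : ∀ t, cSize n κ s t ≤ CK := fun t => (cSize_mono (Nat.le_succ n) _ _ _).trans (hκ t)
    obtain ⟨i1, i2⟩ := ih h s hs (fun t => (mM t).trans (min_le_left _ _))
      (fun t => (mc t).trans (min_le_left _ _)) mκ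
    have hτ := h.τ_pos.le
    set X := l2c τ n W s
    set X' := l2c τ (n + 1) W s with hX'
    have hX0 : 0 ≤ X := l2c_nonneg hτ _ _ _
    have hX0' : 0 ≤ X' := l2c_nonneg hτ _ _ _
    set E : ℝ := 2 * (5 ^ n * CK) ^ 2 * X + 8 * (5 ^ n * (2 * η)) ^ 2 * X' with hE
    have hE0 : 0 ≤ E := by positivity
    have hcomm : ∀ i j, i + j = n →
        l2sq τ (pd (i + 1) j W) s ≤ 2 * l2sq τ (pd i (j + 1) W) s + 2 * E ∧
        l2sq τ (pd i (j + 1) W) s ≤ 2 * l2sq τ (pd (i + 1) j W) s + 2 * E := by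
      intro i j hij
      have hb := h.l2sq_commutation_le hs mM mc mκ hij
      have sL : Smooth2 (fun s t => pd (i + 1) j W s t + J0 (pd i (j + 1) W s t)) :=
        (h.smooth_W.pd _ _).add ((h.smooth_W.pd _ _).clm J0)
      constructor
      · have := l2sq_add_le hτ (h.smooth_W.pd i (j + 1)) sL (h.smooth_W.pd (i + 1) j) (s := s)
          (fun t => by
            have := norm_sub_le (pd (i + 1) j W s t + J0 (pd i (j + 1) W s t)) (J0 (pd i (j + 1) W s t))
            rw [add_sub_cancel_right, norm_J0] at this
            linarith)
        linarith
      · have := l2sq_add_le hτ (h.smooth_W.pd (i + 1) j) sL (h.smooth_W.pd i (j + 1)) (s := s)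
          (fun t => by
            have := norm_sub_le (pd (i + 1) j W s t + J0 (pd i (j + 1) W s t)) (pd (i + 1) j W s t)
            rw [add_sub_cancel_left, norm_J0] at this
            linarith)
        linarith
    have hnn := fun i j => l2sq_nonneg hτ (pd i j W) s
    -- One bound serves both chains: every derivative of order `n + 1` is compared with a single
    -- extreme one, of squared norm `p`, and the top-order norm is absorbed.
    have fin : ∀ p : ℝ, 0 ≤ p → (∀ i j, i + j = n + 1 → l2sq τ (pd i j W) s ≤ 2 ^ (n + 1) * (p + 2 * E)) →
        X' ≤ 2 * (2 + 2 * A * c1) * X + 2 * A * p := by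
      intro p hp hb
      have h1 := l2c_succ_le hτ h.smooth_W n s _ hb
      rw [← hX'] at h1
      have h2 : 2 * ((n : ℝ) + 2) ^ 2 * (2 ^ (n + 1) * (p + 2 * E)) = A * p + 2 * A * c1 * X
          + Z * η ^ 2 * X' := by rw [hE, hA, hZ, hc1]; ring
      rw [h2] at h1
      have h3 : Z * η ^ 2 * X' ≤ 1 / 2 * X' := by
        refine mul_le_mul_of_nonneg_right ?_ hX0'
        calc Z * η ^ 2 ≤ Z * (1 / (2 * Z)) := by gcongr
          _ = 1 / 2 := by field_simp
      linarith
    have hc10 : 0 ≤ c1 := by positivity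
    constructor
    -- From the pure `t`-derivative towards `s`; the second case runs in the opposite direction.
    · have hch := chain_le (A := fun i => l2sq τ (pd i (n + 1 - i) W) s) (n := n + 1) hE0 (hnn _ _)
        (fun i hi => by
          have := (hcomm i (n - i) (by omega)).1
          rwa [show n - i + 1 = n + 1 - i by omega, show n - i = n + 1 - (i + 1) by omega] at this)
      have h1 := fin (l2sq τ (pd 0 (n + 1) W) s) (hnn _ _) (fun i j hij => by
        have := hch i (by omega)
        rwa [show n + 1 - i = j by omega] at this)
      rw [Finset.sum_range_succ, mul_add]
      have p0 : 0 ≤ ∑ l ∈ Finset.range (n + 1), l2sq τ (pd 0 l W) s := Finset.sum_nonneg fun _ _ => hnn _ _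
      have h2 : 2 * (2 + 2 * A * c1) * X ≤ 2 * (2 + 2 * A * c1) *
        (C0 * ∑ l ∈ Finset.range (n + 1), l2sq τ (pd 0 l W) s) := by gcongr
      have h3 : 0 ≤ 2 * A * ∑ l ∈ Finset.range (n + 1), l2sq τ (pd 0 l W) s := by positivity
      have h4 : 0 ≤ 2 * (2 + 2 * A * c1) * C0 * l2sq τ (pd 0 (n + 1) W) s :=
        mul_nonneg (by positivity) (hnn _ _)
      linarith
    · have hch := chain_le (A := fun i => l2sq τ (pd (n + 1 - i) i W) s) (n := n + 1) hE0 (hnn _ _)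
        (fun i hi => by
          have := (hcomm (n - i) i (by omega)).2
          rwa [show n - i + 1 = n + 1 - i by omega, show n - i = n + 1 - (i + 1) by omega] at this)
      have h1 := fin (l2sq τ (pd (n + 1) 0 W) s) (hnn _ _) (fun i j hij => by
        have := hch j (by omega)
        rwa [show n + 1 - j = i by omega] at this)
      rw [Finset.sum_range_succ, mul_add]
      have p0 : 0 ≤ ∑ l ∈ Finset.range (n + 1), l2sq τ (pd l 0 W) s := Finset.sum_nonneg fun _ _ => hnn _ _
      have h2 : 2 * (2 + 2 * A * c1) * X ≤ 2 * (2 + 2 * A * c1) *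
        (C0 * ∑ l ∈ Finset.range (n + 1), l2sq τ (pd l 0 W) s) := by gcongr
      have h3 : 0 ≤ 2 * A * ∑ l ∈ Finset.range (n + 1), l2sq τ (pd l 0 W) s := by positivity
      have h4 : 0 ≤ 2 * (2 + 2 * A * c1) * C0 * l2sq τ (pd (n + 1) 0 W) s :=
        mul_nonneg (by positivity) (hnn _ _)
      linarith

end LinSys

/-! ### Interpolation -/

/-- A log-convex sequence with last term at most `1`. -/
theorem pow_le_of_logConvex {x : ℕ → ℝ} {k : ℕ} (h0 : ∀ l, 0 ≤ x l)
    (hlog : ∀ l, l + 2 ≤ k → x (l + 1) ^ 2 ≤ x l * x (l + 2)) (hk : x k ≤ 1) :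
    ∀ l ≤ k, x l ^ k ≤ x 0 ^ (k - l) := by
  -- The logarithmic increments are nondecreasing, so their average up to `l` is at most the next
  -- one. A vanishing term is treated apart, since the induction divides by a power of it.
  have step : ∀ l, l + 1 ≤ k → x l ^ (l + 1) ≤ x 0 * x (l + 1) ^ l := by
    intro l hl
    induction l with
    | zero => simp
    | succ l ih =>
      have ih := ih (by omega)
      have h1 := hlog l (by omega)
      rcases (h0 (l + 1)).eq_or_lt with hz | hpos
      · rw [← hz]
        have := h0 0
        have := h0 (l + 1 + 1)
        rw [zero_pow (by omega)]
        positivity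
      · have h2 : x (l + 1) ^ l * x (l + 1) ^ (l + 2) ≤ x (l + 1) ^ l * (x 0 * x (l + 2) ^ (l + 1)) := by
          calc x (l + 1) ^ l * x (l + 1) ^ (l + 2) = (x (l + 1) ^ 2) ^ (l + 1) := by ring
            _ ≤ (x l * x (l + 2)) ^ (l + 1) := pow_le_pow_left₀ (sq_nonneg _) h1 _
            _ = x l ^ (l + 1) * x (l + 2) ^ (l + 1) := mul_pow _ _ _
            _ ≤ (x 0 * x (l + 1) ^ l) * x (l + 2) ^ (l + 1) :=
              mul_le_mul_of_nonneg_right ih (pow_nonneg (h0 _) _)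
            _ = _ := by ring
        exact le_of_mul_le_mul_left h2 (pow_pos hpos l)
  -- Descending from the last term, which is at most one, each step combines the previous estimate
  -- with the bound from below.
  have down : ∀ d ≤ k, x (k - d) ^ k ≤ x 0 ^ d := by
    intro d hd
    induction d with
    | zero => simpa using pow_le_one₀ (h0 k) hk
    | succ d ih =>
      have ih := ih (by omega)
      set l := k - (d + 1) with hl
      have e : k - d = l + 1 := by omega
      rw [e] at ih
      have h1 := step l (by omega)
      have h2 : (x l ^ k) ^ (l + 1) ≤ (x 0 ^ (d + 1)) ^ (l + 1) := by
        calc (x l ^ k) ^ (l + 1) = (x l ^ (l + 1)) ^ k := by rw [← pow_mul, ← pow_mul, mul_comm]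
          _ ≤ (x 0 * x (l + 1) ^ l) ^ k := pow_le_pow_left₀ (pow_nonneg (h0 _) _) h1 _
          _ = x 0 ^ k * (x (l + 1) ^ k) ^ l := by rw [mul_pow, ← pow_mul, ← pow_mul, mul_comm l k]
          _ ≤ x 0 ^ k * (x 0 ^ d) ^ l := by
            have := h0 0
            have := h0 (l + 1)
            gcongr
          _ = (x 0 ^ (d + 1)) ^ (l + 1) := by
            rw [← pow_mul, ← pow_add, ← pow_mul]
            congr 1
            have : k = l + d + 1 := by omega
            rw [this]; ring
      exact (pow_le_pow_iff_left₀ (pow_nonneg (h0 _) _) (pow_nonneg (h0 _) _) (by omega)).1 h2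
  intro l hl
  have := down (k - l) (by omega)
  rwa [show k - (k - l) = l by omega] at this

/-! ### Decay of all derivatives -/

theorem exists_mem_Icc_of_periodicOn {E : Type} {τ : ℝ} (hτ : 0 < τ) {f : ℝ → E}
    (hp : ∀ t, f (t + τ) = f t) (t : ℝ) : ∃ y ∈ Set.Icc 0 τ, f t = f y := by
  have hper : Function.Periodic f τ := hp
  obtain ⟨y, hy, e⟩ := hper.exists_mem_Ico₀ hτ t
  exact ⟨y, ⟨hy.1, hy.2.le⟩, e⟩

theorem le_rpow_inv_of_pow_le {x y : ℝ} {k : ℕ} (hk : k ≠ 0) (hx : 0 ≤ x)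
    (h : x ^ k ≤ y) : x ≤ y ^ (1 / (k : ℝ)) := by
  have h1 : (x ^ k) ^ (1 / (k : ℝ)) = x := by
    rw [one_div]; exact Real.pow_rpow_inv_natCast hx hk
  rw [← h1]
  exact Real.rpow_le_rpow (pow_nonneg hx k) h (by positivity)

namespace LinSys

variable {τ a b : ℝ} {κ : ℝ → ℝ → ℝ} {M c : ℝ → ℝ → E4 →L[ℝ] E4} {W : ℝ → ℝ → E4}

theorem smallCoef (h : LinSys τ a b κ M c W) {k : ℕ} {η : ℝ}
    (hM : ∀ s ∈ Set.Icc a b, ∀ t, cSize k M s t ≤ η)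
    (hc : ∀ s ∈ Set.Icc a b, ∀ t, cSize k c s t ≤ η)
    (hκ : ∀ s ∈ Set.Icc a b, ∀ t, cSize (k - 1) (dS κ) s t ≤ η) :
    SmallCoef a b κ M c k (3 ^ k * η) := by
  have hη : 0 ≤ η := (cSize_nonneg _ _ _ _).trans (hM a (Set.left_mem_Icc.2 h.lt.le) 0)
  have h3 : ∀ n, n < k → (3 : ℝ) ^ n * η ≤ 3 ^ k * η := fun n hn =>
    mul_le_mul_of_nonneg_right (pow_le_pow_right₀ (by norm_num) hn.le) hη
  refine ⟨fun n l hn _ s hs t => ?_, fun n l hn _ s hs t => ?_, fun s hs t => ?_⟩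
  · refine (cSize_mono (show 1 ≤ k - n by omega) _ _ _).trans
      ((cSize_leibnizCoef_le h.smooth_M (Smooth2.const 0) (hM s hs t) ?_ n l hn.le).trans (h3 n hn))
    rw [dS_const, cSize_zero_fun]; exact hη
  · refine (cSize_mono (show 1 ≤ k - n by omega) _ _ _).trans
      ((cSize_leibnizCoef_le h.smooth_c (smooth_kop h.smooth_κ) (hc s hs t) ?_ n l hn.le).trans (h3 n hn))
    rw [dS_kop h.smooth_κ]
    exact (cSize_kop_le h.smooth_κ.dS _ s t).trans (hκ s hs t)
  · refine (norm_le_cSize (k - 1) (dS κ) s t).trans ((hκ s hs t).trans ?_)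
    exact le_mul_of_one_le_left hη (one_le_pow₀ (by norm_num))

/-- The condition on `σ` makes the derivative of order `k` have norm at most one, so log-convexity
in the order applies; `l < k` leaves at least one factor of the norm of `W`. This is the origin of
the exponent `1 / k`. -/
theorem l2sq_pd_t_le (h : LinSys τ a b κ M c W) {k : ℕ} (hk : 1 ≤ k) {σ s : ℝ}
    (hs : s ∈ Set.Icc a b) (hσ : τ * σ ^ 2 ≤ 1) (hW : ∀ t, cSize k W s t ≤ σ) {l : ℕ} (hl : l < k) :
    l2sq τ (pd 0 l W) s ≤ l2sq τ W s ^ (1 / (k : ℝ)) := by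
  have hτ := h.τ_pos.le
  have hnn := fun l => l2sq_nonneg hτ (pd 0 l W) s
  have hle : ∀ l ≤ k, l2sq τ (pd 0 l W) s ≤ 1 := fun l hl =>
    (l2sq_le_sq hτ (h.smooth_W.pd 0 l) fun t =>
      (norm_pd_le_cSize (by omega) _ _ _).trans (hW t)).trans hσ
  have hp := fun l => h.periodic_W.pd h.smooth_W h.lt 0 l s hs 0
  simp only [zero_add] at hp
  have hd : ∀ l t, HasDerivAt (fun t => pd 0 l W s t) (pd 0 (l + 1) W s t) t := fun l t => by
    have := (h.smooth_W.pd 0 l).hasDerivAt_snd s t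
    rwa [h.smooth_W.dT_pd] at this
  have key := pow_le_of_logConvex (x := fun l => l2sq τ (pd 0 l W) s) (k := k) hnn
    (fun l _ => sq_integral_deriv_le hτ (hd l) (hd (l + 1))
      ((h.smooth_W.pd 0 (l + 2)).continuous_snd s) (hp l) (hp (l + 1))) (hle k le_rfl) l hl.le
  refine le_rpow_inv_of_pow_le (by omega) (hnn l) (key.trans ?_)
  exact (pow_le_pow_of_le_one (hnn 0) (hle 0 (by omega)) (show 1 ≤ k - l by omega)).trans_eq (pow_one _)

/-- The derivative one order higher is only known to be at most `σ`. The one-dimensional Sobolev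
inequality then bounds the squared supremum by the `L²`-norm itself rather than its square, hence
the fourth power. -/
theorem norm_pow_four_le (h : LinSys τ a b κ M c W) {n : ℕ} {σ s : ℝ}
    (hs : s ∈ Set.Icc a b) (hW : ∀ t, cSize (n + 1) W s t ≤ σ) {i j : ℕ}
    (hij : i + j ≤ n) (t : ℝ) :
    ‖pd i j W s t‖ ^ 4 ≤ (2 * τ⁻¹ + 8 * τ) * σ ^ 2 * l2c τ n W s := by
  have hτ := h.τ_pos
  have hσ : 0 ≤ σ := (cSize_nonneg _ _ _ _).trans (hW 0)
  obtain ⟨y, hy, e⟩ := exists_mem_Icc_of_periodicOn hτ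
    (h.periodic_W.pd h.smooth_W h.lt i j s hs) t
  rw [e]
  have hd : ∀ t, HasDerivAt (fun t => pd i j W s t) (pd i (j + 1) W s t) t := fun t => by
    have := (h.smooth_W.pd i j).hasDerivAt_snd s t
    rwa [h.smooth_W.dT_pd] at this
  have c0 := (h.smooth_W.pd i j).continuous_snd s
  have c1 := (h.smooth_W.pd i (j + 1)).continuous_snd s
  have h1 := norm_sq_le_integral hτ hd c1 hy
  set X := l2c τ n W s with hX
  have hX0 : 0 ≤ X := l2c_nonneg hτ.le _ _ _
  have h2 : ∫ t in (0 : ℝ)..τ, ‖pd i j W s t‖ ^ 2 ≤ X := by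
    have := l2sq_le_l2c (C := 1) (n := n) (s := s) hτ.le (h.smooth_W.pd i j) h.smooth_W
      (fun t => by rw [one_mul]; exact norm_pd_le_cSize hij _ _ _)
    rwa [one_pow, one_mul] at this
  have hXσ : X ≤ τ * σ ^ 2 :=
    integral_le_const_mul (f := fun t => cSize n W s t ^ 2) hτ.le
      ((cSize_continuous h.smooth_W n s).pow 2) fun t _ =>
      pow_le_pow_left₀ (cSize_nonneg _ _ _ _) ((cSize_mono (Nat.le_succ n) _ _ _).trans (hW t)) 2
  set I := ∫ t in (0 : ℝ)..τ, ‖pd i j W s t‖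
  have hI : I ^ 2 ≤ τ * X := (sq_integral_le hτ.le c0.norm).trans
    (mul_le_mul_of_nonneg_left h2 hτ.le)
  have h3 : ∫ t in (0 : ℝ)..τ, ‖pd i j W s t‖ * ‖pd i (j + 1) W s t‖ ≤ σ * I := by
    rw [← intervalIntegral.integral_const_mul]
    refine intervalIntegral.integral_mono_on hτ.le (Continuous.intervalIntegrable (by fun_prop) _ _)
      (Continuous.intervalIntegrable (by fun_prop) _ _) fun t _ => ?_
    rw [mul_comm]
    exact mul_le_mul_of_nonneg_right ((norm_pd_le_cSize (by omega) _ _ _).trans (hW t)) (norm_nonneg _)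
  have hτi : 0 < τ⁻¹ := inv_pos.2 hτ
  have h4 : ‖pd i j W s y‖ ^ 2 ≤ τ⁻¹ * X + 2 * (σ * I) := by
    have := mul_le_mul_of_nonneg_left h2 hτi.le
    linarith
  calc ‖pd i j W s y‖ ^ 4 = (‖pd i j W s y‖ ^ 2) ^ 2 := by ring
    _ ≤ (τ⁻¹ * X + 2 * (σ * I)) ^ 2 := pow_le_pow_left₀ (sq_nonneg _) h4 2
    _ ≤ 2 * (τ⁻¹ * X) ^ 2 + 8 * σ ^ 2 * I ^ 2 := by nlinarith [sq_nonneg (τ⁻¹ * X - 2 * (σ * I))]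
    _ ≤ 2 * (τ⁻¹ ^ 2 * X * (τ * σ ^ 2)) + 8 * σ ^ 2 * (τ * X) := by
      have e1 : (τ⁻¹ * X) ^ 2 ≤ τ⁻¹ ^ 2 * X * (τ * σ ^ 2) := by
        rw [mul_pow, sq X, ← mul_assoc]
        gcongr
      have e2 : 8 * σ ^ 2 * I ^ 2 ≤ 8 * σ ^ 2 * (τ * X) := by gcongr
      linarith
    _ = _ := by
      field_simp

/-- Decay of all derivatives of a small solution of the linear system. -/
theorem exists_decay_cSize {τ Kb m : ℝ} (hτ : 0 < τ) (hm : 0 < m) : ∃ μ : ℝ, 0 < μ ∧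
    ∀ (k : ℕ) (CK : ℝ), 1 ≤ k → ∃ η C : ℝ, 0 < η ∧ 0 < C ∧
    ∀ (a b : ℝ) (κ : ℝ → ℝ → ℝ) (M c : ℝ → ℝ → E4 →L[ℝ] E4) (W : ℝ → ℝ → E4) (σ : ℝ),
      LinSys τ a b κ M c W → τ * σ ^ 2 ≤ 1 →
      (∀ s ∈ Set.Icc a b, ∀ t, cSize k M s t ≤ η) →
      (∀ s ∈ Set.Icc a b, ∀ t, cSize k c s t ≤ η) →
      (∀ s ∈ Set.Icc a b, ∀ t, cSize (k - 1) (dS κ) s t ≤ η) →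
      (∀ s ∈ Set.Icc a b, ∀ t, cSize k κ s t ≤ CK) →
      (∀ s ∈ Set.Icc a b, ∀ t, |κ s t| ≤ Kb) →
      (∀ s ∈ Set.Icc a b, m ≤ |∫ t in (0 : ℝ)..τ, κ s t|) →
      (∀ s ∈ Set.Icc a b, ∀ t, cSize k W s t ≤ σ) → ∀ s ∈ Set.Icc a b,
      l2c τ (k - 1) W s ≤ C * (max (l2sq τ W a) (l2sq τ W b) ^ (1 / (k : ℝ)) *
          (Real.cosh (μ * (s - (a + b) / 2)) / Real.cosh (μ * (b - a) / 2))) ∧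
      ∀ t, cSize (k - 1) W s t ^ 4 ≤ C * σ ^ 2 *
        (max (l2sq τ W a) (l2sq τ W b) ^ (1 / (k : ℝ)) *
          (Real.cosh (μ * (s - (a + b) / 2)) / Real.cosh (μ * (b - a) / 2))) := by
  obtain ⟨μ, hμ, hdec⟩ := exists_decay (Kb := Kb) hτ hm
  refine ⟨μ, hμ, fun k CK hk => ?_⟩
  obtain ⟨η1, hη1, hdec⟩ := hdec k
  obtain ⟨η2, C2, hη2, hC2, hcomp⟩ := exists_l2c_le (k - 1) CK
  -- At the ends: from `∂_s` to `∂_t` (`C2`), interpolation of `k` terms, and a sum over `k`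
  -- derivatives. Inside: back from `∂_s` to all derivatives (`C2` again). The added one keeps the
  -- constant positive.
  set C3 : ℝ := C2 * (k * (C2 * (k * 1))) + 1 with hC3
  have hC3p : 0 < C3 := by positivity
  have hτi : 0 < τ⁻¹ := inv_pos.2 hτ
  refine ⟨min (η1 / 3 ^ k) η2, (1 + (k : ℝ) ^ 8 * (2 * τ⁻¹ + 8 * τ)) * C3, by positivity,
    by positivity, ?_⟩
  intro a b κ M c W σ h hσ hM hc hκs hκ hκb hκm hW
  have hk1 : k - 1 + 1 = k := by omega
  set η := min (η1 / 3 ^ k) η2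
  have h3η : 3 ^ k * η ≤ η1 := by
    have : η ≤ η1 / 3 ^ k := min_le_left _ _
    rw [le_div_iff₀ (by positivity)] at this
    linarith
  have hsm := h.smallCoef hM hc hκs
  have hsm1 : SmallCoef a b κ M c k η1 :=
    ⟨fun n l hn hl s hs t => (hsm.m n l hn hl s hs t).trans h3η,
      fun n l hn hl s hs t => (hsm.c n l hn hl s hs t).trans h3η,
      fun s hs t => (hsm.κ s hs t).trans h3η⟩
  have hc' : ∀ s ∈ Set.Icc a b,
      l2c τ (k - 1) W s ≤ C2 * ∑ l ∈ Finset.range k, l2sq τ (pd 0 l W) s ∧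
      l2c τ (k - 1) W s ≤ C2 * ∑ l ∈ Finset.range k, l2sq τ (pd l 0 W) s := by
    intro s hs
    have := hcomp h s hs
      (fun t => (cSize_mono (Nat.sub_le k 1) _ _ _).trans ((hM s hs t).trans (min_le_right _ _)))
      (fun t => (cSize_mono (Nat.sub_le k 1) _ _ _).trans ((hc s hs t).trans (min_le_right _ _)))
      (fun t => (cSize_mono (Nat.sub_le k 1) _ _ _).trans (hκ s hs t))
    rwa [hk1] at this
  set X0 := max (l2sq τ W a) (l2sq τ W b) ^ (1 / (k : ℝ)) with hX0
  have hmax0 : 0 ≤ max (l2sq τ W a) (l2sq τ W b) := (l2sq_nonneg hτ.le W a).trans (le_max_left _ _)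
  have hX0p : 0 ≤ X0 := Real.rpow_nonneg hmax0 _
  -- The norm of `W` is the only information retained at the ends: the equation turns
  -- `s`-derivatives into `t`-derivatives, and these are interpolated.
  have bdry : ∀ s ∈ Set.Icc a b, l2sq τ W s ≤ max (l2sq τ W a) (l2sq τ W b) →
      ∑ l ∈ Finset.range k, l2sq τ (pd l 0 W) s ≤ k * (C2 * (k * X0)) := by
    intro s hs hle
    have h1 : ∑ l ∈ Finset.range k, l2sq τ (pd 0 l W) s ≤ k * X0 := by
      refine (Finset.sum_le_card_nsmul _ _ X0 fun l hl => ?_).trans_eq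
        (by rw [Finset.card_range, nsmul_eq_mul])
      refine (h.l2sq_pd_t_le hk hs hσ (hW s hs) (Finset.mem_range.1 hl)).trans ?_
      exact Real.rpow_le_rpow (l2sq_nonneg hτ.le _ _) hle (by positivity)
    refine (Finset.sum_le_card_nsmul _ _ (C2 * (k * X0)) fun l hl => ?_).trans_eq
        (by rw [Finset.card_range, nsmul_eq_mul])
    have hl := Finset.mem_range.1 hl
    have h2 := l2sq_le_l2c (C := 1) (n := k - 1) (s := s) hτ.le (h.smooth_W.pd l 0) h.smooth_W
      (fun t => by rw [one_mul]; exact norm_pd_le_cSize (by omega) _ _ _)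
    rw [one_pow, one_mul] at h2
    refine h2.trans ((hc' s hs).1.trans ?_)
    gcongr
  intro s hs
  have hBs := hdec a b κ M c W h hsm1 hκb hκm (k * (C2 * (k * X0)))
    (bdry a (Set.left_mem_Icc.2 h.lt.le) (le_max_left _ _))
    (bdry b (Set.right_mem_Icc.2 h.lt.le) (le_max_right _ _)) s hs
  set ch := Real.cosh (μ * (s - (a + b) / 2)) / Real.cosh (μ * (b - a) / 2) with hch
  have hch0 : 0 < ch := div_pos (Real.cosh_pos _) (Real.cosh_pos _)
  have hY0 : 0 ≤ X0 * ch := by positivity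
  have hX : l2c τ (k - 1) W s ≤ C3 * (X0 * ch) := by
    refine (hc' s hs).2.trans ?_
    calc C2 * ∑ l ∈ Finset.range k, l2sq τ (pd l 0 W) s ≤ C2 * (k * (C2 * (k * X0)) * ch) := by gcongr
      _ = (C3 - 1) * (X0 * ch) := by rw [hC3]; ring
      _ ≤ C3 * (X0 * ch) := by gcongr; linarith
  constructor
  · refine hX.trans ?_
    refine mul_le_mul_of_nonneg_right (le_mul_of_one_le_left hC3p.le ?_) hY0
    have : 0 ≤ (k : ℝ) ^ 8 * (2 * τ⁻¹ + 8 * τ) := by positivity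
    linarith
  · intro t
    set Y := (2 * τ⁻¹ + 8 * τ) * σ ^ 2 * l2c τ (k - 1) W s with hY
    have hYp : 0 ≤ Y := mul_nonneg (by positivity) (l2c_nonneg hτ.le _ _ _)
    have hK : ∀ i j : ℕ, i + j ≤ k - 1 → ‖pd i j W s t‖ ≤ Real.sqrt (Real.sqrt Y) := by
      intro i j hij
      have := h.norm_pow_four_le hs (n := k - 1) (by rw [hk1]; exact hW s hs) hij t
      refine Real.le_sqrt_of_sq_le (Real.le_sqrt_of_sq_le ?_)
      rw [← pow_mul]
      exact this
    have h5 := cSize_le (Real.sqrt_nonneg _) hK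
    have h6 : cSize (k - 1) W s t ^ 4 ≤ (k : ℝ) ^ 8 * Y := by
      calc cSize (k - 1) W s t ^ 4 ≤ ((((k - 1 : ℕ) : ℝ) + 1) ^ 2 * Real.sqrt (Real.sqrt Y)) ^ 4 :=
            pow_le_pow_left₀ (cSize_nonneg _ _ _ _) h5 4
        _ = (((k - 1 : ℕ) : ℝ) + 1) ^ 8 * ((Real.sqrt (Real.sqrt Y)) ^ 2) ^ 2 := by ring
        _ = (k : ℝ) ^ 8 * Y := by
          rw [Real.sq_sqrt (Real.sqrt_nonneg _), Real.sq_sqrt hYp]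
          congr 2
          exact_mod_cast congrArg (Nat.cast : ℕ → ℝ) hk1
    refine h6.trans ?_
    calc (k : ℝ) ^ 8 * Y ≤ (k : ℝ) ^ 8 * ((2 * τ⁻¹ + 8 * τ) * σ ^ 2 * (C3 * (X0 * ch))) := by
          rw [hY]; gcongr
      _ ≤ (k : ℝ) ^ 8 * ((2 * τ⁻¹ + 8 * τ) * σ ^ 2 * (C3 * (X0 * ch))) + C3 * σ ^ 2 * (X0 * ch) :=
          le_add_of_nonneg_right (by positivity)
      _ = _ := by ring

end LinSys

/-! ### Globally defined coefficients near the torus -/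

theorem contDiff_E3_mk {V : Type} [NormedAddCommGroup V] [NormedSpace ℝ V] {n : WithTop ℕ∞}
    {a b c : V → ℝ} (ha : ContDiff ℝ n a) (hb : ContDiff ℝ n b) (hc : ContDiff ℝ n c) :
    ContDiff ℝ n (fun v => (!₂[a v, b v, c v] : E3)) := by
  rw [contDiff_euclidean]
  intro i; fin_cases i
  · exact ha
  · exact hb
  · exact hc

theorem contDiff_E4_mk {V : Type} [NormedAddCommGroup V] [NormedSpace ℝ V] {n : WithTop ℕ∞}
    {a b c d : V → ℝ} (ha : ContDiff ℝ n a) (hb : ContDiff ℝ n b) (hc : ContDiff ℝ n c)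
    (hd : ContDiff ℝ n d) : ContDiff ℝ n (fun v => (!₂[a v, b v, c v, d v] : E4)) := by
  rw [contDiff_euclidean]
  intro i; fin_cases i
  · exact ha
  · exact hb
  · exact hc
  · exact hd

theorem contDiff_coord3 (i : Fin 3) {n : WithTop ℕ∞} : ContDiff ℝ n (fun q : E3 => q i) :=
  (EuclideanSpace.proj (𝕜 := ℝ) i : E3 →L[ℝ] ℝ).contDiff

namespace MorseBottNbhd

variable (G : MorseBottNbhd)

/-- The bump function used to cut off the `y`-coordinate. -/
def bump : ContDiffBump (0 : ℝ) := ⟨G.ρ / 4, G.ρ / 2, by linarith [G.ρ_pos], by linarith [G.ρ_pos]⟩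

/-- A smooth retraction-like map to `{|y| < ρ}` that is the identity near the torus. -/
def cut (q : E3) : E3 := !₂[q 0, q 1, q 2 * G.bump (q 2)]

theorem cut_mem (q : E3) : |G.cut q 2| < G.ρ := by
  change |q 2 * G.bump (q 2)| < G.ρ
  have hρ := G.ρ_pos
  by_cases h : |q 2| < G.ρ / 2
  · rw [abs_mul, abs_of_nonneg (G.bump.nonneg)]
    have h1 : |q 2| * G.bump (q 2) ≤ |q 2| := mul_le_of_le_one_right (abs_nonneg _) G.bump.le_one
    linarith
  · have : G.bump (q 2) = 0 := G.bump.zero_of_le_dist (by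
      rw [Real.dist_eq, sub_zero]; exact not_lt.1 h)
    rw [this, mul_zero, abs_zero]; exact hρ

theorem cut_eq {q : E3} (h : |q 2| < G.ρ / 4) : G.cut q = q := by
  have : G.bump (q 2) = 1 := G.bump.one_of_mem_closedBall (by
    rw [Metric.mem_closedBall, Real.dist_eq, sub_zero]; exact h.le)
  ext i; fin_cases i <;> simp [cut, this]

theorem cut_contDiff : ContDiff ℝ ∞ G.cut :=
  contDiff_E3_mk (contDiff_coord3 0) (contDiff_coord3 1)
    ((contDiff_coord3 2).mul (G.bump.contDiff.comp (contDiff_coord3 2)))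

/-- The conformal factor `h`, cut off. -/
def hc (q : E3) : ℝ := G.h (G.cut q)

/-- The complex structure `j`, cut off. -/
def jc (q : E3) : E3 →L[ℝ] E3 := G.j (G.cut q)

theorem hc_contDiff : ContDiff ℝ ∞ G.hc := G.h_smooth.comp_contDiff G.cut_contDiff G.cut_mem

theorem jc_contDiff : ContDiff ℝ ∞ G.jc := G.j_smooth.comp_contDiff G.cut_contDiff G.cut_mem

theorem hc_pos (q : E3) : 0 < G.hc q := G.h_pos _ (G.cut_mem q)

theorem cut_add_ez (q : E3) : G.cut (q + G.τ • ez) = G.cut q + G.τ • ez := by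
  ext i; fin_cases i <;> simp [cut, ez]

theorem cut_add_ex (q : E3) : G.cut (q + ex) = G.cut q + ex := by
  ext i; fin_cases i <;> simp [cut, ex]

theorem hc_add_ez (q : E3) : G.hc (q + G.τ • ez) = G.hc q := by
  unfold hc; rw [cut_add_ez]; exact (G.h_periodic _ (G.cut_mem q)).1

theorem hc_add_ex (q : E3) : G.hc (q + ex) = G.hc q := by
  unfold hc; rw [cut_add_ex]; exact (G.h_periodic _ (G.cut_mem q)).2

theorem jc_add_ez (q : E3) : G.jc (q + G.τ • ez) = G.jc q := by
  unfold jc; rw [cut_add_ez]; exact (G.j_periodic _ (G.cut_mem q)).1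

theorem jc_add_ex (q : E3) : G.jc (q + ex) = G.jc q := by
  unfold jc; rw [cut_add_ex]; exact (G.j_periodic _ (G.cut_mem q)).2

theorem isOpen_near : IsOpen {q : E3 | |q 2| < G.ρ / 4} :=
  isOpen_lt ((contDiff_coord3 2 (n := 0)).continuous.abs) continuous_const

theorem hc_eventuallyEq {q : E3} (h : |q 2| < G.ρ / 4) : G.hc =ᶠ[nhds q] G.h := by
  filter_upwards [G.isOpen_near.mem_nhds h] with r hr
  unfold hc; rw [G.cut_eq hr]

theorem near_of_zero {q : E3} (h : q 2 = 0) : |q 2| < G.ρ / 4 := by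
  rw [h, abs_zero]; linarith [G.ρ_pos]

theorem hc_torus {q : E3} (h : q 2 = 0) : G.hc q = 1 := by
  rw [(G.hc_eventuallyEq (G.near_of_zero h)).eq_of_nhds]; exact (G.h_torus q h).1

theorem fderiv_hc_torus {q : E3} (h : q 2 = 0) : fderiv ℝ G.hc q = 0 := by
  rw [(G.hc_eventuallyEq (G.near_of_zero h)).fderiv_eq]; exact (G.h_torus q h).2

theorem jc_ex {q : E3} (h : q 2 = 0) : G.jc q ex = ey := by
  unfold jc; rw [G.cut_eq (G.near_of_zero h)]; exact G.j_torus q h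

theorem jc_ey {q : E3} (h : q 2 = 0) : G.jc q ey = -ex := by
  have h1 := G.jc_ex h
  unfold jc at *
  rw [G.cut_eq (G.near_of_zero h)] at *
  have h2 := (G.j_compatible q ex (by rw [h, abs_zero]; exact G.ρ_pos)
    (by rw [contactForm_apply]; simp [ex, h])).2.1
  rwa [h1] at h2

/-- The conformal factor `e^{δ f} h`, cut off. -/
def pertc (δ : ℝ) (q : E3) : ℝ := Real.exp (δ * G.f (q 1)) * G.hc q

theorem pertc_pos (δ : ℝ) (q : E3) : 0 < G.pertc δ q := mul_pos (Real.exp_pos _) (G.hc_pos q)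

theorem pertc_contDiff {V : Type} [NormedAddCommGroup V] [NormedSpace ℝ V] {d : V → ℝ} {r : V → E3}
    (hd : ContDiff ℝ ∞ d) (hr : ContDiff ℝ ∞ r) : ContDiff ℝ ∞ (fun v => G.pertc (d v) (r v)) :=
  (Real.contDiff_exp.comp (hd.mul (G.f_smooth.comp ((contDiff_coord3 1).comp hr)))).mul
    (G.hc_contDiff.comp hr)

theorem pertc_zero : G.pertc 0 = G.hc := by
  funext q; simp [pertc]

theorem f_add_one (x : ℝ) : G.f (x + 1) = G.f x := G.f_periodic x

theorem pertc_add_ez (δ : ℝ) (q : E3) : G.pertc δ (q + G.τ • ez) = G.pertc δ q := by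
  unfold pertc; rw [hc_add_ez]; simp [ez]

theorem pertc_add_ex (δ : ℝ) (q : E3) : G.pertc δ (q + ex) = G.pertc δ q := by
  unfold pertc; rw [hc_add_ex]; simp [ex, f_add_one]

theorem pert_eventuallyEq (δ : ℝ) {q : E3} (h : |q 2| < G.ρ / 4) :
    G.pertc δ =ᶠ[nhds q] G.pert δ := by
  filter_upwards [G.hc_eventuallyEq h] with r hr
  unfold pertc pert; rw [hr]

/-- The Reeb field of the cut-off form. -/
def reebc (p : ℝ × E3) : E3 := reeb (G.pertc p.1) p.2

theorem reeb_congr {F F' : E3 → ℝ} {q : E3} (h : F =ᶠ[nhds q] F') : reeb F q = reeb F' q := by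
  have h1 : (fun r => (F r)⁻¹) =ᶠ[nhds q] fun r => (F' r)⁻¹ := by
    filter_upwards [h] with r hr; rw [hr]
  unfold reeb
  rw [h.eq_of_nhds, h1.fderiv_eq]

theorem reeb_comp_add {F : E3 → ℝ} {w : E3} (hw : w 2 = 0) (h : ∀ q, F (q + w) = F q) (q : E3) :
    reeb F (q + w) = reeb F q := by
  have h1 : fderiv ℝ (fun r => (F r)⁻¹) (q + w) = fderiv ℝ (fun r => (F r)⁻¹) q := by
    rw [← fderiv_comp_add_right w]
    simp only [h]
  unfold reeb
  simp [h1, h, hw]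

/-- The derivative of `1 / (e^{δ f} h)`. -/
def dHc (p : ℝ × E3) : E3 →L[ℝ] ℝ := fderiv ℝ (fun r => (G.pertc p.1 r)⁻¹) p.2

theorem Hc_contDiff : ContDiff ℝ ∞ (fun v : ℝ × E3 => (G.pertc v.1 v.2)⁻¹) :=
  (G.pertc_contDiff contDiff_fst contDiff_snd).inv fun _ => (G.pertc_pos _ _).ne'

theorem dHc_contDiff : ContDiff ℝ ∞ G.dHc := by
  refine ContDiff.fderiv (m := ∞) (f := fun (p : ℝ × E3) r => (G.pertc p.1 r)⁻¹)
    (g := fun p => p.2) ?_ contDiff_snd (by simp)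
  exact (G.pertc_contDiff (contDiff_fst.comp contDiff_fst) contDiff_snd).inv
    fun _ => (G.pertc_pos _ _).ne'

theorem reebc_eq (p : ℝ × E3) : G.reebc p = !₂[(G.pertc p.1 p.2)⁻¹ - p.2 2 * G.dHc p ey,
    -G.dHc p ey, G.dHc p ex + p.2 2 * G.dHc p ez] := rfl

theorem reebc_contDiff : ContDiff ℝ ∞ G.reebc := by
  have e : G.reebc = fun p => !₂[(G.pertc p.1 p.2)⁻¹ - p.2 2 * G.dHc p ey,
    -G.dHc p ey, G.dHc p ex + p.2 2 * G.dHc p ez] := funext G.reebc_eq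
  rw [e]
  have hd : ∀ v, ContDiff ℝ ∞ fun p => G.dHc p v := fun v => G.dHc_contDiff.clm_apply contDiff_const
  have hy : ContDiff ℝ ∞ fun p : ℝ × E3 => p.2 2 := (contDiff_coord3 2).comp contDiff_snd
  exact contDiff_E3_mk (G.Hc_contDiff.sub (hy.mul (hd ey))) (hd ey).neg
    ((hd ex).add (hy.mul (hd ez)))

/-- The almost complex structure built from the cut-off data. -/
def acsc (p : ℝ × E3) : E4 →L[ℝ] E4 := LinearMap.toContinuousLinearMap
  { toFun := fun V =>
      let l : ℝ := G.pertc p.1 p.2 * (V 1 - p.2 2 * V 2)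
      let W : E3 := V 0 • G.reebc p + G.jc p.2 (!₂[V 1, V 2, V 3] - l • G.reebc p)
      !₂[-l, W 0, W 1, W 2]
    map_add' := fun v w => by
      have e : (!₂[(v + w) 1, (v + w) 2, (v + w) 3] : E3)
          - (G.pertc p.1 p.2 * ((v + w) 1 - p.2 2 * (v + w) 2)) • G.reebc p
          = (!₂[v 1, v 2, v 3] - (G.pertc p.1 p.2 * (v 1 - p.2 2 * v 2)) • G.reebc p)
          + (!₂[w 1, w 2, w 3] - (G.pertc p.1 p.2 * (w 1 - p.2 2 * w 2)) • G.reebc p) := by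
        ext i; fin_cases i <;> simp <;> ring
      simp only [e, map_add]
      ext i; fin_cases i <;> simp <;> ring
    map_smul' := fun r v => by
      have e : (!₂[(r • v) 1, (r • v) 2, (r • v) 3] : E3)
          - (G.pertc p.1 p.2 * ((r • v) 1 - p.2 2 * (r • v) 2)) • G.reebc p
          = r • (!₂[v 1, v 2, v 3] - (G.pertc p.1 p.2 * (v 1 - p.2 2 * v 2)) • G.reebc p) := by
        ext i; fin_cases i <;> simp <;> ring
      simp only [e, map_smul]
      ext i; fin_cases i <;> simp <;> ring }

theorem acsc_apply (p : ℝ × E3) (V : E4) : G.acsc p V =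
    let l : ℝ := G.pertc p.1 p.2 * (V 1 - p.2 2 * V 2)
    let W : E3 := V 0 • G.reebc p + G.jc p.2 (!₂[V 1, V 2, V 3] - l • G.reebc p)
    !₂[-l, W 0, W 1, W 2] := rfl

theorem acs_eq_acsc (δ : ℝ) {q : E3} (h : |q 2| < G.ρ / 4) (V : E4) :
    G.acs δ q V = G.acsc (δ, q) V := by
  have h1 := G.pert_eventuallyEq δ h
  rw [acsc_apply]
  unfold acs
  simp only [contactForm_apply, reebc, reeb_congr h1, h1.eq_of_nhds, jc, G.cut_eq h]
  rfl

theorem acsc_contDiff : ContDiff ℝ ∞ G.acsc := by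
  rw [contDiff_clm_apply_iff]
  intro V
  have hl : ContDiff ℝ ∞ fun p : ℝ × E3 => G.pertc p.1 p.2 * (V 1 - p.2 2 * V 2) :=
    (G.pertc_contDiff contDiff_fst contDiff_snd).mul
      (contDiff_const.sub (((contDiff_coord3 2).comp contDiff_snd).mul contDiff_const))
  have h1 : ContDiff ℝ ∞ fun p : ℝ × E3 => V 0 • G.reebc p := G.reebc_contDiff.const_smul (V 0)
  have h2 : ContDiff ℝ ∞ fun p : ℝ × E3 =>
      (G.pertc p.1 p.2 * (V 1 - p.2 2 * V 2)) • G.reebc p := hl.smul G.reebc_contDiff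
  have h3 : ContDiff ℝ ∞ fun p : ℝ × E3 => G.jc p.2 := G.jc_contDiff.comp contDiff_snd
  have hW : ContDiff ℝ ∞ fun p : ℝ × E3 => V 0 • G.reebc p + G.jc p.2 (!₂[V 1, V 2, V 3]
      - (G.pertc p.1 p.2 * (V 1 - p.2 2 * V 2)) • G.reebc p) :=
    h1.add (h3.clm_apply (contDiff_const.sub h2))
  exact contDiff_E4_mk hl.neg ((contDiff_coord3 0).comp hW) ((contDiff_coord3 1).comp hW)
    ((contDiff_coord3 2).comp hW)

theorem acsc_add_ez (δ : ℝ) (q : E3) : G.acsc (δ, q + G.τ • ez) = G.acsc (δ, q) := by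
  ext1 V
  have e : G.reebc (δ, q + G.τ • ez) = G.reebc (δ, q) :=
    reeb_comp_add (by simp [ez]) (G.pertc_add_ez δ) q
  rw [acsc_apply, acsc_apply]
  simp only [e, pertc_add_ez, jc_add_ez]
  simp [ez]

theorem acsc_add_ex (δ : ℝ) (q : E3) : G.acsc (δ, q + ex) = G.acsc (δ, q) := by
  ext1 V
  have e : G.reebc (δ, q + ex) = G.reebc (δ, q) :=
    reeb_comp_add (by simp [ex]) (G.pertc_add_ex δ) q
  rw [acsc_apply, acsc_apply]
  simp only [e, pertc_add_ex, jc_add_ex]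
  simp [ex]

end MorseBottNbhd

namespace MorseBottNbhd

variable (G : MorseBottNbhd)

/-! ### Values and first derivatives on the torus -/

theorem dHc_torus (δ : ℝ) {q : E3} (h : q 2 = 0) (v : E3) :
    G.dHc (δ, q) v = -(Real.exp (δ * G.f (q 1)))⁻¹ * (δ * deriv G.f (q 1)) * v 1 := by
  have h1 : HasFDerivAt G.hc (0 : E3 →L[ℝ] ℝ) q := by
    have := (G.hc_contDiff.differentiable (by simp) q).hasFDerivAt
    rwa [G.fderiv_hc_torus h] at this
  have h2 : HasDerivAt (fun x => Real.exp (δ * G.f x))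
      (Real.exp (δ * G.f (q 1)) * (δ * deriv G.f (q 1))) (q 1) :=
    (((G.f_smooth.differentiable (by simp) (q 1)).hasDerivAt).const_mul δ).exp
  have h3 := h2.comp_hasFDerivAt q (EuclideanSpace.proj (𝕜 := ℝ) (1 : Fin 3) : E3 →L[ℝ] ℝ).hasFDerivAt
  have h4 := h3.mul h1
  have h5 := (hasDerivAt_inv (G.pertc_pos δ q).ne').comp_hasFDerivAt q h4
  have h6 : G.dHc (δ, q) = _ := h5.fderiv
  rw [h6]
  have hp : Real.exp (δ * G.f (q 1)) ≠ 0 := (Real.exp_pos _).ne'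
  simp [pertc, G.hc_torus h]
  field_simp

theorem reebc_torus (δ : ℝ) {q : E3} (h : q 2 = 0) : G.reebc (δ, q)
    = (Real.exp (δ * G.f (q 1)))⁻¹ • !₂[1, 0, -(δ * deriv G.f (q 1))] := by
  rw [reebc_eq]
  ext i
  fin_cases i <;> simp [G.dHc_torus δ h, h, pertc, G.hc_torus h, ex, ey]

/-- The deviation of the almost complex structure from its value on the torus at `δ = 0`. -/
def dev (p : ℝ × E3) : E4 →L[ℝ] E4 := J0 - G.acsc p

/-- The inhomogeneous term of the Cauchy–Riemann equation for the displacement. -/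
def drift (p : ℝ × E3) : E4 := G.dev p (EuclideanSpace.single 1 1)

/-- The inhomogeneous term on the torus. -/
def drift0 (δ x : ℝ) : E4 := !₂[Real.exp (δ * G.f x) - 1, 0, δ * deriv G.f x, 0]

theorem dev_contDiff : ContDiff ℝ ∞ G.dev := contDiff_const.sub G.acsc_contDiff

theorem drift_contDiff : ContDiff ℝ ∞ G.drift := G.dev_contDiff.clm_apply contDiff_const

theorem dev_periodic_z : Function.Periodic G.dev (0, G.τ • ez) := by
  rintro ⟨δ, q⟩
  simp only [dev, Prod.mk_add_mk, add_zero, acsc_add_ez]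

theorem dev_periodic_x : Function.Periodic G.dev (0, ex) := by
  rintro ⟨δ, q⟩
  simp only [dev, Prod.mk_add_mk, add_zero, acsc_add_ex]

theorem drift_periodic_z : Function.Periodic G.drift (0, G.τ • ez) := fun p => by
  unfold drift; rw [G.dev_periodic_z p]

theorem drift_periodic_x : Function.Periodic G.drift (0, ex) := fun p => by
  unfold drift; rw [G.dev_periodic_x p]

theorem dev_torus {q : E3} (h : q 2 = 0) : G.dev (0, q) = 0 := by
  ext1 V
  have e : (!₂[V 1, V 2, V 3] : E3) - V 1 • !₂[1, 0, 0] = V 2 • ex + V 3 • ey := by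
    ext i; fin_cases i <;> simp [ex, ey]
  have h1 : G.reebc (0, q) = !₂[1, 0, 0] := by rw [G.reebc_torus 0 h]; simp
  have h2 : G.pertc 0 q = 1 := by simp [pertc, G.hc_torus h]
  simp only [dev, sub_apply, acsc_apply, h1, h2, h]
  simp only [zero_mul, sub_zero, one_mul, e, map_add, map_smul, G.jc_ex h, G.jc_ey h]
  ext i; fin_cases i <;> simp [J0_apply, ex, ey]

theorem drift_eq (p : ℝ × E3) : G.drift p =
    let W : E3 := G.jc p.2 (ez - G.pertc p.1 p.2 • G.reebc p)
    !₂[G.pertc p.1 p.2 - 1, -W 0, -W 1, -W 2] := by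
  have e : (!₂[(EuclideanSpace.single 1 1 : E4) 1, (EuclideanSpace.single 1 1 : E4) 2,
      (EuclideanSpace.single 1 1 : E4) 3] : E3) = ez := by
    ext i; fin_cases i <;> simp [ez]
  simp only [drift, dev, sub_apply, acsc_apply, e]
  ext i; fin_cases i <;> simp [J0_apply]; ring

theorem drift_torus (δ : ℝ) {q : E3} (h : q 2 = 0) : G.drift (δ, q) = G.drift0 δ (q 1) := by
  have h2 : G.pertc δ q = Real.exp (δ * G.f (q 1)) := by simp [pertc, G.hc_torus h]
  have e : (ez : E3) - G.pertc δ q • G.reebc (δ, q) = (δ * deriv G.f (q 1)) • ey := by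
    rw [G.reebc_torus δ h, h2, smul_smul, mul_inv_cancel₀ (Real.exp_pos _).ne']
    ext i; fin_cases i <;> simp [ez, ey]
  rw [drift_eq]
  have hj : G.jc q (ez - G.pertc δ q • G.reebc (δ, q)) = -((δ * deriv G.f (q 1)) • ex) := by
    rw [e, map_smul, G.jc_ey h, smul_neg]
  change (let W : E3 := G.jc q (ez - G.pertc δ q • G.reebc (δ, q))
    (!₂[G.pertc δ q - 1, -W 0, -W 1, -W 2] : E4)) = _
  rw [hj, h2]
  ext i; fin_cases i <;> simp [drift0, ex]

/-- The rotation coefficient of the linearized Reeb flow. -/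
def rot (q : E3) : ℝ := -fderiv ℝ (fun r => G.dHc (0, r) ey) q ey

theorem dHc_snd_contDiff (v : E3) : ContDiff ℝ ∞ (fun r => G.dHc (0, r) v) :=
  (G.dHc_contDiff.comp (contDiff_prodMk_right (0 : ℝ))).clm_apply contDiff_const

theorem rot_contDiff : ContDiff ℝ ∞ G.rot := by
  have h : ContDiff ℝ ∞ (fderiv ℝ (fun r => G.dHc (0, r) ey)) :=
    (G.dHc_snd_contDiff ey).fderiv_right (by simp)
  exact (h.clm_apply contDiff_const).neg

theorem dHc_add (w : E3) (hw : ∀ q, G.pertc 0 (q + w) = G.pertc 0 q) (q : E3) :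
    G.dHc (0, q + w) = G.dHc (0, q) := by
  change fderiv ℝ (fun r => (G.pertc 0 r)⁻¹) (q + w) = fderiv ℝ (fun r => (G.pertc 0 r)⁻¹) q
  rw [← fderiv_comp_add_right w]
  simp only [hw]

theorem rot_add (w : E3) (hw : ∀ q, G.pertc 0 (q + w) = G.pertc 0 q) :
    Function.Periodic G.rot w := by
  intro q
  unfold rot
  rw [← fderiv_comp_add_right w]
  simp only [G.dHc_add w hw]

theorem rot_periodic_z : Function.Periodic G.rot (G.τ • ez) := G.rot_add _ (G.pertc_add_ez 0)

theorem rot_periodic_x : Function.Periodic G.rot ex := G.rot_add _ (G.pertc_add_ex 0)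

/-- The differential of `1 / h` vanishes along the whole torus, so its derivative in tangential
directions is zero. -/
theorem fderiv_dHc_tangent {q : E3} (h : q 2 = 0) (v w : E3) (hw : w 2 = 0) :
    fderiv ℝ (fun r => G.dHc (0, r) v) q w = 0 := by
  have h1 := ((G.dHc_snd_contDiff v).differentiable (by simp) q).hasFDerivAt
  have e1 : HasDerivAt (fun θ : ℝ => q + θ • w) w 0 := by
    simpa using ((hasDerivAt_id (0 : ℝ)).smul_const w).const_add q
  have h2 := (h1.congr_of_eventuallyEq Filter.EventuallyEq.rfl).comp_hasDerivAt_of_eq (0 : ℝ) e1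
    (by simp)
  refine h2.unique ?_
  have e : ((fun r => G.dHc (0, r) v) ∘ fun θ : ℝ => q + θ • w) = fun _ => 0 := by
    funext θ
    have h3 : (q + θ • w) 2 = 0 := by simp [h, hw]
    simp [G.dHc_torus 0 h3]
  rw [e]
  exact hasDerivAt_const _ _

theorem fderiv_dHc_symm (q v w : E3) :
    fderiv ℝ (fun r => G.dHc (0, r) v) q w = fderiv ℝ (fun r => G.dHc (0, r) w) q v := by
  have hH : ContDiff ℝ ∞ (fun r => (G.pertc 0 r)⁻¹) :=
    G.Hc_contDiff.comp (contDiff_prodMk_right (0 : ℝ))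
  have hs : IsSymmSndFDerivAt ℝ (fun r => (G.pertc 0 r)⁻¹) q :=
    hH.contDiffAt.isSymmSndFDerivAt
      (by rw [minSmoothness_of_isRCLikeNormedField]; exact WithTop.coe_le_coe.2 le_top)
  have hd : DifferentiableAt ℝ (fderiv ℝ (fun r => (G.pertc 0 r)⁻¹)) q :=
    (hH.fderiv_right (m := ∞) (by simp)).differentiable (by simp) q
  have e : ∀ v w, fderiv ℝ (fun r => G.dHc (0, r) v) q w
      = fderiv ℝ (fderiv ℝ (fun r => (G.pertc 0 r)⁻¹)) q w v := by
    intro v w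
    change fderiv ℝ (fun r => fderiv ℝ (fun r => (G.pertc 0 r)⁻¹) r v) q w = _
    rw [fderiv_clm_apply hd (differentiableAt_const v)]
    simp
  rw [e, e]
  exact hs.eq w v

/-- By symmetry of the Hessian and vanishing in tangential directions, only its `yy` entry survives.
-/
theorem fderiv_dHc_torus {q : E3} (h : q 2 = 0) (v w : E3) :
    fderiv ℝ (fun r => G.dHc (0, r) v) q w = -G.rot q * v 2 * w 2 := by
  have key : ∀ v w : E3, fderiv ℝ (fun r => G.dHc (0, r) v) q w
      = w 2 * fderiv ℝ (fun r => G.dHc (0, r) v) q ey := by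
    intro v w
    conv_lhs => rw [vec_eq w]
    rw [map_add, map_add, map_smul, map_smul, map_smul,
      G.fderiv_dHc_tangent h v ez (by simp [ez]), G.fderiv_dHc_tangent h v ex (by simp [ex])]
    simp
  rw [key, G.fderiv_dHc_symm, key]
  simp only [rot]; ring

/-- The linearized Reeb flow along the torus is a shear: height is constant and drives a motion in
`x`. All information is therefore in the scalar `rot`. -/
theorem fderiv_reebc_torus {q : E3} (h : q 2 = 0) (v : E3) :
    HasFDerivAt (fun r => G.reebc (0, r)) (fderiv ℝ (fun r => G.reebc (0, r)) q) q ∧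
    fderiv ℝ (fun r => G.reebc (0, r)) q v = (G.rot q * v 2) • ex := by
  have hc : ContDiff ℝ ∞ (fun r => G.reebc (0, r)) :=
    G.reebc_contDiff.comp (contDiff_prodMk_right (0 : ℝ))
  have h0 := (hc.differentiable (by simp) q).hasFDerivAt
  refine ⟨h0, ?_⟩
  have hcoord : ∀ i, fderiv ℝ (fun r => G.reebc (0, r)) q v i
      = fderiv ℝ (fun r => G.reebc (0, r) i) q v := by
    intro i
    have := (EuclideanSpace.proj (𝕜 := ℝ) i : E3 →L[ℝ] ℝ).hasFDerivAt.comp q h0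
    rw [show (fun r => G.reebc (0, r) i)
      = (EuclideanSpace.proj (𝕜 := ℝ) i : E3 →L[ℝ] ℝ) ∘ fun r => G.reebc (0, r) from rfl,
      this.fderiv]
    rfl
  have hd : ∀ v, DifferentiableAt ℝ (fun r => G.dHc (0, r) v) q :=
    fun v => (G.dHc_snd_contDiff v).differentiable (by simp) q
  have hy : HasFDerivAt (fun r : E3 => r 2) (EuclideanSpace.proj (𝕜 := ℝ) (2 : Fin 3) : E3 →L[ℝ] ℝ) q :=
    (EuclideanSpace.proj (𝕜 := ℝ) (2 : Fin 3) : E3 →L[ℝ] ℝ).hasFDerivAt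
  have hH : HasFDerivAt (fun r => (G.pertc 0 r)⁻¹) (G.dHc (0, q)) q := by
    have hH : ContDiff ℝ ∞ (fun r => (G.pertc 0 r)⁻¹) :=
      G.Hc_contDiff.comp (contDiff_prodMk_right (0 : ℝ))
    exact (hH.differentiable (by simp) q).hasFDerivAt
  have ht : ∀ v, G.dHc (0, q) v = 0 := fun v => by rw [G.dHc_torus 0 h]; simp
  ext i
  rw [hcoord]
  fin_cases i
  · have := (hH.sub (hy.mul (hd ey).hasFDerivAt)).fderiv
    change fderiv ℝ (fun r : E3 => (G.pertc 0 r)⁻¹ - r 2 * G.dHc (0, r) ey) q v = _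
    rw [show (fun r : E3 => (G.pertc 0 r)⁻¹ - r 2 * G.dHc (0, r) ey) =
      ((fun r : E3 => (G.pertc 0 r)⁻¹) - (fun r : E3 => r 2) * fun r => G.dHc (0, r) ey) from rfl, this]
    simp [ht, h, ex]
  · have := (hd ey).hasFDerivAt.neg.fderiv
    change fderiv ℝ (fun r : E3 => -G.dHc (0, r) ey) q v = _
    rw [show (fun r : E3 => -G.dHc (0, r) ey) = -(fun r : E3 => G.dHc (0, r) ey) from rfl, this]
    simp [G.fderiv_dHc_torus h, ex, ey]
  · have := ((hd ex).hasFDerivAt.add (hy.mul (hd ez).hasFDerivAt)).fderiv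
    change fderiv ℝ (fun r : E3 => G.dHc (0, r) ex + r 2 * G.dHc (0, r) ez) q v = _
    rw [show (fun r : E3 => G.dHc (0, r) ex + r 2 * G.dHc (0, r) ez) =
      ((fun r : E3 => G.dHc (0, r) ex) + (fun r : E3 => r 2) * fun r => G.dHc (0, r) ez) from rfl, this]
    simp [G.fderiv_dHc_torus h, ex, h, ht]

/-- This identifies the first-order part of the drift with the term `κ π_y` of the asymptotic
operator. -/
theorem fderiv_drift_torus {q : E3} (h : q 2 = 0) (v : E3) :
    fderiv ℝ G.drift (0, q) (0, v) = !₂[0, 0, 0, G.rot q * v 2] := by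
  have h0 : HasFDerivAt G.drift (fderiv ℝ G.drift (0, q)) (0, q) :=
    (G.drift_contDiff.differentiable (by simp) _).hasFDerivAt
  have e1 : HasDerivAt (fun θ : ℝ => q + θ • v) v 0 := by
    simpa using ((hasDerivAt_id (0 : ℝ)).smul_const v).const_add q
  have e0 : q + (0 : ℝ) • v = q := by simp
  have e2 : HasDerivAt (fun θ : ℝ => ((0 : ℝ), q + θ • v)) (0, v) 0 :=
    (hasDerivAt_const (0 : ℝ) (0 : ℝ)).prodMk e1
  have h1 := h0.comp_hasDerivAt_of_eq (0 : ℝ) e2 (by simp)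
  have hr := (G.fderiv_reebc_torus h v).1.comp_hasDerivAt_of_eq (0 : ℝ) e1 e0.symm
  rw [(G.fderiv_reebc_torus h v).2] at hr
  have hhc : HasDerivAt (fun θ : ℝ => G.pertc 0 (q + θ • v)) 0 0 := by
    have := (G.hc_contDiff.differentiable (by simp) q).hasFDerivAt.comp_hasDerivAt_of_eq (0 : ℝ) e1
      e0.symm
    rw [G.fderiv_hc_torus h] at this
    rw [G.pertc_zero]
    exact this
  have hj : HasDerivAt (fun θ : ℝ => G.jc (q + θ • v)) (fderiv ℝ G.jc q v) 0 :=
    (G.jc_contDiff.differentiable (by simp) q).hasFDerivAt.comp_hasDerivAt_of_eq (0 : ℝ) e1 e0.symm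
  have hp : G.pertc 0 q = 1 := by rw [G.pertc_zero, G.hc_torus h]
  -- The vector to which `j` is applied vanishes on the torus at `δ = 0`, so the derivative of `j`
  -- drops out of the product rule.
  have hg0 : (ez : E3) - G.pertc 0 q • G.reebc (0, q) = 0 := by
    rw [G.reebc_torus 0 h, hp]
    ext i; fin_cases i <;> simp [ez]
  have hg : HasDerivAt (fun θ : ℝ => ez - G.pertc 0 (q + θ • v) • G.reebc (0, q + θ • v))
      (-((G.rot q * v 2) • ex)) 0 := by
    have := (hhc.smul hr).const_sub ez
    simpa [hp] using this
  have hW := hj.clm_apply hg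
  simp only [zero_smul, add_zero, hg0, map_zero, zero_add, map_neg, map_smul, G.jc_ex h] at hW
  have hWc : ∀ i : Fin 3, HasDerivAt (fun θ : ℝ => G.jc (q + θ • v)
      (ez - G.pertc 0 (q + θ • v) • G.reebc (0, q + θ • v)) i) ((-((G.rot q * v 2) • ey) : E3) i) 0 :=
    fun i => (EuclideanSpace.proj (𝕜 := ℝ) i : E3 →L[ℝ] ℝ).hasFDerivAt.comp_hasDerivAt 0 hW
  have hdc := fun i : Fin 4 => hasDerivAt_coord h1 i
  ext i
  refine (hdc i).unique ?_
  simp only [Function.comp_def, drift_eq]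
  fin_cases i
  · simpa using hhc.sub_const 1
  · refine (hWc 0).neg.congr_deriv ?_
    simp [ey]
  · refine (hWc 1).neg.congr_deriv ?_
    simp [ey]
  · refine (hWc 2).neg.congr_deriv ?_
    simp [ey]

/-- The Morse–Bott condition: the total rotation along each Reeb orbit of the torus is nonzero. -/
theorem integral_rot_ne_zero (x : ℝ) : ∫ t in (0 : ℝ)..G.τ, G.rot !₂[t, x, 0] ≠ 0 := by
  intro h0
  have hc : Continuous fun t : ℝ => G.rot !₂[t, x, 0] :=
    G.rot_contDiff.continuous.comp
      (contDiff_E3_mk (n := 0) contDiff_id contDiff_const contDiff_const).continuous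
  have hre : ∀ t : ℝ, fderiv ℝ (reeb G.h) !₂[t, x, 0] = fderiv ℝ (fun r => G.reebc (0, r)) !₂[t, x, 0] := by
    intro t
    refine Filter.EventuallyEq.fderiv_eq ?_
    filter_upwards [G.isOpen_near.mem_nhds (G.near_of_zero (q := !₂[t, x, 0]) (by simp))] with r hr
    refine (reeb_congr ?_).symm
    simp only [G.pertc_zero]
    exact G.hc_eventuallyEq hr
  -- With zero total rotation this shear solution would be periodic, although its `y`-component is
  -- one.
  have key := G.morseBott x (fun t => (∫ r in (0 : ℝ)..t, G.rot !₂[r, x, 0]) • ex + ey) ?_ ?_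
  · simp [ex, ey] at key
  · intro t
    rw [hre, (G.fderiv_reebc_torus (by simp) _).2]
    have h1 := intervalIntegral.integral_hasDerivAt_right (hc.intervalIntegrable 0 t)
      (hc.stronglyMeasurableAtFilter _ _) hc.continuousAt
    simpa [ex, ey] using (h1.smul_const ex).add_const ey
  · simp [h0]

/-- Periodicity in `x` and `z` makes the bounds uniform over all orbits of the torus, so that the
spectral gap depends only on the local geometry. -/
theorem exists_rot_bounds : ∃ Kb m : ℝ, 0 < m ∧ (∀ t x : ℝ, |G.rot !₂[t, x, 0]| ≤ Kb) ∧
    ∀ x : ℝ, m ≤ |∫ t in (0 : ℝ)..G.τ, G.rot !₂[t, x, 0]| := by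
  have hs : Smooth2 fun x t : ℝ => G.rot !₂[t, x, 0] := G.rot_contDiff.comp
    (contDiff_E3_mk contDiff_snd contDiff_fst contDiff_const)
  have hx : ∀ t, Function.Periodic (fun x : ℝ => G.rot !₂[t, x, 0]) 1 := by
    intro t x
    have e : (!₂[t, x + 1, 0] : E3) = !₂[t, x, 0] + ex := by
      ext i; fin_cases i <;> simp [ex]
    simp only [e]
    exact G.rot_periodic_x _
  have ht : ∀ x, Function.Periodic (fun t : ℝ => G.rot !₂[t, x, 0]) G.τ := by
    intro x t
    have e : (!₂[t + G.τ, x, 0] : E3) = !₂[t, x, 0] + G.τ • ez := by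
      ext i; fin_cases i <;> simp [ez]
    simp only [e]
    exact G.rot_periodic_z _
  obtain ⟨Kb, hKb⟩ := (isCompact_Icc.prod isCompact_Icc : IsCompact
    (Set.Icc (0 : ℝ) 1 ×ˢ Set.Icc (0 : ℝ) G.τ)).exists_bound_of_continuousOn
    (f := fun q : ℝ × ℝ => G.rot !₂[q.2, q.1, 0]) hs.continuous.continuousOn
  have hI : Continuous fun x : ℝ => |∫ t in (0 : ℝ)..G.τ, G.rot !₂[t, x, 0]| :=
    (hs.integral 0 G.τ).continuous.abs
  obtain ⟨x0, -, hx0⟩ := (isCompact_Icc : IsCompact (Set.Icc (0 : ℝ) 1)).exists_isMinOn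
    (Set.nonempty_Icc.2 zero_le_one) hI.continuousOn
  refine ⟨Kb, _, abs_pos.2 (G.integral_rot_ne_zero x0), fun t x => ?_, fun x => ?_⟩
  · obtain ⟨x', hx', e1⟩ := (hx t).exists_mem_Ico₀ one_pos x
    obtain ⟨t', ht', e2⟩ := (ht x').exists_mem_Ico₀ G.τ_pos t
    rw [e1, e2]
    exact hKb (x', t') ⟨⟨hx'.1, hx'.2.le⟩, ⟨ht'.1, ht'.2.le⟩⟩
  · have hp : Function.Periodic (fun x : ℝ => |∫ t in (0 : ℝ)..G.τ, G.rot !₂[t, x, 0]|) 1 := by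
      intro x
      have : ∀ t, G.rot !₂[t, x + 1, 0] = G.rot !₂[t, x, 0] := fun t => hx t x
      simp only [this]
    obtain ⟨x', hx', e1⟩ := hp.exists_mem_Ico₀ one_pos x
    rw [show |∫ t in (0 : ℝ)..G.τ, G.rot !₂[t, x, 0]| = _ from e1]
    exact hx0 ⟨hx'.1, hx'.2.le⟩

end MorseBottNbhd

/-! ### Periodic functions: bounded derivatives near the span of the periods -/

section Periodic

variable {V F : Type} [NormedAddCommGroup V] [NormedSpace ℝ V] [NormedAddCommGroup F]
  [NormedSpace ℝ F]

theorem hadamard_periodic {Φ : V → F} {e : V} (h : Function.Periodic Φ e) :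
    Function.Periodic (hadamard Φ) (e, 0) := by
  rintro ⟨p, w⟩
  have h1 : ∀ x, fderiv ℝ Φ (x + e) = fderiv ℝ Φ x := by
    intro x
    rw [← fderiv_comp_add_right e]
    simp only [show ∀ x, Φ (x + e) = Φ x from h]
  unfold hadamard
  simp only [Prod.mk_add_mk, add_zero]
  refine intervalIntegral.integral_congr fun θ _ => ?_
  rw [← h1 (p + θ • w)]
  congr 1; abel

/-- Subtracting the integer parts of the two coefficients brings the point into a fixed ball. The
two periods are not assumed independent. -/
theorem BddDerivs.of_periodic [FiniteDimensional ℝ V] {Φ : V → F} (hΦ : ContDiff ℝ ∞ Φ) {e₁ e₂ : V}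
    (h1 : Function.Periodic Φ e₁) (h2 : Function.Periodic Φ e₂) (R : ℝ) :
    BddDerivs {v | ∃ r₁ r₂ : ℝ, ‖v - r₁ • e₁ - r₂ • e₂‖ ≤ R} Φ := by
  have : ProperSpace V := FiniteDimensional.proper ℝ V
  refine BddDerivs.of_compact hΦ (isCompact_closedBall (0 : V) (R + ‖e₁‖ + ‖e₂‖)) ?_
  rintro v ⟨r₁, r₂, hv⟩
  refine ⟨v - ⌊r₁⌋ • e₁ - ⌊r₂⌋ • e₂, ?_, fun x => ?_⟩
  · rw [mem_closedBall_zero_iff]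
    have e : v - ⌊r₁⌋ • e₁ - ⌊r₂⌋ • e₂
        = (v - r₁ • e₁ - r₂ • e₂) + Int.fract r₁ • e₁ + Int.fract r₂ • e₂ := by
      rw [Int.fract, Int.fract, sub_smul, sub_smul, Int.cast_smul_eq_zsmul, Int.cast_smul_eq_zsmul]
      abel
    have hf : ∀ (r : ℝ) (e : V), ‖Int.fract r • e‖ ≤ ‖e‖ := by
      intro r e
      rw [norm_smul, Real.norm_eq_abs, abs_of_nonneg (Int.fract_nonneg r)]
      exact mul_le_of_le_one_left (norm_nonneg _) (Int.fract_lt_one r).le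
    rw [e]
    exact (norm_add₃_le).trans (by gcongr <;> apply hf)
  · have e : x + (v - (v - ⌊r₁⌋ • e₁ - ⌊r₂⌋ • e₂)) = (x + ⌊r₁⌋ • e₁) + ⌊r₂⌋ • e₂ := by abel
    rw [e, h2.zsmul ⌊r₂⌋ _, h1.zsmul ⌊r₁⌋ _]

theorem Smooth2.affine (c e : V) : Smooth2 (fun _ t : ℝ => c + t • e) :=
  contDiff_const.add (contDiff_snd.smul contDiff_const)

theorem norm_pd_affine_le (c e : V) {i j : ℕ} (h : 1 ≤ i + j) (s t : ℝ) :
    ‖pd i j (fun _ t : ℝ => c + t • e) s t‖ ≤ ‖e‖ := by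
  have hT : dT (fun _ t : ℝ => c + t • e) = fun _ _ => e := by
    funext s t
    exact (((hasDerivAt_id t).smul_const e).const_add c).deriv.trans (one_smul ℝ e)
  have hS : dS (fun _ t : ℝ => c + t • e) = fun _ _ => 0 := by
    funext s t
    exact deriv_const _ _
  rcases j with _ | j
  · obtain ⟨i, rfl⟩ : ∃ i', i = i' + 1 := ⟨i - 1, by omega⟩
    rw [← (Smooth2.affine c e).pd_dS, hS]
    refine (norm_pd_le_cSize (le_refl _) _ s t).trans ?_
    rw [cSize_zero_fun]
    exact norm_nonneg _
  · rw [← pd_dT, hT]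
    refine (norm_pd_le_cSize (le_refl _) _ s t).trans ?_
    rw [cSize_const]

/-- The affine part carries the unbounded motion along the Reeb orbit; its derivatives of positive
order are bounded by `‖e‖`. -/
theorem norm_pd_affine_add_clm_le {X : ℝ → ℝ → F} (hX : Smooth2 X) (c e : V) (A : F →L[ℝ] V)
    {i j : ℕ} (h : 1 ≤ i + j) {s t η : ℝ} (hη : ‖pd i j X s t‖ ≤ η) :
    ‖pd i j (fun s t : ℝ => c + t • e + A (X s t)) s t‖ ≤ ‖e‖ + ‖A‖ * η := by
  rw [(Smooth2.affine c e).pd_add (hX.clm A), hX.pd_clm]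
  refine (norm_add_le _ _).trans (add_le_add (norm_pd_affine_le c e h s t) ?_)
  exact (A.le_opNorm _).trans (by gcongr)

end Periodic

/-! ### Components of the displacement -/

/-- The components `z, x, y`. -/
def tail : E4 →L[ℝ] E3 := LinearMap.toContinuousLinearMap
  { toFun := fun V => !₂[V 1, V 2, V 3]
    map_add' := fun v w => by ext i; fin_cases i <;> simp
    map_smul' := fun r v => by ext i; fin_cases i <;> simp }

theorem tail_apply (V : E4) : tail V = !₂[V 1, V 2, V 3] := rfl

/-- The inclusion of the components `z, x, y`. -/
def tailIncl : E3 →L[ℝ] E4 := LinearMap.toContinuousLinearMap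
  { toFun := fun V => !₂[0, V 0, V 1, V 2]
    map_add' := fun v w => by ext i; fin_cases i <;> simp
    map_smul' := fun r v => by ext i; fin_cases i <;> simp }

theorem tailIncl_apply (V : E3) : tailIncl V = !₂[0, V 0, V 1, V 2] := rfl

/-- The splitting of a point near the torus into a point of the torus and its height. -/
def heightSplit : E3 →L[ℝ] ((ℝ × E3) × (ℝ × E3)) := LinearMap.toContinuousLinearMap
  { toFun := fun V => ((0, !₂[V 0, V 1, 0]), (0, !₂[0, 0, V 2]))
    map_add' := fun v w => by
      refine Prod.ext (Prod.ext (by simp) ?_) (Prod.ext (by simp) ?_) <;>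
      · ext i; fin_cases i <;> simp
    map_smul' := fun r v => by
      refine Prod.ext (Prod.ext (by simp) ?_) (Prod.ext (by simp) ?_) <;>
      · ext i; fin_cases i <;> simp }

theorem heightSplit_apply (V : E3) :
    heightSplit V = ((0, !₂[V 0, V 1, 0]), (0, !₂[0, 0, V 2])) := rfl

theorem E3_norm_sq (v : E3) : ‖v‖ ^ 2 = v 0 ^ 2 + v 1 ^ 2 + v 2 ^ 2 := by
  rw [EuclideanSpace.norm_sq_eq, Fin.sum_univ_three]; simp

theorem E3_norm_le (v : E3) : ‖v‖ ≤ |v 0| + |v 1| + |v 2| := by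
  refine (pow_le_pow_iff_left₀ (norm_nonneg _) (by positivity) two_ne_zero).1 ?_
  rw [E3_norm_sq, ← sq_abs (v 0), ← sq_abs (v 1), ← sq_abs (v 2)]
  nlinarith [mul_nonneg (abs_nonneg (v 0)) (abs_nonneg (v 1)),
    mul_nonneg (abs_nonneg (v 0)) (abs_nonneg (v 2)), mul_nonneg (abs_nonneg (v 1)) (abs_nonneg (v 2))]

theorem Smooth2.coord {φ : ℝ → ℝ → E4} (h : Smooth2 φ) (i : Fin 4) : Smooth2 (fun s t => φ s t i) :=
  h.clm (EuclideanSpace.proj (𝕜 := ℝ) i)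

theorem pd_coord {φ : ℝ → ℝ → E4} (h : Smooth2 φ) (l : Fin 4) (i j : ℕ) (s t : ℝ) :
    pd i j (fun s t => φ s t l) s t = pd i j φ s t l :=
  congrFun (congrFun (h.pd_clm (EuclideanSpace.proj (𝕜 := ℝ) l) i j) s) t

theorem displacement_smooth {u : ℝ → ℝ → E4} (h : Smooth2 u) : Smooth2 (displacement u) :=
  ContDiff.sub h (contDiff_E4_mk contDiff_fst contDiff_snd contDiff_const contDiff_const)

/-- At the point `(s, t)` the derivatives of `Y_z, Y_y` of order at most `k` and those of `Y_x` of
order `1, …, k` are at most `ε`. -/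
def CloseAt (k : ℕ) (ε : ℝ) (Y : ℝ → ℝ → E4) (s t : ℝ) : Prop :=
  ∀ i j : ℕ, i + j ≤ k → |pd i j Y s t 1| ≤ ε ∧ |pd i j Y s t 3| ≤ ε ∧
    (1 ≤ i + j → |pd i j Y s t 2| ≤ ε)

theorem IsCloseToTorus.closeAt {k : ℕ} {ε a b : ℝ} {u : ℝ → ℝ → E4} (hu : Smooth2 u)
    (h : IsCloseToTorus k ε a b u) {s : ℝ} (hs : s ∈ Set.Icc a b) (t : ℝ) :
    CloseAt k ε (displacement u) s t := by
  intro i j hij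
  have hY := displacement_smooth hu
  have h1 := h s hs t i j hij
  have e1 : (fun s t => u s t 1 - t) = fun s t => displacement u s t 1 := by
    funext s t; simp [displacement]
  have e2 : (fun s t => u s t 2) = fun s t => displacement u s t 2 := by
    funext s t; simp [displacement]
  have e3 : (fun s t => u s t 3) = fun s t => displacement u s t 3 := by
    funext s t; simp [displacement]
  rw [e1, e2, e3, pd_coord hY, pd_coord hY, pd_coord hY] at h1
  exact h1

theorem CloseAt.norm_tail_le {k : ℕ} {ε : ℝ} {Y : ℝ → ℝ → E4} {s t : ℝ} (h : CloseAt k ε Y s t)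
    {i j : ℕ} (h1 : 1 ≤ i + j) (hk : i + j ≤ k) : ‖tail (pd i j Y s t)‖ ≤ 3 * ε := by
  refine (E3_norm_le _).trans ?_
  obtain ⟨a1, a3, a2⟩ := h i j hk
  have := a2 h1
  simp only [tail_apply]
  simp only [Fin.isValue, Matrix.cons_val_zero, Matrix.cons_val_one, Matrix.cons_val]
  linarith

namespace MorseBottNbhd

variable (G : MorseBottNbhd)

/-- The deviation vanishes on the torus at `δ = 0`. Its Hadamard factorization from the torus point
`(z, x, 0)` at `δ = 0` has increment `(δ, y ∂_y)`, which is small with its derivatives, while the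
coefficient is periodic and so uniformly bounded. -/
theorem exists_cSize_dev_le (k : ℕ) : ∃ C : ℝ, 0 < C ∧ ∀ (δ ε : ℝ) (Y : ℝ → ℝ → E4) (s t : ℝ),
    0 < δ → 0 < ε → δ ≤ 1 → ε ≤ 1 → Smooth2 Y → CloseAt k ε Y s t →
    cSize k (fun s t => G.dev (δ, t • ez + tail (Y s t))) s t ≤ C * (δ + ε) := by
  have hB := BddDerivs.of_periodic (hadamard_contDiff G.dev_contDiff)
    (hadamard_periodic G.dev_periodic_z) (hadamard_periodic G.dev_periodic_x) 1
  obtain ⟨C, hC0, hC⟩ := cSize_comp_le k (hadamard_contDiff G.dev_contDiff) hB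
    (‖(((0, ez), 0) : (ℝ × E3) × (ℝ × E3))‖ + ‖heightSplit‖ * 3) (by positivity)
  set L2 : E4 →L[ℝ] (ℝ × E3) := (ContinuousLinearMap.inr ℝ ℝ E3).comp
    ((EuclideanSpace.proj (𝕜 := ℝ) (3 : Fin 4) : E4 →L[ℝ] ℝ).smulRight ey)
  refine ⟨5 ^ k * C * (1 + ‖(ContinuousLinearMap.inr ℝ ℝ E3)‖ * ‖(ey : E3)‖ * ((k : ℝ) + 1) ^ 2) + 1, by positivity, ?_⟩
  intro δ ε Y s t hδ hε hδ1 hε1 hY hcl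
  set θ : ℝ → ℝ → (ℝ × E3) × (ℝ × E3) := fun s t =>
    ((0, 0), (δ, 0)) + t • ((0, ez), 0) + heightSplit (tail (Y s t)) with hθ
  have hθs : Smooth2 θ := (Smooth2.affine _ _).add ((hY.clm tail).clm heightSplit)
  have e1 : ∀ s t, θ s t = ((0, !₂[t + Y s t 1, Y s t 2, 0]), (δ, !₂[0, 0, Y s t 3])) := by
    intro s t
    simp only [hθ, heightSplit_apply, tail_apply]
    refine Prod.ext (Prod.ext (by simp) ?_) (Prod.ext (by simp) ?_) <;>
    · ext i; fin_cases i <;> simp [ez]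
  have hYh : Smooth2 (fun s t => Y s t 3) := hY.coord 3
  have e2 : ∀ s t, (θ s t).2 = (δ, 0) + ContinuousLinearMap.inr ℝ ℝ E3 (Y s t 3 • ey) := by
    intro s t
    rw [e1]
    refine Prod.ext (by simp) ?_
    ext i; fin_cases i <;> simp [ey]
  have e3 : (fun s t => G.dev (δ, t • ez + tail (Y s t)))
      = fun s t => hadamard G.dev (θ s t) (θ s t).2 := by
    funext s t
    have h1 := hadamard_apply G.dev_contDiff (θ s t).1 (θ s t).2
    rw [show hadamard G.dev (θ s t) (θ s t).2 = _ from h1, e1,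
      G.dev_torus (q := !₂[t + Y s t 1, Y s t 2, 0]) (by simp), sub_zero]
    congr 1
    refine Prod.ext (by simp) ?_
    ext i; fin_cases i <;> simp [ez, tail_apply]
  have hmem : θ s t ∈ {v : (ℝ × E3) × (ℝ × E3) | ∃ r₁ r₂ : ℝ,
      ‖v - r₁ • ((0, G.τ • ez), 0) - r₂ • ((0, ex), 0)‖ ≤ 1} := by
    refine ⟨(t + Y s t 1) / G.τ, Y s t 2, ?_⟩
    have hτ := G.τ_pos.ne'
    have e : θ s t - ((t + Y s t 1) / G.τ) • (((0, G.τ • ez), 0) : (ℝ × E3) × (ℝ × E3))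
        - Y s t 2 • (((0, ex), 0) : (ℝ × E3) × (ℝ × E3)) = ((0, 0), (δ, Y s t 3 • ey)) := by
      rw [e1]
      refine Prod.ext (Prod.ext (by simp) ?_) (Prod.ext (by simp) ?_) <;>
      · ext i; fin_cases i <;> simp [ez, ex, ey, hτ]
    rw [e]
    have h3 : |Y s t 3| ≤ ε := (hcl 0 0 (by omega)).2.1
    simp only [Prod.norm_def, norm_zero, max_self, norm_smul, Real.norm_eq_abs, abs_of_pos hδ]
    have : ‖(ey : E3)‖ = 1 := by simp [ey]
    rw [this, mul_one]
    exact max_le zero_le_one (max_le hδ1 (h3.trans hε1))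
  have h1 : cSize k (fun s t => hadamard G.dev (θ s t)) s t ≤ C := by
    refine hC θ hθs s t hmem fun i j h1 hk => ?_
    refine norm_pd_affine_add_clm_le (hY.clm tail) _ _ heightSplit h1 ?_
    rw [hY.pd_clm]
    exact (hcl.norm_tail_le h1 hk).trans (by linarith)
  have h2 : cSize k (fun s t => (θ s t).2) s t
      ≤ δ + ‖(ContinuousLinearMap.inr ℝ ℝ E3)‖ * ‖(ey : E3)‖ * (((k : ℝ) + 1) ^ 2 * ε) := by
    have e4 : (fun s t => (θ s t).2) = fun s t => ((δ, 0) : ℝ × E3)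
        + (ContinuousLinearMap.inr ℝ ℝ E3) ((ContinuousLinearMap.toSpanSingleton ℝ ey) (Y s t 3)) := by
      funext s t; rw [e2]; rfl
    rw [e4]
    refine (cSize_add_le (Smooth2.const _) ((hYh.clm _).clm _) k s t).trans (add_le_add ?_ ?_)
    · rw [cSize_const]
      simp [Prod.norm_def, abs_of_pos hδ, hδ.le]
    · refine (cSize_clm_le (hYh.clm _) _ k s t).trans ?_
      rw [mul_assoc]
      gcongr
      refine (cSize_clm_le hYh _ k s t).trans ?_
      rw [ContinuousLinearMap.norm_toSpanSingleton]
      gcongr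
      refine cSize_le hε.le fun i j hij => ?_
      rw [pd_coord hY, Real.norm_eq_abs]
      exact (hcl i j hij).2.1
  rw [e3]
  refine (cSize_apply_le k (Smooth2.comp (hadamard_contDiff G.dev_contDiff) hθs)
    (hθs.clm (ContinuousLinearMap.snd ℝ _ _)) s t).trans ?_
  have h3 : cSize k (fun s t => (ContinuousLinearMap.snd ℝ (ℝ × E3) (ℝ × E3)) (θ s t)) s t
      ≤ (1 + ‖(ContinuousLinearMap.inr ℝ ℝ E3)‖ * ‖(ey : E3)‖ * ((k : ℝ) + 1) ^ 2) * (δ + ε) := by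
    refine h2.trans ?_
    have : 0 ≤ ‖(ContinuousLinearMap.inr ℝ ℝ E3)‖ * ‖(ey : E3)‖ * ((k : ℝ) + 1) ^ 2 := by positivity
    nlinarith
  calc 5 ^ k * cSize k (fun s t => hadamard G.dev (θ s t)) s t * _
      ≤ 5 ^ k * C * ((1 + ‖(ContinuousLinearMap.inr ℝ ℝ E3)‖ * ‖(ey : E3)‖ * ((k : ℝ) + 1) ^ 2) * (δ + ε)) := by
        gcongr
        exact cSize_nonneg _ _ _ _
    _ ≤ _ := by nlinarith

end MorseBottNbhd

theorem CloseAt.mono {k l : ℕ} (hl : l ≤ k) {ε : ℝ} {Y : ℝ → ℝ → E4} {s t : ℝ}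
    (h : CloseAt k ε Y s t) : CloseAt l ε Y s t := fun i j hij => h i j (hij.trans hl)

theorem norm_projP_le {τ C : ℝ} (hτ : 0 < τ) {φ : ℝ → ℝ → E4} (h : Smooth2 φ) {s : ℝ}
    (hb : ∀ t, ‖φ s t‖ ≤ C) (t : ℝ) : ‖projP τ φ s t‖ ≤ C := by
  have h0 : 0 ≤ C := (norm_nonneg _).trans (hb 0)
  refine (pow_le_pow_iff_left₀ (norm_nonneg _) h0 two_ne_zero).1 ?_
  refine (norm_projP_sq_le hτ h s t).trans ?_
  have h1 := l2sq_le_sq hτ.le h hb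
  calc τ⁻¹ * ∫ t in (0 : ℝ)..τ, ‖φ s t‖ ^ 2 ≤ τ⁻¹ * (τ * C ^ 2) := by gcongr; exact h1
    _ = C ^ 2 := by field_simp

theorem projQ_eq_add {τ : ℝ} {Y : ℝ → ℝ → E4} (h : Smooth2 Y) (s t : ℝ) :
    projQ τ Y s t = piP (Y s t - τ⁻¹ • ∫ r in (0 : ℝ)..τ, Y s r) + piY (Y s t) := by
  unfold projQ
  rw [projP_eq h, map_sub]
  have : Y s t = piP (Y s t) + piY (Y s t) := by
    ext i; fin_cases i <;> simp [piP_apply, piY_apply]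
  nth_rewrite 1 [this]
  abel

theorem norm_piY (v : E4) : ‖piY v‖ = |v 3| := by
  have : ‖piY v‖ ^ 2 = |v 3| ^ 2 := by rw [E4_norm_sq]; simp [piY_apply]
  exact (pow_left_inj₀ (norm_nonneg _) (abs_nonneg _) two_ne_zero).1 this

/-- The `a`, `z`, `x` parts of `QY` have zero mean and are controlled by `Y_t`; the `y` part is not
averaged away and is controlled by closeness to the torus. -/
theorem norm_projQ_le {τ C ε : ℝ} (hτ : 0 < τ) {Y : ℝ → ℝ → E4} (h : Smooth2 Y) {s : ℝ}
    (hper : ∀ t, Y s (t + τ) = Y s t) (hb : ∀ t, ‖dT Y s t‖ ≤ C) (hy : ∀ t, |Y s t 3| ≤ ε) (t : ℝ) :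
    ‖projQ τ Y s t‖ ≤ τ * C + ε := by
  have h0 : 0 ≤ C := (norm_nonneg _).trans (hb 0)
  rw [projQ_eq_add h]
  refine (norm_add_le _ _).trans (add_le_add ?_ ((norm_piY _).trans_le (hy t)))
  refine (norm_piP_le _).trans ?_
  obtain ⟨r, hr, e⟩ := exists_mem_Icc_of_periodicOn hτ hper t
  rw [e]
  refine (pow_le_pow_iff_left₀ (norm_nonneg _) (by positivity) two_ne_zero).1 ?_
  refine (norm_sub_mean_sq_le hτ (h.hasDerivAt_snd s) (h.dT.continuous_snd s) hr).trans ?_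
  have h1 := l2sq_le_sq hτ.le h.dT hb
  calc τ * ∫ t in (0 : ℝ)..τ, ‖dT Y s t‖ ^ 2 ≤ τ * (τ * C ^ 2) := by gcongr; exact h1
    _ = _ := by ring

/-! ### Cylinders near the torus and a priori bounds -/

namespace MorseBottNbhd

variable (G : MorseBottNbhd)

/-- The coefficient of `∂_t Y` in the perturbed Cauchy–Riemann equation. -/
def coef (δ : ℝ) (Y : ℝ → ℝ → E4) (s t : ℝ) : E4 →L[ℝ] E4 := G.dev (δ, t • ez + tail (Y s t))

theorem coef_smooth (δ : ℝ) {Y : ℝ → ℝ → E4} (h : Smooth2 Y) : Smooth2 (G.coef δ Y) := by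
  have h1 : Smooth2 (fun s t => t • ez + tail (Y s t)) :=
    (contDiff_snd.smul contDiff_const : Smooth2 (fun _ t : ℝ => t • ez)).add (h.clm tail)
  exact G.dev_contDiff.comp (contDiff_const.prodMk h1)

/-- The displacement of a cylinder near the torus. -/
structure IsNearCylinder (δ ε a b : ℝ) (k : ℕ) (Y : ℝ → ℝ → E4) : Prop where
  lt : a < b
  δ_pos : 0 < δ
  ε_pos : 0 < ε
  smooth : Smooth2 Y
  close : ∀ s ∈ Set.Icc a b, ∀ t, CloseAt k ε Y s t
  periodic : PeriodicOn G.τ (Set.Icc a b) Y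
  eqn : ∀ s ∈ Set.Icc a b, ∀ t,
    dS Y s t = -J0 (dT Y s t) + G.coef δ Y s t (dT Y s t + EuclideanSpace.single 1 1)

/-- Smallness fixes the homotopy class. A `z`-winding other than one would change `z - t` by at
least `τ`, and a nonzero `x`-winding would need variation at least one over a period; hence `Y` is
genuinely periodic. Subtracting `(s, t, 0, 0)` produces the inhomogeneity, because `J₀ ∂_z = -∂_a`.
-/
theorem IsNearCylinder.of_holomorphic {G : MorseBottNbhd} {δ ε a b : ℝ} {k : ℕ} {u : ℝ → ℝ → E4}
    (hk : 1 ≤ k) (hδ : 0 < δ) (hε : 0 < ε) (hab : a < b) (hρ : ε < G.ρ / 4) (h2 : 2 * ε < G.τ)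
    (h1 : ε * G.τ < 1) (hu : IsHolomorphicCylinder G δ a b u) (hc : IsCloseToTorus k ε a b u) :
    G.IsNearCylinder δ ε a b k (displacement u) := by
  have hus : Smooth2 u := hu.smooth
  have hYs := displacement_smooth hus
  have hτ := G.τ_pos
  have hdisp : displacement u = fun s t => u s t - (EuclideanSpace.single 0 s + EuclideanSpace.single 1 t) := by
    funext s t; unfold displacement; congr 1; ext i; fin_cases i <;> simp
  have hdS : ∀ s t, dS (displacement u) s t = dS u s t - EuclideanSpace.single 0 1 := by
    intro s t
    have e : (fun r : ℝ => displacement u r t)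
        = fun r => u r t - (r • EuclideanSpace.single 0 1 + EuclideanSpace.single 1 t) := by
      funext r; rw [hdisp]; ext i; fin_cases i <;> simp
    unfold dS
    rw [e]
    have := (hus.hasDerivAt_fst s t).sub
      (((hasDerivAt_id s).smul_const (EuclideanSpace.single 0 1 : E4)).add_const (EuclideanSpace.single 1 t))
    rw [one_smul] at this
    exact this.deriv
  have hdT : ∀ s t, dT (displacement u) s t = dT u s t - EuclideanSpace.single 1 1 := by
    intro s t
    have e : (fun r : ℝ => displacement u s r)
        = fun r => u s r - (r • EuclideanSpace.single 1 1 + EuclideanSpace.single 0 s) := by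
      funext r; rw [hdisp]; ext i; fin_cases i <;> simp
    unfold dT
    rw [e]
    have := (hus.hasDerivAt_snd s t).sub
      (((hasDerivAt_id t).smul_const (EuclideanSpace.single 1 1 : E4)).add_const (EuclideanSpace.single 0 s))
    rw [one_smul] at this
    exact this.deriv
  have hcl : ∀ s ∈ Set.Icc a b, ∀ t, CloseAt k ε (displacement u) s t :=
    fun s hs t => hc.closeAt hus hs t
  refine ⟨hab, hδ, hε, hYs, hcl, ?_, ?_⟩
  · obtain ⟨m, n, hmn⟩ := hu.deck
    have hn : n = 1 := by
      have ha : a ∈ Set.Icc a b := ⟨le_refl _, hab.le⟩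
      have e1 := (hcl a ha 0 0 0 (by omega)).1
      have e2 := (hcl a ha (0 + G.τ) 0 0 (by omega)).1
      simp only [pd_zero_zero, displacement, hmn a ha 0] at e1 e2
      simp at e1 e2
      have h3 : |((n : ℝ) - 1) * G.τ| < G.τ := by
        have : ((n : ℝ) - 1) * G.τ = (u a 0 1 + n * G.τ - G.τ) - u a 0 1 := by ring
        rw [this]
        exact (abs_sub _ _).trans_lt (by linarith)
      rw [abs_mul, abs_of_pos hτ] at h3
      have h4 : |((n - 1 : ℤ) : ℝ)| < 1 := by push_cast; nlinarith
      have h5 : |n - 1| < 1 := by exact_mod_cast h4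
      have := Int.abs_lt_one_iff.1 h5
      omega
    have hm : m = 0 := by
      have ha : a ∈ Set.Icc a b := ⟨le_refl _, hab.le⟩
      have e : ∀ t, HasDerivAt (fun t => displacement u a t 2) (dT (displacement u) a t 2) t :=
        fun t => hasDerivAt_coord (hYs.hasDerivAt_snd a t) 2
      have h3 := norm_image_sub_le_of_norm_deriv_le_segment' (f := fun t => displacement u a t 2)
        (a := 0) (b := G.τ) (C := ε)
        (fun t _ => (e t).hasDerivWithinAt) (fun t _ => (hcl a ha t 0 1 (by omega)).2.2 (by omega))
        G.τ ⟨hτ.le, le_refl _⟩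
      have h4 := hmn a ha 0
      rw [zero_add] at h4
      simp only [displacement, h4] at h3
      simp at h3
      have h5 : |(m : ℝ)| < 1 := h3.trans_lt h1
      have h6 : |m| < 1 := by exact_mod_cast h5
      exact Int.abs_lt_one_iff.1 h6
    intro s hs t
    simp only [displacement, hmn s hs t, hn, hm]
    ext i; fin_cases i <;> simp
  · intro s hs t
    have hy : |(!₂[u s t 1, u s t 2, u s t 3] : E3) 2| < G.ρ / 4 := by
      have := (hc s hs t 0 0 (by omega)).2.1
      exact lt_of_le_of_lt this hρ
    have h3 := hu.holomorphic s hs t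
    rw [G.acs_eq_acsc δ hy] at h3
    have e : t • ez + tail (displacement u s t) = !₂[u s t 1, u s t 2, u s t 3] := by
      ext i; fin_cases i <;> simp [ez, tail_apply, displacement]
    have e2 : J0 (EuclideanSpace.single 1 1 : E4) = -EuclideanSpace.single 0 1 := by
      ext i; fin_cases i <;> simp [J0_apply]
    rw [hdS, hdT, coef, e, sub_add_cancel, dev, sub_apply, map_sub, e2, eq_neg_of_add_eq_zero_left h3]
    abel

variable {G} {δ ε a b : ℝ} {k : ℕ} {Y : ℝ → ℝ → E4}

/-- Closeness to the torus says nothing about `a`. The `z`-component of the equation expresses `a_t`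
through `z_s` and a remainder that is small relative to `Y_t`, so it can be absorbed; afterwards the
full equation bounds `Y_s`. -/
theorem exists_cSize_deriv_le (G : MorseBottNbhd) (n : ℕ) : ∃ C η : ℝ, 0 < C ∧ 0 < η ∧
    ∀ (δ ε a b : ℝ) (Y : ℝ → ℝ → E4), G.IsNearCylinder δ ε a b (n + 1) Y → δ + ε ≤ η →
    ∀ s ∈ Set.Icc a b, ∀ t, cSize n (dT Y) s t ≤ C * (δ + ε) ∧ cSize n (dS Y) s t ≤ C * (δ + ε) := by
  obtain ⟨CM, hCM, hM⟩ := G.exists_cSize_dev_le n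
  set L := ‖tailIncl‖ * (((n : ℝ) + 1) ^ 2 * 3)
  set B := ((n : ℝ) + 1) ^ 2
  set D := 5 ^ n * CM
  set P := ‖(EuclideanSpace.proj (𝕜 := ℝ) (1 : Fin 4) : E4 →L[ℝ] ℝ)‖
  have hL : 0 ≤ L := by positivity
  have hB : 0 ≤ B := by positivity
  have hD : 0 < D := by positivity
  have hP : 0 ≤ P := norm_nonneg _
  set C1 := 2 * L + 2 * B + 2 * P * D
  have hC1 : 0 ≤ C1 := by positivity
  refine ⟨‖J0‖ * C1 + C1 + D * (C1 + 1), min 1 (1 / (2 * (P * D + 1))), by positivity,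
    by positivity, ?_⟩
  intro δ ε a b Y h hη s hs t
  have hδ := h.δ_pos
  have hε := h.ε_pos
  have hη1 : δ + ε ≤ 1 := hη.trans (min_le_left _ _)
  have hη2 : P * D * (δ + ε) ≤ 1 / 2 := by
    have h1 := hη.trans (min_le_right _ _)
    rw [le_div_iff₀ (by positivity)] at h1
    nlinarith
  have hY := h.smooth
  have hcl := h.close s hs t
  have hMs := G.coef_smooth δ hY
  have hM' : cSize n (G.coef δ Y) s t ≤ CM * (δ + ε) :=
    hM δ ε Y s t hδ hε (by linarith) (by linarith) hY (hcl.mono (by omega))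
  have hv : Smooth2 (fun s t => dT Y s t + EuclideanSpace.single 1 1) := hY.dT.add (Smooth2.const _)
  set r : ℝ → ℝ → E4 := fun s t => G.coef δ Y s t (dT Y s t + EuclideanSpace.single 1 1)
  have hr : Smooth2 r := hMs.apply hv
  set T := cSize n (dT Y) s t
  set A := cSize n (fun s t => dT Y s t 0) s t
  set R := cSize n r s t
  have hT0 : 0 ≤ T := cSize_nonneg _ _ _ _
  have hR0 : 0 ≤ R := cSize_nonneg _ _ _ _
  have hTA : T ≤ L * ε + A := by
    have e : dT Y = fun s t => tailIncl (tail (dT Y s t))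
        + ContinuousLinearMap.toSpanSingleton ℝ (EuclideanSpace.single 0 1 : E4) (dT Y s t 0) := by
      funext s t; ext i; fin_cases i <;> simp [tailIncl_apply, tail_apply]
    have h1 := cSize_add_le ((hY.dT.clm tail).clm tailIncl) ((hY.dT.coord 0).clm
      (ContinuousLinearMap.toSpanSingleton ℝ (EuclideanSpace.single 0 1 : E4))) n s t
    rw [← e] at h1
    refine h1.trans (add_le_add ?_ ?_)
    · refine (cSize_clm_le (hY.dT.clm tail) tailIncl n s t).trans ?_
      rw [mul_assoc, mul_assoc]
      gcongr
      refine cSize_le (by positivity) fun i j hij => ?_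
      rw [hY.dT.pd_clm, pd_dT]
      exact hcl.norm_tail_le (by omega) (by omega)
    · refine (cSize_clm_le (hY.dT.coord 0) _ n s t).trans ?_
      rw [ContinuousLinearMap.norm_toSpanSingleton]
      simp [A]
  have hRT : R ≤ D * (δ + ε) * (T + 1) := by
    refine (cSize_apply_le n hMs hv s t).trans ?_
    have h1 : cSize n (fun s t => dT Y s t + EuclideanSpace.single 1 1) s t ≤ T + 1 := by
      refine (cSize_add_le hY.dT (Smooth2.const _) n s t).trans ?_
      rw [cSize_const]; simp [T]
    calc 5 ^ n * cSize n (G.coef δ Y) s t * _ ≤ 5 ^ n * (CM * (δ + ε)) * (T + 1) := by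
          gcongr; exact cSize_nonneg _ _ _ _
      _ = _ := by ring
  have hAR : A ≤ B * ε + P * R := by
    have e : ∀ s ∈ Set.Icc a b, ∀ t, (fun s t => dT Y s t 0) s t
        = (fun s t => r s t 1 - dS Y s t 1) s t := by
      intro s hs t
      have := congrArg (fun v : E4 => v 1) (h.eqn s hs t)
      simp only [PiLp.add_apply, PiLp.neg_apply, J0_apply, Fin.isValue, Matrix.cons_val_one,
        Matrix.cons_val_zero] at this
      simp only [r]
      linarith
    have h1 := cSize_congr_strip (hY.dT.coord 0) ((hr.coord 1).sub (hY.dS.coord 1)) h.lt e n s hs t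
    change cSize n (fun s t => dT Y s t 0) s t ≤ _
    rw [h1]
    refine (cSize_sub_le (hr.coord 1) (hY.dS.coord 1) n s t).trans ?_
    rw [add_comm]
    refine add_le_add ?_ ?_
    · refine cSize_le hε.le fun i j hij => ?_
      rw [pd_coord hY.dS, hY.pd_dS, Real.norm_eq_abs]
      exact (hcl (i + 1) j (by omega)).1
    · exact cSize_clm_le hr (EuclideanSpace.proj (𝕜 := ℝ) (1 : Fin 4)) n s t
  -- The remainder contains the unknown size `T` with coefficient at most one half, which is moved
  -- to the left.
  have hT1 : T ≤ C1 * (δ + ε) := by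
    have h1 : P * R ≤ P * (D * (δ + ε) * (T + 1)) := mul_le_mul_of_nonneg_left hRT hP
    have h2 : P * (D * (δ + ε) * (T + 1)) = P * D * (δ + ε) * T + P * D * (δ + ε) := by ring
    have h3 : P * D * (δ + ε) * T ≤ 1 / 2 * T := mul_le_mul_of_nonneg_right hη2 hT0
    have h4 : L * ε ≤ L * (δ + ε) := by nlinarith
    have h5 : B * ε ≤ B * (δ + ε) := by nlinarith
    have h6 : C1 * (δ + ε) = 2 * (L * (δ + ε)) + 2 * (B * (δ + ε)) + 2 * (P * D * (δ + ε)) := by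
      simp only [C1]; ring
    linarith
  have hR1 : R ≤ D * (C1 + 1) * (δ + ε) := by
    have h1 : T + 1 ≤ C1 + 1 := by nlinarith
    calc R ≤ D * (δ + ε) * (T + 1) := hRT
      _ ≤ D * (δ + ε) * (C1 + 1) := by gcongr
      _ = _ := by ring
  have hDC : 0 ≤ D * (C1 + 1) * (δ + ε) := by positivity
  have hJ : 0 ≤ ‖J0‖ * C1 * (δ + ε) := by positivity
  refine ⟨by nlinarith, ?_⟩
  have e : ∀ s ∈ Set.Icc a b, ∀ t, dS Y s t = (fun s t => r s t - J0 (dT Y s t)) s t := by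
    intro s hs t
    rw [h.eqn s hs t]
    simp only [r]; abel
  rw [cSize_congr_strip hY.dS (hr.sub (hY.dT.clm J0)) h.lt e n s hs t]
  refine (cSize_sub_le hr (hY.dT.clm J0) n s t).trans ?_
  have h1 := cSize_clm_le hY.dT J0 n s t
  have h2 : ‖J0‖ * T ≤ ‖J0‖ * (C1 * (δ + ε)) := by gcongr
  have h3 : 0 ≤ C1 * (δ + ε) := by positivity
  change R + _ ≤ _
  nlinarith

/-- Order zero needs the Poincaré argument. For `PY` only positive orders are claimed, since the
values of `a` and `x` are unrestricted. -/
theorem exists_cSize_projQ_le (G : MorseBottNbhd) {k : ℕ} (hk : 1 ≤ k) : ∃ C η : ℝ, 0 < C ∧ 0 < η ∧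
    ∀ (δ ε a b : ℝ) (Y : ℝ → ℝ → E4), G.IsNearCylinder δ ε a b k Y → δ + ε ≤ η →
    ∀ s ∈ Set.Icc a b, ∀ t, cSize k (projQ G.τ Y) s t ≤ C * (δ + ε) ∧
      ∀ i j : ℕ, 1 ≤ i + j → i + j ≤ k → ‖pd i j (projP G.τ Y) s t‖ ≤ C * (δ + ε) := by
  obtain ⟨n, rfl⟩ : ∃ n, k = n + 1 := ⟨k - 1, by omega⟩
  obtain ⟨C, η, hC, hη, H⟩ := exists_cSize_deriv_le G n
  have hτ := G.τ_pos
  set K := 2 * C + (G.τ * C + 1)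
  refine ⟨(((n + 1 : ℕ) : ℝ) + 1) ^ 2 * K + C, η, by positivity, hη, ?_⟩
  intro δ ε a b Y h hle s hs t
  have hδ := h.δ_pos
  have hε := h.ε_pos
  have hY := h.smooth
  have h0 : 0 ≤ C * (δ + ε) := by positivity
  have h1 : ∀ i j : ℕ, 1 ≤ i + j → i + j ≤ n + 1 → ∀ t, ‖pd i j Y s t‖ ≤ C * (δ + ε) := by
    intro i j hij hle' t
    obtain ⟨hT, hS⟩ := H δ ε a b Y h hle s hs t
    rcases j with _ | j
    · obtain ⟨i, rfl⟩ : ∃ i', i = i' + 1 := ⟨i - 1, by omega⟩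
      rw [← hY.pd_dS]
      exact (norm_pd_le_cSize (by omega) _ s t).trans hS
    · rw [← pd_dT]
      exact (norm_pd_le_cSize (by omega) _ s t).trans hT
  have hP : ∀ i j : ℕ, 1 ≤ i + j → i + j ≤ n + 1 → ‖pd i j (projP G.τ Y) s t‖ ≤ C * (δ + ε) := by
    intro i j hij hle'
    rcases j with _ | j
    · rw [pd_projP hY]
      exact norm_projP_le hτ (hY.pd i 0) (h1 i 0 hij hle') t
    · rw [pd_projP_succ, norm_zero]
      exact h0
  have hK : 0 ≤ K * (δ + ε) := by positivity
  have hτC : 0 ≤ G.τ * C * (δ + ε) := by positivity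
  refine ⟨?_, fun i j hij hle' => (hP i j hij hle').trans ?_⟩
  · have : cSize (n + 1) (projQ G.τ Y) s t ≤ (((n + 1 : ℕ) : ℝ) + 1) ^ 2 * (K * (δ + ε)) := by
      refine cSize_le hK fun i j hij => ?_
      rcases Nat.eq_zero_or_pos (i + j) with h2 | h2
      · obtain ⟨rfl, rfl⟩ : i = 0 ∧ j = 0 := by omega
        refine (norm_projQ_le hτ hY (h.periodic s hs) (h1 0 1 (by omega) (by omega))
          (fun t => (h.close s hs t 0 0 (by omega)).2.1) t).trans ?_
        simp only [K]; nlinarith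
      · unfold projQ
        rw [hY.pd_sub hY.projP]
        refine (norm_sub_le _ _).trans ((add_le_add (h1 i j h2 hij t) (hP i j h2 hij)).trans ?_)
        simp only [K]; nlinarith
    nlinarith
  · have : 0 ≤ (((n + 1 : ℕ) : ℝ) + 1) ^ 2 * K * (δ + ε) := by positivity
    nlinarith

end MorseBottNbhd

section Proj

variable {τ : ℝ} {φ ψ : ℝ → ℝ → E4}

theorem projP_congr {s : ℝ} (h : ∀ t, φ s t = ψ s t) (t : ℝ) : projP τ φ s t = projP τ ψ s t := by
  unfold projP
  simp only [h]

theorem projP_dT (h : Smooth2 φ) {s : ℝ} (hp : φ s τ = φ s 0) (t : ℝ) : projP τ (dT φ) s t = 0 := by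
  rw [projP_eq h.dT, intervalIntegral.integral_eq_sub_of_hasDerivAt
    (fun r _ => h.hasDerivAt_snd s r) ((h.dT.continuous_snd s).intervalIntegrable _ _), hp]
  simp

theorem projP_of_const (hτ : 0 < τ) {g : ℝ → E4} {s : ℝ} (h : g s 3 = 0) (t : ℝ) :
    projP τ (fun s _ => g s) s t = g s := by
  ext i; fin_cases i <;> simp [projP, h, hτ.ne']

theorem projP_smul_piY (κ : ℝ → ℝ → ℝ) (s t : ℝ) :
    projP τ (fun s t => κ s t • piY (φ s t)) s t = 0 := by
  have := projQ_smul_piY (τ := τ) κ φ s t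
  unfold projQ at this
  rwa [sub_eq_self] at this

end Proj

/-! ### Splitting the Cauchy–Riemann equation by the projections -/

namespace MorseBottNbhd

variable (G : MorseBottNbhd)

/-- The inclusion of tangent vectors of the torus neighbourhood. -/
def inV : E3 →L[ℝ] (ℝ × E3) := ContinuousLinearMap.inr ℝ ℝ E3

theorem inV_apply (v : E3) : inV v = (0, v) := rfl

/-- The `x`-component. -/
def xPart : E4 →L[ℝ] E3 := (EuclideanSpace.proj (𝕜 := ℝ) (2 : Fin 4) : E4 →L[ℝ] ℝ).smulRight ex

/-- The `z`-component. -/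
def zPart : E4 →L[ℝ] E3 := (EuclideanSpace.proj (𝕜 := ℝ) (1 : Fin 4) : E4 →L[ℝ] ℝ).smulRight ez

theorem xPart_apply (V : E4) : xPart V = V 2 • ex := rfl

/-- The rotation coefficient along the projected cylinder. -/
def rotAlong (Y : ℝ → ℝ → E4) (s t : ℝ) : ℝ := G.rot (0 + t • ez + xPart (projP G.τ Y s t))

/-- The `z`-component, as an offset between torus points. -/
def offZ : E4 →L[ℝ] (ℝ × E3) × (ℝ × E3) :=
  (ContinuousLinearMap.inl ℝ (ℝ × E3) (ℝ × E3)).comp (inV.comp zPart)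

/-- The components `z, x, y`, as an offset from a torus point. -/
def offW : E4 →L[ℝ] (ℝ × E3) × (ℝ × E3) :=
  (ContinuousLinearMap.inr ℝ (ℝ × E3) (ℝ × E3)).comp (inV.comp tail)

/-- The `x`-component, as the position of a torus point. -/
def posX : E4 →L[ℝ] (ℝ × E3) × (ℝ × E3) :=
  (ContinuousLinearMap.inl ℝ (ℝ × E3) (ℝ × E3)).comp (inV.comp xPart)

theorem offZ_apply (V : E4) : offZ V = ((0, V 1 • ez), 0) := rfl

theorem offW_apply (V : E4) : offW V = (0, (0, tail V)) := rfl

theorem posX_apply (V : E4) : posX V = ((0, V 2 • ex), 0) := rfl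

/-- The offset of a point of the cylinder from the torus point on the Reeb orbit below it. -/
def offset (δ : ℝ) (Y : ℝ → ℝ → E4) (s t : ℝ) : (ℝ × E3) × (ℝ × E3) :=
  ((δ, 0), 0) + offZ (projP G.τ Y s t) + offW (projQ G.τ Y s t)

/-- The torus point below a point of the cylinder. -/
def foot (Y : ℝ → ℝ → E4) (s t : ℝ) : (ℝ × E3) × (ℝ × E3) :=
  0 + t • ((0, ez), 0) + posX (projP G.τ Y s t)

theorem foot_eq (Y : ℝ → ℝ → E4) (s t : ℝ) :
    G.foot Y s t = ((0, 0 + t • ez + xPart (projP G.τ Y s t)), 0) := by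
  refine Prod.ext (Prod.ext (by simp [foot, posX_apply]) ?_) (by simp [foot, posX_apply])
  simp [foot, posX_apply, xPart_apply]

/-- The zeroth order coefficient, up to the rotation coefficient. -/
def remCoef (δ : ℝ) (Y : ℝ → ℝ → E4) (s t : ℝ) : E4 →L[ℝ] E4 :=
  (hadamard (hadamard G.drift) (G.foot Y s t, G.offset δ Y s t) (G.offset δ Y s t)).comp (inV.comp tail)

/-- Two Hadamard expansions. The first is in `W` about the projected point, where the drift is known
exactly for every `δ`. The second compares the resulting coefficient with its value at `δ = 0`, on
the orbit with mean `z` and `W` removed, which is the derivative computed in `fderiv_drift_torus`.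
The remainder is thus linear in `W` with a coefficient linear in the small offset. -/
theorem drift_eq_add (δ : ℝ) (Y : ℝ → ℝ → E4) (s t : ℝ) :
    G.drift (δ, t • ez + tail (Y s t)) = G.drift0 δ (projP G.τ Y s t 2)
      + G.rotAlong Y s t • piY (projQ G.τ Y s t) + G.remCoef δ Y s t (projQ G.τ Y s t) := by
  set P := projP G.τ Y s t with hP
  set W := projQ G.τ Y s t with hW
  have hP3 : P 3 = 0 := by simp [hP, projP]
  have hY : Y s t = P + W := by rw [hW, projQ]; abel
  have h1 := hadamard_apply G.drift_contDiff (δ, !₂[t + P 1, P 2, 0]) (inV (tail W))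
  have e1 : ((δ, !₂[t + P 1, P 2, 0]) : ℝ × E3) + inV (tail W) = (δ, t • ez + tail (Y s t)) := by
    rw [hY]
    refine Prod.ext (by simp [inV_apply]) ?_
    ext i; fin_cases i <;> simp [inV_apply, tail_apply, ez, hP3, add_assoc]
  rw [e1, G.drift_torus δ (q := !₂[t + P 1, P 2, 0]) (by simp)] at h1
  have h2 := hadamard_apply (hadamard_contDiff G.drift_contDiff)
    (G.foot Y s t) (G.offset δ Y s t)
  have e2 : G.foot Y s t + G.offset δ Y s t = ((δ, !₂[t + P 1, P 2, 0]), inV (tail W)) := by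
    rw [foot_eq, offset, offZ_apply, offW_apply]
    refine Prod.ext (Prod.ext (by simp) ?_) (by simp [inV_apply, ← hW])
    ext i; fin_cases i <;> simp [← hP, xPart_apply, ez, ex]
  rw [e2, foot_eq, ← hP, hadamard_zero] at h2
  have h3 := G.fderiv_drift_torus (q := 0 + t • ez + xPart P) (by simp [ez, ex, xPart_apply]) (tail W)
  have h4 : G.remCoef δ Y s t W = hadamard G.drift ((δ, !₂[t + P 1, P 2, 0]), inV (tail W)) (inV (tail W))
      - fderiv ℝ G.drift (0, 0 + t • ez + xPart P) (0, tail W) := by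
    unfold remCoef
    rw [foot_eq, ← hP]
    exact congrArg (fun L : (ℝ × E3) →L[ℝ] E4 => L (inV (tail W))) h2
  have h5 : G.rotAlong Y s t • piY W = !₂[0, 0, 0, G.rot (0 + t • ez + xPart P) * tail W 2] := by
    unfold rotAlong
    rw [← hP]
    ext i; fin_cases i <;> simp [piY_apply, tail_apply]
  rw [h4, h1, h3, h5]
  simp

theorem drift0_contDiff (δ : ℝ) : ContDiff ℝ ∞ (G.drift0 δ) :=
  contDiff_E4_mk ((Real.contDiff_exp.comp (contDiff_const.mul G.f_smooth)).sub contDiff_const)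
    contDiff_const (contDiff_const.mul (by
      have := (contDiff_infty_iff_deriv.1 G.f_smooth).2
      exact this)) contDiff_const

section Smooth

variable {G} {Y : ℝ → ℝ → E4} (hY : Smooth2 Y) (δ : ℝ)
include hY

theorem smooth_base : Smooth2 (fun s t => 0 + t • ez + xPart (projP G.τ Y s t)) :=
  (Smooth2.affine 0 ez).add (hY.projP.clm xPart)

theorem rotAlong_smooth : Smooth2 (G.rotAlong Y) := Smooth2.comp G.rot_contDiff (smooth_base hY)

theorem offset_smooth : Smooth2 (G.offset δ Y) :=
  ((Smooth2.const _).add (hY.projP.clm offZ)).add (hY.projQ.clm offW)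

theorem foot_smooth : Smooth2 (G.foot Y) := (Smooth2.affine _ _).add (hY.projP.clm posX)

theorem foot_offset_smooth : Smooth2 (fun s t => (G.foot Y s t, G.offset δ Y s t)) :=
  ContDiff.prodMk (foot_smooth hY) (offset_smooth hY δ)

theorem remCoef_smooth : Smooth2 (G.remCoef δ Y) :=
  Smooth2.clm (Smooth2.apply (Smooth2.comp (hadamard_contDiff (hadamard_contDiff G.drift_contDiff))
    (foot_offset_smooth hY δ)) (offset_smooth hY δ)) (ContinuousLinearMap.precomp E4 (inV.comp tail))

end Smooth

/-- `PY` is constant on circles, so `Y_t` may be replaced by the `t`-derivative of `QY` and the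
right side depends on `PY` only through `drift0` and the coefficients. -/
theorem IsNearCylinder.dS_eq {G : MorseBottNbhd} {δ ε a b : ℝ} {k : ℕ} {Y : ℝ → ℝ → E4}
    (h : G.IsNearCylinder δ ε a b k Y) {s : ℝ} (hs : s ∈ Set.Icc a b) (t : ℝ) :
    dS Y s t = dT (fun s t => -J0 (projQ G.τ Y s t)) s t + G.drift0 δ (projP G.τ Y s t 2)
      + G.rotAlong Y s t • piY (projQ G.τ Y s t)
      + (G.coef δ Y s t (dT (projQ G.τ Y) s t) + G.remCoef δ Y s t (projQ G.τ Y s t)) := by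
  have h1 := G.drift_eq_add δ Y s t
  have h2 : dT (fun s t => -J0 (projQ G.τ Y s t)) s t = -J0 (dT Y s t) := by
    have := h.smooth.projQ (τ := G.τ) |>.dT_clm (-J0)
    rw [dT_projQ h.smooth] at this
    exact congrFun (congrFun this s) t
  rw [h.eqn s hs t, h2, dT_projQ h.smooth, map_add]
  unfold drift at h1
  change _ + (_ + G.dev (δ, t • ez + tail (Y s t)) (EuclideanSpace.single 1 1)) = _
  rw [h1]
  abel

theorem IsNearCylinder.periodic_projQ {G : MorseBottNbhd} {δ ε a b : ℝ} {k : ℕ} {Y : ℝ → ℝ → E4}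
    (h : G.IsNearCylinder δ ε a b k Y) : PeriodicOn G.τ (Set.Icc a b) (projQ G.τ Y) := by
  intro s hs t
  unfold projQ
  rw [h.periodic s hs]
  rfl

theorem IsNearCylinder.periodic_coef {G : MorseBottNbhd} {δ ε a b : ℝ} {k : ℕ} {Y : ℝ → ℝ → E4}
    (h : G.IsNearCylinder δ ε a b k Y) : PeriodicOn G.τ (Set.Icc a b) (G.coef δ Y) := by
  intro s hs t
  unfold coef
  rw [h.periodic s hs, ← G.dev_periodic_z (δ, t • ez + tail (Y s t))]
  rw [show (t + G.τ) • ez + tail (Y s t) = t • ez + tail (Y s t) + G.τ • ez by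
    rw [add_smul, add_right_comm]]
  simp

/-- `P` kills the exact derivative `-J₀ W_t` and the `y`-directed term, while it fixes `drift0`;
hence `drift0` disappears from the equation of `QY` and drives that of `PY`. Integration by parts
replaces `P(M W_t)` by `-P(M_t W)`, so no derivative of `W` forces `PY`. -/
theorem IsNearCylinder.linSys {G : MorseBottNbhd} {δ ε a b : ℝ} {k : ℕ} {Y : ℝ → ℝ → E4}
    (h : G.IsNearCylinder δ ε a b k Y) :
    LinSys G.τ a b (G.rotAlong Y) (G.coef δ Y) (G.remCoef δ Y) (projQ G.τ Y) ∧
    ∀ s ∈ Set.Icc a b, ∀ t, dS (projP G.τ Y) s t = G.drift0 δ (projP G.τ Y s t 2)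
      + projP G.τ (fun s t => (G.remCoef δ Y s t - dT (G.coef δ Y) s t) (projQ G.τ Y s t)) s t := by
  have hτ := G.τ_pos
  have hY := h.smooth
  have hW : Smooth2 (projQ G.τ Y) := hY.projQ
  have hM := G.coef_smooth δ hY
  have hc : Smooth2 (G.remCoef δ Y) := remCoef_smooth hY δ
  have hκ : Smooth2 (G.rotAlong Y) := rotAlong_smooth hY
  have s1 : Smooth2 (fun s t => -J0 (projQ G.τ Y s t)) := hW.clm (-J0)
  have s2 : Smooth2 (fun s t => G.drift0 δ (projP G.τ Y s t 2)) :=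
    Smooth2.comp (G.drift0_contDiff δ) (hY.projP.coord 2)
  have e2 : ∀ s t, projP G.τ (fun s t => G.drift0 δ (projP G.τ Y s t 2)) s t
      = G.drift0 δ (projP G.τ Y s t 2) := fun s t =>
    projP_of_const hτ (g := fun s => G.drift0 δ (projP G.τ Y s 0 2)) (by simp [drift0]) t
  have s3 : Smooth2 (fun s t => G.rotAlong Y s t • piY (projQ G.τ Y s t)) := hκ.smul (hW.clm piY)
  have s4 : Smooth2 (fun s t => G.coef δ Y s t (dT (projQ G.τ Y) s t)) := hM.apply hW.dT
  have s5 : Smooth2 (fun s t => G.remCoef δ Y s t (projQ G.τ Y s t)) := hc.apply hW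
  have hper := h.periodic_projQ
  have hz : ∀ s ∈ Set.Icc a b, ∀ t, projP G.τ (dT (fun s t => -J0 (projQ G.τ Y s t))) s t = 0 := by
    intro s hs t
    refine projP_dT s1 ?_ t
    have := hper s hs 0
    rw [zero_add] at this
    rw [this]
  have key : ∀ s ∈ Set.Icc a b, ∀ t, projP G.τ (dS Y) s t = G.drift0 δ (projP G.τ Y s t 2)
      + projP G.τ (fun s t => G.coef δ Y s t (dT (projQ G.τ Y) s t)
        + G.remCoef δ Y s t (projQ G.τ Y s t)) s t := by
    intro s hs t
    rw [projP_congr (ψ := fun s t => dT (fun s t => -J0 (projQ G.τ Y s t)) s t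
      + G.drift0 δ (projP G.τ Y s t 2)
      + G.rotAlong Y s t • piY (projQ G.τ Y s t)
      + (G.coef δ Y s t (dT (projQ G.τ Y) s t) + G.remCoef δ Y s t (projQ G.τ Y s t)))
      (fun t => h.dS_eq hs t),
      projP_add ((s1.dT.add s2).add s3) (s4.add s5), projP_add (s1.dT.add s2) s3,
      projP_add s1.dT s2, hz s hs, projP_smul_piY, zero_add, add_zero, e2]
  refine ⟨⟨hτ, h.lt, hκ, hM, hc, hW, h.periodic_coef, hper,
    fun s _ => piP_integral_projQ hτ hY s, fun s hs t => ?_⟩, fun s hs t => ?_⟩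
  · rw [dS_projQ hY]
    have e : dT (fun s t => -J0 (projQ G.τ Y s t)) s t = -J0 (dT (projQ G.τ Y) s t) :=
      congrFun (congrFun (hW.dT_clm (-J0)) s) t
    change dS Y s t - projP G.τ (dS Y) s t = _ + (_ - projP G.τ _ s t)
    rw [key s hs t]
    rw [h.dS_eq hs t, e]
    have aux : ∀ A B C D E : E4, A + B + C + D - (B + E) = A + C + (D - E) := by intros; abel
    exact aux _ _ _ _ _
  · rw [dS_projP hY, key s hs t]
    congr 1
    have s6 : Smooth2 (fun s t => G.coef δ Y s t (projQ G.τ Y s t)) := hM.apply hW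
    have s7 : Smooth2 (fun s t => (G.remCoef δ Y s t - dT (G.coef δ Y) s t) (projQ G.τ Y s t)) :=
      (hc.sub hM.dT).apply hW
    rw [projP_congr (ψ := fun s t => dT (fun s t => G.coef δ Y s t (projQ G.τ Y s t)) s t
      + (G.remCoef δ Y s t - dT (G.coef δ Y) s t) (projQ G.τ Y s t)), projP_add s6.dT s7,
      projP_dT s6, zero_add]
    · have h1 := hper s hs 0
      have h2 := h.periodic_coef s hs 0
      rw [zero_add] at h1 h2
      simp only [h1, h2]
    · intro t
      rw [hM.dT_apply hW, sub_apply]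
      -- The product rule, solved for the term containing the derivative of `W`.
      have aux : ∀ A B C : E4, A + B = C + A + (B - C) := by intros; abel
      exact aux _ _ _

end MorseBottNbhd

theorem abs_projP_one_le {τ ε : ℝ} (hτ : 0 < τ) {Y : ℝ → ℝ → E4} {s : ℝ}
    (hb : ∀ t, |Y s t 1| ≤ ε) (t : ℝ) : |projP τ Y s t 1| ≤ ε := by
  have h1 := intervalIntegral.norm_integral_le_of_norm_le_const (a := 0) (b := τ)
    (f := fun t => Y s t 1) (C := ε) (fun t _ => hb t)
  rw [sub_zero, abs_of_pos hτ, Real.norm_eq_abs] at h1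
  have e : projP τ Y s t 1 = τ⁻¹ * ∫ t in (0 : ℝ)..τ, Y s t 1 := by simp [projP]
  rw [e, abs_mul, abs_of_pos (inv_pos.2 hτ)]
  calc τ⁻¹ * |∫ t in (0 : ℝ)..τ, Y s t 1| ≤ τ⁻¹ * (ε * τ) := by gcongr
    _ = ε := by field_simp

/-! ### Smallness of the coefficients -/

namespace MorseBottNbhd

/-- Composition with the inclusion of the components `z, x, y`. -/
def preTail : ((ℝ × E3) →L[ℝ] E4) →L[ℝ] (E4 →L[ℝ] E4) :=
  ContinuousLinearMap.precomp E4 (inV.comp tail)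

variable (G : MorseBottNbhd)

/-- Of `PY` the offset contains only the mean of `z - t`, which is small. The mean of `x` is not
small and is assigned to the foot point instead. -/
theorem exists_cSize_offset_le {k : ℕ} (hk : 1 ≤ k) : ∃ C η : ℝ, 0 < C ∧ 0 < η ∧ η ≤ 1 ∧
    ∀ (δ ε a b : ℝ) (Y : ℝ → ℝ → E4), G.IsNearCylinder δ ε a b k Y → δ + ε ≤ η →
    ∀ s ∈ Set.Icc a b, ∀ t, cSize k (G.offset δ Y) s t ≤ C * (δ + ε) ∧
      cSize k (projQ G.τ Y) s t ≤ C * (δ + ε) ∧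
      ∀ i j : ℕ, 1 ≤ i + j → i + j ≤ k → ‖pd i j (projP G.τ Y) s t‖ ≤ C * (δ + ε) := by
  obtain ⟨C, η, hC, hη, H⟩ := exists_cSize_projQ_le G hk
  refine ⟨1 + ((k : ℝ) + 1) ^ 2 * (1 + ‖offZ‖ * C) + ‖offW‖ * C + C, min η 1, by positivity,
    by positivity, min_le_right _ _, ?_⟩
  intro δ ε a b Y h hle s hs t
  have hδ := h.δ_pos
  have hε := h.ε_pos
  have hY := h.smooth
  obtain ⟨h1, h2⟩ := H δ ε a b Y h (hle.trans (min_le_left _ _)) s hs t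
  have hZ : cSize k (fun s t => offZ (projP G.τ Y s t)) s t
      ≤ ((k : ℝ) + 1) ^ 2 * ((1 + ‖offZ‖ * C) * (δ + ε)) := by
    refine cSize_le (by positivity) fun i j hij => ?_
    rw [hY.projP.pd_clm]
    rcases Nat.eq_zero_or_pos (i + j) with h3 | h3
    · obtain ⟨rfl, rfl⟩ : i = 0 ∧ j = 0 := by omega
      have h4 := abs_projP_one_le G.τ_pos (fun t => (h.close s hs t 0 0 (by omega)).1) t
      rw [pd_zero_zero] at h4
      change ‖offZ (projP G.τ Y s t)‖ ≤ _
      rw [offZ_apply]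
      have h5 : ‖(ez : E3)‖ = 1 := by simp [ez]
      have h6 : 0 ≤ ‖offZ‖ * C * (δ + ε) := by positivity
      simp only [Prod.norm_def, norm_zero, norm_smul, h5, mul_one, Real.norm_eq_abs]
      refine (max_le (max_le hε.le h4) (by simp [hε.le])).trans (by nlinarith)
    · refine (offZ.le_opNorm _).trans ?_
      have h4 := h2 i j h3 hij
      have h5 : ‖offZ‖ * ‖pd i j (projP G.τ Y) s t‖ ≤ ‖offZ‖ * (C * (δ + ε)) := by gcongr
      nlinarith
  have hW : cSize k (fun s t => offW (projQ G.τ Y s t)) s t ≤ ‖offW‖ * (C * (δ + ε)) :=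
    (cSize_clm_le hY.projQ offW k s t).trans (by gcongr)
  have hδ' : ‖(((δ, 0), 0) : (ℝ × E3) × (ℝ × E3))‖ ≤ δ := by
    simp [Prod.norm_def, abs_of_pos hδ, hδ.le]
  have p1 : 0 ≤ ((k : ℝ) + 1) ^ 2 * (1 + ‖offZ‖ * C) * (δ + ε) := by positivity
  have p2 : 0 ≤ ‖offW‖ * C * (δ + ε) := by positivity
  have p3 : 0 ≤ C * (δ + ε) := by positivity
  refine ⟨?_, by nlinarith, fun i j h3 h4 => (h2 i j h3 h4).trans (by nlinarith)⟩
  have hP : Smooth2 (projP G.τ Y) := hY.projP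
  have hQ : Smooth2 (projQ G.τ Y) := hY.projQ
  have h3 := cSize_add_le ((Smooth2.const (((δ, 0), 0) : (ℝ × E3) × (ℝ × E3))).add
    (hP.clm offZ)) (hQ.clm offW) k s t
  have h4 := cSize_add_le (Smooth2.const (((δ, 0), 0) : (ℝ × E3) × (ℝ × E3)))
    (hP.clm offZ) k s t
  rw [cSize_const] at h4
  change cSize k (fun s t => ((δ, 0), 0) + offZ (projP G.τ Y s t) + offW (projQ G.τ Y s t)) s t ≤ _
  have e : (1 + ((k : ℝ) + 1) ^ 2 * (1 + ‖offZ‖ * C) + ‖offW‖ * C + C) * (δ + ε)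
      = (δ + ε) + ((k : ℝ) + 1) ^ 2 * ((1 + ‖offZ‖ * C) * (δ + ε)) + ‖offW‖ * (C * (δ + ε))
        + C * (δ + ε) := by ring
  rw [e]
  linarith

/-- The coefficient is evaluated on the offset, which is small. The second Hadamard quotient is
periodic in the foot point, so it is bounded although the foot point runs through the universal
cover. -/
theorem exists_cSize_remCoef_le {k : ℕ} (hk : 1 ≤ k) : ∃ C η : ℝ, 0 < C ∧ 0 < η ∧
    ∀ (δ ε a b : ℝ) (Y : ℝ → ℝ → E4), G.IsNearCylinder δ ε a b k Y → δ + ε ≤ η →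
    ∀ s ∈ Set.Icc a b, ∀ t, cSize k (G.remCoef δ Y) s t ≤ C * (δ + ε) := by
  obtain ⟨C, η, hC, hη, hη1, H⟩ := G.exists_cSize_offset_le hk
  have hΦ := hadamard_contDiff (hadamard_contDiff G.drift_contDiff)
  have hB := BddDerivs.of_periodic hΦ
    (hadamard_periodic (hadamard_periodic G.drift_periodic_z))
    (hadamard_periodic (hadamard_periodic G.drift_periodic_x)) C
  obtain ⟨C', hC0, hC'⟩ := cSize_comp_le k hΦ hB (‖(((0, ez), 0) : (ℝ × E3) × (ℝ × E3))‖ + ‖posX‖ * C + C)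
    (by positivity)
  set L := ‖preTail‖
  refine ⟨L * (5 ^ k * C' * C) + 1, η, by positivity, hη, ?_⟩
  intro δ ε a b Y h hle s hs t
  have hδ := h.δ_pos
  have hε := h.ε_pos
  have hY := h.smooth
  obtain ⟨h1, h2, h3⟩ := H δ ε a b Y h hle s hs t
  have hle1 : C * (δ + ε) ≤ C := by nlinarith
  have hτ := G.τ_pos.ne'
  have hmem : (G.foot Y s t, G.offset δ Y s t) ∈ {v | ∃ r₁ r₂ : ℝ,
      ‖v - r₁ • (((((0 : ℝ), G.τ • ez), (0 : ℝ × E3)), (0 : (ℝ × E3) × (ℝ × E3))))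
        - r₂ • (((((0 : ℝ), ex), (0 : ℝ × E3)), (0 : (ℝ × E3) × (ℝ × E3))))‖ ≤ C} := by
    refine ⟨t / G.τ, projP G.τ Y s t 2, ?_⟩
    have e : (G.foot Y s t, G.offset δ Y s t)
        - (t / G.τ) • (((((0 : ℝ), G.τ • ez), (0 : ℝ × E3)), (0 : (ℝ × E3) × (ℝ × E3))))
        - projP G.τ Y s t 2 • (((((0 : ℝ), ex), (0 : ℝ × E3)), (0 : (ℝ × E3) × (ℝ × E3))))
        = (0, G.offset δ Y s t) := by
      rw [foot_eq]
      refine Prod.ext (Prod.ext (Prod.ext (by simp) ?_) (by simp)) (by simp)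
      simp [xPart_apply, smul_smul, hτ]
    rw [e, Prod.norm_def, norm_zero]
    exact max_le hC.le ((norm_le_cSize k _ s t).trans (h1.trans hle1))
  have h4 : cSize k (fun s t => hadamard (hadamard G.drift) (G.foot Y s t, G.offset δ Y s t)) s t ≤ C' := by
    refine hC' _ (foot_offset_smooth hY δ) s t hmem fun i j hij hk' => ?_
    have e : (fun s t => (G.foot Y s t, G.offset δ Y s t)) = fun s t =>
        (ContinuousLinearMap.inl ℝ ((ℝ × E3) × (ℝ × E3)) ((ℝ × E3) × (ℝ × E3))) (G.foot Y s t)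
        + (ContinuousLinearMap.inr ℝ ((ℝ × E3) × (ℝ × E3)) ((ℝ × E3) × (ℝ × E3))) (G.offset δ Y s t) := by
      funext s t; simp
    rw [e, ((foot_smooth hY).clm _).pd_add ((offset_smooth hY δ).clm _), (foot_smooth hY).pd_clm,
      (offset_smooth hY δ).pd_clm]
    have b1 : ‖pd i j (G.foot Y) s t‖ ≤ ‖(((0, ez), 0) : (ℝ × E3) × (ℝ × E3))‖ + ‖posX‖ * C :=
      norm_pd_affine_add_clm_le hY.projP 0 _ posX hij ((h3 i j hij hk').trans hle1)
    have b2 : ‖pd i j (G.offset δ Y) s t‖ ≤ C :=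
      (norm_pd_le_cSize hk' _ s t).trans (h1.trans hle1)
    refine (norm_add_le _ _).trans (add_le_add ?_ ?_)
    · simpa [Prod.norm_def] using b1
    · simpa [Prod.norm_def] using b2
  have hs1 := Smooth2.comp hΦ (foot_offset_smooth (G := G) hY δ)
  have hs2 := offset_smooth (G := G) hY δ
  have h5 := cSize_apply_le k hs1 hs2 s t
  have h6 := cSize_clm_le (hs1.apply hs2)
    preTail k s t
  have h7 : 5 ^ k * cSize k (fun s t => hadamard (hadamard G.drift) (G.foot Y s t, G.offset δ Y s t)) s t
      * cSize k (G.offset δ Y) s t ≤ 5 ^ k * C' * (C * (δ + ε)) := by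
    gcongr
    exact cSize_nonneg _ _ _ _
  calc cSize k (G.remCoef δ Y) s t ≤ L * (5 ^ k * C' * (C * (δ + ε))) :=
        h6.trans (mul_le_mul_of_nonneg_left (h5.trans h7) (norm_nonneg _))
    _ ≤ _ := by nlinarith

/-- The coefficient depends on `s` only through the mean of `x`, whose derivatives of positive order
are small. -/
theorem exists_cSize_rotAlong_le {k : ℕ} (hk : 1 ≤ k) : ∃ C η : ℝ, 0 < C ∧ 0 < η ∧
    ∀ (δ ε a b : ℝ) (Y : ℝ → ℝ → E4), G.IsNearCylinder δ ε a b k Y → δ + ε ≤ η →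
    ∀ s ∈ Set.Icc a b, ∀ t, cSize k (G.rotAlong Y) s t ≤ C ∧
      cSize (k - 1) (dS (G.rotAlong Y)) s t ≤ C * (δ + ε) := by
  obtain ⟨C, η, hC, hη, hη1, H⟩ := G.exists_cSize_offset_le hk
  have hB := BddDerivs.of_periodic G.rot_contDiff G.rot_periodic_z G.rot_periodic_x 0
  obtain ⟨C1, hC10, hC1⟩ := cSize_comp_le k G.rot_contDiff hB (‖(ez : E3)‖ + ‖xPart‖ * C) (by positivity)
  obtain ⟨C2, hC20, hC2⟩ := cSize_dS_comp_le (k - 1) G.rot_contDiff hB (‖(ez : E3)‖ + ‖xPart‖ * C)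
    (by positivity)
  refine ⟨C1 + C2 * (‖xPart‖ * ((((k - 1 : ℕ) : ℝ) + 1) ^ 2 * C)) + 1, η, by positivity, hη, ?_⟩
  intro δ ε a b Y h hle s hs t
  have hδ := h.δ_pos
  have hε := h.ε_pos
  have hY := h.smooth
  obtain ⟨h1, h2, h3⟩ := H δ ε a b Y h hle s hs t
  have hle1 : C * (δ + ε) ≤ C := by nlinarith
  have hτ := G.τ_pos.ne'
  have hθ : Smooth2 (fun s t => 0 + t • ez + xPart (projP G.τ Y s t)) := smooth_base hY
  have hmem : (0 + t • ez + xPart (projP G.τ Y s t)) ∈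
      {v : E3 | ∃ r₁ r₂ : ℝ, ‖v - r₁ • G.τ • ez - r₂ • ex‖ ≤ 0} := by
    refine ⟨t / G.τ, projP G.τ Y s t 2, ?_⟩
    simp [xPart_apply, smul_smul, hτ]
  have hD : ∀ i j : ℕ, 1 ≤ i + j → i + j ≤ k →
      ‖pd i j (fun s t => 0 + t • ez + xPart (projP G.τ Y s t)) s t‖ ≤ ‖(ez : E3)‖ + ‖xPart‖ * C :=
    fun i j hij hk' => norm_pd_affine_add_clm_le hY.projP 0 _ xPart hij ((h3 i j hij hk').trans hle1)
  have b1 : cSize k (G.rotAlong Y) s t ≤ C1 := hC1 _ hθ s t hmem hD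
  have b2 : cSize (k - 1) (dS (G.rotAlong Y)) s t
      ≤ C2 * cSize (k - 1) (dS (fun s t => 0 + t • ez + xPart (projP G.τ Y s t))) s t :=
    hC2 _ hθ s t hmem fun i j hij hk' => hD i j hij (by omega)
  have e : dS (fun s t => 0 + t • ez + xPart (projP G.τ Y s t))
      = fun s t => xPart (dS (projP G.τ Y) s t) := by
    rw [(Smooth2.affine 0 ez).dS_add (hY.projP.clm xPart), hY.projP.dS_clm]
    funext s t
    have : dS (fun _ t : ℝ => (0 : E3) + t • ez) s t = 0 := deriv_const _ _
    rw [this, zero_add]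
  have b3 : cSize (k - 1) (fun s t => xPart (dS (projP G.τ Y) s t)) s t
      ≤ ‖xPart‖ * ((((k - 1 : ℕ) : ℝ) + 1) ^ 2 * (C * (δ + ε))) := by
    refine (cSize_clm_le hY.projP.dS xPart _ s t).trans ?_
    gcongr
    refine cSize_le (by positivity) fun i j hij => ?_
    rw [hY.projP.pd_dS]
    exact h3 _ _ (by omega) (by omega)
  rw [e] at b2
  have p1 : 0 ≤ C2 * (‖xPart‖ * ((((k - 1 : ℕ) : ℝ) + 1) ^ 2 * C)) := by positivity
  refine ⟨by linarith, b2.trans ?_⟩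
  have b4 := mul_le_mul_of_nonneg_left b3 hC20
  have p2 : 0 ≤ (C1 + 1) * (δ + ε) := by positivity
  nlinarith

theorem exists_small_linSys {k : ℕ} (hk : 1 ≤ k) : ∃ C η : ℝ, 0 < C ∧ 0 < η ∧
    ∀ (δ ε a b : ℝ) (Y : ℝ → ℝ → E4), G.IsNearCylinder δ ε a b k Y → δ + ε ≤ η →
    ∀ s ∈ Set.Icc a b, ∀ t,
      cSize k (G.coef δ Y) s t ≤ C * (δ + ε) ∧ cSize k (G.remCoef δ Y) s t ≤ C * (δ + ε) ∧
      cSize (k - 1) (dS (G.rotAlong Y)) s t ≤ C * (δ + ε) ∧ cSize k (G.rotAlong Y) s t ≤ C ∧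
      cSize k (projQ G.τ Y) s t ≤ C * (δ + ε) := by
  obtain ⟨C1, h1, H1⟩ := G.exists_cSize_dev_le k
  obtain ⟨C2, η2, h2, e2, H2⟩ := G.exists_cSize_remCoef_le hk
  obtain ⟨C3, η3, h3, e3, H3⟩ := G.exists_cSize_rotAlong_le hk
  obtain ⟨C4, η4, h4, e4, H4⟩ := exists_cSize_projQ_le G hk
  refine ⟨C1 + C2 + C3 + C4, min (min η2 η3) (min η4 1), by positivity, by positivity, ?_⟩
  intro δ ε a b Y h hle s hs t
  have hδ := h.δ_pos
  have hε := h.ε_pos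
  simp only [le_min_iff] at hle
  obtain ⟨⟨l2, l3⟩, l4, l1⟩ := hle
  have r1 := H1 δ ε Y s t hδ hε (by linarith) (by linarith) h.smooth (h.close s hs t)
  have r2 := H2 δ ε a b Y h l2 s hs t
  obtain ⟨r3, r3'⟩ := H3 δ ε a b Y h l3 s hs t
  have r4 := (H4 δ ε a b Y h l4 s hs t).1
  have p1 : 0 ≤ C1 * (δ + ε) := by positivity
  have p2 : 0 ≤ C2 * (δ + ε) := by positivity
  have p3 : 0 ≤ C3 * (δ + ε) := by positivity
  have p4 : 0 ≤ C4 * (δ + ε) := by positivity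
  have e : (C1 + C2 + C3 + C4) * (δ + ε)
      = C1 * (δ + ε) + C2 * (δ + ε) + C3 * (δ + ε) + C4 * (δ + ε) := by ring
  rw [e]
  exact ⟨r1.trans (by linarith), by linarith, by linarith, by linarith, by linarith⟩

end MorseBottNbhd

/-! ### Hyperbolic cosine profiles and end norms -/

theorem cosh_two_mul_div_le {x y : ℝ} (h : |x| ≤ |y|) :
    Real.cosh (2 * x) / Real.cosh (2 * y) ≤ (Real.cosh x / Real.cosh y) ^ 2 := by
  have hx := Real.cosh_pos x
  have hy := Real.cosh_pos y
  have h1 : Real.cosh x ^ 2 ≤ Real.cosh y ^ 2 :=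
    pow_le_pow_left₀ hx.le (Real.cosh_le_cosh.2 h) 2
  rw [div_pow, div_le_div_iff₀ (Real.cosh_pos _) (by positivity), Real.cosh_two_mul,
    Real.cosh_two_mul, Real.sinh_sq, Real.sinh_sq]
  nlinarith

theorem cosh_div_le_one {x y : ℝ} (h : |x| ≤ |y|) : Real.cosh x / Real.cosh y ≤ 1 :=
  (div_le_one (Real.cosh_pos _)).2 (Real.cosh_le_cosh.2 h)

theorem abs_mul_sub_mid_le {a b s ν : ℝ} (hν : 0 ≤ ν) (hs : s ∈ Set.Icc a b) :
    |ν * (s - (a + b) / 2)| ≤ |ν * (b - a) / 2| := by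
  rw [mul_div_assoc, abs_mul, abs_mul, abs_of_nonneg hν,
    abs_of_nonneg (by linarith [hs.1, hs.2] : (0 : ℝ) ≤ (b - a) / 2)]
  refine mul_le_mul_of_nonneg_left (abs_le.2 ⟨?_, ?_⟩) hν <;> linarith [hs.1, hs.2]

/-- The profile `cosh(ν (s - (a+b)/2)) / cosh(ν (b - a)/2)`. -/
def coshProfile (ν a b s : ℝ) : ℝ :=
  Real.cosh (ν * (s - (a + b) / 2)) / Real.cosh (ν * (b - a) / 2)

theorem coshProfile_pos (ν a b s : ℝ) : 0 < coshProfile ν a b s :=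
  div_pos (Real.cosh_pos _) (Real.cosh_pos _)

theorem coshProfile_le_one {ν a b s : ℝ} (hν : 0 ≤ ν) (hs : s ∈ Set.Icc a b) :
    coshProfile ν a b s ≤ 1 := cosh_div_le_one (abs_mul_sub_mid_le hν hs)

/-- The rate is traded for a power: roots of a profile are bounded by the profile with
correspondingly smaller rate. It rests on `cosh 2x = 2 cosh² x - 1`, because `(2X - 1)/(2Y - 1) ≤
X/Y` for `1 ≤ X ≤ Y`. -/
theorem coshProfile_two_mul_le {ν a b s : ℝ} (hν : 0 ≤ ν) (hs : s ∈ Set.Icc a b) :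
    coshProfile (2 * ν) a b s ≤ coshProfile ν a b s ^ 2 := by
  have := cosh_two_mul_div_le (abs_mul_sub_mid_le hν hs)
  unfold coshProfile
  rw [mul_assoc, show 2 * ν * (b - a) / 2 = 2 * (ν * (b - a) / 2) by ring]
  exact this

/-- The larger of the `L²`-norms over the two boundary circles. -/
def endNorm (τ a b : ℝ) (W : ℝ → ℝ → E4) : ℝ := max (sliceNorm τ W a) (sliceNorm τ W b)

theorem endNorm_nonneg (τ a b : ℝ) (W : ℝ → ℝ → E4) : 0 ≤ endNorm τ a b W :=
  le_max_of_le_left (Real.sqrt_nonneg _)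

theorem endNorm_eq (τ a b : ℝ) (W : ℝ → ℝ → E4) :
    endNorm τ a b W = Real.sqrt (max (l2sq τ W a) (l2sq τ W b)) :=
  (Monotone.map_max (f := Real.sqrt) fun _ _ h => Real.sqrt_le_sqrt h).symm

theorem max_l2sq_rpow {τ : ℝ} (hτ : 0 ≤ τ) (a b : ℝ) (W : ℝ → ℝ → E4) (k : ℝ) :
    max (l2sq τ W a) (l2sq τ W b) ^ (1 / k) = endNorm τ a b W ^ (2 / k) := by
  have h0 : 0 ≤ max (l2sq τ W a) (l2sq τ W b) := le_max_of_le_left (l2sq_nonneg hτ _ _)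
  rw [endNorm_eq, Real.sqrt_eq_rpow, ← Real.rpow_mul h0]
  congr 1; ring

/-- For a nonnegative exponent, taking powers commutes with the maximum of the two end norms. -/
theorem coshBound_eq {τ p : ℝ} (hp : 0 ≤ 2 / p) (lam a b : ℝ) (Y : ℝ → ℝ → E4) (s : ℝ) :
    coshBound τ p lam a b Y s = endNorm τ a b (projQ τ Y) ^ (2 / p) * coshProfile lam a b s := by
  unfold coshBound coshProfile endNorm
  congr 1
  have h1 : (0 : ℝ) ≤ sliceNorm τ (projQ τ Y) a := Real.sqrt_nonneg _
  have h2 : (0 : ℝ) ≤ sliceNorm τ (projQ τ Y) b := Real.sqrt_nonneg _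
  rcases le_total (sliceNorm τ (projQ τ Y) a) (sliceNorm τ (projQ τ Y) b) with h | h
  · rw [max_eq_right h, max_eq_right (Real.rpow_le_rpow h1 h hp)]
  · rw [max_eq_left h, max_eq_left (Real.rpow_le_rpow h2 h hp)]

namespace MorseBottNbhd

variable (G : MorseBottNbhd)

theorem exists_decay : ∃ μ : ℝ, 0 < μ ∧ ∀ k : ℕ, 1 ≤ k → ∃ C η : ℝ, 0 < C ∧ 0 < η ∧
    ∀ (δ ε a b : ℝ) (Y : ℝ → ℝ → E4), G.IsNearCylinder δ ε a b k Y → δ + ε ≤ η →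
    endNorm G.τ a b (projQ G.τ Y) ≤ 1 ∧
    (∀ s ∈ Set.Icc a b, ∀ t, cSize k (G.coef δ Y) s t ≤ C * (δ + ε) ∧
      cSize k (G.remCoef δ Y) s t ≤ C * (δ + ε)) ∧
    ∀ s ∈ Set.Icc a b, l2c G.τ (k - 1) (projQ G.τ Y) s
        ≤ C * (endNorm G.τ a b (projQ G.τ Y) ^ (2 / (k : ℝ)) * coshProfile μ a b s) ∧
      ∀ t, cSize (k - 1) (projQ G.τ Y) s t ^ 4
        ≤ C * (δ + ε) ^ 2 * (endNorm G.τ a b (projQ G.τ Y) ^ (2 / (k : ℝ)) * coshProfile μ a b s) := by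
  obtain ⟨Kb, m, hm, hKb, hmle⟩ := G.exists_rot_bounds
  have hτ := G.τ_pos
  obtain ⟨μ, hμ, H⟩ := LinSys.exists_decay_cSize (Kb := Kb) hτ hm
  refine ⟨μ, hμ, fun k hk => ?_⟩
  obtain ⟨C1, η1, hC1, hη1, H1⟩ := G.exists_small_linSys hk
  obtain ⟨η2, C2, hη2, hC2, H2⟩ := H k C1 hk
  -- With `σ = C1 (δ + ε)` the last bound on `δ + ε` ensures `τ σ² ≤ 1`, which interpolation
  -- requires and which also makes the end norms at most one.
  refine ⟨C1 + C2 + C2 * C1 ^ 2, min η1 (min (η2 / C1) (1 / (C1 * (τ G + 1)))), by positivity,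
    by positivity, ?_⟩
  intro δ ε a b Y h hle
  have hδ := h.δ_pos
  have hε := h.ε_pos
  have hpos : 0 < δ + ε := by linarith
  simp only [le_min_iff] at hle
  obtain ⟨l1, l2, l3⟩ := hle
  rw [le_div_iff₀ hC1] at l2
  rw [le_div_iff₀ (by positivity)] at l3
  have hb := H1 δ ε a b Y h l1
  have hσ0 : 0 ≤ C1 * (δ + ε) := by positivity
  have hσ1 : G.τ * (C1 * (δ + ε)) ^ 2 ≤ 1 := by
    have e1 : C1 * (δ + ε) * (G.τ + 1) ≤ 1 := by linarith
    have e2 : C1 * (δ + ε) ≤ 1 := by nlinarith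
    nlinarith
  -- On each circle the rotation coefficient is that of one Reeb orbit of the torus, so the uniform
  -- bounds and the lower bound of its integral apply.
  have hrot : ∀ s t, G.rotAlong Y s t = G.rot !₂[t, projP G.τ Y s 0 2, 0] := by
    intro s t
    unfold rotAlong
    congr 1
    ext i; fin_cases i <;> simp [xPart_apply, ez, ex, projP]
  have key := H2 a b _ _ _ _ (C1 * (δ + ε)) h.linSys.1 hσ1
    (fun s hs t => (hb s hs t).1.trans (by linarith))
    (fun s hs t => (hb s hs t).2.1.trans (by linarith))
    (fun s hs t => (hb s hs t).2.2.1.trans (by linarith))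
    (fun s hs t => (hb s hs t).2.2.2.1)
    (fun s _ t => by rw [hrot]; exact hKb _ _)
    (fun s _ => by simp only [hrot]; exact hmle _)
    (fun s hs t => (hb s hs t).2.2.2.2)
  have hW : Smooth2 (projQ G.τ Y) := h.smooth.projQ
  have hl : ∀ s ∈ Set.Icc a b, l2sq G.τ (projQ G.τ Y) s ≤ 1 := fun s hs =>
    (l2sq_le_sq hτ.le hW (C := C1 * (δ + ε)) fun t =>
      (norm_le_cSize k _ s t).trans (hb s hs t).2.2.2.2).trans hσ1
  have c1 : 0 ≤ C2 * C1 ^ 2 := by positivity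
  have hN0 := endNorm_nonneg G.τ a b (projQ G.τ Y)
  refine ⟨?_, fun s hs t => ⟨(hb s hs t).1.trans ?_, (hb s hs t).2.1.trans ?_⟩, fun s hs => ?_⟩
  · rw [endNorm_eq]
    exact Real.sqrt_le_one.2 (max_le (hl a ⟨le_refl _, h.lt.le⟩) (hl b ⟨h.lt.le, le_refl _⟩))
  · gcongr; linarith
  · gcongr; linarith
  · have hX : 0 ≤ endNorm G.τ a b (projQ G.τ Y) ^ (2 / (k : ℝ)) * coshProfile μ a b s :=
      mul_nonneg (Real.rpow_nonneg hN0 _) (coshProfile_pos _ _ _ _).le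
    obtain ⟨k1, k2⟩ := key s hs
    rw [max_l2sq_rpow hτ.le] at k1 k2
    refine ⟨k1.trans (mul_le_mul_of_nonneg_right (by linarith) hX), fun t => (k2 t).trans ?_⟩
    refine mul_le_mul_of_nonneg_right ?_ hX
    have : 0 ≤ (C1 + C2) * (δ + ε) ^ 2 := by positivity
    nlinarith

end MorseBottNbhd

theorem rpow_le_rpow_of_le_one {N : ℝ} (h0 : 0 ≤ N) (h1 : N ≤ 1) {x y : ℝ} (hx : 0 ≤ x)
    (hxy : x ≤ y) : N ^ y ≤ N ^ x := Real.rpow_le_rpow_of_exponent_ge' h0 h1 hx hxy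

/-- The fourth root of `N^(2/k)` is `N^(1/(2k))`; for `N ≤ 1` this is at most `N^(2/p)` because `p >
4k`. -/
theorem le_of_pow_four_le {N ch4 ch A K : ℝ} {k : ℕ} {p : ℝ} (hk : 1 ≤ k) (hp : 4 * (k : ℝ) < p)
    (hN0 : 0 ≤ N) (hN1 : N ≤ 1) (hch : 0 ≤ ch) (hch4 : ch4 ≤ ch ^ 4) (hc0 : 0 ≤ ch4)
    (hK : K ≤ 1) (hA : A ^ 4 ≤ K * (N ^ (2 / (k : ℝ)) * ch4)) : A ≤ N ^ (2 / p) * ch := by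
  have hk' : (0 : ℝ) < k := by exact_mod_cast hk
  have hp0 : 0 < p := by linarith
  have hB : 0 ≤ N ^ (2 / p) * ch := mul_nonneg (Real.rpow_nonneg hN0 _) hch
  refine le_of_pow_le_pow_left₀ (n := 4) (by norm_num) hB (hA.trans ?_)
  have e1 : (N ^ (2 / p)) ^ 4 = N ^ (8 / p) := by
    rw [← Real.rpow_natCast, ← Real.rpow_mul hN0]
    congr 1; push_cast; ring
  have e2 : N ^ (2 / (k : ℝ)) ≤ N ^ (8 / p) := by
    refine rpow_le_rpow_of_le_one hN0 hN1 (by positivity) ?_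
    rw [div_le_div_iff₀ hp0 hk']
    linarith
  rw [mul_pow, e1]
  have h2 : 0 ≤ N ^ (2 / (k : ℝ)) := Real.rpow_nonneg hN0 _
  calc K * (N ^ (2 / (k : ℝ)) * ch4) ≤ 1 * (N ^ (2 / (k : ℝ)) * ch4) := by gcongr
    _ = N ^ (2 / (k : ℝ)) * ch4 := one_mul _
    _ ≤ N ^ (8 / p) * ch ^ 4 := by gcongr

/-! ### Global solutions and comparison for ordinary differential equations -/

theorem exists_global_solution {g : ℝ → ℝ} {K L : NNReal} (hK : LipschitzWith K g)
    (hL : ∀ x, |g x| ≤ L) (t₀ x₀ : ℝ) : ∃ x : ℝ → ℝ, x t₀ = x₀ ∧ ∀ t, HasDerivAt x (g (x t)) t := by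
  have h1 : ∀ n : ℕ, ∃ α : ℝ → ℝ, α t₀ = x₀ ∧
      ∀ t ∈ Set.Ioo (t₀ - (n + 1)) (t₀ + (n + 1)), HasDerivAt α (g (α t)) t := by
    intro n
    have hn : (0 : ℝ) < n + 1 := by positivity
    have hmem : t₀ ∈ Set.Icc (t₀ - ((n : ℝ) + 1)) (t₀ + ((n : ℝ) + 1)) := ⟨by linarith, by linarith⟩
    -- The spatial radius is the speed bound times the half-length of the interval, so the solution
    -- cannot leave it; the radius of initial values is zero.
    have hP : IsPicardLindelof (fun _ : ℝ => g) (⟨t₀, hmem⟩ : Set.Icc _ _) x₀ (L * (n + 1)) 0 L K := by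
      refine ⟨fun _ _ => hK.lipschitzOnWith, fun _ _ => continuousOn_const, fun _ _ x _ => hL x, ?_⟩
      simp
    obtain ⟨α, h0, h⟩ := hP.exists_eq_forall_mem_Icc_hasDerivWithinAt₀
    exact ⟨α, h0, fun t ht => (h t ⟨ht.1.le, ht.2.le⟩).hasDerivAt (Icc_mem_nhds ht.1 ht.2)⟩
  choose α hα0 hα using h1
  have huniq : ∀ m n : ℕ, m ≤ n →
      Set.EqOn (α m) (α n) (Set.Ioo (t₀ - (m + 1)) (t₀ + (m + 1))) := by
    intro m n hmn
    have hm : (0 : ℝ) < m + 1 := by positivity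
    have hmn' : (m : ℝ) ≤ n := by exact_mod_cast hmn
    exact ODE_solution_unique_of_mem_Ioo (v := fun _ => g) (s := fun _ => Set.univ) (t₀ := t₀)
      (fun _ _ => hK.lipschitzOnWith) ⟨by linarith, by linarith⟩
      (fun t ht => ⟨hα m t ht, trivial⟩)
      (fun t ht => ⟨hα n t ⟨by linarith [ht.1], by linarith [ht.2]⟩, trivial⟩)
      ((hα0 m).trans (hα0 n).symm)
  -- The interval with index `n` has half-length `n + 1`, so `t` lies in the interior of the
  -- interval chosen for it.
  refine ⟨fun t => α ⌈|t - t₀|⌉₊ t, by simp [hα0], fun t => ?_⟩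
  set N := ⌈|t - t₀|⌉₊ with hN
  have hle : |t - t₀| < N + 1 := by linarith [Nat.le_ceil |t - t₀|]
  have hmem : t ∈ Set.Ioo (t₀ - ((N : ℝ) + 1)) (t₀ + ((N : ℝ) + 1)) := by
    rw [abs_lt] at hle; exact ⟨by linarith [hle.1], by linarith [hle.2]⟩
  have hd := hα N t hmem
  refine hd.congr_of_eventuallyEq ?_
  filter_upwards [Ioo_mem_nhds hmem.1 hmem.2] with r hr
  have hr' : |r - t₀| < N + 1 := by rw [abs_lt]; exact ⟨by linarith [hr.1], by linarith [hr.2]⟩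
  rcases le_total ⌈|r - t₀|⌉₊ N with h | h
  · refine huniq _ _ h ?_
    have : |r - t₀| < (⌈|r - t₀|⌉₊ : ℝ) + 1 := by linarith [Nat.le_ceil |r - t₀|]
    rw [abs_lt] at this
    exact ⟨by linarith [this.1], by linarith [this.2]⟩
  · exact (huniq _ _ h hr).symm

/-- Comparison with a multiple of `sinh(ν r)`, which vanishes at zero as `D` does. Since `4κ ≤ ν`,
the feedback term uses at most a quarter of the comparison function's derivative, and the forcing
uses at most half. -/
theorem norm_le_sinh_of_deriv {ν κ e ℓ : ℝ} (hν : 0 < ν) (hκ : 0 ≤ κ) (hκν : 4 * κ ≤ ν)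
    (he : 0 ≤ e) {D D' : ℝ → E4} (hD : ∀ r, HasDerivAt D (D' r) r) (h0 : D 0 = 0)
    (hb : ∀ r ∈ Set.Icc 0 ℓ, ‖D' r‖ ≤ κ * ‖D r‖ + e * Real.cosh (ν * r)) :
    ∀ r ∈ Set.Icc 0 ℓ, ‖D r‖ ≤ 2 * e / ν * Real.cosh (ν * r) := by
  have key : ∀ θ > 0, ∀ r ∈ Set.Icc 0 ℓ, ‖D r‖ ≤ 2 * (e + θ) / ν * Real.sinh (ν * r) := by
    intro θ hθ r hr
    have hB : ∀ x, HasDerivAt (fun x => 2 * (e + θ) / ν * Real.sinh (ν * x))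
        (2 * (e + θ) * Real.cosh (ν * x)) x := by
      intro x
      have h1 := ((Real.hasDerivAt_sinh (ν * x)).comp x ((hasDerivAt_id x).const_mul ν)).const_mul
        (2 * (e + θ) / ν)
      refine h1.congr_deriv ?_
      field_simp
    refine image_norm_le_of_norm_deriv_right_lt_deriv_boundary (f := D) (f' := D') (a := 0) (b := ℓ)
      (fun x _ => (hD x).continuousAt.continuousWithinAt) (fun x _ => (hD x).hasDerivWithinAt)
      (by simp [h0]) hB ?_ hr
    intro x hx hxB
    have h1 := hb x ⟨hx.1, hx.2.le⟩
    rw [hxB] at h1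
    refine h1.trans_lt ?_
    have hc := Real.cosh_pos (ν * x)
    have hs : Real.sinh (ν * x) ≤ Real.cosh (ν * x) := (Real.sinh_lt_cosh _).le
    have h2 : κ * (2 * (e + θ) / ν * Real.sinh (ν * x)) ≤ (e + θ) / 2 * Real.cosh (ν * x) := by
      have hq : κ * (2 * (e + θ) / ν) ≤ (e + θ) / 2 := by
        rw [mul_div_assoc', div_le_iff₀ hν]
        nlinarith
      have hq0 : 0 ≤ κ * (2 * (e + θ) / ν) := by positivity
      calc κ * (2 * (e + θ) / ν * Real.sinh (ν * x)) = κ * (2 * (e + θ) / ν) * Real.sinh (ν * x) := by ring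
        _ ≤ κ * (2 * (e + θ) / ν) * Real.cosh (ν * x) := by gcongr
        _ ≤ _ := by gcongr
    nlinarith [mul_pos hθ hc, mul_nonneg he hc.le]
  intro r hr
  refine le_of_forall_pos_le_add fun θ hθ => ?_
  have hc := Real.cosh_pos (ν * r)
  -- This value of `θ` makes the excess at `r` exactly the prescribed one.
  have h1 := key (θ * ν / (2 * Real.cosh (ν * r))) (by positivity) r hr
  refine h1.trans ?_
  have hs : Real.sinh (ν * r) ≤ Real.cosh (ν * r) := (Real.sinh_lt_cosh _).le
  calc 2 * (e + θ * ν / (2 * Real.cosh (ν * r))) / ν * Real.sinh (ν * r)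
      ≤ 2 * (e + θ * ν / (2 * Real.cosh (ν * r))) / ν * Real.cosh (ν * r) := by gcongr
    _ = _ := by field_simp

/-- The one-sided comparison is run in both directions from the midpoint, where `cosh` is smallest
and integration of the forcing keeps its profile. Starting from an end would not give this. -/
theorem norm_le_cosh_of_deriv {ν κ e a b : ℝ} (hν : 0 < ν) (hκ : 0 ≤ κ) (hκν : 4 * κ ≤ ν)
    (he : 0 ≤ e) {D D' : ℝ → E4} (hD : ∀ r, HasDerivAt D (D' r) r) (h0 : D ((a + b) / 2) = 0)
    (hb : ∀ s ∈ Set.Icc a b, ‖D' s‖ ≤ κ * ‖D s‖ + e * Real.cosh (ν * (s - (a + b) / 2))) :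
    ∀ s ∈ Set.Icc a b, ‖D s‖ ≤ 2 * e / ν * Real.cosh (ν * (s - (a + b) / 2)) := by
  intro s hs
  rcases le_total ((a + b) / 2) s with h | h
  · have hd : ∀ r, HasDerivAt (fun r => D ((a + b) / 2 + r)) (D' ((a + b) / 2 + r)) r := fun r => by
      have := (hD ((a + b) / 2 + r)).scomp r ((hasDerivAt_id r).const_add ((a + b) / 2))
      rwa [one_smul] at this
    have := norm_le_sinh_of_deriv hν hκ hκν he (ℓ := (b - a) / 2) hd (by simp [h0]) (fun r hr => by
      have h1 := hb ((a + b) / 2 + r) ⟨by linarith [hr.1, hs.1, hs.2], by linarith [hr.2]⟩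
      rwa [add_sub_cancel_left] at h1) (s - (a + b) / 2) ⟨by linarith, by linarith [hs.2]⟩
    rwa [add_sub_cancel] at this
  · have hd : ∀ r, HasDerivAt (fun r => D ((a + b) / 2 - r)) (-D' ((a + b) / 2 - r)) r := fun r => by
      have := (hD ((a + b) / 2 - r)).scomp r ((hasDerivAt_id r).const_sub ((a + b) / 2))
      rwa [neg_one_smul] at this
    have := norm_le_sinh_of_deriv hν hκ hκν he (ℓ := (b - a) / 2) hd (by simp [h0]) (fun r hr => by
      have h1 := hb ((a + b) / 2 - r) ⟨by linarith [hr.2], by linarith [hr.1, hs.1, hs.2]⟩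
      rw [sub_sub_cancel_left, mul_neg, Real.cosh_neg] at h1
      rwa [norm_neg]) ((a + b) / 2 - s) ⟨by linarith, by linarith [hs.1]⟩
    rw [sub_sub_cancel] at this
    rwa [← Real.cosh_neg, ← mul_neg, neg_sub] at this

theorem hasDerivAt_E4_mk {a b c d : ℝ → ℝ} {a' b' c' d' s : ℝ} (ha : HasDerivAt a a' s)
    (hb : HasDerivAt b b' s) (hc : HasDerivAt c c' s) (hd : HasDerivAt d d' s) :
    HasDerivAt (fun s => (!₂[a s, b s, c s, d s] : E4)) !₂[a', b', c', d'] s := by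
  rw [hasDerivAt_iff_hasFDerivAt, ← hasFDerivWithinAt_univ, hasFDerivWithinAt_euclidean]
  intro i
  fin_cases i
  · exact ha.hasFDerivAt.hasFDerivWithinAt.congr_fderiv (by ext; simp)
  · exact hb.hasFDerivAt.hasFDerivWithinAt.congr_fderiv (by ext; simp)
  · exact hc.hasFDerivAt.hasFDerivWithinAt.congr_fderiv (by ext; simp)
  · exact hd.hasFDerivAt.hasFDerivWithinAt.congr_fderiv (by ext; simp)

theorem contDiff_of_hasDerivAt_comp {x g : ℝ → ℝ} (hg : ContDiff ℝ ∞ g)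
    (h : ∀ t, HasDerivAt x (g (x t)) t) : ContDiff ℝ ∞ x := by
  rw [contDiff_infty]
  intro n
  induction n with
  | zero => exact contDiff_zero.2 (continuous_iff_continuousAt.2 fun t => (h t).continuousAt)
  | succ n ih =>
    push_cast
    rw [contDiff_succ_iff_deriv]
    refine ⟨fun t => (h t).differentiableAt, by simp, ?_⟩
    have e : deriv x = fun t => g (x t) := funext fun t => (h t).deriv
    rw [e]
    exact (hg.of_le (by exact_mod_cast le_top)).comp ih

namespace MorseBottNbhd

variable (G : MorseBottNbhd)

/-! ### Gradient trajectories -/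

theorem deriv_f_contDiff : ContDiff ℝ ∞ (deriv G.f) := (contDiff_infty_iff_deriv.1 G.f_smooth).2

theorem deriv_periodic {g : ℝ → ℝ} (h : Function.Periodic g 1) : Function.Periodic (deriv g) 1 := by
  intro x
  rw [← deriv_comp_add_const]
  simp only [show ∀ x, g (x + 1) = g x from h]

theorem exists_abs_le_of_periodic {g : ℝ → ℝ} (hc : Continuous g) (h : Function.Periodic g 1) :
    ∃ C : ℝ, 0 ≤ C ∧ ∀ x, |g x| ≤ C := by
  obtain ⟨C, hC⟩ := (isCompact_Icc : IsCompact (Set.Icc (0 : ℝ) 1)).exists_bound_of_continuousOn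
    hc.continuousOn
  refine ⟨C, (norm_nonneg _).trans (hC 0 ⟨le_refl _, zero_le_one⟩), fun x => ?_⟩
  obtain ⟨y, hy, e⟩ := h.exists_mem_Ico₀ one_pos x
  rw [e]
  exact hC y ⟨hy.1, hy.2.le⟩

theorem abs_sub_le_of_abs_deriv_le {g : ℝ → ℝ} (hg : Differentiable ℝ g) {C : ℝ}
    (hC : ∀ x, |deriv g x| ≤ C) (x y : ℝ) : |g x - g y| ≤ C * |x - y| := by
  have := Convex.norm_image_sub_le_of_norm_deriv_le (s := Set.univ) (f := g) (C := C)
    (fun x _ => hg x) (fun x _ => hC x) convex_univ (x := y) (y := x) trivial trivial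
  simpa using this

theorem exists_drift0_lipschitz : ∃ K : ℝ, 0 < K ∧ ∀ δ x y : ℝ, 0 < δ → δ ≤ 1 →
    ‖G.drift0 δ x - G.drift0 δ y‖ ≤ δ * K * |x - y| := by
  have hf := G.f_smooth
  have hf1 := G.deriv_f_contDiff
  have hf2 : Continuous (deriv (deriv G.f)) := hf1.continuous_deriv (by simp)
  obtain ⟨M0, h00, h0⟩ := exists_abs_le_of_periodic hf.continuous G.f_periodic
  obtain ⟨M1, h10, h1⟩ := exists_abs_le_of_periodic hf1.continuous (deriv_periodic G.f_periodic)
  obtain ⟨M2, h20, h2⟩ := exists_abs_le_of_periodic hf2 (deriv_periodic (deriv_periodic G.f_periodic))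
  refine ⟨Real.exp M0 * M1 + M2 + 1, by positivity, fun δ x y hδ hδ1 => ?_⟩
  have e1 : |Real.exp (δ * G.f x) - Real.exp (δ * G.f y)| ≤ δ * (Real.exp M0 * M1) * |x - y| := by
    have hd : ∀ x, HasDerivAt (fun x => Real.exp (δ * G.f x))
        (Real.exp (δ * G.f x) * (δ * deriv G.f x)) x := fun x =>
      ((hf.differentiable (by simp) x).hasDerivAt.const_mul δ).exp
    refine abs_sub_le_of_abs_deriv_le (g := fun x => Real.exp (δ * G.f x))
      (fun x => (hd x).differentiableAt) (fun x => ?_) x y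
    rw [(hd x).deriv, abs_mul, abs_mul, abs_of_pos hδ, abs_of_pos (Real.exp_pos _)]
    have : Real.exp (δ * G.f x) ≤ Real.exp M0 := by
      refine Real.exp_le_exp.2 ?_
      have := le_abs_self (G.f x)
      nlinarith [h0 x, abs_nonneg (G.f x)]
    calc Real.exp (δ * G.f x) * (δ * |deriv G.f x|) ≤ Real.exp M0 * (δ * M1) := by gcongr; exact h1 x
      _ = _ := by ring
  have e2 : |δ * deriv G.f x - δ * deriv G.f y| ≤ δ * M2 * |x - y| := by
    rw [← mul_sub, abs_mul, abs_of_pos hδ, mul_assoc]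
    gcongr
    exact abs_sub_le_of_abs_deriv_le (hf1.differentiable (by simp)) h2 x y
  have e3 : ‖G.drift0 δ x - G.drift0 δ y‖ ≤ |Real.exp (δ * G.f x) - Real.exp (δ * G.f y)|
      + |δ * deriv G.f x - δ * deriv G.f y| := by
    refine (pow_le_pow_iff_left₀ (norm_nonneg _) (by positivity) two_ne_zero).1 ?_
    rw [E4_norm_sq, add_sq, sq_abs, sq_abs]
    simp [drift0]
    positivity
  have : 0 ≤ δ * |x - y| := by positivity
  nlinarith

/-- Subtracting `(s, t, 0, 0)` turns the equations of a lift into the autonomous system with right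
side `drift0`. The field is bounded and Lipschitz, so the solution through any prescribed point
exists for all times. -/
theorem exists_gradientLift {δ : ℝ} (hδ : 0 < δ) (m : ℝ) {p : E4} (hp : p 3 = 0) :
    ∃ v : ℝ → ℝ → E4, IsGradientLift G δ v ∧ ∃ V : ℝ → E4, ContDiff ℝ ∞ V ∧ V m = p ∧
      (∀ s, HasDerivAt V (G.drift0 δ (V s 2)) s) ∧ ∀ s t, displacement v s t = V s := by
  have hf := G.f_smooth
  have hf1 := G.deriv_f_contDiff
  have hf2 : Continuous (deriv (deriv G.f)) := hf1.continuous_deriv (by simp)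
  obtain ⟨M1, h10, h1⟩ := exists_abs_le_of_periodic hf1.continuous (deriv_periodic G.f_periodic)
  obtain ⟨M2, h20, h2⟩ := exists_abs_le_of_periodic hf2 (deriv_periodic (deriv_periodic G.f_periodic))
  have hL : LipschitzWith (δ * M2).toNNReal (fun x => δ * deriv G.f x) := by
    refine LipschitzWith.of_dist_le_mul fun x y => ?_
    rw [Real.dist_eq, Real.dist_eq, ← mul_sub, abs_mul, abs_of_pos hδ,
      Real.coe_toNNReal _ (by positivity), mul_assoc]
    gcongr
    exact abs_sub_le_of_abs_deriv_le (hf1.differentiable (by simp)) h2 x y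
  obtain ⟨x, hx0, hx⟩ := exists_global_solution (L := (δ * M1).toNNReal) hL (fun x => by
    rw [abs_mul, abs_of_pos hδ, Real.coe_toNNReal _ (by positivity)]
    gcongr; exact h1 x) m (p 2)
  have hxs : ContDiff ℝ ∞ x :=
    contDiff_of_hasDerivAt_comp (g := fun x => δ * deriv G.f x) (contDiff_const.mul hf1) hx
  have hes : ContDiff ℝ ∞ (fun s => Real.exp (δ * G.f (x s))) :=
    Real.contDiff_exp.comp (contDiff_const.mul (hf.comp hxs))
  -- The constant is chosen so that `A m - m = p 0`.
  set A : ℝ → ℝ := fun s => p 0 + m + ∫ r in m..s, Real.exp (δ * G.f (x r)) with hA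
  have hAd : ∀ s, HasDerivAt A (Real.exp (δ * G.f (x s))) s := fun s =>
    (intervalIntegral.integral_hasDerivAt_right (hes.continuous.intervalIntegrable _ _)
      (hes.continuous.stronglyMeasurableAtFilter _ _) hes.continuous.continuousAt).const_add _
  have hAs : ContDiff ℝ ∞ A := by
    rw [contDiff_infty_iff_deriv]
    refine ⟨fun s => (hAd s).differentiableAt, ?_⟩
    rw [show deriv A = fun s => Real.exp (δ * G.f (x s)) from funext fun s => (hAd s).deriv]
    exact hes
  refine ⟨fun s t => !₂[A s, t + p 1, x s, 0], ⟨A, x, p 1, hAd, hx, rfl⟩,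
    fun s => !₂[A s - s, p 1, x s, 0],
    contDiff_E4_mk (hAs.sub contDiff_id) contDiff_const hxs contDiff_const, ?_, fun s => ?_,
    fun s t => ?_⟩
  · ext i; fin_cases i <;> simp [hA, hx0, hp]
  · exact hasDerivAt_E4_mk ((hAd s).sub (hasDerivAt_id s)) (hasDerivAt_const s _) (hx s)
      (hasDerivAt_const s _)
  · unfold displacement
    ext i; fin_cases i <;> simp

end MorseBottNbhd

/-! ### Shadowing the projected cylinder by a gradient trajectory -/

namespace MorseBottNbhd

variable (G : MorseBottNbhd)

/-- The deviation of the projected cylinder from a gradient trajectory, infinitesimally. -/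
def drag (δ : ℝ) (Y : ℝ → ℝ → E4) : ℝ → ℝ → E4 :=
  projP G.τ (fun s t => (G.remCoef δ Y s t - dT (G.coef δ Y) s t) (projQ G.τ Y s t))

/-- The decay rate profile of the projected cylinder. -/
def dragProfile (ν : ℝ) (k : ℕ) (a b : ℝ) (Y : ℝ → ℝ → E4) (s : ℝ) : ℝ :=
  endNorm G.τ a b (projQ G.τ Y) ^ (1 / (k : ℝ)) * coshProfile ν a b s

theorem dragProfile_nonneg (ν : ℝ) (k : ℕ) (a b : ℝ) (Y : ℝ → ℝ → E4) (s : ℝ) :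
    0 ≤ G.dragProfile ν k a b Y s :=
  mul_nonneg (Real.rpow_nonneg (endNorm_nonneg _ _ _ _) _) (coshProfile_pos _ _ _ _).le

theorem dragProfile_le_one {ν a b s : ℝ} (hν : 0 ≤ ν) (k : ℕ) {Y : ℝ → ℝ → E4}
    (hN : endNorm G.τ a b (projQ G.τ Y) ≤ 1) (hs : s ∈ Set.Icc a b) :
    G.dragProfile ν k a b Y s ≤ 1 := by
  have h1 := Real.rpow_le_one (endNorm_nonneg G.τ a b (projQ G.τ Y)) hN
    (by positivity : (0 : ℝ) ≤ 1 / (k : ℝ))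
  exact mul_le_one₀ h1 (coshProfile_pos _ _ _ _).le (coshProfile_le_one hν hs)

theorem le_dragProfile_sq {ν a b s : ℝ} (hν : 0 ≤ ν) (k : ℕ) (Y : ℝ → ℝ → E4)
    (hs : s ∈ Set.Icc a b) :
    endNorm G.τ a b (projQ G.τ Y) ^ (2 / (k : ℝ)) * coshProfile (2 * ν) a b s
      ≤ G.dragProfile ν k a b Y s ^ 2 := by
  have hN := endNorm_nonneg G.τ a b (projQ G.τ Y)
  have e : (endNorm G.τ a b (projQ G.τ Y) ^ (1 / (k : ℝ))) ^ 2
      = endNorm G.τ a b (projQ G.τ Y) ^ (2 / (k : ℝ)) := by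
    rw [← Real.rpow_natCast, ← Real.rpow_mul hN]
    congr 1; push_cast; ring
  rw [dragProfile, mul_pow, e]
  exact mul_le_mul_of_nonneg_left (coshProfile_two_mul_le hν hs) (Real.rpow_nonneg hN _)

theorem drag_smooth {δ : ℝ} {Y : ℝ → ℝ → E4} (hY : Smooth2 Y) : Smooth2 (G.drag δ Y) :=
  Smooth2.projP (((remCoef_smooth hY δ).sub (G.coef_smooth δ hY).dT).apply hY.projQ)

/-- The forcing of `PY` is a mean over circles, so Cauchy–Schwarz bounds it by the `L²`-norm of `W`
and its derivatives. It decays like the square root of the energy, with exponent `1 / k` and half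
the rate, whereas the pointwise bound of `W` is for a fourth power. -/
theorem exists_drag_decay : ∃ ν : ℝ, 0 < ν ∧ ∀ k : ℕ, 1 ≤ k → ∃ C η : ℝ, 0 < C ∧ 0 < η ∧
    ∀ (δ ε a b : ℝ) (Y : ℝ → ℝ → E4), G.IsNearCylinder δ ε a b k Y → δ + ε ≤ η →
    endNorm G.τ a b (projQ G.τ Y) ≤ 1 ∧
    ∀ s ∈ Set.Icc a b, ∀ t,
      cSize (k - 1) (projQ G.τ Y) s t ^ 4 ≤ C * (δ + ε) ^ 2 *
        (endNorm G.τ a b (projQ G.τ Y) ^ (2 / (k : ℝ)) * coshProfile (2 * ν) a b s) ∧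
      cSize (k - 1) (G.drag δ Y) s t ≤ C * (δ + ε) * G.dragProfile ν k a b Y s := by
  obtain ⟨μ, hμ, H⟩ := G.exists_decay
  have hτ := G.τ_pos
  have hμ2 : 2 * (μ / 2) = μ := by ring
  refine ⟨μ / 2, by positivity, fun k hk => ?_⟩
  obtain ⟨C, η, hC, hη, hH⟩ := H k hk
  -- The product constant of order `k - 1` times the combined bound for `c` and `M_t`; the latter
  -- costs the derivative of order `k` of `M`.
  set A : ℝ := 5 ^ (k - 1) * (2 * C)
  refine ⟨C + (((k - 1 : ℕ) : ℝ) + 1) ^ 2 * Real.sqrt (G.τ⁻¹ * A ^ 2 * C), η, by positivity, hη, ?_⟩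
  intro δ ε a b Y h hle
  have hδ := h.δ_pos
  have hε := h.ε_pos
  have hY := h.smooth
  obtain ⟨hN, hcoef, hW⟩ := hH δ ε a b Y h hle
  refine ⟨hN, fun s hs t => ⟨?_, ?_⟩⟩
  · rw [hμ2]
    refine ((hW s hs).2 t).trans ?_
    have h1 : 0 ≤ endNorm G.τ a b (projQ G.τ Y) ^ (2 / (k : ℝ)) * coshProfile μ a b s :=
      mul_nonneg (Real.rpow_nonneg (endNorm_nonneg _ _ _ _) _) (coshProfile_pos _ _ _ _).le
    gcongr
    exact le_add_of_nonneg_right (by positivity)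
  set Pf := G.dragProfile (μ / 2) k a b Y s
  have hPf : 0 ≤ Pf := G.dragProfile_nonneg _ _ _ _ _ _
  have hl2 : l2c G.τ (k - 1) (projQ G.τ Y) s ≤ C * Pf ^ 2 := by
    refine (hW s hs).1.trans ?_
    have := G.le_dragProfile_sq (ν := μ / 2) (by positivity) k Y hs
    rw [hμ2] at this
    gcongr
  have hc : Smooth2 (fun s t => G.remCoef δ Y s t - dT (G.coef δ Y) s t) :=
    (remCoef_smooth hY δ).sub (G.coef_smooth δ hY).dT
  have hQ : Smooth2 (projQ G.τ Y) := hY.projQ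
  have hφ := hc.apply hQ
  have hcb : ∀ t, cSize (k - 1) (fun s t => G.remCoef δ Y s t - dT (G.coef δ Y) s t) s t
      ≤ 2 * C * (δ + ε) := by
    intro t
    obtain ⟨b1, b2⟩ := hcoef s hs t
    have h1 := cSize_sub_le (remCoef_smooth (G := G) hY δ) (G.coef_smooth δ hY).dT (k - 1) s t
    have h2 := cSize_mono (Nat.sub_le k 1) (G.remCoef δ Y) s t
    have h3 := cSize_dT_le (G.coef δ Y) (k - 1) s t
    rw [Nat.sub_add_cancel hk] at h3
    linarith
  have hφb : ∀ i ≤ k - 1, ∀ t, ‖pd i 0 (fun s t => (G.remCoef δ Y s t - dT (G.coef δ Y) s t)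
      (projQ G.τ Y s t)) s t‖ ≤ A * (δ + ε) * cSize (k - 1) (projQ G.τ Y) s t := by
    intro i hi t
    refine (norm_pd_le_cSize (n := k - 1) (by omega) _ s t).trans ?_
    refine (cSize_apply_le (k - 1) hc hQ s t).trans ?_
    refine mul_le_mul_of_nonneg_right ?_ (cSize_nonneg _ _ _ _)
    have := mul_le_mul_of_nonneg_left (hcb t) (by positivity : (0 : ℝ) ≤ 5 ^ (k - 1))
    calc _ ≤ _ := this
      _ = A * (δ + ε) := by simp only [A]; ring
  have hpd : ∀ i j : ℕ, i + j ≤ k - 1 → ‖pd i j (G.drag δ Y) s t‖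
      ≤ Real.sqrt (G.τ⁻¹ * A ^ 2 * C) * (δ + ε) * Pf := by
    intro i j hij
    rcases j with _ | j
    · unfold drag
      rw [pd_projP hφ]
      refine (pow_le_pow_iff_left₀ (norm_nonneg _) (by positivity) two_ne_zero).1 ?_
      refine (norm_projP_sq_le hτ (hφ.pd i 0) s t).trans ?_
      have hA0 : 0 ≤ A := by positivity
      have h1 : ∫ t in (0 : ℝ)..G.τ, ‖pd i 0 (fun s t => (G.remCoef δ Y s t - dT (G.coef δ Y) s t)
          (projQ G.τ Y s t)) s t‖ ^ 2
          ≤ (A * (δ + ε)) ^ 2 * l2c G.τ (k - 1) (projQ G.τ Y) s := by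
        unfold l2c
        rw [← intervalIntegral.integral_const_mul]
        refine intervalIntegral.integral_mono_on hτ.le
          ((((hφ.pd i 0).continuous_snd s).norm.pow 2).intervalIntegrable _ _)
          ((continuous_const.mul ((cSize_continuous hQ (k - 1) s).pow 2)).intervalIntegrable _ _) ?_
        intro t _
        rw [← mul_pow]
        exact pow_le_pow_left₀ (norm_nonneg _) (hφb i (by omega) t) 2
      calc G.τ⁻¹ * _ ≤ G.τ⁻¹ * ((A * (δ + ε)) ^ 2 * (C * Pf ^ 2)) := by
            gcongr; exact h1.trans (by gcongr)
        _ = (Real.sqrt (G.τ⁻¹ * A ^ 2 * C) * (δ + ε) * Pf) ^ 2 := by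
            rw [show ∀ X : ℝ, (X * (δ + ε) * Pf) ^ 2 = X ^ 2 * ((δ + ε) ^ 2 * Pf ^ 2) from
              fun X => by ring, Real.sq_sqrt (by positivity)]
            ring
    · unfold drag
      rw [pd_projP_succ, norm_zero]
      positivity
  refine (cSize_le (by positivity) hpd).trans ?_
  have : 0 ≤ C * (δ + ε) * Pf := by positivity
  linarith

/-- The position and displacement of a trajectory, as arguments of the drift. -/
def trajPos : E4 →L[ℝ] (ℝ × ℝ) × (ℝ × ℝ) :=
  (ContinuousLinearMap.inl ℝ (ℝ × ℝ) (ℝ × ℝ)).comp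
    ((ContinuousLinearMap.inr ℝ ℝ ℝ).comp (EuclideanSpace.proj (𝕜 := ℝ) (2 : Fin 4)))

/-- The displacement of a trajectory, as an argument of the drift. -/
def trajShift : E4 →L[ℝ] (ℝ × ℝ) :=
  -((ContinuousLinearMap.inr ℝ ℝ ℝ).comp (EuclideanSpace.proj (𝕜 := ℝ) (2 : Fin 4)))

theorem drift0_contDiff₂ : ContDiff ℝ ∞ (fun q : ℝ × ℝ => G.drift0 q.1 q.2) :=
  contDiff_E4_mk ((Real.contDiff_exp.comp (contDiff_fst.mul (G.f_smooth.comp contDiff_snd))).sub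
    contDiff_const) contDiff_const (contDiff_fst.mul (G.deriv_f_contDiff.comp contDiff_snd))
    contDiff_const

theorem drift0_periodic : Function.Periodic (fun q : ℝ × ℝ => G.drift0 q.1 q.2) (0, 1) := by
  rintro ⟨δ, x⟩
  have h1 := G.f_periodic x
  have h2 := deriv_periodic G.f_periodic x
  simp [drift0, h1, h2]

/-- Replacing the projected cylinder by a gradient trajectory. -/
structure IsShadow (δ a b : ℝ) (Y : ℝ → ℝ → E4) (V : ℝ → E4) : Prop where
  smooth : ContDiff ℝ ∞ V
  deriv : ∀ s, HasDerivAt V (G.drift0 δ (V s 2)) s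
  mid : V ((a + b) / 2) = projP G.τ Y ((a + b) / 2) 0

/-- `PY - V` vanishes at the midpoint, is forced by the drag and is fed back with constant `δ K`.
Requiring `4 δ K ≤ ν` lets the decay of the forcing dominate the divergence of nearby gradient
trajectories, uniformly in the length of the cylinder. -/
theorem exists_norm_sub_shadow_le {ν : ℝ} (hν : 0 < ν) {C : ℝ} (hC : 0 < C) (k : ℕ) :
    ∃ C' η : ℝ, 0 < C' ∧ 0 < η ∧ ∀ (δ ε a b : ℝ) (Y : ℝ → ℝ → E4) (V : ℝ → E4),
    G.IsNearCylinder δ ε a b k Y → δ + ε ≤ η → G.IsShadow δ a b Y V →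
    (∀ s ∈ Set.Icc a b, ∀ t, cSize (k - 1) (G.drag δ Y) s t
      ≤ C * (δ + ε) * G.dragProfile ν k a b Y s) →
    ∀ s ∈ Set.Icc a b, ∀ t, ‖projP G.τ Y s t - V s‖ ≤ C' * (δ + ε) * G.dragProfile ν k a b Y s := by
  obtain ⟨K, hK, hLip⟩ := G.exists_drift0_lipschitz
  refine ⟨2 * C / ν, min 1 (ν / (4 * K)), by positivity, by positivity, ?_⟩
  intro δ ε a b Y V h hle hV hdrag s hs t
  have hδ := h.δ_pos
  have hε := h.ε_pos
  have hY := h.smooth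
  simp only [le_min_iff] at hle
  obtain ⟨l1, l2⟩ := hle
  rw [le_div_iff₀ (by positivity)] at l2
  set N := endNorm G.τ a b (projQ G.τ Y) ^ (1 / (k : ℝ))
  have hN : 0 ≤ N := Real.rpow_nonneg (endNorm_nonneg _ _ _ _) _
  have hc := Real.cosh_pos (ν * (b - a) / 2)
  set e := C * (δ + ε) * N / Real.cosh (ν * (b - a) / 2)
  have he : 0 ≤ e := by positivity
  have hprof : ∀ s, C * (δ + ε) * G.dragProfile ν k a b Y s
      = e * Real.cosh (ν * (s - (a + b) / 2)) := by
    intro s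
    unfold dragProfile coshProfile
    simp only [e, N]
    field_simp
  have hD : ∀ r, HasDerivAt (fun r => projP G.τ Y r 0 - V r)
      (dS (projP G.τ Y) r 0 - G.drift0 δ (V r 2)) r := fun r =>
    (hY.projP.hasDerivAt_fst r 0).sub (hV.deriv r)
  have key := norm_le_cosh_of_deriv (ν := ν) (κ := δ * K) (e := e) (a := a) (b := b) hν (by positivity)
    (by nlinarith) he hD (by simp [hV.mid]) (fun r hr => by
      rw [h.linSys.2 r hr 0, ← hprof]
      have h1 := hLip δ (projP G.τ Y r 0 2) (V r 2) hδ (by linarith)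
      have h2 := abs_coord_le (projP G.τ Y r 0 - V r) 2
      rw [PiLp.sub_apply] at h2
      have h3 := (norm_le_cSize (k - 1) (G.drag δ Y) r 0).trans (hdrag r hr 0)
      change ‖_ + G.drag δ Y r 0 - _‖ ≤ _
      rw [add_sub_right_comm]
      refine (norm_add_le _ _).trans (add_le_add (h1.trans ?_) h3)
      gcongr) s hs
  change ‖projP G.τ Y s 0 - V s‖ ≤ _
  refine key.trans (le_of_eq ?_)
  have := hprof s
  calc 2 * e / ν * Real.cosh (ν * (s - (a + b) / 2))
      = 2 / ν * (e * Real.cosh (ν * (s - (a + b) / 2))) := by ring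
    _ = 2 / ν * (C * (δ + ε) * G.dragProfile ν k a b Y s) := by rw [this]
    _ = _ := by ring

/-- The difference is independent of `t`, so only `s`-derivatives matter. Its equation expresses one
more of them by the drag and a bounded Hadamard coefficient applied to the difference itself, which
closes the induction. -/
theorem exists_cSize_sub_shadow_le {ν : ℝ} (hν : 0 < ν) {C : ℝ} (hC : 0 < C) {k : ℕ} (hk : 1 ≤ k)
    (n : ℕ) : n ≤ k - 1 →
    ∃ C' η : ℝ, 0 < C' ∧ 0 < η ∧ ∀ (δ ε a b : ℝ) (Y : ℝ → ℝ → E4) (V : ℝ → E4),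
    G.IsNearCylinder δ ε a b k Y → δ + ε ≤ η → endNorm G.τ a b (projQ G.τ Y) ≤ 1 →
    G.IsShadow δ a b Y V →
    (∀ s ∈ Set.Icc a b, ∀ t, cSize (k - 1) (G.drag δ Y) s t
      ≤ C * (δ + ε) * G.dragProfile ν k a b Y s) →
    ∀ s ∈ Set.Icc a b, ∀ t, cSize n (fun s t => projP G.τ Y s t - V s) s t
      ≤ C' * (δ + ε) * G.dragProfile ν k a b Y s := by
  induction n with
  | zero =>
    intro _
    obtain ⟨C', η, hC', hη, H⟩ := G.exists_norm_sub_shadow_le hν hC k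
    refine ⟨C', η, hC', hη, fun δ ε a b Y V h hle _ hV hd s hs t => ?_⟩
    rw [cSize_zero]
    exact H δ ε a b Y V h hle hV hd s hs t
  | succ n ih =>
    intro hn
    obtain ⟨C1, η1, hC1, hη1, H1⟩ := ih (by omega)
    obtain ⟨C2, η2, hC2, hη2, -, H2⟩ := G.exists_cSize_offset_le hk
    have hΦ := hadamard_contDiff G.drift0_contDiff₂
    have hB := BddDerivs.of_periodic hΦ (hadamard_periodic G.drift0_periodic)
      (hadamard_periodic G.drift0_periodic) 1
    set L := ‖trajPos‖ + ‖ContinuousLinearMap.inr ℝ (ℝ × ℝ) (ℝ × ℝ)‖ * ‖trajShift‖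
    obtain ⟨C3, hC30, hC3⟩ := cSize_comp_le n hΦ hB L (by positivity)
    -- The extra bounds on `δ + ε` make the difference and the derivatives of `PY` at most one, as
    -- the composition estimate for the coefficient requires.
    refine ⟨C1 + 5 ^ n * C3 * (‖trajShift‖ * C1) + C, min (min η1 η2) (min 1 (min (1 / C1) (1 / C2))),
      by positivity, by positivity, ?_⟩
    intro δ ε a b Y V h hle hN hV hd s hs t
    have hδ := h.δ_pos
    have hε := h.ε_pos
    have hY := h.smooth
    simp only [le_min_iff] at hle
    obtain ⟨⟨l1, l2⟩, l3, l4, l5⟩ := hle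
    rw [le_div_iff₀ (by positivity)] at l4 l5
    have hPs : Smooth2 (projP G.τ Y) := hY.projP
    have hVs : Smooth2 (fun s (_ : ℝ) => V s) := hV.smooth.comp contDiff_fst
    set D : ℝ → ℝ → E4 := fun s t => projP G.τ Y s t - V s
    have hDs : Smooth2 D := hPs.sub hVs
    set Pf := G.dragProfile ν k a b Y s
    have hPf : 0 ≤ Pf := G.dragProfile_nonneg _ _ _ _ _ _
    have hPf1 : Pf ≤ 1 := G.dragProfile_le_one hν.le k hN hs
    have hDn : cSize n D s t ≤ C1 * (δ + ε) * Pf := H1 δ ε a b Y V h l1 hN hV hd s hs t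
    have hDn1 : cSize n D s t ≤ 1 := hDn.trans (mul_le_one₀ (by rw [mul_comm]; exact l4) hPf hPf1)
    set θ : ℝ → ℝ → (ℝ × ℝ) × (ℝ × ℝ) := fun s t => ((δ, 0), 0) + t • 0 + trajPos (projP G.τ Y s t)
      + ContinuousLinearMap.inr ℝ (ℝ × ℝ) (ℝ × ℝ) (trajShift (D s t))
    have hθ1 : Smooth2 (fun s t => (((δ, 0), 0) : (ℝ × ℝ) × (ℝ × ℝ)) + t • 0 + trajPos (projP G.τ Y s t)) :=
      (Smooth2.affine _ _).add (hPs.clm trajPos)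
    have hθ2 := (hDs.clm trajShift).clm (ContinuousLinearMap.inr ℝ (ℝ × ℝ) (ℝ × ℝ))
    have hθ : Smooth2 θ := hθ1.add hθ2
    have eθ : ∀ s t, θ s t = ((δ, projP G.τ Y s t 2), trajShift (D s t)) := by
      intro s t
      simp [θ, trajPos]
    have eshift : ∀ v, trajShift v = (0, -v 2) := fun v => by simp [trajShift]
    -- Expanding about `PY` with increment `-x(D)` expresses the coefficient through `PY` and `D`,
    -- both already controlled, with no separate bound on the derivatives of `V`.
    have hdiff : ∀ s t, G.drift0 δ (projP G.τ Y s t 2) - G.drift0 δ (V s 2)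
        = -hadamard (fun q : ℝ × ℝ => G.drift0 q.1 q.2) (θ s t) (trajShift (D s t)) := by
      intro s t
      rw [eθ, hadamard_apply G.drift0_contDiff₂, eshift]
      simp [D]
    have hA : cSize n (fun s t => hadamard (fun q : ℝ × ℝ => G.drift0 q.1 q.2) (θ s t)) s t ≤ C3 := by
      refine hC3 θ hθ s t ⟨projP G.τ Y s t 2, 0, ?_⟩ fun i j hij hle => ?_
      · rw [eθ, eshift]
        have h1 := (abs_coord_le (D s t) 2).trans ((norm_le_cSize n D s t).trans hDn1)
        simp only [zero_smul, sub_zero, Prod.norm_def, Prod.fst_sub, Prod.snd_sub, Prod.smul_fst,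
          Prod.smul_snd, smul_zero, smul_eq_mul, mul_one, sub_self, norm_zero, norm_neg,
          Real.norm_eq_abs]
        refine max_le (max_le (by rw [mul_zero, sub_zero, abs_of_pos hδ]; linarith) (by simp)) (max_le (by simp) h1)
      · rw [hθ1.pd_add hθ2, (hDs.clm trajShift).pd_clm, hDs.pd_clm]
        refine (norm_add_le _ _).trans (add_le_add ?_ ?_)
        · have h2 := (H2 δ ε a b Y h l2 s hs t).2.2 i j hij (by omega)
          refine (norm_pd_affine_add_clm_le hPs _ _ trajPos hij (h2.trans ?_)).trans
            (by rw [norm_zero, zero_add, mul_one])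
          linarith
        · have h2 := (norm_pd_le_cSize hle D s t).trans hDn1
          refine (ContinuousLinearMap.le_opNorm _ _).trans ?_
          gcongr
          exact (trajShift.le_opNorm _).trans (mul_le_of_le_one_right (norm_nonneg _) h2)
    have hAs : Smooth2 (fun s t => hadamard (fun q : ℝ × ℝ => G.drift0 q.1 q.2) (θ s t)) :=
      Smooth2.comp hΦ hθ
    have hE : Smooth2 (G.drag δ Y) := G.drag_smooth hY
    have hdS : ∀ s ∈ Set.Icc a b, ∀ t, dS D s t = (fun s t => G.drag δ Y s t
        - hadamard (fun q : ℝ × ℝ => G.drift0 q.1 q.2) (θ s t) (trajShift (D s t))) s t := by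
      intro s hs t
      have h1 : dS D s t = dS (projP G.τ Y) s t - G.drift0 δ (V s 2) :=
        ((hPs.hasDerivAt_fst s t).sub (hV.deriv s)).deriv
      have h2 := hdiff s t
      rw [h1, h.linSys.2 s hs t]
      change _ + G.drag δ Y s t - _ = _
      rw [add_sub_right_comm, h2]
      simp only
      abel
    have hT : dT D = fun _ _ => 0 := by
      funext s t
      exact deriv_const t (projP G.τ Y s 0 - V s)
    have hs1 := cSize_succ_le hDs n s t
    rw [hT, cSize_zero_fun, add_zero,
      cSize_congr_strip hDs.dS (hE.sub (hAs.apply (hDs.clm trajShift))) h.lt hdS n s hs t] at hs1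
    have hs2 := cSize_sub_le hE (hAs.apply (hDs.clm trajShift)) n s t
    have hs3 := cSize_apply_le n hAs (hDs.clm trajShift) s t
    have hs4 := cSize_clm_le hDs trajShift n s t
    have hs5 := (cSize_mono (by omega : n ≤ k - 1) (G.drag δ Y) s t).trans (hd s hs t)
    have hs6 := (norm_le_cSize n D s t).trans hDn
    have hs7 : 5 ^ n * cSize n (fun s t => hadamard (fun q : ℝ × ℝ => G.drift0 q.1 q.2) (θ s t)) s t
        * cSize n (fun s t => trajShift (D s t)) s t
        ≤ 5 ^ n * C3 * (‖trajShift‖ * (C1 * (δ + ε) * Pf)) := by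
      gcongr
      · exact cSize_nonneg _ _ _ _
      · exact hs4.trans (by gcongr)
    have e : (C1 + 5 ^ n * C3 * (‖trajShift‖ * C1) + C) * (δ + ε) * Pf
        = C1 * (δ + ε) * Pf + 5 ^ n * C3 * (‖trajShift‖ * (C1 * (δ + ε) * Pf))
          + C * (δ + ε) * Pf := by ring
    rw [e]
    linarith

end MorseBottNbhd

/-! ### Choice of constants and conclusion -/

theorem exists_pos_lt_of_forall (A B C D E F : ℝ) (hA : 0 < A) (hB : 0 < B) (hC : 0 < C) (hD : 0 < D)
    (hE : 0 < E) (hF : 0 < F) :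
    ∃ θ : ℝ, 0 < θ ∧ θ < A ∧ θ < B ∧ θ < C ∧ θ < D ∧ θ < E ∧ θ < F := by
  have h : 0 < min A (min B (min C (min D (min E F)))) := by positivity
  obtain ⟨θ, h0, h1⟩ := exists_between h
  simp only [lt_min_iff] at h1
  exact ⟨θ, h0, h1⟩

namespace MorseBottNbhd

variable (G : MorseBottNbhd)

/-- Here there is room to spare: `1 / k` exceeds `2 / p`, and the square of a profile that is at
most one is below the profile. -/
theorem dragProfile_le_rpow_mul_coshProfile {ν : ℝ} (hν : 0 ≤ ν) {k : ℕ} (hk : 1 ≤ k) {p : ℝ}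
    (hp : 4 * (k : ℝ) < p) {a b s : ℝ} (hs : s ∈ Set.Icc a b) {Y : ℝ → ℝ → E4}
    (hN : endNorm G.τ a b (projQ G.τ Y) ≤ 1) :
    G.dragProfile (2 * ν) k a b Y s
      ≤ endNorm G.τ a b (projQ G.τ Y) ^ (2 / p) * coshProfile ν a b s := by
  have hk' : (0 : ℝ) < k := by exact_mod_cast hk
  have hp0 : 0 < p := by linarith
  have hc := coshProfile_pos ν a b s
  unfold dragProfile
  refine mul_le_mul (rpow_le_rpow_of_le_one (endNorm_nonneg _ _ _ _) hN (by positivity) ?_) ?_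
    (coshProfile_pos _ _ _ _).le (Real.rpow_nonneg (endNorm_nonneg _ _ _ _) _)
  · rw [div_le_div_iff₀ hp0 hk']
    linarith
  · refine (coshProfile_two_mul_le hν hs).trans ?_
    nlinarith [coshProfile_le_one hν hs]

end MorseBottNbhd

end MorseBottCylinder

end

theorem mainTheorem7 (G : MorseBottCylinder.MorseBottNbhd) :
    ∃ lam : ℝ, 0 < lam ∧ ∀ k : ℕ, 1 ≤ k → ∀ p : ℝ, 4 * (k : ℝ) < p →
      ∃ ε δ₀ : ℝ, 0 < ε ∧ 0 < δ₀ ∧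
        ∀ δ : ℝ, 0 < δ → δ ≤ δ₀ → ∀ s₀ s₁ : ℝ, s₀ < s₁ → ∀ u : ℝ → ℝ → MorseBottCylinder.E4,
          MorseBottCylinder.IsHolomorphicCylinder G δ s₀ s₁ u →
          MorseBottCylinder.IsCloseToTorus k ε s₀ s₁ u →
          (∀ s ∈ Set.Icc s₀ s₁, ∀ t : ℝ,
            MorseBottCylinder.cSize (k - 1)
                (MorseBottCylinder.projQ G.τ (MorseBottCylinder.displacement u)) s t ≤
              MorseBottCylinder.coshBound G.τ p lam s₀ s₁
                (MorseBottCylinder.displacement u) s) ∧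
          (∀ η : ℝ, 0 < η → MorseBottCylinder.AwayFromAllButOne G η s₀ s₁ u →
            ∃ v : ℝ → ℝ → MorseBottCylinder.E4, MorseBottCylinder.IsGradientLift G δ v ∧
              ∀ s ∈ Set.Icc s₀ s₁, ∀ t : ℝ,
                MorseBottCylinder.cSize (k - 1)
                    (fun s t =>
                      MorseBottCylinder.projP G.τ (MorseBottCylinder.displacement u) s t -
                        MorseBottCylinder.displacement v s t) s t ≤
                  MorseBottCylinder.coshBound G.τ p lam s₀ s₁
                    (MorseBottCylinder.displacement u) s) := by
  open MorseBottCylinder MorseBottNbhd in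
  obtain ⟨ν, hν, H⟩ := G.exists_drag_decay
  -- The energy decays with rate `2ν`. The pointwise estimate of `QY` takes a fourth root, leaving
  -- rate `ν / 2`; the shadowing estimate alone would allow `ν`.
  refine ⟨ν / 2, by positivity, fun k hk p hp => ?_⟩
  have hν2 : 0 ≤ ν / 2 := by positivity
  obtain ⟨C, η, hC, hη, hd⟩ := H k hk
  obtain ⟨C', η', hC', hη', hsh⟩ := G.exists_cSize_sub_shadow_le hν hC hk (k - 1) le_rfl
  have hρ := G.ρ_pos
  have hτ := G.τ_pos
  -- One number serves as `ε` and as `δ₀`. It keeps `δ + ε` below both thresholds and makes the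
  -- constants `C (δ + ε)²` and `C' (δ + ε)` at most one; the last two bounds place the cylinder in
  -- the region without cutoff and fix its winding numbers.
  obtain ⟨θ, hθ, t1, t2, t3, t4, t5, t6⟩ := exists_pos_lt_of_forall (min (η / 2) (1 / 2)) (η' / 2)
    (1 / (2 * C)) (1 / (2 * C')) (G.ρ / 4) (min (G.τ / 2) (1 / G.τ)) (by positivity) (by positivity)
    (by positivity) (by positivity) (by positivity) (by positivity)
  simp only [lt_min_iff] at t1 t6
  rw [lt_div_iff₀ (by positivity)] at t3 t4
  have t7 := (lt_div_iff₀ hτ).1 t6.2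
  refine ⟨θ, θ, hθ, hθ, fun δ hδ hδθ a b hab u hu hc => ?_⟩
  have hnear := IsNearCylinder.of_holomorphic hk hδ hθ hab t5 (by linarith) t7 hu hc
  obtain ⟨hN, hB⟩ := hd δ θ a b _ hnear (by linarith)
  have hk' : (1 : ℝ) ≤ k := by exact_mod_cast hk
  have hp2 : 0 ≤ 2 / p := div_nonneg zero_le_two (by linarith)
  have hN0 := endNorm_nonneg G.τ a b (projQ G.τ (displacement u))
  refine ⟨fun s hs t => ?_, fun _ _ _ => ?_⟩
  · rw [coshBound_eq hp2]
    have e : 2 * (2 * (ν / 2)) = 2 * ν := by ring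
    have h2 := coshProfile_two_mul_le hν2 hs
    have h4 := coshProfile_two_mul_le (by positivity : 0 ≤ 2 * (ν / 2)) hs
    rw [e] at h4
    -- Doubling the rate twice turns the profile of rate `2ν` into the fourth power of the profile
    -- of rate `ν / 2`.
    refine le_of_pow_four_le hk hp hN0 hN (coshProfile_pos _ _ _ _).le
      (h4.trans ((pow_le_pow_left₀ (coshProfile_pos _ _ _ _).le h2 2).trans_eq (by ring)))
      (coshProfile_pos _ _ _ _).le ?_ (hB s hs t).1
    have h5 : δ + θ ≤ 1 := by linarith
    have h6 : C * (δ + θ) ≤ 1 := by nlinarith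
    nlinarith [mul_nonneg hC.le (by linarith : 0 ≤ δ + θ)]
  -- The trajectory is chosen through the projected cylinder at the midpoint of `[a, b]`.
  · obtain ⟨v, hv, V, hV, hmid, hder, heq⟩ := G.exists_gradientLift hδ ((a + b) / 2)
      (p := projP G.τ (displacement u) ((a + b) / 2) 0) (by simp [projP])
    refine ⟨v, hv, fun s hs t => ?_⟩
    simp only [heq]
    rw [coshBound_eq hp2]
    refine (hsh δ θ a b _ V hnear (by linarith) hN ⟨hV, hder, hmid⟩
      (fun s hs t => (hB s hs t).2) s hs t).trans ?_
    have e : 2 * (ν / 2) = ν := by ring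
    have h1 := G.dragProfile_le_rpow_mul_coshProfile hν2 hk hp hs hN
    rw [e] at h1
    refine (mul_le_of_le_one_left (G.dragProfile_nonneg _ _ _ _ _ _) ?_).trans h1
    nlinarith
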